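/- Matroids and graphs are finite; graphs may have loops and parallel edges. A biased graph $\Omega=(G,\mathcal B)$ is a graph $G$ with a set $\mathcal B$ of its cycles, called balanced (the others are unbalanced), such that no theta subgraph contains exactly two balanced cycles. Its frame matroid $F(\Omega)$ is the matroid on $E(G)$ whose circuits are the edge sets of: balanced cycles; pairs of edge-disjoint unbalanced cycles meeting in exactly one vertex; pairs of vertex-disjoint unbalanced cycles together with a path joining them that meets them only in its ends; and theta subgraphs all three of whose cycles are unbalanced. $\Omega$ represents $M$ if $M=F(\Omega)$, and it is $L$-biased if every element of $L$ is an unbalanced loop of $\Omega$. A matroidal is a pair $(M,L)$ with $M$ a matroid and $L\subseteq E(M)$; it is frame if some $L$-biased graph represents $M$, and connected if $M$ is connected. A $2$-separation of $M$ is a partition $(A,B)$ of $E(M)$ with $|A|,|B|\ge 2$ and $r(A)+r(B)-r(M)=1$. For $X\subseteq E(G)$, $\Omega[X]$ is the biased subgraph formed by the edges in $X$ and their ends, $V(X)$ is its vertex set, and it is balanced if it contains no unbalanced cycle. For a biased graph $\Omega$ representing $M$, the $2$-separation $(A,B)$ is of - type 1 if $\Omega[A]$ and $\Omega[B]$ are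 both connected and unbalanced and $|V(A)\cap V(B)|=1$; - type 2 if, up to exchanging $A$ and $B$, $\Omega[A]$ is connected and balanced, $V(A)\cap V(B)=\{x,y\}$ with $x\ne y$, and either (a) $\Omega[B]$ is connected and unbalanced, or (b) $\Omega[B]$ has exactly two components, both unbalanced, one containing $x$ and the other containing $y$. The $2$-sum of $M_1$ and $M_2$ on $e_1\in E(M_1)$, $e_2\in E(M_2)$ (with $E(M_1)\setminus e_1$ and $E(M_2)\setminus e_2$ disjoint) is the matroid on $(E(M_1)\setminus e_1)\cup (E(M_2)\setminus e_2)$ whose circuits are the circuits of each $M_i$ avoiding $e_i$ and the sets $(C_1\setminus e_1)\cup(C_2\setminus e_2)$, where $C_i$ is a circuit of $M_i$ containing $e_i$. If each $e_i$ is an unbalanced loop of $\Omega_i$ at $v_i$, the loop-sum of $\Omega_1,\Omega_2$ on $e_1,e_2$ is obtained from the disjoint union of $\Omega_1-e_1$ and $\Omega_2-e_2$ by identifying $v_1$ with $v_2$; its balanced cycles are those of $\Omega_1-e_1$ and $\Omega_2-e_2$. If one of $\Omega_1,\Omega_2$ is balanced and each $e_i$ is a link $u_iv_i$ of $\Omega_i$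 ($u_i\neq v_i$), a link-sum on $e_1,e_2$ is obtained from the disjoint union of $\Omega_1-e_1$ and $\Omega_2-e_2$ by identifying $u_1$ with $u_2$ and $v_1$ with $v_2$; its balanced cycles are those of $\Omega_1-e_1$ and $\Omega_2-e_2$ and all cycles $(C_1\setminus e_1)\cup(C_2\setminus e_2)$ with $C_i$ a balanced cycle of $\Omega_i$ containing $e_i$. **Theorem.** Let $(M,L)$ be a connected frame matroidal. For every $2$-separation $(A,B)$ of $M$ there is an $L$-biased graph $\Omega$ representing $M$ for which $(A,B)$ is of type 1 or of type 2. Moreover, whenever $M$ is the $2$-sum of matroids $M_1,M_2$ on elements $e_1,e_2$ with $E(M_1)\setminus e_1=A$ and $E(M_2)\setminus e_2=B$, there are biased graphs $\Omega_1,\Omega_2$ representing $M_1,M_2$ such that $\Omega$ is the loop-sum of $\Omega_1$ and $\Omega_2$ on $e_1,e_2$ if $(A,B)$ is of type 1, and a link-sum of $\Omega_1$ and $\Omega_2$ on $e_1,e_2$ if $(A,B)$ is of type 2. -/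

import Mathlib

open scoped Graph

/-! ### Paths, cycles and thetas in multigraphs (as sets of edges) -/

namespace Graph

variable {V α : Type*}

/-- The set of vertices incident with an edge in `X`. -/
def vertsOf (G : Graph V α) (X : Set α) : Set V := {v | ∃ e ∈ X, G.Inc e v}

/-- `G.IsPathSet P x y`: the set of edges `P` is the edge set of a path of `G` with at least one
edge whose ends are the distinct vertices `x` and `y`. -/
inductive IsPathSet (G : Graph V α) : Set α → V → V → Prop
  | single {e : α} {x y : V} (hxy : x ≠ y) (he : G.IsLink e x y) : IsPathSet G {e} x y
  | cons {e : α} {x y z : V} {P : Set α} (he : G.IsLink e x y) (hP : IsPathSet G P y z)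
      (hx : x ∉ G.vertsOf P) : IsPathSet G (insert e P) x z

/-- `C` is the edge set of a cycle of `G`: a loop, or a path together with one further edge
joining its ends. -/
def IsCycleSet (G : Graph V α) (C : Set α) : Prop :=
  (∃ e x, G.IsLoopAt e x ∧ C = {e}) ∨
    ∃ P e x y, G.IsPathSet P x y ∧ G.IsLink e x y ∧ e ∉ P ∧ C = insert e P

/-- `P`, `Q`, `R` are the edge sets of three internally disjoint paths with the same two ends;
their union is a theta subgraph, whose three cycles are `P ∪ Q`, `P ∪ R` and `Q ∪ R`. -/
def IsTheta (G : Graph V α) (P Q R : Set α) : Prop :=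
  ∃ x y, G.IsPathSet P x y ∧ G.IsPathSet Q x y ∧ G.IsPathSet R x y ∧
    Disjoint P Q ∧ Disjoint P R ∧ Disjoint Q R ∧
    G.vertsOf P ∩ G.vertsOf Q = {x, y} ∧
    G.vertsOf P ∩ G.vertsOf R = {x, y} ∧
    G.vertsOf Q ∩ G.vertsOf R = {x, y}

/-- The subgraph `G[X]` formed by the edges in `X` and their ends is connected. -/
def ConnectedOn (G : Graph V α) (X : Set α) : Prop :=
  ∀ u ∈ G.vertsOf X, ∀ v ∈ G.vertsOf X,
    Relation.ReflTransGen (fun a b => ∃ e ∈ X, G.IsLink e a b) u v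

end Graph

/-! ### Biased graphs -/

/-- A (finite) biased graph: a graph with a collection of balanced cycles such that no theta
subgraph contains exactly two balanced cycles. -/
structure BiasedGraph (V α : Type*) where
  graph : Graph V α
  finite_verts : V(graph).Finite
  finite_edges : E(graph).Finite
  /-- the edge sets of the balanced cycles -/
  balanced : Set (Set α)
  isCycleSet_of_balanced : ∀ C ∈ balanced, graph.IsCycleSet C
  theta : ∀ P Q R, graph.IsTheta P Q R →
    P ∪ Q ∈ balanced → P ∪ R ∈ balanced → Q ∪ R ∈ balanced

namespace BiasedGraph

variable {V α : Type*}

/-- `C` is an unbalanced cycle. -/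
def IsUnbalancedCycle (Ω : BiasedGraph V α) (C : Set α) : Prop :=
  Ω.graph.IsCycleSet C ∧ C ∉ Ω.balanced

/-- `Ω[X]` contains no unbalanced cycle. -/
def IsBalancedOn (Ω : BiasedGraph V α) (X : Set α) : Prop :=
  ∀ C ⊆ X, ¬ Ω.IsUnbalancedCycle C

/-- `e` is an unbalanced loop with end `v`. -/
def IsUnbalancedLoopAt (Ω : BiasedGraph V α) (e : α) (v : V) : Prop :=
  Ω.graph.IsLoopAt e v ∧ {e} ∉ Ω.balanced

/-- `C` is the edge set of a pair of tight handcuffs: two edge-disjoint unbalanced cycles with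
exactly one common vertex. -/
def IsTightHandcuffs (Ω : BiasedGraph V α) (C : Set α) : Prop :=
  ∃ C₁ C₂, Ω.IsUnbalancedCycle C₁ ∧ Ω.IsUnbalancedCycle C₂ ∧ Disjoint C₁ C₂ ∧
    (∃ v, Ω.graph.vertsOf C₁ ∩ Ω.graph.vertsOf C₂ = {v}) ∧ C = C₁ ∪ C₂

/-- `C` is the edge set of a pair of loose handcuffs: two vertex-disjoint unbalanced cycles
together with a path from one to the other meeting them only in its ends. -/
def IsLooseHandcuffs (Ω : BiasedGraph V α) (C : Set α) : Prop :=
  ∃ C₁ C₂ P x y, Ω.IsUnbalancedCycle C₁ ∧ Ω.IsUnbalancedCycle C₂ ∧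
    Disjoint (Ω.graph.vertsOf C₁) (Ω.graph.vertsOf C₂) ∧ Ω.graph.IsPathSet P x y ∧
    Ω.graph.vertsOf P ∩ Ω.graph.vertsOf C₁ = {x} ∧
    Ω.graph.vertsOf P ∩ Ω.graph.vertsOf C₂ = {y} ∧ C = C₁ ∪ C₂ ∪ P

/-- `C` is the edge set of a theta subgraph all three of whose cycles are unbalanced. -/
def IsContrabalancedTheta (Ω : BiasedGraph V α) (C : Set α) : Prop :=
  ∃ P Q R, Ω.graph.IsTheta P Q R ∧ P ∪ Q ∉ Ω.balanced ∧ P ∪ R ∉ Ω.balanced ∧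
    Q ∪ R ∉ Ω.balanced ∧ C = P ∪ Q ∪ R

/-- The circuits of the frame matroid `F(Ω)`. -/
def IsFrameCircuit (Ω : BiasedGraph V α) (C : Set α) : Prop :=
  C ∈ Ω.balanced ∨ Ω.IsTightHandcuffs C ∨ Ω.IsLooseHandcuffs C ∨ Ω.IsContrabalancedTheta C

/-- `M = F(Ω)`. -/
def Represents (Ω : BiasedGraph V α) (M : Matroid α) : Prop :=
  M.E = E(Ω.graph) ∧ ∀ C, M.IsCircuit C ↔ Ω.IsFrameCircuit C

/-- `Ω` is `L`-biased: every element of `L` is an unbalanced loop. -/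
def IsLBiased (Ω : BiasedGraph V α) (L : Set α) : Prop :=
  ∀ e ∈ L, ∃ v, Ω.IsUnbalancedLoopAt e v

/-! ### Types of biseparations -/

/-- Type 1: `Ω[A]` and `Ω[B]` are both connected and unbalanced and meet in one vertex. -/
def IsType1 (Ω : BiasedGraph V α) (A B : Set α) : Prop :=
  Ω.graph.ConnectedOn A ∧ ¬ Ω.IsBalancedOn A ∧ Ω.graph.ConnectedOn B ∧ ¬ Ω.IsBalancedOn B ∧
    ∃ v, Ω.graph.vertsOf A ∩ Ω.graph.vertsOf B = {v}

/-- Type 2 with `A` as the balanced side: `Ω[A]` is connected and balanced, and it meets `Ω[B]`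
in exactly two vertices `x`, `y`. Moreover (a) `Ω[B]` is connected and unbalanced, or
(b) `Ω[B]` has exactly two components, both unbalanced, one containing `x` and one
containing `y`. -/
def IsType2Left (Ω : BiasedGraph V α) (A B : Set α) : Prop :=
  Ω.graph.ConnectedOn A ∧ Ω.IsBalancedOn A ∧
    ∃ x y, x ≠ y ∧ Ω.graph.vertsOf A ∩ Ω.graph.vertsOf B = {x, y} ∧
      ((Ω.graph.ConnectedOn B ∧ ¬ Ω.IsBalancedOn B) ∨
        ∃ B₁ B₂, B = B₁ ∪ B₂ ∧ Disjoint (Ω.graph.vertsOf B₁) (Ω.graph.vertsOf B₂) ∧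
          Ω.graph.ConnectedOn B₁ ∧ ¬ Ω.IsBalancedOn B₁ ∧ x ∈ Ω.graph.vertsOf B₁ ∧
          Ω.graph.ConnectedOn B₂ ∧ ¬ Ω.IsBalancedOn B₂ ∧ y ∈ Ω.graph.vertsOf B₂)

/-- Type 2, with either side as the balanced one. -/
def IsType2 (Ω : BiasedGraph V α) (A B : Set α) : Prop :=
  Ω.IsType2Left A B ∨ Ω.IsType2Left B A

/-! ### Loop-sums and link-sums

The two summands have edges labelled by `Option α`; both edges on which the sum is taken carry
the label `none`, and the other edges carry labels `some e`. The vertices that are identified in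
the sum already carry the same name in the two summands, and all other vertices carry different
names. -/

/-- The graph of `Ω` is the union of the graphs of `Ω₁ - none` and `Ω₂ - none`, whose edge sets
are disjoint and whose vertex sets have intersection `S`. -/
def IsGluing (Ω : BiasedGraph V α) (Ω₁ Ω₂ : BiasedGraph V (Option α)) (S : Set V) : Prop :=
  V(Ω.graph) = V(Ω₁.graph) ∪ V(Ω₂.graph) ∧ V(Ω₁.graph) ∩ V(Ω₂.graph) = S ∧
    E(Ω₁.graph) ∩ E(Ω₂.graph) ⊆ {none} ∧
    ∀ e x y, Ω.graph.IsLink e x y ↔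
      Ω₁.graph.IsLink (some e) x y ∨ Ω₂.graph.IsLink (some e) x y

/-- `Ω` is the loop-sum of `Ω₁` and `Ω₂` on their edges `none`. -/
def IsLoopSum (Ω : BiasedGraph V α) (Ω₁ Ω₂ : BiasedGraph V (Option α)) : Prop :=
  ∃ v, Ω₁.IsUnbalancedLoopAt none v ∧ Ω₂.IsUnbalancedLoopAt none v ∧
    Ω.IsGluing Ω₁ Ω₂ {v} ∧
    ∀ C, C ∈ Ω.balanced ↔ some '' C ∈ Ω₁.balanced ∨ some '' C ∈ Ω₂.balanced

/-- `Ω` is the link-sum of `Ω₁`, which is balanced, and `Ω₂` on their edges `none`. -/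
def IsLinkSumLeft (Ω : BiasedGraph V α) (Ω₁ Ω₂ : BiasedGraph V (Option α)) : Prop :=
  Ω₁.IsBalancedOn E(Ω₁.graph) ∧
  ∃ x y, x ≠ y ∧ Ω₁.graph.IsLink none x y ∧ Ω₂.graph.IsLink none x y ∧
    Ω.IsGluing Ω₁ Ω₂ {x, y} ∧
    ∀ C, C ∈ Ω.balanced ↔ some '' C ∈ Ω₁.balanced ∨ some '' C ∈ Ω₂.balanced ∨
      ∃ C₁ ∈ Ω₁.balanced, ∃ C₂ ∈ Ω₂.balanced, none ∈ C₁ ∧ none ∈ C₂ ∧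
        C = some ⁻¹' C₁ ∪ some ⁻¹' C₂

/-- `Ω` is the link-sum of `Ω₁` and `Ω₂` on their edges `none`, where one of `Ω₁`, `Ω₂` is
balanced. -/
def IsLinkSum (Ω : BiasedGraph V α) (Ω₁ Ω₂ : BiasedGraph V (Option α)) : Prop :=
  Ω.IsLinkSumLeft Ω₁ Ω₂ ∨ Ω.IsLinkSumLeft Ω₂ Ω₁

end BiasedGraph

/-! ### Separations and 2-sums of matroids, frame matroidals -/

namespace Matroid

variable {α : Type*}

/-- `(A, B)` is a `k`-separation of `M`: a partition of the ground set with
`r(A) + r(B) - r(M) + 1 = k` and `|A|, |B| ≥ k`. -/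
def IsKSeparation (M : Matroid α) (k : ℕ) (A B : Set α) : Prop :=
  A ∪ B = M.E ∧ Disjoint A B ∧ (k : ℕ∞) ≤ A.encard ∧ (k : ℕ∞) ≤ B.encard ∧
    M.eRk A + M.eRk B + 1 = M.eRank + k

/-- `M` is connected: it has no 1-separation. -/
def HasNoOneSeparation (M : Matroid α) : Prop := ∀ A B, ¬ M.IsKSeparation 1 A B

/-- `(M, L)` is a frame matroidal: some (finite) `L`-biased graph represents `M`. -/
def IsFrameMatroidal (M : Matroid α) (L : Set α) : Prop :=
  ∃ (V : Type) (Ω : BiasedGraph V α), Ω.Represents M ∧ Ω.IsLBiased L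

/-- `M` is the 2-sum of `M₁` and `M₂`, where `M₁` has ground set `A` together with the element
`none`, `M₂` has ground set `B` together with the element `none`, and the sum is taken on these
two elements. -/
def IsTwoSum (M : Matroid α) (A B : Set α) (M₁ M₂ : Matroid (Option α)) : Prop :=
  Disjoint A B ∧ M.E = A ∪ B ∧
    M₁.E = insert none (some '' A) ∧ M₂.E = insert none (some '' B) ∧
    ∀ C, M.IsCircuit C ↔ M₁.IsCircuit (some '' C) ∨ M₂.IsCircuit (some '' C) ∨
      ∃ C₁ C₂, M₁.IsCircuit C₁ ∧ M₂.IsCircuit C₂ ∧ none ∈ C₁ ∧ none ∈ C₂ ∧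
        C = some ⁻¹' C₁ ∪ some ⁻¹' C₂

end Matroid

/-! The combinatorics is done by counting edges against vertices. Cycles, paths, forests and
bicycles (thetas and handcuffs, the minimal edge sets with more edges than vertices) are given by
cardinalities. A loopless matroid is the frame matroid of a biased graph on a multigraph once
independent sets have at most as many edges as vertices, an edge with a new vertex can be added to
any independent set, and vertex-disjoint independent sets have independent union
(`Matroid.IsFrame`). The balanced cycles need not be chosen: they are the cycles that are circuits
(`IsFrame.represents_biasedGraph`). So it suffices to find suitable ends for the edges.

Both summands of a 2-sum are determined by `M`: a set `Q` in `A` stays independent with the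
basepoint exactly when it is independent and skew to `B` (`IsTip`, `IsTwoSum.isTip`). The heart of
the proof is the dichotomy `TwoSep.loRep_or`: either the summand on `B` has a frame representation
in which `L` and the basepoint are loops, or the summand on `A` is graphic, `A` avoids `L`, and the
summand on `B` has a representation of full rank in which the basepoint is a link.

To prove it, an unbalanced loop (a joint) is added at each vertex (`IsFrame.jointExt`). The joints
form a basis in which every element is spanned by at most two of them, and this structure survives
contraction, even with a prescribed set of joints kept (`Jointed.contract`). So the aim is to
contract a set that turns the tip of `A` into a joint. If `A` spans a joint, a circuit through that
joint and `B` provides the set (`Jointed.loSide_of_mem_closure`). Otherwise `A` has no unbalanced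
cycle. For connected `A` take a minimal `T` in `A` that is not skew to `B`. If some joint of `T` is
not spanned by `T` and `B`, the tip can again be made a joint (`Thin.loSide_of_notMem`). If all are
spanned, `T` has one more vertex than edges, hence two leaves, and either contracting all of `T` but
a leaf edge works, or the two leaves alone decide which subsets of `A` are skew to `B`
(`Spine.leaf`); in that case the tip behaves like an edge between the leaves and `A` is graphic
(`Side.grSide`). A disconnected `A` is handled by contracting one part, inducting, and composing
graphic parts in series (`Side.loSide_or_grSide`).

The dichotomy is applied to `(A, B)` and to `(B, A)`. Two loop representations give a loop-sum of
type 1; otherwise a graphic side and a full-rank side give a link-sum of type 2. Gluing is justified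
by `TwoSep.isFrame`, and the types follow because each component of a side meets the basepoint
(`TwoSep.exists_reach`) and full rank puts an unbalanced cycle in every component. -/

section

open scoped Classical

/-! ### Finite multigraphs given by the ends of their edges -/

namespace Multi

variable {α V : Type*} {ends : α → Finset V}

/-- The vertices incident with an edge of `X`. -/
noncomputable def vs (ends : α → Finset V) (X : Finset α) : Finset V := X.biUnion ends

lemma mem_vs {X : Finset α} {v : V} : v ∈ vs ends X ↔ ∃ e ∈ X, v ∈ ends e := by
  simp [vs]

lemma vs_mono {X Y : Finset α} (h : X ⊆ Y) : vs ends X ⊆ vs ends Y :=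
  Finset.biUnion_subset_biUnion_of_subset_left _ h

@[simp] lemma vs_empty : vs ends ∅ = ∅ := by simp [vs]

@[simp] lemma vs_singleton (e : α) : vs ends {e} = ends e := by simp [vs]

lemma vs_union (X Y : Finset α) : vs ends (X ∪ Y) = vs ends X ∪ vs ends Y := by
  ext v; simp only [mem_vs, Finset.mem_union]; grind

lemma vs_insert (e : α) (X : Finset α) : vs ends (insert e X) = ends e ∪ vs ends X := by
  simp [vs]

lemma ends_subset_vs {X : Finset α} {e : α} (he : e ∈ X) : ends e ⊆ vs ends X :=
  fun _ hv ↦ mem_vs.2 ⟨e, he, hv⟩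

/-- Numerical description of the edge set of a cycle. -/
def IsCyc (ends : α → Finset V) (C : Finset α) : Prop :=
  C.Nonempty ∧ (vs ends C).card = C.card ∧ ∀ Z ⊂ C, Z.Nonempty → Z.card < (vs ends Z).card

/-- Numerical description of a theta or a pair of handcuffs. -/
def IsBicyc (ends : α → Finset V) (C : Finset α) : Prop :=
  (vs ends C).card + 1 = C.card ∧ ∀ Z ⊂ C, Z.card ≤ (vs ends Z).card

/-- Numerical description of the edge set of a path from `x` to `y`. -/
def IsPth (ends : α → Finset V) (P : Finset α) (x y : V) : Prop :=
  x ≠ y ∧ (∀ Z ⊆ P, Z.Nonempty → Z.card < (vs ends Z).card) ∧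
    (∀ Z ⊂ P, Z.card + 2 ≤ (vs ends Z ∪ {x, y}).card) ∧ (vs ends P ∪ {x, y}).card ≤ P.card + 1

/-- Numerical description of forests. -/
def IsForest (ends : α → Finset V) (X : Finset α) : Prop :=
  ∀ Z ⊆ X, Z.Nonempty → Z.card < (vs ends Z).card

lemma card_union_eq (S T : Finset V) : (S ∪ T).card + (S ∩ T).card = S.card + T.card :=
  Finset.card_union_add_card_inter S T

lemma IsCyc.eq_of_subset {C D : Finset α} (hC : IsCyc ends C) (hD : D ⊆ C) (hne : D.Nonempty)
    (h : (vs ends D).card ≤ D.card) : D = C := by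
  by_contra hDC
  have := hC.2.2 D (hD.ssubset_of_ne hDC) hne
  omega

lemma IsBicyc.nonempty {C : Finset α} (hC : IsBicyc ends C) : C.Nonempty := by
  rw [← Finset.card_pos]; have := hC.1; omega

/-- Deleting `e` would lose the vertex `v`, leaving `|C| - 1` edges on at most as many vertices,
against the strict inequality for proper nonempty subsets. The bound `h2` keeps the remainder
nonempty; it excludes loops. -/
lemma IsCyc.exists_ne {C : Finset α} (hC : IsCyc ends C) (h2 : 2 ≤ C.card) {e : α} (he : e ∈ C)
    {v : V} (hv : v ∈ ends e) : ∃ f ∈ C, f ≠ e ∧ v ∈ ends f := by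
  by_contra! hcon
  have hc := Finset.card_erase_add_one he
  have h1 := hC.2.2 (C.erase e) (Finset.erase_ssubset he) (by rw [← Finset.card_pos]; omega)
  have h3 : vs ends (C.erase e) ⊆ (vs ends C).erase v := by
    intro w hw
    obtain ⟨f, hf, hwf⟩ := mem_vs.1 hw
    rw [Finset.mem_erase] at hf ⊢
    exact ⟨fun h ↦ hcon f hf.2 hf.1 (h ▸ hwf), mem_vs.2 ⟨f, hf.2, hwf⟩⟩
  have h4 := Finset.card_le_card h3
  have h5 := Finset.card_erase_add_one (mem_vs.2 ⟨e, he, hv⟩ : v ∈ vs ends C)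
  have := hC.2.1
  omega

lemma IsBicyc.exists_ne {C : Finset α} (hC : IsBicyc ends C) {e : α} (he : e ∈ C)
    {v : V} (hv : v ∈ ends e) : ∃ f ∈ C, f ≠ e ∧ v ∈ ends f := by
  by_contra! hcon
  have hc := Finset.card_erase_add_one he
  have h1 := hC.2 (C.erase e) (Finset.erase_ssubset he)
  have h3 : vs ends (C.erase e) ⊆ (vs ends C).erase v := by
    intro w hw
    obtain ⟨f, hf, hwf⟩ := mem_vs.1 hw
    rw [Finset.mem_erase] at hf ⊢
    exact ⟨fun h ↦ hcon f hf.2 hf.1 (h ▸ hwf), mem_vs.2 ⟨f, hf.2, hwf⟩⟩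
  have h4 := Finset.card_le_card h3
  have h5 := Finset.card_erase_add_one (mem_vs.2 ⟨e, he, hv⟩ : v ∈ vs ends C)
  have := hC.1
  omega

lemma ssubset_of_disjoint_union {C X Y : Finset α} (h : X ∪ Y = C) (hd : Disjoint X Y)
    (hY : Y.Nonempty) : X ⊂ C := by
  obtain ⟨y, hy⟩ := hY
  rw [← h]
  refine Finset.ssubset_iff_of_subset Finset.subset_union_left |>.2 ⟨y, by simp [hy], ?_⟩
  exact Finset.disjoint_right.1 hd hy

/-- Each part has at least one vertex more than edges, the whole has no surplus, and the two units
can only be lost in the overlap. -/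
lemma IsCyc.two_le_inter {C X Y : Finset α} (hC : IsCyc ends C) (h : X ∪ Y = C)
    (hd : Disjoint X Y) (hX : X.Nonempty) (hY : Y.Nonempty) :
    2 ≤ (vs ends X ∩ vs ends Y).card := by
  have h1 := hC.2.2 X (ssubset_of_disjoint_union h hd hY) hX
  have h2 := hC.2.2 Y (ssubset_of_disjoint_union (by rw [Finset.union_comm, h]) hd.symm hX) hY
  have h3 := card_union_eq (vs ends X) (vs ends Y)
  rw [← vs_union, h, hC.2.1, ← h, Finset.card_union_of_disjoint hd] at h3
  omega

/-- Neither part has fewer vertices than edges, while the whole is one vertex short, so some vertex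
is counted twice. This is the connectedness of a bicycle. -/
lemma IsBicyc.one_le_inter {C X Y : Finset α} (hC : IsBicyc ends C) (h : X ∪ Y = C)
    (hd : Disjoint X Y) (hX : X.Nonempty) (hY : Y.Nonempty) :
    1 ≤ (vs ends X ∩ vs ends Y).card := by
  have h1 := hC.2 X (ssubset_of_disjoint_union h hd hY)
  have h2 := hC.2 Y (ssubset_of_disjoint_union (by rw [Finset.union_comm, h]) hd.symm hX)
  have h3 := card_union_eq (vs ends X) (vs ends Y)
  have h4 := hC.1
  rw [← vs_union, h] at h3
  rw [← h, Finset.card_union_of_disjoint hd, h] at h4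
  omega

lemma IsPth.symm {P : Finset α} {x y : V} (h : IsPth ends P x y) : IsPth ends P y x := by
  unfold IsPth at h ⊢
  rw [Finset.pair_comm y x]
  exact ⟨h.1.symm, h.2⟩

lemma IsPth.nonempty {P : Finset α} {x y : V} (h : IsPth ends P x y) : P.Nonempty := by
  by_contra hP
  rw [Finset.not_nonempty_iff_eq_empty] at hP
  have := h.2.2.2
  subst hP
  simp [Finset.card_pair h.1] at this

/-- The forest count already gives `|P| + 1` vertices, the maximum allowed once the two ends are
added, so the ends are among them. -/
lemma IsPth.pair_subset {P : Finset α} {x y : V} (h : IsPth ends P x y) :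
    {x, y} ⊆ vs ends P := by
  have h1 := h.2.1 P subset_rfl h.nonempty
  have h2 := h.2.2.2
  have h3 : vs ends P = vs ends P ∪ {x, y} :=
    Finset.eq_of_subset_of_card_le Finset.subset_union_left (by omega)
  rw [h3]; exact Finset.subset_union_right

lemma IsPth.left_mem {P : Finset α} {x y : V} (h : IsPth ends P x y) : x ∈ vs ends P :=
  h.pair_subset (by simp)

lemma IsPth.right_mem {P : Finset α} {x y : V} (h : IsPth ends P x y) : y ∈ vs ends P :=
  h.pair_subset (by simp)

lemma IsPth.card_vs {P : Finset α} {x y : V} (h : IsPth ends P x y) :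
    (vs ends P).card = P.card + 1 := by
  have h1 := h.2.1 P subset_rfl h.nonempty
  have h2 := h.2.2.2
  rw [Finset.union_eq_left.2 h.pair_subset] at h2
  omega

lemma isForest_card_union_singleton {X : Finset α} (h : IsForest ends X) (x : V) :
    X.card + 1 ≤ (vs ends X ∪ {x}).card := by
  rcases X.eq_empty_or_nonempty with rfl | hX
  · simp
  · have := h X subset_rfl hX
    have := Finset.card_le_card (Finset.subset_union_left (s₁ := vs ends X) (s₂ := {x}))
    omega

lemma IsForest.mono {X Y : Finset α} (h : IsForest ends X) (hY : Y ⊆ X) : IsForest ends Y :=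
  fun Z hZ ↦ h Z (hZ.trans hY)

lemma IsPth.forest {P : Finset α} {x y : V} (h : IsPth ends P x y) : IsForest ends P := h.2.1

lemma IsPth.single {e : α} {x y : V} (hxy : x ≠ y) (he : ends e = {x, y}) :
    IsPth ends {e} x y := by
  refine ⟨hxy, ?_, ?_, ?_⟩
  · intro Z hZ hne
    rw [hne.subset_singleton_iff.1 hZ]
    simp [he, Finset.card_pair hxy]
  · intro Z hZ
    rw [Finset.ssubset_singleton_iff.1 hZ]
    simp [Finset.card_pair hxy]
  · simp [he, Finset.card_pair hxy]

/-- In every count the fresh vertex `x` splits off and contributes exactly one. What remains is a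
count for part of `P`, in which `y` may be added as an extra vertex when `e` is used. -/
lemma IsPth.cons {e : α} {x y z : V} {P : Finset α} (he : ends e = {x, y}) (h : IsPth ends P y z)
    (hx : x ∉ vs ends P) : e ∉ P ∧ IsPth ends (insert e P) x z := by
  have heP : e ∉ P := fun h ↦ hx (mem_vs.2 ⟨e, h, by simp [he]⟩)
  have hxz : x ≠ z := fun h' ↦ hx (h' ▸ h.right_mem)
  have key : ∀ S : Finset V, x ∉ S → ({x} ∪ S).card = S.card + 1 := fun S hS ↦ by
    rw [← Finset.insert_eq, Finset.card_insert_of_notMem hS]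
  have hxy : x ≠ y := fun h' ↦ hx (h' ▸ h.left_mem)
  refine ⟨heP, hxz, ?_, ?_, ?_⟩
  · intro Z hZ hne
    by_cases heZ : e ∈ Z
    · have hZ' : Z.erase e ⊆ P := by
        intro f hf; rw [Finset.mem_erase] at hf
        exact (Finset.mem_insert.1 (hZ hf.2)).resolve_left hf.1
      have h1 := isForest_card_union_singleton (h.forest.mono hZ') y
      have h2 : vs ends Z = {x} ∪ (vs ends (Z.erase e) ∪ {y}) := by
        conv_lhs => rw [← Finset.insert_erase heZ, vs_insert, he]
        ext; simp; tauto
      rw [h2, key]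
      · have := Finset.card_erase_add_one heZ; omega
      · simp only [Finset.mem_union, Finset.mem_singleton, not_or]
        exact ⟨fun h ↦ hx (vs_mono hZ' h), hxy⟩
    · exact h.2.1 Z ((Finset.subset_insert_iff_of_notMem heZ).1 hZ) hne
  · intro Z hZ
    by_cases heZ : e ∈ Z
    · have hZ' : Z.erase e ⊂ P := by
        rw [Finset.ssubset_iff_subset_ne]
        constructor
        · intro f hf; rw [Finset.mem_erase] at hf
          exact (Finset.mem_insert.1 (hZ.1 hf.2)).resolve_left hf.1
        · rintro rfl
          rw [Finset.insert_erase heZ] at hZ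
          exact hZ.2 subset_rfl
      have h1 := h.2.2.1 _ hZ'
      have h2 : vs ends Z ∪ {x, z} = {x} ∪ (vs ends (Z.erase e) ∪ {y, z}) := by
        conv_lhs => rw [← Finset.insert_erase heZ, vs_insert, he]
        ext; simp; tauto
      rw [h2, key]
      · have := Finset.card_erase_add_one heZ; omega
      · simp only [Finset.mem_union, Finset.mem_insert, Finset.mem_singleton, not_or]
        exact ⟨fun h ↦ hx (vs_mono hZ'.1 h), hxy, hxz⟩
    · have hZP := (Finset.subset_insert_iff_of_notMem heZ).1 hZ.1
      have h1 := isForest_card_union_singleton (h.forest.mono hZP) z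
      have h2 : vs ends Z ∪ {x, z} = {x} ∪ (vs ends Z ∪ {z}) := by ext; simp; tauto
      rw [h2, key]
      · omega
      · simp only [Finset.mem_union, Finset.mem_singleton, not_or]
        exact ⟨fun h ↦ hx (vs_mono hZP h), hxz⟩
  · have h1 := h.2.2.2
    have h2 : vs ends (insert e P) ∪ {x, z} = {x} ∪ (vs ends P ∪ {y, z}) := by
      rw [vs_insert, he]; ext; simp; tauto
    rw [h2, Finset.card_insert_of_notMem heP]
    have := Finset.card_union_le {x} (vs ends P ∪ {y, z})
    simp only [Finset.card_singleton] at this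
    omega

lemma IsPth.isCyc_insert {P : Finset α} {x y : V} {e : α} (h : IsPth ends P x y)
    (he : ends e = {x, y}) (heP : e ∉ P) : IsCyc ends (insert e P) := by
  refine ⟨⟨e, by simp⟩, ?_, ?_⟩
  · rw [vs_insert, he, Finset.union_eq_right.2 h.pair_subset, h.card_vs,
      Finset.card_insert_of_notMem heP]
  · intro Z hZ hne
    by_cases heZ : e ∈ Z
    · have hZ' : Z.erase e ⊂ P := by
        rw [Finset.ssubset_iff_subset_ne]
        constructor
        · intro f hf; rw [Finset.mem_erase] at hf
          exact (Finset.mem_insert.1 (hZ.1 hf.2)).resolve_left hf.1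
        · rintro rfl
          rw [Finset.insert_erase heZ] at hZ
          exact hZ.2 subset_rfl
      have h1 := h.2.2.1 _ hZ'
      have h2 : vs ends Z = vs ends (Z.erase e) ∪ {x, y} := by
        conv_lhs => rw [← Finset.insert_erase heZ, vs_insert, he]
        rw [Finset.union_comm]
      rw [h2]
      have := Finset.card_erase_add_one heZ; omega
    · exact h.2.1 Z ((Finset.subset_insert_iff_of_notMem heZ).1 hZ.1) hne

lemma isCyc_singleton {e : α} (h : (ends e).card = 1) : IsCyc ends {e} := by
  refine ⟨by simp, by simp [h], fun Z hZ hne ↦ ?_⟩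
  rw [Finset.ssubset_singleton_iff.1 hZ] at hne
  simp at hne

/-- `a` and `b` are joined by an edge in `X`. -/
def AdjOn (ends : α → Finset V) (X : Finset α) (a b : V) : Prop := ∃ e ∈ X, ends e = {a, b}

/-- The witness consists of the edges with an end reachable from `u`; since an edge has at most two
ends, the other end is then reachable too. -/
lemma exists_component (X : Finset α) (hX : ∀ e ∈ X, (ends e).card ≤ 2) (u : V) :
    ∃ Z ⊆ X, (∀ v ∈ vs ends Z, Relation.ReflTransGen (AdjOn ends X) u v) ∧
      ∀ v ∈ vs ends (X \ Z), ¬ Relation.ReflTransGen (AdjOn ends X) u v := by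
  refine ⟨X.filter (fun e ↦ ∃ v ∈ ends e, Relation.ReflTransGen (AdjOn ends X) u v),
    Finset.filter_subset _ _, ?_, ?_⟩
  · intro v hv
    obtain ⟨e, he, hve⟩ := mem_vs.1 hv
    obtain ⟨heX, w, hw, hr⟩ := Finset.mem_filter.1 he
    by_cases hwv : w = v
    · exact hwv ▸ hr
    · refine hr.tail ⟨e, heX, ?_⟩
      exact (Finset.eq_of_subset_of_card_le (by grind)
        (by rw [Finset.card_pair hwv]; exact hX e heX)).symm
  · intro v hv hr
    obtain ⟨e, he, hve⟩ := mem_vs.1 hv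
    rw [Finset.mem_sdiff, Finset.mem_filter] at he
    exact he.2 ⟨he.1, v, hve, hr⟩

lemma adjOn_symm {X : Finset α} {a b : V} (h : AdjOn ends X a b) : AdjOn ends X b a := by
  obtain ⟨e, he, h⟩ := h
  exact ⟨e, he, by rw [h, Finset.pair_comm]⟩

lemma reach_symm {X : Finset α} {a b : V} (h : Relation.ReflTransGen (AdjOn ends X) a b) :
    Relation.ReflTransGen (AdjOn ends X) b a := by
  have : Std.Symm (AdjOn ends X) := ⟨fun a b h ↦ adjOn_symm h⟩
  exact Std.Symm.symm _ _ h

lemma reach_mono {X Y : Finset α} (hXY : X ⊆ Y) {a b : V}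
    (h : Relation.ReflTransGen (AdjOn ends X) a b) : Relation.ReflTransGen (AdjOn ends Y) a b :=
  Relation.ReflTransGen.mono (fun _ _ ⟨e, he, h⟩ ↦ ⟨e, hXY he, h⟩) _ _ h

/-- A cycle minus an edge connects the ends of that edge. -/
lemma IsCyc.reach_erase {C : Finset α} (hC : IsCyc ends C) (h2 : ∀ e ∈ C, (ends e).card ≤ 2)
    {e : α} (he : e ∈ C) {x y : V} (hx : x ∈ vs ends C) (hy : y ∈ vs ends C) :
    Relation.ReflTransGen (AdjOn ends (C.erase e)) x y := by
  by_contra hcon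
  obtain ⟨Z, hZ, h3, h4⟩ := exists_component (C.erase e)
    (fun f hf ↦ h2 f (Finset.mem_of_mem_erase hf)) x
  have hs := Finset.erase_ssubset he
  have hf1 : IsForest ends Z := fun Y hY hne ↦ hC.2.2 Y ((hY.trans hZ).trans_ssubset hs) hne
  have hf2 : IsForest ends (C.erase e \ Z) := fun Y hY hne ↦
    hC.2.2 Y ((hY.trans Finset.sdiff_subset).trans_ssubset hs) hne
  have c1 := isForest_card_union_singleton hf1 x
  have c2 := isForest_card_union_singleton hf2 y
  -- The two forests, with `x` and `y` thrown in, have a surplus vertex each. Being disjoint they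
  -- would need `|C| + 1` of the `|C|` vertices of the cycle.
  have hd : Disjoint (vs ends Z ∪ {x}) (vs ends (C.erase e \ Z) ∪ {y}) := by
    rw [Finset.disjoint_left]
    intro v hv hv'
    have hr : Relation.ReflTransGen (AdjOn ends (C.erase e)) x v := by
      rcases Finset.mem_union.1 hv with h | h
      · exact h3 v h
      · rw [Finset.mem_singleton.1 h]
    rcases Finset.mem_union.1 hv' with h | h
    · exact h4 v h hr
    · rw [Finset.mem_singleton.1 h] at hr; exact hcon hr
  have c3 := Finset.card_union_of_disjoint hd
  have c4 : ((vs ends Z ∪ {x}) ∪ (vs ends (C.erase e \ Z) ∪ {y})).card ≤ (vs ends C).card := by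
    apply Finset.card_le_card
    have a1 := vs_mono (ends := ends) (hZ.trans hs.1)
    have a2 := vs_mono (ends := ends) ((Finset.sdiff_subset (s := C.erase e) (t := Z)).trans hs.1)
    grind
  have c5 := Finset.card_sdiff_add_card_eq_card hZ
  have c6 := Finset.card_erase_add_one he
  have := hC.2.1
  omega

lemma IsCyc.reach {C : Finset α} (hC : IsCyc ends C) (h2 : ∀ e ∈ C, (ends e).card ≤ 2)
    {x y : V} (hx : x ∈ vs ends C) (hy : y ∈ vs ends C) :
    Relation.ReflTransGen (AdjOn ends C) x y := by
  obtain ⟨e, he⟩ := hC.1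
  exact reach_mono (Finset.erase_subset e C) (hC.reach_erase h2 he hx hy)

/-- The ends of a path are joined in the path. -/
lemma IsPth.reach {P : Finset α} {x y : V} (h : IsPth ends P x y)
    (h2 : ∀ e ∈ P, (ends e).card ≤ 2) : Relation.ReflTransGen (AdjOn ends P) x y := by
  by_contra hcon
  obtain ⟨Z, hZ, h3, h4⟩ := exists_component P h2 x
  have c1 := isForest_card_union_singleton (h.forest.mono hZ) x
  have c2 := isForest_card_union_singleton (h.forest.mono (Finset.sdiff_subset (t := Z))) y
  have hd : Disjoint (vs ends Z ∪ {x}) (vs ends (P \ Z) ∪ {y}) := by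
    rw [Finset.disjoint_left]
    intro v hv hv'
    have hr : Relation.ReflTransGen (AdjOn ends P) x v := by
      rcases Finset.mem_union.1 hv with h | h
      · exact h3 v h
      · rw [Finset.mem_singleton.1 h]
    rcases Finset.mem_union.1 hv' with h | h
    · exact h4 v h hr
    · rw [Finset.mem_singleton.1 h] at hr; exact hcon hr
  have c3 := Finset.card_union_of_disjoint hd
  have c4 : ((vs ends Z ∪ {x}) ∪ (vs ends (P \ Z) ∪ {y})).card ≤ (vs ends P).card := by
    apply Finset.card_le_card
    have a1 := vs_mono (ends := ends) hZ
    have a2 := vs_mono (ends := ends) (Finset.sdiff_subset (s := P) (t := Z))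
    have := h.left_mem
    have := h.right_mem
    grind
  have c5 := Finset.card_sdiff_add_card_eq_card hZ
  have := h.card_vs
  omega

/-- Inner vertices of a path have degree at least two. -/
lemma IsPth.exists_ne {P : Finset α} {x y : V} (h : IsPth ends P x y) {e : α} (he : e ∈ P) {v : V}
    (hv : v ∈ ends e) (hx : v ≠ x) (hy : v ≠ y) : ∃ f ∈ P, f ≠ e ∧ v ∈ ends f := by
  by_contra! hcon
  have hc := Finset.card_erase_add_one he
  have h1 := h.2.2.1 (P.erase e) (Finset.erase_ssubset he)
  have h3 : vs ends (P.erase e) ∪ {x, y} ⊆ (vs ends P).erase v := by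
    intro w hw
    rw [Finset.mem_erase]
    rcases Finset.mem_union.1 hw with hw | hw
    · obtain ⟨f, hf, hwf⟩ := mem_vs.1 hw
      rw [Finset.mem_erase] at hf
      exact ⟨fun h ↦ hcon f hf.2 hf.1 (h ▸ hwf), mem_vs.2 ⟨f, hf.2, hwf⟩⟩
    · exact ⟨by grind, h.pair_subset hw⟩
  have h4 := Finset.card_le_card h3
  have h5 := Finset.card_erase_add_one (mem_vs.2 ⟨e, he, hv⟩ : v ∈ vs ends P)
  have := h.card_vs
  omega

/-- Any edge set with at least as many edges as vertices contains a cycle. -/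
lemma exists_isCyc {X : Finset α} (hX : X.Nonempty) (hne : ∀ e ∈ X, (ends e).Nonempty)
    (h : (vs ends X).card ≤ X.card) : ∃ C ⊆ X, IsCyc ends C := by
  obtain ⟨C, hCX, hC⟩ := exists_minimal_le_of_wellFoundedLT
    (fun Y : Finset α ↦ Y.Nonempty ∧ (vs ends Y).card ≤ Y.card) X ⟨hX, h⟩
  have hmin : ∀ Z ⊂ C, Z.Nonempty → Z.card < (vs ends Z).card := by
    intro Z hZ hne
    by_contra! hcon
    exact hZ.2 (hC.2 ⟨hne, hcon⟩ hZ.1)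
  refine ⟨C, hCX, hC.1.1, ?_, hmin⟩
  refine le_antisymm hC.1.2 ?_
  obtain ⟨e, he⟩ := hC.1.1
  have hc := Finset.card_erase_add_one he
  rcases (C.erase e).eq_empty_or_nonempty with h0 | h0
  · rw [h0] at hc
    have : (vs ends C).Nonempty := (hne e (hCX he)).mono (ends_subset_vs he)
    have := this.card_pos
    simp at hc
    omega
  · have h1 := hmin _ (Finset.erase_ssubset he) h0
    have := Finset.card_le_card (vs_mono (ends := ends) (Finset.erase_subset e C))
    omega

/-- A minimal subset with more edges than vertices works: deleting one edge removes the excess, so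
the excess is exactly one. -/
lemma exists_isBicyc {X : Finset α} 
    (h : (vs ends X).card < X.card) : ∃ C ⊆ X, IsBicyc ends C := by
  obtain ⟨C, hCX, hC⟩ := exists_minimal_le_of_wellFoundedLT
    (fun Y : Finset α ↦ (vs ends Y).card < Y.card) X h
  have hmin : ∀ Z ⊂ C, Z.card ≤ (vs ends Z).card := by
    intro Z hZ
    by_contra! hcon
    exact hZ.2 (hC.2 hcon hZ.1)
  refine ⟨C, hCX, ?_, hmin⟩
  obtain ⟨e, he⟩ : C.Nonempty := by
    rw [← Finset.card_pos]; have := hC.1; omega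
  have hc := Finset.card_erase_add_one he
  have h1 := hmin _ (Finset.erase_ssubset he)
  have := Finset.card_le_card (vs_mono (ends := ends) (Finset.erase_subset e C))
  have := hC.1
  omega

/-! Degrees -/

/-- The number of edges of `X` at `v`. -/
noncomputable def deg (ends : α → Finset V) (X : Finset α) (v : V) : ℕ :=
  (X.filter (fun e ↦ v ∈ ends e)).card

lemma sum_deg (X : Finset α) : ∑ v ∈ vs ends X, deg ends X v = ∑ e ∈ X, (ends e).card := by
  simp_rw [deg, Finset.card_filter]
  rw [Finset.sum_comm]
  refine Finset.sum_congr rfl fun e he ↦ ?_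
  rw [← Finset.card_filter]
  congr 1
  ext v
  simp only [Finset.mem_filter, and_iff_right_iff_imp]
  exact fun h ↦ ends_subset_vs he h

lemma two_le_deg {X : Finset α} (hdeg : ∀ e ∈ X, ∀ v ∈ ends e, ∃ f ∈ X, f ≠ e ∧ v ∈ ends f)
    {v : V} (hv : v ∈ vs ends X) : 2 ≤ deg ends X v := by
  obtain ⟨e, he, hve⟩ := mem_vs.1 hv
  obtain ⟨f, hf, hfe, hvf⟩ := hdeg e he v hve
  exact Finset.one_lt_card.2 ⟨f, by simp [hf, hvf], e, by simp [he, hve], hfe⟩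

lemma sum_ends_le {X : Finset α} (h2 : ∀ e ∈ X, (ends e).card ≤ 2) :
    ∑ e ∈ X, (ends e).card ≤ 2 * X.card := by
  have := Finset.sum_le_card_nsmul X (fun e ↦ (ends e).card) 2 h2
  rw [smul_eq_mul] at this; omega

/-- Double counting of incidences: every vertex carries at least two of them and every edge at most
two. A loop counts once, which is why it makes the inequality strict in the next lemma. -/
lemma card_vs_le_of_deg {X : Finset α} (h2 : ∀ e ∈ X, (ends e).card ≤ 2)
    (hdeg : ∀ e ∈ X, ∀ v ∈ ends e, ∃ f ∈ X, f ≠ e ∧ v ∈ ends f) :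
    (vs ends X).card ≤ X.card := by
  have h1 := Finset.card_nsmul_le_sum (vs ends X) (deg ends X) 2 fun v hv ↦ two_le_deg hdeg hv
  have h3 := sum_ends_le h2
  rw [sum_deg, smul_eq_mul] at h1
  omega

lemma card_vs_lt_of_deg {X : Finset α} (h2 : ∀ e ∈ X, (ends e).card ≤ 2)
    (hdeg : ∀ e ∈ X, ∀ v ∈ ends e, ∃ f ∈ X, f ≠ e ∧ v ∈ ends f) {e : α} (he : e ∈ X)
    (he1 : (ends e).card ≤ 1) : (vs ends X).card < X.card := by
  have h1 := Finset.card_nsmul_le_sum (vs ends X) (deg ends X) 2 fun v hv ↦ two_le_deg hdeg hv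
  have h3 : ∑ e ∈ X, (ends e).card < ∑ e ∈ X, 2 := Finset.sum_lt_sum h2 ⟨e, he, by omega⟩
  rw [sum_deg, smul_eq_mul] at h1
  simp at h3
  omega

lemma deg_eq_two {X : Finset α} (h2 : ∀ e ∈ X, (ends e).card ≤ 2)
    (hdeg : ∀ e ∈ X, ∀ v ∈ ends e, ∃ f ∈ X, f ≠ e ∧ v ∈ ends f)
    (h : X.card ≤ (vs ends X).card) {v : V} (hv : v ∈ vs ends X) : deg ends X v = 2 := by
  by_contra hne
  have h1 : ∑ v ∈ vs ends X, 2 < ∑ v ∈ vs ends X, deg ends X v :=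
    Finset.sum_lt_sum (fun v hv ↦ two_le_deg hdeg hv)
      ⟨v, hv, lt_of_le_of_ne (two_le_deg hdeg hv) (Ne.symm hne)⟩
  have h3 := sum_ends_le h2
  rw [sum_deg] at h1
  simp at h1
  omega

lemma deg_union {X Y : Finset α} (hd : Disjoint X Y) (v : V) :
    deg ends (X ∪ Y) v = deg ends X v + deg ends Y v := by
  rw [deg, Finset.filter_union, Finset.card_union_of_disjoint]
  · rfl
  · exact Finset.disjoint_filter_filter hd

lemma one_le_deg {X : Finset α} {v : V} : 1 ≤ deg ends X v ↔ v ∈ vs ends X := by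
  rw [deg, Nat.succ_le_iff, Finset.card_pos, mem_vs]
  simp [Finset.Nonempty]

lemma IsCyc.deg_eq_two {C : Finset α} (hC : IsCyc ends C) (h2 : ∀ e ∈ C, (ends e).card ≤ 2)
    (hC2 : 2 ≤ C.card) {v : V} (hv : v ∈ vs ends C) : deg ends C v = 2 :=
  Multi.deg_eq_two h2 (fun _ he _ hv ↦ hC.exists_ne hC2 he hv) hC.2.1.symm.le hv

/-! ### Thetas and handcuffs -/

/-- A proper part of a path brings at least as many inner vertices as edges. This is what lets
partial paths be ignored when thetas and handcuffs are counted. -/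
lemma IsPth.card_le_inner {P Z : Finset α} {x y : V} (h : IsPth ends P x y) (hZ : Z ⊂ P) :
    Z.card ≤ (vs ends Z \ {x, y}).card := by
  have h1 := h.2.2.1 Z hZ
  have h2 := Finset.card_pair h.1
  rw [Finset.union_comm, ← Finset.union_sdiff_self_eq_union] at h1
  have := Finset.card_union_le {x, y} (vs ends Z \ {x, y})
  omega

lemma sdiff_card_le {S T U : Finset V} (h : S ∩ T ⊆ U) : T.card + (S \ U).card ≤ (S ∪ T).card := by
  rw [← Finset.card_union_of_disjoint]
  · exact Finset.card_le_card (by grind)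
  · rw [Finset.disjoint_left]; intro a ha ha'
    rw [Finset.mem_sdiff] at ha'
    exact ha'.2 (h (Finset.mem_inter.2 ⟨ha'.1, ha⟩))

lemma card_split {Z P Q : Finset α} (hZ : Z ⊆ P ∪ Q) (hd : Disjoint P Q) :
    Z = Z ∩ P ∪ Z ∩ Q ∧ Z.card = (Z ∩ P).card + (Z ∩ Q).card := by
  have h1 : Z = Z ∩ P ∪ Z ∩ Q := by
    rw [← Finset.inter_union_distrib_left, Finset.inter_eq_left.2 hZ]
  refine ⟨h1, ?_⟩
  conv_lhs => rw [h1]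
  exact Finset.card_union_of_disjoint
    (hd.mono Finset.inter_subset_right Finset.inter_subset_right)

lemma isCyc_union {P Q : Finset α} {x y : V} (hP : IsPth ends P x y) (hQ : IsPth ends Q x y)
    (hd : Disjoint P Q) (hv : vs ends P ∩ vs ends Q = {x, y}) : IsCyc ends (P ∪ Q) := by
  -- If `Z` misses an edge of `P`, its part in `P` pays for itself with inner vertices, and the
  -- surplus of the forest `Z ∩ Q` survives.
  have key : ∀ P Q : Finset α, IsPth ends P x y → IsPth ends Q x y → Disjoint P Q →
      vs ends P ∩ vs ends Q = {x, y} → ∀ Z ⊆ P ∪ Q, Z ∩ P ⊂ P → Z.Nonempty →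
      Z.card < (vs ends Z).card := by
    intro P Q hP hQ hd hv Z hZ hZP hne
    obtain ⟨h1, h2⟩ := card_split hZ hd
    rcases (Z ∩ Q).eq_empty_or_nonempty with h0 | h0
    · rw [h0, Finset.union_empty] at h1
      exact hP.forest Z (h1.symm ▸ hZP.1) hne
    · have h3 := hP.card_le_inner hZP
      have h4 := hQ.forest _ Finset.inter_subset_right h0
      have h5 : vs ends (Z ∩ P) ∩ vs ends (Z ∩ Q) ⊆ {x, y} := by
        rw [← hv]
        exact Finset.inter_subset_inter (vs_mono Finset.inter_subset_right)
          (vs_mono Finset.inter_subset_right)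
      have h6 := sdiff_card_le h5
      rw [← vs_union, ← h1] at h6
      omega
  refine ⟨hP.nonempty.mono Finset.subset_union_left, ?_, ?_⟩
  · have h1 := card_union_eq (vs ends P) (vs ends Q)
    rw [hv, Finset.card_pair hP.1, hP.card_vs, hQ.card_vs] at h1
    rw [vs_union, Finset.card_union_of_disjoint hd]
    omega
  · intro Z hZ hne
    by_cases hZP : Z ∩ P ⊂ P
    · exact key P Q hP hQ hd hv Z hZ.1 hZP hne
    · by_cases hZQ : Z ∩ Q ⊂ Q
      · exact key Q P hQ hP hd.symm (by rw [Finset.inter_comm, hv]) Z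
          (by rw [Finset.union_comm]; exact hZ.1) hZQ hne
      · exfalso
        apply hZ.2
        rw [Finset.ssubset_iff_subset_ne, not_and_not_right] at hZP hZQ
        have a := hZP Finset.inter_subset_right
        have b := hZQ Finset.inter_subset_right
        rw [← a, ← b]
        exact Finset.union_subset Finset.inter_subset_left Finset.inter_subset_left

/-- A cycle meeting a path whose inner vertices have no further edges contains the path. -/
lemma IsCyc.path_subset {D P : Finset α} {x y : V} (hD : IsCyc ends D) (hP : IsPth ends P x y)
    (hv : vs ends (D \ P) ∩ vs ends P ⊆ {x, y}) : D ∩ P = ∅ ∨ P ⊆ D := by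
  by_contra! hcon
  have hZ : D ∩ P ⊂ P := by
    refine Finset.inter_subset_right.ssubset_of_ne fun h ↦ hcon.2 ?_
    rw [← h]; exact Finset.inter_subset_left
  have h1 := hP.card_le_inner hZ
  have hs : D \ P ∪ D ∩ P = D := Finset.sdiff_union_inter D P
  have hcard : (D \ P).card + (D ∩ P).card = D.card := Finset.card_sdiff_add_card_inter D P
  rcases (D \ P).eq_empty_or_nonempty with h0 | h0
  · have h2 := hP.forest D (by rwa [Finset.sdiff_eq_empty_iff_subset] at h0) hD.1
    have := hD.2.1; omega
  -- A partial path pays for its own edges with inner vertices, so the surplus vertex of `D \ P`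
  -- would survive in the cycle `D`, which has none.
  · have h2 := hD.2.2 (D \ P) (ssubset_of_disjoint_union hs
      (Finset.disjoint_sdiff_inter D P) hcon.1) h0
    have h5 : vs ends (D ∩ P) ∩ vs ends (D \ P) ⊆ {x, y} := by
      rw [Finset.inter_comm]
      exact (Finset.inter_subset_inter_left (vs_mono Finset.inter_subset_right)).trans hv
    have h6 := sdiff_card_le h5
    rw [← vs_union, Finset.union_comm, hs] at h6
    have := hD.2.1
    omega

/-- Numerical version of `Graph.IsTheta`. -/
def IsThetaN (ends : α → Finset V) (P Q R : Finset α) : Prop :=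
  ∃ x y, IsPth ends P x y ∧ IsPth ends Q x y ∧ IsPth ends R x y ∧ Disjoint P Q ∧ Disjoint P R ∧
    Disjoint Q R ∧ vs ends P ∩ vs ends Q = {x, y} ∧ vs ends P ∩ vs ends R = {x, y} ∧
    vs ends Q ∩ vs ends R = {x, y}

lemma IsThetaN.rotate {P Q R : Finset α} (h : IsThetaN ends P Q R) : IsThetaN ends Q R P := by
  obtain ⟨x, y, hP, hQ, hR, h1, h2, h3, h4, h5, h6⟩ := h
  exact ⟨x, y, hQ, hR, hP, h3, h1.symm, h2.symm, h6, by rw [Finset.inter_comm, h4],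
    by rw [Finset.inter_comm, h5]⟩

lemma IsThetaN.isCyc {P Q R : Finset α} (h : IsThetaN ends P Q R) : IsCyc ends (P ∪ Q) := by
  obtain ⟨x, y, hP, hQ, hR, h1, h2, h3, h4, h5, h6⟩ := h
  exact isCyc_union hP hQ h1 h4

lemma notMem_of_inter_eq_empty {D P : Finset α} (h : D ∩ P = ∅) : ∀ e ∈ D, e ∉ P :=
  Finset.disjoint_left.1 (Finset.disjoint_iff_inter_eq_empty.2 h)

lemma IsThetaN.isBicyc {P Q R : Finset α} (h : IsThetaN ends P Q R) :
    IsBicyc ends (P ∪ Q ∪ R) := by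
  have key : ∀ P Q R : Finset α, IsThetaN ends P Q R → ∀ Z ⊆ P ∪ Q ∪ R, Z ∩ R ⊂ R →
      Z.card ≤ (vs ends Z).card := by
    intro P Q R h Z hZ hZR
    have hcyc := h.isCyc
    obtain ⟨x, y, hP, hQ, hR, h1, h2, h3, h4, h5, h6⟩ := h
    have hd : Disjoint (P ∪ Q) R := Finset.disjoint_union_left.2 ⟨h2, h3⟩
    obtain ⟨e1, e2⟩ := card_split hZ hd
    have h7 := hR.card_le_inner hZR
    have h8 : (Z ∩ (P ∪ Q)).card ≤ (vs ends (Z ∩ (P ∪ Q))).card := by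
      rcases (Z ∩ (P ∪ Q)).eq_empty_or_nonempty with h0 | h0
      · simp [h0]
      · by_cases heq : Z ∩ (P ∪ Q) = P ∪ Q
        · rw [heq, hcyc.2.1]
        · exact (hcyc.2.2 _ (Finset.inter_subset_right.ssubset_of_ne heq) h0).le
    have h9 : vs ends (Z ∩ R) ∩ vs ends (Z ∩ (P ∪ Q)) ⊆ {x, y} := by
      refine (Finset.inter_subset_inter (vs_mono Finset.inter_subset_right)
        (vs_mono Finset.inter_subset_right)).trans ?_
      rw [vs_union, Finset.inter_comm, Finset.union_inter_distrib_right, h5, h6,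
        Finset.union_idempotent]
    have h10 := sdiff_card_le h9
    rw [← vs_union, Finset.union_comm (Z ∩ R), ← e1] at h10
    omega
  refine ⟨?_, ?_⟩
  · have hcyc := h.isCyc
    obtain ⟨x, y, hP, hQ, hR, h1, h2, h3, h4, h5, h6⟩ := h
    have c1 := card_union_eq (vs ends (P ∪ Q)) (vs ends R)
    rw [← vs_union, hcyc.2.1, hR.card_vs, vs_union P Q, Finset.union_inter_distrib_right, h5, h6,
      Finset.union_idempotent, Finset.card_pair hP.1] at c1
    rw [Finset.card_union_of_disjoint (Finset.disjoint_union_left.2 ⟨h2, h3⟩)]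
    omega
  · intro Z hZ
    by_cases hR : Z ∩ R ⊂ R
    · exact key P Q R h Z hZ.1 hR
    by_cases hP : Z ∩ P ⊂ P
    · exact key Q R P h.rotate Z (by have := hZ.1; grind) hP
    by_cases hQ : Z ∩ Q ⊂ Q
    · exact key R P Q h.rotate.rotate Z (by have := hZ.1; grind) hQ
    exfalso
    apply hZ.2
    rw [Finset.ssubset_iff_subset_ne, not_and_not_right] at hP hQ hR
    rw [← hP Finset.inter_subset_right, ← hQ Finset.inter_subset_right,
      ← hR Finset.inter_subset_right]
    grind

lemma IsThetaN.path_subset {P Q R D : Finset α} (h : IsThetaN ends P Q R)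
    (hD : IsCyc ends D) (hDs : D ⊆ P ∪ Q ∪ R) : D ∩ P = ∅ ∨ P ⊆ D := by
  obtain ⟨x, y, hP, hQ, hR, h1, h2, h3, h4, h5, h6⟩ := h
  refine hD.path_subset hP ?_
  have : D \ P ⊆ Q ∪ R := by grind
  refine (Finset.inter_subset_inter_right (vs_mono this)).trans ?_
  rw [vs_union, Finset.inter_comm, Finset.inter_union_distrib_left, h4, h5,
    Finset.union_idempotent]

/-- Each of the three paths is contained in `D` or edge-disjoint from it. One path is a forest, so
at least two are contained, and two of them already form a cycle. -/
lemma IsThetaN.eq_of_isCyc {P Q R D : Finset α} (h : IsThetaN ends P Q R)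
    (hD : IsCyc ends D) (hDs : D ⊆ P ∪ Q ∪ R) : D = P ∪ Q ∨ D = P ∪ R ∨ D = Q ∪ R := by
  have key : ∀ P Q R : Finset α, IsThetaN ends P Q R → P ⊆ D → Q ⊆ D → D = P ∪ Q :=
    fun P Q R h hP hQ ↦ (hD.eq_of_subset (Finset.union_subset hP hQ) h.isCyc.1
      h.isCyc.2.1.le).symm
  have hforest : ∀ P Q R : Finset α, IsThetaN ends P Q R → ¬ D ⊆ P := by
    intro P Q R h hDP
    obtain ⟨x, y, hP, -⟩ := h
    have := hP.forest D hDP hD.1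
    have := hD.2.1
    omega
  have e1 : D ⊆ Q ∪ R ∪ P := by grind
  have e2 : D ⊆ R ∪ P ∪ Q := by grind
  rcases h.path_subset hD hDs with hP | hP <;>
  rcases h.rotate.path_subset hD e1 with hQ | hQ <;>
  rcases h.rotate.rotate.path_subset hD e2 with hR | hR
  · exact absurd (by have := notMem_of_inter_eq_empty hP; have := notMem_of_inter_eq_empty hQ
                     have := notMem_of_inter_eq_empty hR; grind) (hforest P Q R h)
  · exact absurd (by have := notMem_of_inter_eq_empty hP; have := notMem_of_inter_eq_empty hQ
                     grind) (hforest R P Q h.rotate.rotate)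
  · exact absurd (by have := notMem_of_inter_eq_empty hP; have := notMem_of_inter_eq_empty hR
                     grind) (hforest Q R P h.rotate)
  · exact .inr (.inr (key Q R P h.rotate hQ hR))
  · exact absurd (by have := notMem_of_inter_eq_empty hQ; have := notMem_of_inter_eq_empty hR
                     grind) (hforest P Q R h)
  · exact .inr (.inl (by rw [key R P Q h.rotate.rotate hR hP, Finset.union_comm]))
  · exact .inl (key P Q R h hP hQ)
  · exact .inl (key P Q R h hP hQ)

lemma IsCyc.card_le_of_subset {C Z : Finset α} (hC : IsCyc ends C) (hZ : Z ⊆ C) :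
    Z.card ≤ (vs ends Z).card := by
  rcases Z.eq_empty_or_nonempty with rfl | h0
  · simp
  · by_cases heq : Z = C
    · rw [heq, hC.2.1]
    · exact (hC.2.2 _ (hZ.ssubset_of_ne heq) h0).le

/-- Numerical version of tight handcuffs. -/
def IsTightN (ends : α → Finset V) (C₁ C₂ : Finset α) : Prop :=
  IsCyc ends C₁ ∧ IsCyc ends C₂ ∧ Disjoint C₁ C₂ ∧ ∃ v, vs ends C₁ ∩ vs ends C₂ = {v}

/-- Numerical version of loose handcuffs. -/
def IsLooseN (ends : α → Finset V) (C₁ C₂ P : Finset α) : Prop :=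
  IsCyc ends C₁ ∧ IsCyc ends C₂ ∧ Disjoint (vs ends C₁) (vs ends C₂) ∧ ∃ x y, IsPth ends P x y ∧
    vs ends P ∩ vs ends C₁ = {x} ∧ vs ends P ∩ vs ends C₂ = {y}

/-- A cycle meeting a cycle that is attached at one vertex is equal to it. -/
lemma IsCyc.eq_of_one_attachment {D C : Finset α} {v : V} (hD : IsCyc ends D) (hC : IsCyc ends C)
    (hv : vs ends (D \ C) ∩ vs ends C ⊆ {v}) : D ∩ C = ∅ ∨ D = C := by
  by_contra! hcon
  rcases (D \ C).eq_empty_or_nonempty with h0 | h0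
  · exact hcon.2 (hC.eq_of_subset (by rwa [Finset.sdiff_eq_empty_iff_subset] at h0) hD.1 hD.2.1.le)
  · have h1 := hD.two_le_inter (Finset.sdiff_union_inter D C) (Finset.disjoint_sdiff_inter D C)
      h0 hcon.1
    have h2 := Finset.card_le_card ((Finset.inter_subset_inter_left
      (vs_mono (ends := ends) (Finset.inter_subset_right (s₁ := D) (s₂ := C)))).trans hv)
    simp at h2
    omega

lemma IsTightN.symm {C₁ C₂ : Finset α} (h : IsTightN ends C₁ C₂) : IsTightN ends C₂ C₁ := by
  obtain ⟨h1, h2, h3, v, h4⟩ := h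
  exact ⟨h2, h1, h3.symm, v, by rw [Finset.inter_comm, h4]⟩

lemma IsTightN.isBicyc {C₁ C₂ : Finset α} (h : IsTightN ends C₁ C₂) : IsBicyc ends (C₁ ∪ C₂) := by
  have key : ∀ C₁ C₂ : Finset α, IsTightN ends C₁ C₂ → ∀ Z ⊆ C₁ ∪ C₂, Z ∩ C₁ ⊂ C₁ →
      Z.card ≤ (vs ends Z).card := by
    intro C₁ C₂ h Z hZ hZ1
    obtain ⟨h1, h2, h3, v, h4⟩ := h
    obtain ⟨e1, e2⟩ := card_split hZ h3
    have h5 := h2.card_le_of_subset (Finset.inter_subset_right (s₁ := Z))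
    rcases (Z ∩ C₁).eq_empty_or_nonempty with h0 | h0
    · rw [h0, Finset.empty_union] at e1
      exact e1 ▸ h5
    · have h6 := h1.2.2 _ hZ1 h0
      have h7 := card_union_eq (vs ends (Z ∩ C₁)) (vs ends (Z ∩ C₂))
      have h8 : (vs ends (Z ∩ C₁) ∩ vs ends (Z ∩ C₂)).card ≤ 1 := by
        rw [← Finset.card_singleton v, ← h4]
        exact Finset.card_le_card (Finset.inter_subset_inter (vs_mono Finset.inter_subset_right)
          (vs_mono Finset.inter_subset_right))
      rw [← vs_union, ← e1] at h7
      omega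
  refine ⟨?_, fun Z hZ ↦ ?_⟩
  · obtain ⟨h1, h2, h3, v, h4⟩ := h
    have := card_union_eq (vs ends C₁) (vs ends C₂)
    rw [← vs_union, h4, Finset.card_singleton, h1.2.1, h2.2.1] at this
    rw [Finset.card_union_of_disjoint h3, this]
  · by_cases h1 : Z ∩ C₁ ⊂ C₁
    · exact key _ _ h Z hZ.1 h1
    by_cases h2 : Z ∩ C₂ ⊂ C₂
    · exact key _ _ h.symm Z (by rw [Finset.union_comm]; exact hZ.1) h2
    exfalso
    apply hZ.2
    rw [Finset.ssubset_iff_subset_ne, not_and_not_right] at h1 h2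
    rw [← h1 Finset.inter_subset_right, ← h2 Finset.inter_subset_right]
    grind

lemma IsTightN.eq_of_isCyc {C₁ C₂ D : Finset α} (h : IsTightN ends C₁ C₂) (hD : IsCyc ends D)
    (hs : D ⊆ C₁ ∪ C₂) : D = C₁ ∨ D = C₂ := by
  obtain ⟨h1, h2, h3, v, h4⟩ := h
  rcases hD.eq_of_one_attachment (v := v) h1 (by
    rw [← h4, Finset.inter_comm]
    exact Finset.inter_subset_inter_left (vs_mono (by grind))) with h | h
  · have := notMem_of_inter_eq_empty h
    exact .inr (h2.eq_of_subset (by grind) hD.1 hD.2.1.le)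
  · exact .inl h

lemma disjoint_of_inter_singleton {P C : Finset α} {x y z : V} (hP : IsPth ends P x y)
    (h : vs ends P ∩ vs ends C = {z}) : Disjoint P C := by
  rw [Finset.disjoint_left]
  intro e he he'
  have h1 := hP.forest {e} (by simpa) (by simp)
  rw [vs_singleton, Finset.card_singleton] at h1
  have := Finset.card_le_card (Finset.subset_inter (ends_subset_vs (ends := ends) he)
    (ends_subset_vs he'))
  rw [h, Finset.card_singleton] at this
  omega

lemma IsLooseN.symm {C₁ C₂ P : Finset α} (h : IsLooseN ends C₁ C₂ P) : IsLooseN ends C₂ C₁ P := by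
  obtain ⟨h1, h2, h3, x, y, hP, h4, h5⟩ := h
  exact ⟨h2, h1, h3.symm, y, x, hP.symm, h5, h4⟩

lemma IsLooseN.disjoint {C₁ C₂ P : Finset α} (h : IsLooseN ends C₁ C₂ P)
    (hne : ∀ e ∈ C₁, (ends e).Nonempty) :
    Disjoint C₁ C₂ ∧ Disjoint P C₁ ∧ Disjoint P C₂ := by
  obtain ⟨h1, h2, h3, x, y, hP, h4, h5⟩ := h
  refine ⟨?_, disjoint_of_inter_singleton hP h4, disjoint_of_inter_singleton hP h5⟩
  rw [Finset.disjoint_left]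
  intro e he he'
  obtain ⟨v, hv⟩ := hne e he
  exact Finset.disjoint_left.1 h3 (ends_subset_vs he hv) (ends_subset_vs he' hv)

lemma IsLooseN.eq_of_isCyc {C₁ C₂ P D : Finset α} (h : IsLooseN ends C₁ C₂ P) (hD : IsCyc ends D)
    (hs : D ⊆ C₁ ∪ C₂ ∪ P) : D = C₁ ∨ D = C₂ := by
  obtain ⟨h1, h2, h3, x, y, hP, h4, h5⟩ := h
  rcases hD.eq_of_one_attachment (v := x) h1 (by
    rw [← h4]
    intro v hv
    obtain ⟨ha, hb⟩ := Finset.mem_inter.1 hv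
    obtain ⟨e, he, hve⟩ := mem_vs.1 ha
    have hb' := Finset.disjoint_left.1 h3 hb
    refine Finset.mem_inter.2 ⟨mem_vs.2 ⟨e, ?_, hve⟩, hb⟩
    by_contra heP
    exact hb' (mem_vs.2 ⟨e, by grind, hve⟩)) with ha | ha
  · rcases hD.eq_of_one_attachment (v := y) h2 (by
      have := notMem_of_inter_eq_empty ha
      rw [← h5]
      exact Finset.inter_subset_inter_right (vs_mono (by grind))) with hb | hb
    · have := notMem_of_inter_eq_empty ha
      have := notMem_of_inter_eq_empty hb
      have := hP.forest D (by grind) hD.1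
      have := hD.2.1
      omega
    · exact .inr hb
  · exact .inl ha

lemma IsLooseN.isBicyc {C₁ C₂ P : Finset α} (h : IsLooseN ends C₁ C₂ P)
    (hne : ∀ e ∈ C₁, (ends e).Nonempty) : IsBicyc ends (C₁ ∪ C₂ ∪ P) := by
  obtain ⟨d1, d2, d3⟩ := h.disjoint hne
  have key : ∀ C₁ C₂ : Finset α, IsLooseN ends C₁ C₂ P → Disjoint C₁ C₂ → Disjoint P C₁ →
      Disjoint P C₂ → ∀ Z ⊆ C₁ ∪ C₂ ∪ P, (Z ∩ C₁ ⊂ C₁ ∨ Z ∩ P ⊂ P) →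
      Z.card ≤ (vs ends Z).card := by
    intro C₁ C₂ h d1 d2 d3 Z hZ hZ1
    obtain ⟨h1, h2, h3, x, y, hP, h4, h5⟩ := h
    obtain ⟨e1, e2⟩ := card_split hZ (Finset.disjoint_union_left.2 ⟨d2.symm, d3.symm⟩)
    have e3 : Z ∩ (C₁ ∪ C₂) = Z ∩ C₁ ∪ Z ∩ C₂ := Finset.inter_union_distrib_left _ _ _
    have e4 : Disjoint (Z ∩ C₁) (Z ∩ C₂) :=
      d1.mono Finset.inter_subset_right Finset.inter_subset_right
    have s1 := vs_mono (ends := ends) (Finset.inter_subset_right (s₁ := Z) (s₂ := C₁))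
    have s2 := vs_mono (ends := ends) (Finset.inter_subset_right (s₁ := Z) (s₂ := C₂))
    have sP := vs_mono (ends := ends) (Finset.inter_subset_right (s₁ := Z) (s₂ := P))
    have i1 := h1.card_le_of_subset (Finset.inter_subset_right (s₁ := Z))
    have i2 := h2.card_le_of_subset (Finset.inter_subset_right (s₁ := Z))
    have e5 : (vs ends (Z ∩ C₁ ∪ Z ∩ C₂)).card =
        (vs ends (Z ∩ C₁)).card + (vs ends (Z ∩ C₂)).card := by
      rw [vs_union, Finset.card_union_of_disjoint (h3.mono s1 s2)]
    rw [e3, Finset.card_union_of_disjoint e4] at e2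
    rw [e3] at e1
    by_cases hZP : Z ∩ P ⊂ P
    · have h7 := hP.card_le_inner hZP
      have h9 : vs ends (Z ∩ P) ∩ vs ends (Z ∩ C₁ ∪ Z ∩ C₂) ⊆ {x, y} := by
        refine (Finset.inter_subset_inter_right sP).trans ?_
        rw [vs_union, Finset.inter_union_distrib_left]
        refine (Finset.union_subset_union (Finset.inter_subset_inter_left s1)
          (Finset.inter_subset_inter_left s2)).trans ?_
        rw [h4, h5]; rfl
      have h10 := sdiff_card_le h9
      rw [← vs_union, Finset.union_comm (Z ∩ P), ← e1] at h10
      omega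
    · have hPZ : Z ∩ P = P := by
        rw [Finset.ssubset_iff_subset_ne, not_and_not_right] at hZP
        exact hZP Finset.inter_subset_right
      have hZ1 := hZ1.resolve_right hZP
      rw [hPZ] at e1 e2
      have h6 : (Z ∩ C₁).card ≤ (vs ends (Z ∩ C₁) \ {x}).card := by
        rcases (Z ∩ C₁).eq_empty_or_nonempty with h0 | h0
        · simp [h0]
        · have := h1.2.2 _ hZ1 h0
          have := Finset.le_card_sdiff {x} (vs ends (Z ∩ C₁))
          simp at this
          omega
      -- `C₂` may be contained in `Z` and then loses a unit when `y` is charged to the path; the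
      -- spare vertex of `P` makes up for it.
      have h7 : (Z ∩ C₂).card ≤ (vs ends (Z ∩ C₂) \ {y}).card + 1 := by
        have := Finset.le_card_sdiff {y} (vs ends (Z ∩ C₂))
        simp at this
        omega
      have h8 : vs ends (Z ∩ C₁) ∩ vs ends P ⊆ {x} := by
        rw [← h4, Finset.inter_comm]
        exact Finset.inter_subset_inter_left s1
      have h9 := sdiff_card_le h8
      have h10 : vs ends (Z ∩ C₂) ∩ (vs ends (Z ∩ C₁) ∪ vs ends P) ⊆ {y} := by
        rw [← h5]
        intro v hv
        have hdis : v ∈ vs ends C₁ → v ∉ vs ends C₂ := fun h ↦ Finset.disjoint_left.1 h3 h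
        have := @s1 v
        have := @s2 v
        simp only [Finset.mem_inter, Finset.mem_union] at hv ⊢
        tauto
      have h11 := sdiff_card_le h10
      have h12 : vs ends Z = vs ends (Z ∩ C₂) ∪ (vs ends (Z ∩ C₁) ∪ vs ends P) := by
        conv_lhs => rw [e1]
        rw [vs_union, vs_union]
        ext; simp; tauto
      rw [← h12] at h11
      have := hP.card_vs
      omega
  refine ⟨?_, fun Z hZ ↦ ?_⟩
  · obtain ⟨h1, h2, h3, x, y, hP, h4, h5⟩ := h
    rw [Finset.card_union_of_disjoint (Finset.disjoint_union_left.2 ⟨d2.symm, d3.symm⟩),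
      Finset.card_union_of_disjoint d1]
    have c1 := card_union_eq (vs ends (C₁ ∪ C₂)) (vs ends P)
    rw [← vs_union, vs_union C₁, Finset.card_union_of_disjoint h3, Finset.inter_comm,
      Finset.inter_union_distrib_left, h4, h5, h1.2.1, h2.2.1, hP.card_vs, ← Finset.insert_eq,
      Finset.card_pair hP.1] at c1
    omega
  · by_cases c1 : Z ∩ C₁ ⊂ C₁
    · exact key _ _ h d1 d2 d3 Z hZ.1 (.inl c1)
    by_cases c2 : Z ∩ C₂ ⊂ C₂
    · exact key _ _ h.symm d1.symm d3 d2 Z (by rw [Finset.union_comm C₂]; exact hZ.1) (.inl c2)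
    by_cases c3 : Z ∩ P ⊂ P
    · exact key _ _ h d1 d2 d3 Z hZ.1 (.inr c3)
    exfalso
    apply hZ.2
    rw [Finset.ssubset_iff_subset_ne, not_and_not_right] at c1 c2 c3
    rw [← c1 Finset.inter_subset_right, ← c2 Finset.inter_subset_right,
      ← c3 Finset.inter_subset_right]
    grind

end Multi

/-! ### Shortest paths, splitting a cycle, and the classification of bicycles -/

namespace Multi

variable {α V : Type*} {ends : α → Finset V}

/-- The edge set of a path, built from its end. -/
inductive IsPathF (ends : α → Finset V) : Finset α → V → V → Prop
  | single {e : α} {x y : V} (hxy : x ≠ y) (he : ends e = {x, y}) : IsPathF ends {e} x y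
  | cons {e : α} {x y z : V} {P : Finset α} (he : ends e = {x, y}) (hP : IsPathF ends P y z)
      (hx : x ∉ vs ends P) : IsPathF ends (insert e P) x z

lemma IsPathF.isPth {P : Finset α} {x y : V} (h : IsPathF ends P x y) : IsPth ends P x y := by
  induction h with
  | single hxy he => exact .single hxy he
  | cons he _ hx ih => exact (IsPth.cons he ih hx).2

/-- The last clause says that the start is really left behind, so the shortening is proper in
arguments by minimality. -/
lemma IsPathF.exists_suffix {P : Finset α} {x y u : V} (h : IsPathF ends P x y)
    (hu : u ∈ vs ends P) (huy : u ≠ y) :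
    ∃ P' ⊆ P, IsPathF ends P' u y ∧ (u ≠ x → x ∉ vs ends P') := by
  induction h with
  | @single e x y hxy he =>
    rw [vs_singleton, he] at hu
    have : u = x := by simp at hu; tauto
    subst this
    exact ⟨_, subset_rfl, .single hxy he, by simp⟩
  | @cons e x y z P he hP hx ih =>
    by_cases hux : u = x
    · subst hux
      exact ⟨_, subset_rfl, .cons he hP hx, by simp⟩
    · have : u ∈ vs ends P := by
        rw [vs_insert, he] at hu
        simp only [Finset.mem_union, Finset.mem_insert, Finset.mem_singleton] at hu
        rcases hu with (h | h) | h
        · exact absurd h hux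
        · exact h ▸ hP.isPth.left_mem
        · exact h
      obtain ⟨P', h1, h2, -⟩ := ih this huy
      exact ⟨P', h1.trans (Finset.subset_insert _ _), h2, fun _ h ↦ hx (vs_mono h1 h)⟩

lemma exists_isPathF {X : Finset α} {a b : V} (h : Relation.ReflTransGen (AdjOn ends X) a b)
    (hab : a ≠ b) : ∃ P ⊆ X, IsPathF ends P a b := by
  induction h using Relation.ReflTransGen.head_induction_on with
  | refl => exact absurd rfl hab
  | @head a c hac hcb ih =>
    obtain ⟨e, he, hac⟩ := hac
    by_cases hc : c = b
    · subst hc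
      exact ⟨{e}, by simpa, .single hab hac⟩
    · obtain ⟨P, hP, h⟩ := ih hc
      by_cases haP : a ∈ vs ends P
      · obtain ⟨P', h1, h2, -⟩ := h.exists_suffix haP hab
        exact ⟨P', h1.trans hP, h2⟩
      · exact ⟨insert e P, Finset.insert_subset he hP, .cons hac h haP⟩

/-- Reachability gives an inductive path inside `P` with the same ends. If it were a proper subset,
it would have `|P'| + 1` vertices including `x` and `y`, one fewer than proper subsets of `P` must
have together with the ends. -/
lemma IsPth.isPathF {P : Finset α} {x y : V} (h : IsPth ends P x y)
    (h2 : ∀ e ∈ P, (ends e).card ≤ 2) : IsPathF ends P x y := by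
  obtain ⟨P', hP', h'⟩ := exists_isPathF (h.reach h2) h.1
  rcases hP'.eq_or_ssubset with rfl | hs
  · exact h'
  · have h3 := h.2.2.1 P' hs
    rw [Finset.union_eq_left.2 h'.isPth.pair_subset, h'.isPth.card_vs] at h3
    omega

/-- A path with minimal edge set between the two vertex sets: a further vertex of `S` or `T` on it
would allow it to be cut short. Both clauses exclude `a` as well as `b` because `S` and `T` may
overlap; the theta case uses `S = T`. -/
lemma exists_min_path {X : Finset α} (h2 : ∀ e ∈ X, (ends e).card ≤ 2) {S T : Finset V} {a b : V}
    (ha : a ∈ S) (hb : b ∈ T) (hab : a ≠ b) (h : Relation.ReflTransGen (AdjOn ends X) a b) :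
    ∃ a ∈ S, ∃ b ∈ T, ∃ P ⊆ X, IsPth ends P a b ∧ (∀ u ∈ vs ends P, u ∈ S → u = a ∨ u = b) ∧
      ∀ u ∈ vs ends P, u ∈ T → u = a ∨ u = b := by
  obtain ⟨P₀, hP₀, hp⟩ := exists_isPathF h hab
  obtain ⟨P, -, ⟨hPX, a, haS, b, hbT, hP⟩, hmin⟩ := exists_minimal_le_of_wellFoundedLT
    (fun P : Finset α ↦ P ⊆ X ∧ ∃ a ∈ S, ∃ b ∈ T, IsPathF ends P a b) P₀
    ⟨hP₀, a, ha, b, hb, hp⟩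
  refine ⟨a, haS, b, hbT, P, hPX, hP.isPth, fun u hu huS ↦ ?_, fun u hu huT ↦ ?_⟩
  · by_contra! hcon
    obtain ⟨P', h1, h3, h4⟩ := hP.exists_suffix hu hcon.2
    exact h4 hcon.1 (vs_mono (hmin ⟨h1.trans hPX, u, huS, b, hbT, h3⟩ h1) hP.isPth.left_mem)
  · by_contra! hcon
    have hs := hP.isPth.symm.isPathF fun e he ↦ h2 e (hPX he)
    obtain ⟨P', h1, h3, h4⟩ := hs.exists_suffix hu hcon.1
    refine h4 hcon.2 (vs_mono (hmin ⟨h1.trans hPX, a, haS, u, huT, ?_⟩ h1) hP.isPth.right_mem)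
    exact h3.isPth.symm.isPathF fun e he ↦ h2 e (hPX (h1 he))

lemma IsBicyc.reach {C : Finset α} (hC : IsBicyc ends C) (h2 : ∀ e ∈ C, (ends e).card ≤ 2)
    {x y : V} (hx : x ∈ vs ends C) (hy : y ∈ vs ends C) :
    Relation.ReflTransGen (AdjOn ends C) x y := by
  by_contra hcon
  obtain ⟨Z, hZ, h3, h4⟩ := exists_component C h2 x
  have hu := Finset.union_sdiff_of_subset hZ
  have hx' : x ∈ vs ends Z := by
    rw [← hu, vs_union, Finset.mem_union] at hx
    exact hx.resolve_right fun h ↦ h4 x h .refl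
  have hy' : y ∈ vs ends (C \ Z) := by
    rw [← hu, vs_union, Finset.mem_union] at hy
    exact hy.resolve_left fun h ↦ hcon (h3 y h)
  have := hC.one_le_inter hu Finset.disjoint_sdiff
    (by obtain ⟨e, he, -⟩ := mem_vs.1 hx'; exact ⟨e, he⟩)
    (by obtain ⟨e, he, -⟩ := mem_vs.1 hy'; exact ⟨e, he⟩)
  obtain ⟨v, hv⟩ := Finset.card_pos.1 this
  rw [Finset.mem_inter] at hv
  exact h4 v hv.2 (h3 v hv.1)

lemma IsCyc.exists_split {C : Finset α} (hC : IsCyc ends C) (h2 : ∀ e ∈ C, (ends e).card ≤ 2)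
    {a b : V} (ha : a ∈ vs ends C) (hb : b ∈ vs ends C) (hab : a ≠ b) :
    ∃ P Q, IsPth ends P a b ∧ IsPth ends Q a b ∧ P ∪ Q = C ∧ Disjoint P Q ∧
      vs ends P ∩ vs ends Q = {a, b} := by
  have hC2 : 2 ≤ C.card := by
    rw [← hC.2.1, ← Finset.card_pair hab]
    exact Finset.card_le_card (by grind)
  obtain ⟨P, hPC, hP⟩ := exists_isPathF (hC.reach h2 ha hb) hab
  replace hP := hP.isPth
  have hPne : P ≠ C := by
    rintro rfl
    have := hP.card_vs
    have := hC.2.1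
    omega
  have hQne : (C \ P).Nonempty := by
    rw [Finset.sdiff_nonempty]; exact fun h ↦ hPne (hPC.antisymm h)
  have hu := Finset.union_sdiff_of_subset hPC
  have hint := hC.two_le_inter hu Finset.disjoint_sdiff hP.nonempty hQne
  have hsub : vs ends P ∩ vs ends (C \ P) ⊆ {a, b} := by
    intro v hv
    rw [Finset.mem_inter] at hv
    by_contra hcon
    simp only [Finset.mem_insert, Finset.mem_singleton, not_or] at hcon
    obtain ⟨e, he, hve⟩ := mem_vs.1 hv.1
    -- An inner vertex of `P` has both of its cycle edges in `P`, so the rest of the cycle does not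
    -- reach it.
    obtain ⟨f, hf, hfe, hvf⟩ := hP.exists_ne he hve hcon.1 hcon.2
    have h3 : 2 ≤ deg ends P v := by
      exact Finset.one_lt_card.2 ⟨e, by simp [he, hve], f, by simp [hf, hvf], hfe.symm⟩
    have h4 := one_le_deg.2 hv.2
    have h5 := hC.deg_eq_two h2 hC2 (vs_mono hPC hv.1)
    have h6 := deg_union (ends := ends) (Finset.disjoint_sdiff (s := P) (t := C)) v
    rw [hu] at h6
    omega
  have heq : vs ends P ∩ vs ends (C \ P) = {a, b} :=
    Finset.eq_of_subset_of_card_le hsub (by rwa [Finset.card_pair hab])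
  have hcard : (vs ends (C \ P)).card = (C \ P).card + 1 := by
    have h3 := card_union_eq (vs ends P) (vs ends (C \ P))
    rw [← vs_union, hu, heq, Finset.card_pair hab, hP.card_vs, hC.2.1] at h3
    have := Finset.card_sdiff_add_card_eq_card hPC
    omega
  have hsub' : {a, b} ⊆ vs ends (C \ P) := heq ▸ Finset.inter_subset_right
  refine ⟨P, C \ P, hP, ⟨hab, fun Z hZ hne ↦ ?_, fun Z hZ ↦ ?_, ?_⟩, hu,
    Finset.disjoint_sdiff, heq⟩
  · refine hC.2.2 Z ((hZ.trans Finset.sdiff_subset).ssubset_of_ne ?_) hne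
    rintro rfl
    obtain ⟨e, he⟩ := hP.nonempty
    exact (Finset.mem_sdiff.1 (hZ (hPC he))).2 he
  -- The count for a proper part `Z` of the second path is read off from the proper subset `Z ∪ P`
  -- of the cycle.
  · have hdZ : Disjoint Z P := Finset.disjoint_of_subset_left hZ.1 Finset.sdiff_disjoint
    have hs : Z ∪ P ⊂ C := by
      refine (Finset.union_subset (hZ.1.trans Finset.sdiff_subset) hPC).ssubset_of_ne fun h ↦ ?_
      exact hZ.2 (by rw [← h, Finset.union_sdiff_right]; exact Finset.sdiff_subset)
    have h3 := hC.2.2 _ hs (hP.nonempty.mono Finset.subset_union_right)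
    rw [vs_union, Finset.card_union_of_disjoint hdZ] at h3
    have h4 := hP.card_vs
    have h5 : (vs ends Z ∪ vs ends P).card = (vs ends Z \ vs ends P).card + (vs ends P).card := by
      rw [← Finset.card_union_of_disjoint Finset.sdiff_disjoint, Finset.sdiff_union_self_eq_union]
    have h6 : (vs ends Z \ vs ends P).card + 2 ≤ (vs ends Z ∪ {a, b}).card := by
      rw [← Finset.card_pair hab, ← Finset.card_union_of_disjoint]
      · exact Finset.card_le_card (Finset.union_subset_union_left Finset.sdiff_subset)
      · exact Finset.disjoint_of_subset_right hP.pair_subset Finset.sdiff_disjoint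
    omega
  · rw [Finset.union_eq_left.2 hsub', hcard]

lemma IsBicyc.eq_of_subset {Y D : Finset α} (hY : IsBicyc ends Y) (hD : IsBicyc ends D)
    (h : D ⊆ Y) : D = Y := by
  by_contra hne
  have := hY.2 D (h.ssubset_of_ne hne)
  have := hD.1
  omega

/-- A minimal edge set with more edges than vertices is a theta or a pair of handcuffs. -/
lemma IsBicyc.classify {Y : Finset α} (hY : IsBicyc ends Y) (h1 : ∀ e ∈ Y, (ends e).Nonempty)
    (h2 : ∀ e ∈ Y, (ends e).card ≤ 2) :
    (∃ P Q R, IsThetaN ends P Q R ∧ Y = P ∪ Q ∪ R) ∨ (∃ C D, IsTightN ends C D ∧ Y = C ∪ D) ∨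
      ∃ C D P, IsLooseN ends C D P ∧ Y = C ∪ D ∪ P := by
  have hYc := hY.1
  obtain ⟨C, hCY, hC⟩ := exists_isCyc hY.nonempty h1 (by omega)
  obtain ⟨e, he⟩ := hC.1
  have heY := hCY he
  have hce := Finset.card_erase_add_one heY
  have hne : (Y.erase e).Nonempty := by
    rw [← Finset.card_pos]
    by_contra h0
    have h3 : Y = {e} := by
      obtain ⟨a, ha⟩ := Finset.card_eq_one.1 (by omega : Y.card = 1)
      rw [ha, Finset.mem_singleton] at heY
      rw [ha, heY]
    obtain ⟨v, hv⟩ := h1 e heY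
    have := Finset.card_pos.2 ⟨v, ends_subset_vs (ends := ends) heY hv⟩
    rw [h3, Finset.card_singleton] at hYc
    rw [h3] at this
    omega
  -- After deletion of an edge of `C` there are still as many edges as vertices, so a second cycle
  -- exists. The number of vertices common to the two cycles decides the shape: none gives loose
  -- handcuffs, one gives tight handcuffs, more give a theta.
  obtain ⟨D, hDY, hD⟩ := exists_isCyc hne (fun e he ↦ h1 e (Finset.mem_of_mem_erase he))
    (by have := Finset.card_le_card (vs_mono (ends := ends) (Finset.erase_subset e Y)); omega)
  have heD : e ∉ D := fun h ↦ (Finset.mem_erase.1 (hDY h)).1 rfl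
  replace hDY := hDY.trans (Finset.erase_subset _ _)
  rcases Nat.lt_or_ge (vs ends C ∩ vs ends D).card 1 with h0 | h0
  · have hdis : Disjoint (vs ends C) (vs ends D) := by
      rw [Finset.disjoint_iff_inter_eq_empty, ← Finset.card_eq_zero]; omega
    obtain ⟨a, ha⟩ : (vs ends C).Nonempty := by
      rw [← Finset.card_pos, hC.2.1, Finset.card_pos]; exact hC.1
    obtain ⟨b, hb⟩ : (vs ends D).Nonempty := by
      rw [← Finset.card_pos, hD.2.1, Finset.card_pos]; exact hD.1
    obtain ⟨a, ha, b, hb, P, hPY, hP, hPa, hPb⟩ := exists_min_path h2 ha hb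
      (fun h ↦ Finset.disjoint_left.1 hdis ha (h ▸ hb))
      (hY.reach h2 (vs_mono hCY ha) (vs_mono hDY hb))
    have hL : IsLooseN ends C D P := by
      refine ⟨hC, hD, hdis, a, b, hP, ?_, ?_⟩
      · ext u
        simp only [Finset.mem_inter, Finset.mem_singleton]
        refine ⟨fun ⟨hu, hu'⟩ ↦ (hPa u hu hu').resolve_right ?_, ?_⟩
        · rintro rfl; exact Finset.disjoint_left.1 hdis hu' hb
        · rintro rfl; exact ⟨hP.left_mem, ha⟩
      · ext u
        simp only [Finset.mem_inter, Finset.mem_singleton]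
        refine ⟨fun ⟨hu, hu'⟩ ↦ (hPb u hu hu').resolve_left ?_, ?_⟩
        · rintro rfl; exact Finset.disjoint_left.1 hdis ha hu'
        · rintro rfl; exact ⟨hP.right_mem, hb⟩
    exact .inr (.inr ⟨C, D, P, hL, (hY.eq_of_subset (hL.isBicyc fun e he ↦ h1 e (hCY he))
      (Finset.union_subset (Finset.union_subset hCY hDY) hPY)).symm⟩)
  rcases Nat.lt_or_ge (vs ends C ∩ vs ends D).card 2 with h3 | h3
  · obtain ⟨v, hv⟩ := Finset.card_eq_one.1 (by omega : (vs ends C ∩ vs ends D).card = 1)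
    have hdis : D ∩ C = ∅ := by
      refine (hD.eq_of_one_attachment (v := v) hC ?_).resolve_right (by rintro rfl; exact heD he)
      rw [← hv, Finset.inter_comm]
      exact Finset.inter_subset_inter_left (vs_mono Finset.sdiff_subset)
    have hT : IsTightN ends C D :=
      ⟨hC, hD, (Finset.disjoint_iff_inter_eq_empty.2 hdis).symm, v, hv⟩
    exact .inr (.inl ⟨C, D, hT, (hY.eq_of_subset hT.isBicyc
      (Finset.union_subset hCY hDY)).symm⟩)
  -- A component of `D \ C` returns to `C` at a second vertex; a shortest path in it between
  -- vertices of `C`, with the two arcs of `C`, is a theta.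
  · left
    have hne : (D \ C).Nonempty := by
      rw [Finset.sdiff_nonempty]
      intro h
      exact heD (hC.eq_of_subset h hD.1 hD.2.1.le ▸ he)
    have h2D : ∀ e ∈ D \ C, (ends e).card ≤ 2 :=
      fun e he ↦ h2 e (hDY (Finset.mem_sdiff.1 he).1)
    obtain ⟨f, hf⟩ := hne
    obtain ⟨u, hu⟩ := h1 f (hDY (Finset.mem_sdiff.1 hf).1)
    obtain ⟨Z, hZ, h4, h5⟩ := exists_component (D \ C) h2D u
    have hfZ : f ∈ Z := by
      by_contra h
      exact h5 u (mem_vs.2 ⟨f, Finset.mem_sdiff.2 ⟨hf, h⟩, hu⟩) .refl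
    have hZD : Z ⊆ D := hZ.trans Finset.sdiff_subset
    -- A vertex shared by `Z` and the rest of `D` lies on `C`, since `Z` is a whole component of `D
    -- \ C`; and a cycle cut in two has at least two such vertices.
    have hcap : 2 ≤ (vs ends Z ∩ vs ends C).card := by
      by_cases hZeq : Z = D
      · rwa [hZeq, Finset.inter_comm]
      · have hne : (D \ Z).Nonempty := by
          rw [Finset.sdiff_nonempty]; exact fun h ↦ hZeq (hZD.antisymm h)
        refine (hD.two_le_inter (Finset.union_sdiff_of_subset hZD) Finset.disjoint_sdiff
          ⟨f, hfZ⟩ hne).trans (Finset.card_le_card ?_)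
        intro v hv
        rw [Finset.mem_inter] at hv ⊢
        refine ⟨hv.1, ?_⟩
        obtain ⟨g, hg, hvg⟩ := mem_vs.1 hv.2
        rw [Finset.mem_sdiff] at hg
        refine mem_vs.2 ⟨g, ?_, hvg⟩
        by_contra hgC
        exact h5 v (mem_vs.2 ⟨g, by simp [hg, hgC], hvg⟩) (h4 v hv.1)
    obtain ⟨a, ha, b, hb, hab⟩ := Finset.one_lt_card.1 hcap
    rw [Finset.mem_inter] at ha hb
    obtain ⟨a, ha, b, hb, R, hRD, hR, hRa, -⟩ := exists_min_path h2D ha.2 hb.2 hab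
      ((reach_symm (h4 a ha.1)).trans (h4 b hb.1))
    obtain ⟨P, Q, hP, hQ, hPQ, hd, hv⟩ := hC.exists_split (fun e he ↦ h2 e (hCY he)) ha hb hR.1
    have hside : ∀ S ⊆ C, {a, b} ⊆ vs ends S → vs ends S ∩ vs ends R = {a, b} := by
      intro S hS hab
      refine Finset.Subset.antisymm (fun u hu ↦ ?_) (Finset.subset_inter hab hR.pair_subset)
      rw [Finset.mem_inter] at hu
      simpa using hRa u hu.2 (vs_mono hS hu.1)
    have hPC : P ⊆ C := hPQ ▸ Finset.subset_union_left
    have hQC : Q ⊆ C := hPQ ▸ Finset.subset_union_right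
    have hRC : Disjoint C R := Finset.disjoint_of_subset_right hRD Finset.disjoint_sdiff
    have hT : IsThetaN ends P Q R := ⟨a, b, hP, hQ, hR, hd, Finset.disjoint_of_subset_left hPC hRC,
      Finset.disjoint_of_subset_left hQC hRC, hv, hside P hPC hP.pair_subset,
      hside Q hQC hQ.pair_subset⟩
    exact ⟨P, Q, R, hT, (hY.eq_of_subset hT.isBicyc (by
      rw [hPQ]; exact Finset.union_subset hCY ((hRD.trans Finset.sdiff_subset).trans hDY))).symm⟩

end Multi

/-! ### From paths, cycles and thetas of graphs to the counting descriptions -/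

namespace Multi

variable {α V : Type*} {ends : α → Finset V}

lemma IsCyc.ends_nonempty {C : Finset α} (hC : IsCyc ends C) {e : α} (he : e ∈ C) :
    (ends e).Nonempty := by
  rw [← Finset.card_pos]
  by_cases h : {e} = C
  · have := hC.2.1
    rw [← h, vs_singleton, Finset.card_singleton] at this
    omega
  · have := hC.2.2 {e} ((Finset.singleton_subset_iff.2 he).ssubset_of_ne h) (by simp)
    rw [vs_singleton, Finset.card_singleton] at this
    omega

lemma IsCyc.card_ends {C : Finset α} (hC : IsCyc ends C) {e : α} (he : e ∈ C)
    (h : {e} ≠ C) : 2 ≤ (ends e).card := by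
  have := hC.2.2 {e} ((Finset.singleton_subset_iff.2 he).ssubset_of_ne h) (by simp)
  rwa [vs_singleton, Finset.card_singleton] at this

end Multi

namespace Graph

open Multi

variable {V α : Type*} {G : Graph V α}

lemma finite_inc (G : Graph V α) (e : α) : {v | G.Inc e v}.Finite := by
  by_cases h : ∃ x y, G.IsLink e x y
  · obtain ⟨x, y, h⟩ := h
    refine (Set.toFinite {x, y}).subset fun v hv ↦ ?_
    exact hv.eq_or_eq_of_isLink h
  · convert Set.finite_empty
    ext v
    simp only [Set.mem_ofPred_eq, Set.mem_empty_iff_false, iff_false]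
    exact fun ⟨y, hy⟩ ↦ h ⟨v, y, hy⟩

/-- The set of ends of an edge. -/
noncomputable def endsF (G : Graph V α) (e : α) : Finset V := (G.finite_inc e).toFinset

@[simp] lemma mem_endsF {e : α} {v : V} : v ∈ G.endsF e ↔ G.Inc e v := by simp [endsF]

lemma isLink_iff_endsF {e : α} {x y : V} : G.IsLink e x y ↔ G.endsF e = {x, y} := by
  constructor
  · intro h
    ext v
    simp only [mem_endsF, Finset.mem_insert, Finset.mem_singleton]
    exact ⟨fun hv ↦ hv.eq_or_eq_of_isLink h, by rintro (rfl | rfl); exacts [h.inc_left, h.inc_right]⟩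
  · intro h
    have hx : G.Inc e x := by rw [← mem_endsF, h]; simp
    have hy : G.Inc e y := by rw [← mem_endsF, h]; simp
    obtain ⟨z, hz⟩ := hx
    rcases hy.eq_or_eq_of_isLink hz with rfl | rfl
    · have : z ∈ G.endsF e := mem_endsF.2 hz.inc_right
      rw [h] at this
      simp at this
      rwa [this] at hz
    · exact hz

lemma endsF_card_le (e : α) : (G.endsF e).card ≤ 2 := by
  by_cases h : ∃ x y, G.IsLink e x y
  · obtain ⟨x, y, h⟩ := h
    rw [isLink_iff_endsF.1 h]
    exact Finset.card_le_two
  · have : G.endsF e = ∅ := by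
      rw [Finset.eq_empty_iff_forall_notMem]
      intro v hv
      obtain ⟨y, hy⟩ := mem_endsF.1 hv
      exact h ⟨v, y, hy⟩
    simp [this]

lemma endsF_nonempty {e : α} : (G.endsF e).Nonempty ↔ e ∈ E(G) := by
  constructor
  · rintro ⟨v, hv⟩
    exact (mem_endsF.1 hv).edge_mem
  · intro h
    obtain ⟨x, y, h⟩ := exists_isLink_of_mem_edgeSet h
    exact ⟨x, mem_endsF.2 h.inc_left⟩

lemma vertsOf_coe (X : Finset α) : G.vertsOf ↑X = ↑(vs G.endsF X) := by
  ext v; simp [vertsOf, mem_vs]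

/-- The counting form is the convenient one for subsets and unions, and nothing is lost:
`IsPth.isPathF` recovers the inductive path because edges have at most two ends. -/
lemma isPathSet_iff {P : Set α} {x y : V} :
    G.IsPathSet P x y ↔ ∃ F : Finset α, (F : Set α) = P ∧ IsPth G.endsF F x y := by
  constructor
  · intro h
    induction h with
    | @single e x y hxy he => exact ⟨{e}, by simp, .single hxy (isLink_iff_endsF.1 he)⟩
    | @cons e x y z P he hP hx ih =>
      obtain ⟨F, rfl, hF⟩ := ih
      rw [vertsOf_coe] at hx
      exact ⟨insert e F, by simp, (hF.cons (isLink_iff_endsF.1 he) (by simpa using hx)).2⟩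
  · rintro ⟨F, rfl, hF⟩
    have := hF.isPathF fun e _ ↦ endsF_card_le e
    clear hF
    induction this with
    | single hxy he => simpa using IsPathSet.single hxy (isLink_iff_endsF.2 he)
    | @cons e x y z P he hP hx ih =>
      rw [Finset.coe_insert]
      exact .cons (isLink_iff_endsF.2 he) ih (by rw [vertsOf_coe]; simpa using hx)

lemma isLoopAt_iff_endsF {e : α} {x : V} : G.IsLoopAt e x ↔ G.endsF e = {x} := by
  rw [← isLink_self_iff, isLink_iff_endsF]; simp

lemma isCycleSet_iff {C : Set α} :
    G.IsCycleSet C ↔ ∃ F : Finset α, (F : Set α) = C ∧ IsCyc G.endsF F := by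
  constructor
  · rintro (⟨e, x, he, rfl⟩ | ⟨P, e, x, y, hP, he, heP, rfl⟩)
    · exact ⟨{e}, by simp, isCyc_singleton (by rw [isLoopAt_iff_endsF.1 he]; simp)⟩
    · obtain ⟨F, rfl, hF⟩ := isPathSet_iff.1 hP
      exact ⟨insert e F, by simp, hF.isCyc_insert (isLink_iff_endsF.1 he) (by simpa using heP)⟩
  · rintro ⟨F, rfl, hF⟩
    obtain ⟨e, he⟩ := hF.1
    by_cases h : {e} = F
    · subst h
      have := hF.2.1
      simp only [vs_singleton, Finset.card_singleton] at this
      obtain ⟨x, hx⟩ := Finset.card_eq_one.1 this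
      exact .inl ⟨e, x, isLoopAt_iff_endsF.2 hx, by simp⟩
    · have h2 := le_antisymm (endsF_card_le e) (hF.card_ends he h)
      obtain ⟨x, y, hxy, hends⟩ := Finset.card_eq_two.1 h2
      have hsub := ends_subset_vs (ends := G.endsF) he
      rw [hends] at hsub
      -- `F` minus `e` still joins the ends of `e`. The path found there closes up with `e` to a
      -- cycle inside `F`, which must be all of `F`.
      obtain ⟨P, hP, hp⟩ := exists_isPathF (hF.reach_erase (fun e _ ↦ endsF_card_le e) he
        (hsub (by simp : x ∈ _)) (hsub (by simp : y ∈ _))) hxy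
      have heP : e ∉ P := fun h ↦ (Finset.mem_erase.1 (hP h)).1 rfl
      have hc := hp.isPth.isCyc_insert hends heP
      have := hF.eq_of_subset (Finset.insert_subset he (hP.trans (Finset.erase_subset _ _)))
        hc.1 hc.2.1.le
      right
      refine ⟨P, e, x, y, isPathSet_iff.2 ⟨P, rfl, hp.isPth⟩, isLink_iff_endsF.2 hends,
        by simpa using heP, by rw [← this]; simp⟩

lemma vertsOf_inter_eq (X Y : Finset α) (S : Finset V) :
    G.vertsOf ↑X ∩ G.vertsOf ↑Y = ↑S ↔ vs G.endsF X ∩ vs G.endsF Y = S := by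
  rw [vertsOf_coe, vertsOf_coe, ← Finset.coe_inter, Finset.coe_inj]

lemma isTheta_iff {P Q R : Set α} : G.IsTheta P Q R ↔ ∃ P' Q' R' : Finset α,
    (P' : Set α) = P ∧ (Q' : Set α) = Q ∧ (R' : Set α) = R ∧ IsThetaN G.endsF P' Q' R' := by
  have key : ∀ (X Y : Finset α) (x y : V), G.vertsOf ↑X ∩ G.vertsOf ↑Y = {x, y} ↔
      vs G.endsF X ∩ vs G.endsF Y = {x, y} := by
    intro X Y x y
    rw [← vertsOf_inter_eq]; simp
  constructor
  · rintro ⟨x, y, hP, hQ, hR, h1, h2, h3, h4, h5, h6⟩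
    obtain ⟨P, rfl, hP'⟩ := isPathSet_iff.1 hP
    obtain ⟨Q, rfl, hQ'⟩ := isPathSet_iff.1 hQ
    obtain ⟨R, rfl, hR'⟩ := isPathSet_iff.1 hR
    rw [key] at h4 h5 h6
    exact ⟨P, Q, R, rfl, rfl, rfl, x, y, hP', hQ', hR', by exact_mod_cast h1, by exact_mod_cast h2,
      by exact_mod_cast h3, h4, h5, h6⟩
  · rintro ⟨P, Q, R, rfl, rfl, rfl, x, y, hP, hQ, hR, h1, h2, h3, h4, h5, h6⟩
    rw [← key] at h4 h5 h6
    exact ⟨x, y, isPathSet_iff.2 ⟨P, rfl, hP⟩, isPathSet_iff.2 ⟨Q, rfl, hQ⟩,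
      isPathSet_iff.2 ⟨R, rfl, hR⟩, by exact_mod_cast h1, by exact_mod_cast h2,
      by exact_mod_cast h3, h4, h5, h6⟩

end Graph

/-! ### Frame circuits in terms of counts -/

namespace BiasedGraph

open Multi Graph

variable {V α : Type*} {Ω : BiasedGraph V α}

lemma isUnbalancedCycle_iff {C : Set α} : Ω.IsUnbalancedCycle C ↔
    ∃ F : Finset α, (F : Set α) = C ∧ IsCyc Ω.graph.endsF F ∧ (F : Set α) ∉ Ω.balanced := by
  rw [IsUnbalancedCycle, isCycleSet_iff]
  constructor
  · rintro ⟨⟨F, rfl, hF⟩, h⟩; exact ⟨F, rfl, hF, h⟩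
  · rintro ⟨F, rfl, hF, h⟩; exact ⟨⟨F, rfl, hF⟩, h⟩

lemma isTightHandcuffs_iff {C : Set α} : Ω.IsTightHandcuffs C ↔
    ∃ C₁ C₂ : Finset α, IsTightN Ω.graph.endsF C₁ C₂ ∧ (C₁ : Set α) ∉ Ω.balanced ∧
      (C₂ : Set α) ∉ Ω.balanced ∧ C = ↑(C₁ ∪ C₂) := by
  constructor
  · rintro ⟨C₁, C₂, h1, h2, h3, ⟨v, h4⟩, rfl⟩
    obtain ⟨C₁, rfl, h1, h1'⟩ := isUnbalancedCycle_iff.1 h1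
    obtain ⟨C₂, rfl, h2, h2'⟩ := isUnbalancedCycle_iff.1 h2
    refine ⟨C₁, C₂, ⟨h1, h2, by exact_mod_cast h3, v, ?_⟩, h1', h2', by simp⟩
    rw [← vertsOf_inter_eq, h4]; simp
  · rintro ⟨C₁, C₂, ⟨h1, h2, h3, v, h4⟩, h1', h2', rfl⟩
    refine ⟨C₁, C₂, isUnbalancedCycle_iff.2 ⟨C₁, rfl, h1, h1'⟩,
      isUnbalancedCycle_iff.2 ⟨C₂, rfl, h2, h2'⟩, by exact_mod_cast h3, ⟨v, ?_⟩, by simp⟩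
    rw [← vertsOf_inter_eq] at h4; rw [h4]; simp

lemma isLooseHandcuffs_iff {C : Set α} : Ω.IsLooseHandcuffs C ↔
    ∃ C₁ C₂ P : Finset α, IsLooseN Ω.graph.endsF C₁ C₂ P ∧ (C₁ : Set α) ∉ Ω.balanced ∧
      (C₂ : Set α) ∉ Ω.balanced ∧ C = ↑(C₁ ∪ C₂ ∪ P) := by
  constructor
  · rintro ⟨C₁, C₂, P, x, y, h1, h2, h3, hP, h4, h5, rfl⟩
    obtain ⟨C₁, rfl, h1, h1'⟩ := isUnbalancedCycle_iff.1 h1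
    obtain ⟨C₂, rfl, h2, h2'⟩ := isUnbalancedCycle_iff.1 h2
    obtain ⟨P, rfl, hP'⟩ := isPathSet_iff.1 hP
    rw [vertsOf_coe, vertsOf_coe] at h3
    refine ⟨C₁, C₂, P, ⟨h1, h2, by exact_mod_cast h3, x, y, hP', ?_, ?_⟩, h1', h2',
      by simp [Set.union_assoc]⟩
    · rw [← vertsOf_inter_eq, h4]; simp
    · rw [← vertsOf_inter_eq, h5]; simp
  · rintro ⟨C₁, C₂, P, ⟨h1, h2, h3, x, y, hP, h4, h5⟩, h1', h2', rfl⟩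
    refine ⟨C₁, C₂, P, x, y, isUnbalancedCycle_iff.2 ⟨C₁, rfl, h1, h1'⟩,
      isUnbalancedCycle_iff.2 ⟨C₂, rfl, h2, h2'⟩, ?_, isPathSet_iff.2 ⟨P, rfl, hP⟩, ?_, ?_,
      by simp [Set.union_assoc]⟩
    · rw [vertsOf_coe, vertsOf_coe]; exact_mod_cast h3
    · rw [← vertsOf_inter_eq] at h4; rw [h4]; simp
    · rw [← vertsOf_inter_eq] at h5; rw [h5]; simp

lemma isContrabalancedTheta_iff {C : Set α} : Ω.IsContrabalancedTheta C ↔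
    ∃ P Q R : Finset α, IsThetaN Ω.graph.endsF P Q R ∧ (↑(P ∪ Q) : Set α) ∉ Ω.balanced ∧
      (↑(P ∪ R) : Set α) ∉ Ω.balanced ∧ (↑(Q ∪ R) : Set α) ∉ Ω.balanced ∧
      C = ↑(P ∪ Q ∪ R) := by
  simp only [Finset.coe_union]
  constructor
  · rintro ⟨P, Q, R, h, h1, h2, h3, rfl⟩
    obtain ⟨P, Q, R, rfl, rfl, rfl, h'⟩ := isTheta_iff.1 h
    exact ⟨P, Q, R, h', h1, h2, h3, by simp⟩
  · rintro ⟨P, Q, R, h, h1, h2, h3, rfl⟩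
    exact ⟨P, Q, R, isTheta_iff.2 ⟨P, Q, R, rfl, rfl, rfl, h⟩, h1, h2, h3, by simp⟩

lemma ends_nonempty_of_isCyc {G : Graph V α} {C : Finset α} (hC : IsCyc G.endsF C) {e : α}
    (he : e ∈ C) : e ∈ E(G) := endsF_nonempty.1 (hC.ends_nonempty he)

/-- The circuits of a frame matroid, numerically. -/
lemma IsFrameCircuit.cases {C : Set α} (h : Ω.IsFrameCircuit C) :
    ∃ F : Finset α, (F : Set α) = C ∧ (IsCyc Ω.graph.endsF F ∨ IsBicyc Ω.graph.endsF F) := by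
  rcases h with h | h | h | h
  · obtain ⟨F, rfl, hF⟩ := isCycleSet_iff.1 (Ω.isCycleSet_of_balanced C h)
    exact ⟨F, rfl, .inl hF⟩
  · obtain ⟨C₁, C₂, h', -, -, rfl⟩ := isTightHandcuffs_iff.1 h
    exact ⟨_, rfl, .inr h'.isBicyc⟩
  · obtain ⟨C₁, C₂, P, h', -, -, rfl⟩ := isLooseHandcuffs_iff.1 h
    exact ⟨_, rfl, .inr (h'.isBicyc fun e he ↦ h'.1.ends_nonempty he)⟩
  · obtain ⟨P, Q, R, h', -, -, -, rfl⟩ := isContrabalancedTheta_iff.1 h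
    exact ⟨_, rfl, .inr h'.isBicyc⟩

/-- An edge set with more edges than vertices contains a circuit of the frame matroid. -/
lemma exists_isFrameCircuit {X : Finset α} (hX : (X : Set α) ⊆ E(Ω.graph))
    (h : (vs Ω.graph.endsF X).card < X.card) : ∃ C ⊆ (X : Set α), Ω.IsFrameCircuit C := by
  obtain ⟨Y, hYX, hY⟩ := exists_isBicyc h
  -- A balanced cycle inside the bicycle is itself a circuit. Otherwise all its cycles are
  -- unbalanced and the bicycle is a circuit by its shape.
  by_cases hb : ∃ C : Finset α, C ⊆ Y ∧ (C : Set α) ∈ Ω.balanced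
  · obtain ⟨C, hC, hb⟩ := hb
    exact ⟨C, by exact_mod_cast hC.trans hYX, .inl hb⟩
  push Not at hb
  refine ⟨Y, by exact_mod_cast hYX, ?_⟩
  rcases hY.classify (fun e he ↦ endsF_nonempty.2 (hX (hYX he))) (fun e _ ↦ endsF_card_le e)
    with ⟨P, Q, R, h, rfl⟩ | ⟨C, D, h, rfl⟩ | ⟨C, D, P, h, rfl⟩
  · exact .inr (.inr (.inr (isContrabalancedTheta_iff.2 ⟨P, Q, R, h, hb _ (by grind),
      hb _ (by grind), hb _ (by grind), rfl⟩)))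
  · exact .inr (.inl (isTightHandcuffs_iff.2 ⟨C, D, h, hb _ (by grind), hb _ (by grind), rfl⟩))
  · exact .inr (.inr (.inl (isLooseHandcuffs_iff.2 ⟨C, D, P, h, hb _ (by grind), hb _ (by grind),
      rfl⟩)))

end BiasedGraph

/-! ### Axioms for frame matroids on a multigraph, and the biased graph they define -/

namespace Matroid

open Multi Graph BiasedGraph

variable {α V : Type*} {M : Matroid α} {ends : α → Finset V}

/-- `M` is a frame matroid on the multigraph with ends `ends`. -/
structure IsFrame (M : Matroid α) (ends : α → Finset V) : Prop where
  nonempty : ∀ e ∈ M.E, (ends e).Nonempty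
  card_le : ∀ e ∈ M.E, (ends e).card ≤ 2
  card_indep : ∀ I : Finset α, M.Indep I → I.card ≤ (vs ends I).card
  leaf : ∀ I : Finset α, M.Indep I → ∀ e ∈ M.E, ∀ v ∈ ends e, v ∉ vs ends I →
    M.Indep ↑(insert e I)
  union : ∀ I J : Finset α, M.Indep I → M.Indep J → Disjoint (vs ends I) (vs ends J) →
    M.Indep ↑(I ∪ J)

lemma exists_isCircuit_of_not_indep {X : Finset α} (hX : (X : Set α) ⊆ M.E) (h : ¬ M.Indep X) :
    ∃ C ⊆ X, M.IsCircuit C := by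
  obtain ⟨C, hC, hc⟩ := ((not_indep_iff hX).1 h).exists_isCircuit_subset
  obtain ⟨C, rfl⟩ := (X.finite_toSet.subset hC).exists_finset_coe
  exact ⟨C, by exact_mod_cast hC, hc⟩

/-- An edge set with excess contains a circuit, and a frame circuit is connected and, unless it is a
single loop, has no vertex met by only one of its edges. The hypothesis `hM` rules out balanced
loops, which would be circuits violating the leaf axiom. -/
lemma _root_.BiasedGraph.Represents.isFrame {Ω : BiasedGraph V α} (h : Ω.Represents M)
    (hM : ∀ e ∈ M.E, M.Indep {e}) : M.IsFrame Ω.graph.endsF := by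
  refine ⟨fun e he ↦ endsF_nonempty.2 (h.1 ▸ he), fun e _ ↦ endsF_card_le e, ?_, ?_, ?_⟩
  · intro I hI
    by_contra! hcon
    obtain ⟨C, hC, hc⟩ := exists_isFrameCircuit (h.1 ▸ hI.subset_ground) hcon
    exact ((h.2 C).2 hc).not_indep (hI.subset hC)
  · intro I hI e he v hv hvI
    by_contra hcon
    obtain ⟨C, hC, hc⟩ := exists_isCircuit_of_not_indep (by
      rw [Finset.coe_insert]; exact Set.insert_subset he hI.subset_ground) hcon
    have heC : e ∈ C := by
      by_contra heC
      refine hc.not_indep (hI.subset ?_)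
      exact_mod_cast (Finset.subset_insert_iff_of_notMem heC).1 hC
    have key : ¬ ∃ f ∈ C, f ≠ e ∧ v ∈ Ω.graph.endsF f := by
      rintro ⟨f, hf, hfe, hvf⟩
      have := hC hf
      rw [Finset.mem_insert] at this
      exact hvI (mem_vs.2 ⟨f, this.resolve_left hfe, hvf⟩)
    obtain ⟨F, hF, hF'⟩ := ((h.2 _).1 hc).cases
    rw [Finset.coe_inj] at hF
    subst hF
    rcases hF' with hF' | hF'
    · rcases Nat.lt_or_ge F.card 2 with h2 | h2
      · have : F = {e} := by
          refine (Finset.eq_singleton_iff_unique_mem.2 ⟨heC, fun f hf ↦ ?_⟩)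
          exact Finset.card_le_one.1 (by omega) f hf e heC
        subst this
        exact hc.not_indep (by simpa using hM e he)
      · exact key (hF'.exists_ne h2 heC hv)
    · exact key (hF'.exists_ne heC hv)
  · intro I J hI hJ hd
    by_contra hcon
    obtain ⟨C, hC, hc⟩ := exists_isCircuit_of_not_indep (by
      rw [Finset.coe_union]; exact Set.union_subset hI.subset_ground hJ.subset_ground) hcon
    obtain ⟨F, hF, hF'⟩ := ((h.2 _).1 hc).cases
    rw [Finset.coe_inj] at hF
    subst hF
    have h1 : (F ∩ I).Nonempty := by
      by_contra h0
      rw [Finset.not_nonempty_iff_eq_empty] at h0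
      have := notMem_of_inter_eq_empty h0
      exact hc.not_indep (hJ.subset (by
        intro f hf; have := this f hf; have := hC hf; rw [Finset.mem_union] at this; tauto))
    have h2 : (F \ I).Nonempty := by
      rw [Finset.sdiff_nonempty]
      exact fun h ↦ hc.not_indep (hI.subset (by exact_mod_cast h))
    have h3 : F ∩ I ∪ F \ I = F := by grind
    have h4 : Disjoint (F ∩ I) (F \ I) := (Finset.disjoint_sdiff_inter F I).symm
    have h5 : vs Ω.graph.endsF (F ∩ I) ∩ vs Ω.graph.endsF (F \ I) = ∅ := by
      rw [← Finset.disjoint_iff_inter_eq_empty]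
      exact hd.mono (vs_mono Finset.inter_subset_right) (vs_mono (by grind))
    rcases hF' with hF' | hF'
    · have := hF'.two_le_inter h3 h4 h1 h2
      rw [h5, Finset.card_empty] at this; omega
    · have := hF'.one_le_inter h3 h4 h1 h2
      rw [h5, Finset.card_empty] at this; omega

namespace IsFrame

lemma indep_singleton (h : M.IsFrame ends) {e : α} (he : e ∈ M.E) : M.Indep {e} := by
  obtain ⟨v, hv⟩ := h.nonempty e he
  have := h.leaf ∅ (by simp) e he v hv (by simp)
  simpa using this

lemma exists_ne (h : M.IsFrame ends) {C : Finset α} (hC : M.IsCircuit C) {e : α} (he : e ∈ C)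
    {v : V} (hv : v ∈ ends e) : ∃ f ∈ C, f ≠ e ∧ v ∈ ends f := by
  by_contra! hcon
  have := h.leaf (C.erase e) (by
    rw [Finset.coe_erase]; exact hC.sdiff_singleton_indep he) e (hC.subset_ground he) v hv (by
    rw [mem_vs]
    rintro ⟨f, hf, hvf⟩
    rw [Finset.mem_erase] at hf
    exact hcon f hf.2 hf.1 hvf)
  rw [Finset.insert_erase he] at this
  exact hC.not_indep this

lemma card_le_of_ssubset (h : M.IsFrame ends) {C : Finset α} (hC : M.IsCircuit C) {Z : Finset α}
    (hZ : Z ⊂ C) : Z.card ≤ (vs ends Z).card :=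
  h.card_indep Z (hC.ssubset_indep (by exact_mod_cast hZ))

lemma card_vs_le (h : M.IsFrame ends) {C : Finset α} (hC : M.IsCircuit C) :
    (vs ends C).card ≤ C.card :=
  card_vs_le_of_deg (fun e he ↦ h.card_le e (hC.subset_ground he))
    (fun _ he _ hv ↦ h.exists_ne hC he hv)

/-- By the leaf axiom a circuit has at least two edges at each vertex, so it has no more vertices
than edges. With fewer vertices it is a bicycle, since its proper subsets are independent. With
equality all degrees are two, so a cycle inside it is vertex-disjoint from the rest, and the union
axiom forces the rest to be empty. -/
lemma isCyc_or_isBicyc (h : M.IsFrame ends) {C : Finset α} (hC : M.IsCircuit C) :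
    IsCyc ends C ∨ IsBicyc ends C := by
  obtain ⟨e, he⟩ : C.Nonempty := by exact_mod_cast hC.nonempty
  have h2 : ∀ e ∈ C, (ends e).card ≤ 2 := fun e he ↦ h.card_le e (hC.subset_ground he)
  have hdeg : ∀ e ∈ C, ∀ v ∈ ends e, ∃ f ∈ C, f ≠ e ∧ v ∈ ends f :=
    fun _ he _ hv ↦ h.exists_ne hC he hv
  rcases Nat.lt_or_ge (vs ends C).card C.card with hlt | hge
  · right
    refine ⟨?_, fun Z hZ ↦ h.card_le_of_ssubset hC hZ⟩
    have h1 := h.card_le_of_ssubset hC (Finset.erase_ssubset he)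
    have h3 := Finset.card_le_card (vs_mono (ends := ends) (Finset.erase_subset e C))
    have := Finset.card_erase_add_one he
    omega
  · left
    obtain ⟨D, hDC, hD⟩ := exists_isCyc ⟨e, he⟩ (fun e he ↦ h.nonempty e (hC.subset_ground he))
      (h.card_vs_le hC)
    rcases hDC.eq_or_ssubset with rfl | hs
    · exact hD
    exfalso
    -- A cycle of one edge has an edge with a single end, which would make the double count of
    -- incidences strict.
    have hD2 : 2 ≤ D.card := by
      by_contra hlt
      obtain ⟨f, hf⟩ := hD.1
      have hDf : D = {f} := Finset.eq_singleton_iff_unique_mem.2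
        ⟨hf, fun g hg ↦ Finset.card_le_one.1 (by omega) g hg f hf⟩
      have h3 := hD.2.1
      rw [hDf, vs_singleton, Finset.card_singleton] at h3
      have := card_vs_lt_of_deg h2 hdeg (hDC hf) h3.le
      omega
    have hu := Finset.union_sdiff_of_subset hDC
    have := h.union D (C \ D) (hC.ssubset_indep (by exact_mod_cast hs))
      (hC.ssubset_indep (by exact_mod_cast Finset.sdiff_ssubset hDC hD.1)) (by
        rw [Finset.disjoint_left]
        intro v hv hv'
        have h3 := hD.deg_eq_two (fun e he ↦ h2 e (hDC he)) hD2 hv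
        have h4 := one_le_deg.2 hv'
        have h5 := deg_eq_two h2 hdeg hge (vs_mono hDC hv)
        have h6 := deg_union (ends := ends) (Finset.disjoint_sdiff (s := D) (t := C)) v
        rw [hu] at h6
        omega)
    rw [hu] at this
    exact hC.not_indep this

lemma isCyc_not_isBicyc {C D : Finset α} (hC : IsBicyc ends C) (hD : IsCyc ends D) : D ≠ C := by
  rintro rfl
  have := hC.1
  have := hD.2.1
  omega

/-- A bicycle none of whose cycles is a circuit is a circuit. -/
lemma isCircuit_of_isBicyc (h : M.IsFrame ends) {Y : Finset α} (hY : IsBicyc ends Y)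
    (hYE : (Y : Set α) ⊆ M.E) (hc : ∀ C ⊆ Y, IsCyc ends C → ¬ M.IsCircuit C) :
    M.IsCircuit Y := by
  obtain ⟨C, hCY, hC⟩ := exists_isCircuit_of_not_indep hYE fun hi ↦ by
    have := h.card_indep Y hi
    have := hY.1
    omega
  rcases h.isCyc_or_isBicyc hC with h1 | h1
  · exact absurd hC (hc C hCY h1)
  · rwa [← hY.eq_of_subset h1 hCY]

lemma not_isCircuit_of_isBicyc {Y C : Finset α} (hYM : M.IsCircuit Y)
    (hY : IsBicyc ends Y) (hCY : C ⊆ Y) (hC : IsCyc ends C) : ¬ M.IsCircuit C := by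
  intro hCM
  refine isCyc_not_isBicyc hY hC (Finset.coe_inj.1 ?_)
  exact hCM.eq_of_subset_isCircuit hYM (by exact_mod_cast hCY)

/-- The multigraph with vertex set `W` underlying a frame matroid. -/
def graph (M : Matroid α) (ends : α → Finset V) (W : Finset V) : Graph V α where
  vertexSet := W
  IsLink e x y := e ∈ M.E ∧ ends e = {x, y} ∧ x ∈ W ∧ y ∈ W
  isLink_symm := by
    refine fun e he ↦ ⟨fun x y ⟨h1, h2, h3, h4⟩ ↦ ?_⟩
    exact ⟨h1, by rw [h2, Finset.pair_comm], h4, h3⟩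
  eq_or_eq_of_isLink_of_isLink := by
    intro e x y v w ⟨_, h2, _⟩ ⟨_, h3, _⟩
    have : x ∈ ends e := by simp [h2]
    rw [h3] at this
    simpa using this
  left_mem_of_isLink := by
    intro e x y h
    exact h.2.2.1

lemma endsF_graph (h : M.IsFrame ends) {W : Finset V} (hW : ∀ e ∈ M.E, ends e ⊆ W) {e : α} :
    (graph M ends W).endsF e = if e ∈ M.E then ends e else ∅ := by
  ext v
  rw [mem_endsF]
  split_ifs with he
  · constructor
    · rintro ⟨y, -, hy, -⟩
      simp [hy]
    · intro hv
      have : ∃ y, ends e = {v, y} := by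
        rcases Nat.lt_or_ge 1 (ends e).card with h2 | h2
        · obtain ⟨x, y, -, hxy⟩ := Finset.card_eq_two.1 (le_antisymm (h.card_le e he) h2)
          rw [hxy] at hv
          rw [hxy]
          rcases Finset.mem_insert.1 hv with rfl | hv
          · exact ⟨y, rfl⟩
          · rw [Finset.mem_singleton] at hv
            exact ⟨x, by rw [hv, Finset.pair_comm]⟩
        · exact ⟨v, by
            rw [Finset.pair_eq_singleton]
            exact Finset.eq_singleton_iff_unique_mem.2
              ⟨hv, fun g hg ↦ Finset.card_le_one.1 h2 g hg v hv⟩⟩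
      obtain ⟨y, hy⟩ := this
      exact ⟨y, he, hy, hW e he hv, hW e he (by simp [hy])⟩
  · simp only [Finset.notMem_empty, iff_false]
    rintro ⟨y, h, -⟩
    exact he h

lemma edgeSet_graph (h : M.IsFrame ends) {W : Finset V} (hW : ∀ e ∈ M.E, ends e ⊆ W) :
    E(graph M ends W) = M.E := by
  ext e
  rw [← endsF_nonempty, h.endsF_graph hW]
  split_ifs with he
  · simp [he, h.nonempty e he]
  · simp [he]

lemma vs_congr {ends' : α → Finset V} {X : Finset α} (h : ∀ e ∈ X, ends' e = ends e) :
    vs ends' X = vs ends X := Finset.biUnion_congr rfl h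

lemma isCyc_endsF (h : M.IsFrame ends) {W : Finset V} (hW : ∀ e ∈ M.E, ends e ⊆ W)
    {C : Finset α} : IsCyc (graph M ends W).endsF C ↔ (C : Set α) ⊆ M.E ∧ IsCyc ends C := by
  have hE := h.edgeSet_graph hW
  have key : (C : Set α) ⊆ M.E → ∀ X ⊆ C, vs (graph M ends W).endsF X = vs ends X := by
    intro hC X hX
    refine vs_congr fun e he ↦ ?_
    rw [h.endsF_graph hW, if_pos (hC (hX he))]
  constructor
  · intro hC
    have hCE : (C : Set α) ⊆ M.E := fun e he ↦ hE ▸ ends_nonempty_of_isCyc hC he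
    refine ⟨hCE, hC.1, ?_, fun Z hZ ↦ ?_⟩
    · rw [← key hCE C subset_rfl]; exact hC.2.1
    · rw [← key hCE Z hZ.1]; exact hC.2.2 Z hZ
  · rintro ⟨hCE, hC⟩
    refine ⟨hC.1, ?_, fun Z hZ ↦ ?_⟩
    · rw [key hCE C subset_rfl]; exact hC.2.1
    · rw [key hCE Z hZ.1]; exact hC.2.2 Z hZ

/-- A frame matroid on `ends` is a frame matroid on the edges of its graph. -/
lemma graph_isFrame (h : M.IsFrame ends) {W : Finset V} (hW : ∀ e ∈ M.E, ends e ⊆ W) :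
    M.IsFrame (graph M ends W).endsF := by
  have key : ∀ X : Finset α, (X : Set α) ⊆ M.E → vs (graph M ends W).endsF X = vs ends X := by
    intro X hX
    refine vs_congr fun e he ↦ ?_
    rw [h.endsF_graph hW, if_pos (hX he)]
  refine ⟨fun e he ↦ ?_, fun e he ↦ ?_, fun I hI ↦ ?_, fun I hI e he v hv hvI ↦ ?_,
    fun I J hI hJ hd ↦ ?_⟩
  · rw [h.endsF_graph hW, if_pos he]; exact h.nonempty e he
  · rw [h.endsF_graph hW, if_pos he]; exact h.card_le e he
  · rw [key I hI.subset_ground]; exact h.card_indep I hI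
  · rw [key I hI.subset_ground] at hvI
    rw [h.endsF_graph hW, if_pos he] at hv
    exact h.leaf I hI e he v hv hvI
  · rw [key I hI.subset_ground, key J hJ.subset_ground] at hd
    exact h.union I J hI hJ hd

/-- The biased graph of a frame matroid: the balanced cycles are those that are circuits. -/
def biasedGraph (h : M.IsFrame ends) (hM : M.Finite) (W : Finset V)
    (hW : ∀ e ∈ M.E, ends e ⊆ W) : BiasedGraph V α where
  graph := graph M ends W
  finite_verts := W.finite_toSet
  finite_edges := by rw [h.edgeSet_graph hW]; exact hM.ground_finite
  balanced := {C | M.IsCircuit C ∧ (graph M ends W).IsCycleSet C}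
  isCycleSet_of_balanced := fun C h ↦ h.2
  theta := by
    intro P Q R ht0 h1 h2
    obtain ⟨P, Q, R, rfl, rfl, rfl, ht⟩ := isTheta_iff.1 ht0
    have hF := h.graph_isFrame hW
    refine ⟨?_, isCycleSet_iff.2 ⟨Q ∪ R, by simp, ht.rotate.isCyc⟩⟩
    obtain ⟨x, y, hP, hQ, -, hPQ, hPR, -⟩ := id ht
    obtain ⟨e, he⟩ := hP.nonempty
    have hne : (↑P ∪ ↑Q : Set α) ≠ ↑P ∪ ↑R := by
      intro heq
      obtain ⟨f, hf⟩ := hQ.nonempty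
      have h3 : f ∈ (↑P ∪ ↑R : Set α) := heq ▸ .inr (by simpa using hf)
      rcases h3 with h3 | h3
      · exact Finset.disjoint_left.1 hPQ (by simpa using h3) hf
      · obtain ⟨x, y, -, -, -, -, -, hQR, -⟩ := id ht
        exact Finset.disjoint_left.1 hQR hf (by simpa using h3)
    -- Circuit elimination at an edge of the common path `P` leaves a circuit in the theta that
    -- avoids this edge; the only cycle or bicycle available is `Q ∪ R`.
    obtain ⟨D, hDs, hD⟩ := h1.1.elimination h2.1 hne e
    obtain ⟨D, rfl⟩ := ((P ∪ Q ∪ R).finite_toSet.subset (hDs.trans (by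
      rw [Finset.coe_union, Finset.coe_union]
      intro f hf; simp only [Set.mem_sdiff, Set.mem_union] at hf ⊢; tauto))).exists_finset_coe
    have hDs' : D ⊆ P ∪ Q ∪ R := by
      intro f hf
      have := hDs hf
      simp only [Set.mem_sdiff, Set.mem_union, Finset.mem_coe, Finset.mem_union] at this ⊢
      tauto
    have heD : e ∉ D := fun heD ↦ (hDs heD).2 rfl
    rcases hF.isCyc_or_isBicyc hD with h4 | h4
    · rcases ht.eq_of_isCyc h4 hDs' with rfl | rfl | rfl
      · exact absurd (Finset.mem_union_left _ he) heD
      · exact absurd (Finset.mem_union_left _ he) heD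
      · simpa using hD
    · have := ht.isBicyc.eq_of_subset h4 hDs'
      exact absurd (by rw [this]; simp [he]) heD

variable {W : Finset V}

lemma mem_balanced_biasedGraph (h : M.IsFrame ends) (hM : M.Finite)
    (hW : ∀ e ∈ M.E, ends e ⊆ W) {C : Finset α} :
    (C : Set α) ∈ (h.biasedGraph hM W hW).balanced ↔ M.IsCircuit C ∧ IsCyc ends C := by
  change M.IsCircuit C ∧ (graph M ends W).IsCycleSet C ↔ _
  rw [isCycleSet_iff]
  simp only [Finset.coe_inj, exists_eq_left, h.isCyc_endsF hW]
  exact ⟨fun h ↦ ⟨h.1, h.2.2⟩, fun h ↦ ⟨h.1, h.1.subset_ground, h.2⟩⟩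

/-- A circuit is a cycle, then balanced by definition, or a bicycle, and then none of its cycles is
a circuit. Conversely a bicycle whose cycles are all unbalanced is a circuit; the cycles in a theta
or in handcuffs are only those named in the definition, so nothing else needs checking. -/
lemma represents_biasedGraph (h : M.IsFrame ends) (hM : M.Finite)
    (hW : ∀ e ∈ M.E, ends e ⊆ W) : (h.biasedGraph hM W hW).Represents M := by
  have hE : E((h.biasedGraph hM W hW).graph) = M.E := h.edgeSet_graph hW
  have hF : M.IsFrame (h.biasedGraph hM W hW).graph.endsF := h.graph_isFrame hW
  have hfin : ∀ C, M.IsCircuit C → ∃ F : Finset α, C = F := fun C hC ↦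
    let ⟨F, hF⟩ := (hM.ground_finite.subset hC.subset_ground).exists_finset_coe; ⟨F, hF.symm⟩
  have hb : ∀ F : Finset α, IsCyc (h.biasedGraph hM W hW).graph.endsF F →
      ((F : Set α) ∈ (h.biasedGraph hM W hW).balanced ↔ M.IsCircuit F) := by
    intro F hF
    exact ⟨fun h ↦ h.1, fun h ↦ ⟨h, isCycleSet_iff.2 ⟨F, rfl, hF⟩⟩⟩
  refine ⟨hE.symm, fun C ↦ ⟨fun hC ↦ ?_, fun hC ↦ ?_⟩⟩
  · obtain ⟨C, rfl⟩ := hfin C hC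
    rcases hF.isCyc_or_isBicyc hC with h1 | h1
    · exact .inl ((hb C h1).2 hC)
    have hn : ∀ D ⊆ C, IsCyc (h.biasedGraph hM W hW).graph.endsF D →
        (D : Set α) ∉ (h.biasedGraph hM W hW).balanced := by
      intro D hD hc hb'
      exact not_isCircuit_of_isBicyc hC h1 hD hc hb'.1
    rcases h1.classify (fun e he ↦ hF.nonempty e (hC.subset_ground he))
      (fun e _ ↦ endsF_card_le e) with ⟨P, Q, R, ht, rfl⟩ | ⟨C, D, ht, rfl⟩ | ⟨C, D, P, ht, rfl⟩
    · refine .inr (.inr (.inr (isContrabalancedTheta_iff.2 ⟨P, Q, R, ht,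
        hn _ (by grind) ht.isCyc, hn _ (by grind) ?_, hn _ (by grind) ht.rotate.isCyc, rfl⟩)))
      rw [Finset.union_comm]
      exact ht.rotate.rotate.isCyc
    · exact .inr (.inl (isTightHandcuffs_iff.2 ⟨C, D, ht, hn _ (by grind) ht.1,
        hn _ (by grind) ht.2.1, rfl⟩))
    · exact .inr (.inr (.inl (isLooseHandcuffs_iff.2 ⟨C, D, P, ht, hn _ (by grind) ht.1,
        hn _ (by grind) ht.2.1, rfl⟩)))
  · have hEB : ∀ Y : Finset α, IsBicyc (h.biasedGraph hM W hW).graph.endsF Y →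
        (∀ e ∈ Y, (h.biasedGraph hM W hW).graph.endsF e |>.Nonempty) → (Y : Set α) ⊆ M.E := by
      intro Y hY hne e he
      rw [← hE]
      exact endsF_nonempty.1 (hne e he)
    have hpE : ∀ (P : Finset α) x y, IsPth (h.biasedGraph hM W hW).graph.endsF P x y →
        ∀ e ∈ P, ((h.biasedGraph hM W hW).graph.endsF e).Nonempty := by
      intro P x y hP e he
      have := hP.forest {e} (by simpa) (by simp)
      rw [vs_singleton, Finset.card_singleton] at this
      exact Finset.card_pos.1 (by omega)
    rcases hC with hC | hC | hC | hC
    · exact hC.1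
    · obtain ⟨C₁, C₂, ht, h1, h2, rfl⟩ := isTightHandcuffs_iff.1 hC
      refine hF.isCircuit_of_isBicyc ht.isBicyc (hEB _ ht.isBicyc ?_) fun D hD hc ↦ ?_
      · intro e he
        rcases Finset.mem_union.1 he with he | he
        exacts [ht.1.ends_nonempty he, ht.2.1.ends_nonempty he]
      · rw [← hb D hc]
        rcases ht.eq_of_isCyc hc hD with rfl | rfl <;> assumption
    · obtain ⟨C₁, C₂, P, ht, h1, h2, rfl⟩ := isLooseHandcuffs_iff.1 hC
      have hbi := ht.isBicyc fun e he ↦ ht.1.ends_nonempty he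
      refine hF.isCircuit_of_isBicyc hbi (hEB _ hbi ?_) fun D hD hc ↦ ?_
      · intro e he
        rcases Finset.mem_union.1 he with he | he
        · rcases Finset.mem_union.1 he with he | he
          exacts [ht.1.ends_nonempty he, ht.2.1.ends_nonempty he]
        · obtain ⟨-, -, -, x, y, hP, -⟩ := ht
          exact hpE P x y hP e he
      · rw [← hb D hc]
        rcases ht.eq_of_isCyc hc hD with rfl | rfl <;> assumption
    · obtain ⟨P, Q, R, ht, h1, h2, h3, rfl⟩ := isContrabalancedTheta_iff.1 hC
      refine hF.isCircuit_of_isBicyc ht.isBicyc (hEB _ ht.isBicyc ?_) fun D hD hc ↦ ?_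
      · intro e he
        obtain ⟨x, y, hP, hQ, hR, -⟩ := ht
        rcases Finset.mem_union.1 he with he | he
        · rcases Finset.mem_union.1 he with he | he
          exacts [hpE _ _ _ hP e he, hpE _ _ _ hQ e he]
        · exact hpE _ _ _ hR e he
      · rw [← hb D hc]
        rcases ht.eq_of_isCyc hc hD with rfl | rfl | rfl <;> assumption

end IsFrame

end Matroid

/-! ### Ranks, skew sets and connectivity through circuits -/

namespace Matroid

set_option linter.unusedSectionVars false

variable {α : Type*} {M : Matroid α} {X Y Z I J : Set α} {e f : α}

/-- The rank of a set, as a natural number. -/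
noncomputable def rk (M : Matroid α) (X : Set α) : ℕ := (M.eRk X).toNat

section Rank

variable [M.RankFinite]

lemma cast_rk (M : Matroid α) [M.RankFinite] (X : Set α) : (M.rk X : ℕ∞) = M.eRk X := by
  rw [rk, ENat.natCast_toNat]
  exact ((M.eRk_le_eRank X).trans_lt (eRank_lt_top_iff.2 inferInstance)).ne

lemma rk_submod (M : Matroid α) [M.RankFinite] (X Y : Set α) :
    M.rk (X ∪ Y) + M.rk (X ∩ Y) ≤ M.rk X + M.rk Y := by
  have := M.eRk_inter_add_eRk_union_le X Y
  simp only [← cast_rk] at this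
  norm_cast at this
  omega

lemma rk_mono (h : X ⊆ Y) : M.rk X ≤ M.rk Y := by
  have := M.eRk_mono h
  simp only [← cast_rk] at this
  exact_mod_cast this

lemma rk_submod' {U : Set α} (M : Matroid α) [M.RankFinite] {X Y Z : Set α} (h : U ⊆ X ∪ Y)
    (h1 : Z ⊆ X) (h2 : Z ⊆ Y) : M.rk U + M.rk Z ≤ M.rk X + M.rk Y := by
  have := M.rk_submod X Y
  have := rk_mono (M := M) h
  have := rk_mono (M := M) (Set.subset_inter h1 h2)
  omega

lemma rk_union_le (M : Matroid α) [M.RankFinite] (X Y : Set α) :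
    M.rk (X ∪ Y) ≤ M.rk X + M.rk Y := by
  have := M.rk_submod X Y
  omega

lemma rk_closure (M : Matroid α) (X : Set α) : M.rk (M.closure X) = M.rk X := by
  simp [rk, eRk_closure_eq]

lemma rk_le_of_subset_closure (h : X ⊆ M.closure Y) : M.rk X ≤ M.rk Y := by
  rw [← rk_closure M Y]; exact rk_mono h

@[simp] lemma rk_empty (M : Matroid α) : M.rk ∅ = 0 := by simp [rk]

lemma rk_union_closure_right (M : Matroid α) (X Y : Set α) :
    M.rk (X ∪ M.closure Y) = M.rk (X ∪ Y) := by
  simp [rk, eRk_union_closure_right_eq]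

lemma rk_union_eq_of_closure_eq (h : M.closure X = M.closure Y) (Z : Set α) :
    M.rk (Z ∪ X) = M.rk (Z ∪ Y) := by
  rw [← rk_union_closure_right, h, rk_union_closure_right]

lemma rk_insert_le (M : Matroid α) [M.RankFinite] (e : α) (X : Set α) :
    M.rk (insert e X) ≤ M.rk X + 1 := by
  have := M.eRk_insert_le_add_one e X
  simp only [← cast_rk] at this
  exact_mod_cast this

lemma rk_insert_of_notMem (he : e ∈ M.E) (h : e ∉ M.closure X) :
    M.rk (insert e X) = M.rk X + 1 := by
  have := eRk_insert_eq_add_one (M := M) (X := X) ⟨he, h⟩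
  simp only [← cast_rk] at this
  exact_mod_cast this

lemma rk_insert_of_mem (h : e ∈ M.closure X) : M.rk (insert e X) = M.rk X := by
  rw [← rk_closure, closure_insert_eq_of_mem_closure h, rk_closure]

lemma mem_closure_iff_rk (he : e ∈ M.E) : e ∈ M.closure X ↔ M.rk (insert e X) = M.rk X := by
  refine ⟨rk_insert_of_mem, fun h ↦ ?_⟩
  by_contra hcon
  have := rk_insert_of_notMem he hcon
  omega

lemma mem_closure_of_rk_le (he : e ∈ M.E) (h : M.rk (insert e X) ≤ M.rk X) : e ∈ M.closure X :=
  (mem_closure_iff_rk he).2 (h.antisymm (rk_mono (Set.subset_insert _ _)))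

lemma subset_closure_of_rk_le (hY : Y ⊆ M.E) (h : M.rk (X ∪ Y) ≤ M.rk X) : Y ⊆ M.closure X := by
  intro e he
  refine mem_closure_of_rk_le (hY he) ((rk_mono ?_).trans h)
  exact Set.insert_subset (.inr he) Set.subset_union_left

lemma Indep.rk_eq_ncard (h : M.Indep I) : M.rk I = I.ncard := by
  rw [rk, h.eRk_eq_encard]; rfl

lemma rk_le_ncard (hX : X.Finite) : M.rk X ≤ X.ncard := by
  have := M.eRk_le_encard X
  rw [← cast_rk, ← hX.cast_ncard_eq] at this
  exact_mod_cast this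

lemma indep_iff_rk (hX : X.Finite) : M.Indep X ↔ M.rk X = X.ncard := by
  rw [indep_iff_eRk_eq_encard_of_finite hX, ← cast_rk, ← hX.cast_ncard_eq]
  exact_mod_cast Iff.rfl

lemma indep_of_le_rk (hX : X.Finite) (h : X.ncard ≤ M.rk X) : M.Indep X :=
  (indep_iff_rk hX).2 ((rk_le_ncard hX).antisymm h)

/-- Two sets are skew if the rank of their union is the sum of their ranks. -/
def Skew (M : Matroid α) (X Y : Set α) : Prop := M.rk (X ∪ Y) = M.rk X + M.rk Y

lemma Skew.symm (h : M.Skew X Y) : M.Skew Y X := by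
  rw [Skew, Set.union_comm, add_comm]; exact h

lemma not_skew_iff : ¬ M.Skew X Y ↔ M.rk (X ∪ Y) < M.rk X + M.rk Y := by
  have := M.rk_union_le X Y
  rw [Skew]; omega

lemma Skew.mono_left (h : M.Skew X Y) (hZ : Z ⊆ X) : M.Skew Z Y := by
  have h1 := M.rk_submod' (U := X ∪ Y) (X := X) (Y := Z ∪ Y) (Z := Z)
    (Set.union_subset_union_right _ Set.subset_union_right) hZ Set.subset_union_left
  have h2 := M.rk_union_le Z Y
  rw [Skew] at h ⊢
  omega

lemma Skew.mono_right (h : M.Skew X Y) (hZ : Z ⊆ Y) : M.Skew X Z := (h.symm.mono_left hZ).symm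

lemma Skew.closure_right_iff : M.Skew X (M.closure Y) ↔ M.Skew X Y := by
  rw [Skew, Skew, rk_union_closure_right, rk_closure]

lemma Skew.of_subset_closure (h : M.Skew X Y) (hZ : Z ⊆ M.closure X) : M.Skew Z Y :=
  (((Skew.closure_right_iff.2 h.symm).mono_right hZ)).symm

lemma Skew.disjoint_closure (h : M.Skew X Y) (he : M.Indep {e}) (hX : e ∈ M.closure X) :
    e ∉ M.closure Y := by
  intro hY
  have h1 := (Skew.closure_right_iff.2 (h.of_subset_closure (Set.singleton_subset_iff.2 hX)))
  have h2 := h1.mono_right (Set.singleton_subset_iff.2 hY)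
  have h3 := he.rk_eq_ncard
  rw [Skew, Set.union_self, h3, Set.ncard_singleton] at h2
  omega

lemma Skew.disjoint (h : M.Skew X Y) (hX : M.Indep X) (hY : Y ⊆ M.E) : Disjoint X Y := by
  rw [Set.disjoint_left]
  intro e he he'
  exact h.disjoint_closure (hX.subset (Set.singleton_subset_iff.2 he))
    (M.mem_closure_of_mem' he (hX.subset_ground he)) (M.mem_closure_of_mem' he' (hY he'))

lemma Skew.indep_union (h : M.Skew X Y) (hX : M.Indep X) (hY : M.Indep Y) (hXf : X.Finite)
    (hYf : Y.Finite) : M.Indep (X ∪ Y) := by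
  refine indep_of_le_rk (hXf.union hYf) ?_
  have h1 := Set.ncard_union_le X Y
  have h2 := hX.rk_eq_ncard
  have h3 := hY.rk_eq_ncard
  rw [Skew] at h
  omega

lemma Indep.skew (h : M.Indep (X ∪ Y)) (hd : Disjoint X Y) (hXf : X.Finite) (hYf : Y.Finite) :
    M.Skew X Y := by
  rw [Skew, h.rk_eq_ncard, (h.subset Set.subset_union_left).rk_eq_ncard,
    (h.subset Set.subset_union_right).rk_eq_ncard, Set.ncard_union_eq hd hXf hYf]

/-- If `r(A) + r(B) - r(A ∪ B) ≤ 1`, then subsets of `A` and `B` which are not skew to the other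
side are not skew to each other. -/
lemma not_skew_of_not_skew {A B Q T : Set α} (h : M.rk A + M.rk B ≤ M.rk (A ∪ B) + 1)
    (hQB : Q ⊆ B) (hTA : T ⊆ A) (hQ : ¬ M.Skew Q A) (hT : ¬ M.Skew T B) : ¬ M.Skew Q T := by
  rw [not_skew_iff] at *
  have := M.rk_submod' (U := A ∪ B) (X := Q ∪ A) (Y := T ∪ B) (Z := Q ∪ T)
    (Set.union_subset_union Set.subset_union_right Set.subset_union_right)
    (Set.union_subset_union_right _ hTA) (by
      rw [Set.union_comm]; exact Set.union_subset_union_right _ hQB)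
  omega

/-- The two sides share at most one dimension, and `T` already detects it. Hence any such small `T`
can replace all of `A` when skewness to `A` is tested from the side of `B`. -/
lemma skew_iff_of_not_skew {A B Q T : Set α} (h : M.rk A + M.rk B ≤ M.rk (A ∪ B) + 1)
    (hQB : Q ⊆ B) (hTA : T ⊆ A) (hT : ¬ M.Skew T B) : M.Skew Q A ↔ M.Skew Q T := by
  refine ⟨fun h ↦ h.mono_right hTA, fun h1 ↦ ?_⟩
  by_contra h2
  exact not_skew_of_not_skew h hQB hTA h2 hT h1

lemma contract_indep_iff_of_skew (hX : M.Indep X) {Q : Set α} (hXf : X.Finite) (hQf : Q.Finite) :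
    (M ／ X).Indep Q ↔ M.Indep Q ∧ M.Skew Q X := by
  rw [hX.contract_indep_iff]
  refine ⟨fun h ↦ ⟨h.2.subset Set.subset_union_left, h.2.skew h.1 hQf hXf⟩, fun h ↦
    ⟨h.2.disjoint h.1 hX.subset_ground, h.2.indep_union h.1 hX hQf hXf⟩⟩

end Rank

/-- Circuit transitivity: two elements in circuits that meet are in a common circuit. -/
lemma IsCircuit.exists_isCircuit_mem_mem [M.Finite] {C D : Set α} (hC : M.IsCircuit C)
    (hD : M.IsCircuit D) (heC : e ∈ C) (hfD : f ∈ D) (hCD : (C ∩ D).Nonempty) :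
    ∃ K, M.IsCircuit K ∧ e ∈ K ∧ f ∈ K := by
  by_contra! hcon
  have hfin : ∀ {C : Set α}, M.IsCircuit C → C.Finite :=
    fun h ↦ M.ground_finite.subset h.subset_ground
  obtain ⟨n, hn⟩ : ∃ n, n = (C ∪ D).ncard := ⟨_, rfl⟩
  induction n using Nat.strong_induction_on generalizing C D with
  | _ n ih =>
  subst hn
  have hmin : ∀ {C' D'}, M.IsCircuit C' → M.IsCircuit D' → e ∈ C' → f ∈ D' →
      (C' ∩ D').Nonempty → ¬ C' ∪ D' ⊂ C ∪ D := fun h1 h2 h3 h4 h5 h6 ↦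
    ih _ (Set.ncard_lt_ncard h6 ((hfin hC).union (hfin hD))) h1 h2 h3 h4 h5 rfl
  obtain ⟨s, hsC, hsD⟩ := hCD
  have heD : e ∉ D := fun h ↦ hcon D hD h hfD
  have hfC : f ∉ C := fun h ↦ hcon C hC heC h
  -- Eliminating the common element `s` gives a circuit through `e` and one through `f`, both
  -- avoiding `s`. Minimality of `C ∪ D` makes `C₃` contain all of `C \ D`, so it meets `C₄`; but
  -- `C₃ ∪ C₄` misses `s` and is smaller.
  obtain ⟨C₃, hC₃s, hC₃, he₃⟩ := hC.strong_elimination hD hsC hsD heC heD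
  obtain ⟨C₄, hC₄s, hC₄, hf₄⟩ := hD.strong_elimination hC hsD hsC hfD hfC
  have h3 : ∃ a ∈ C₃, a ∈ D ∧ a ∉ C := by
    by_contra! h
    have : C₃ ⊆ C := fun a ha ↦ ((hC₃s ha).1).elim id fun h' ↦ h a ha h'
    have := hC₃.eq_of_subset_isCircuit hC this
    exact (hC₃s (this ▸ hsC)).2 rfl
  have h4 : ∃ a ∈ C₄, a ∈ C ∧ a ∉ D := by
    by_contra! h
    have : C₄ ⊆ D := fun a ha ↦ ((hC₄s ha).1).elim id fun h' ↦ h a ha h'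
    have := hC₄.eq_of_subset_isCircuit hD this
    exact (hC₄s (this ▸ hsD)).2 rfl
  obtain ⟨a, ha3, haD, haC⟩ := h3
  obtain ⟨b, hb4, hbC, hbD⟩ := h4
  have hs3 : C₃ ∪ D ⊆ C ∪ D := Set.union_subset (fun x hx ↦ (hC₃s hx).1) Set.subset_union_right
  have hs4 : C₄ ⊆ C ∪ D := fun x hx ↦ ((hC₄s hx).1).symm
  have hb3 : b ∈ C₃ := by
    by_contra hb3
    refine hmin hC₃ hD he₃ hfD ⟨a, ha3, haD⟩ (hs3.ssubset_of_ne fun h ↦ ?_)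
    have : b ∈ C₃ ∪ D := h ▸ .inl hbC
    exact this.elim hb3 hbD
  refine hmin hC₃ hC₄ he₃ hf₄ ⟨b, hb3, hb4⟩ ((Set.union_subset
    (Set.subset_union_left.trans hs3) hs4).ssubset_of_ne fun h ↦ ?_)
  have : s ∈ C₃ ∪ C₄ := h ▸ .inl hsC
  exact this.elim (fun h ↦ (hC₃s h).2 rfl) fun h ↦ (hC₄s h).2 rfl

/-- Bases of `S` and `T` have independent union, as a circuit in it would lie within one of the
bases. Skewness then passes to closures. -/
lemma skew_of_forall_isCircuit [M.Finite] {S T : Set α} (hS : S ⊆ M.E) (hT : T ⊆ M.E)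
    (h : ∀ C ⊆ S ∪ T, M.IsCircuit C → C ⊆ S ∨ C ⊆ T) (hd : Disjoint S T) : M.Skew S T := by
  obtain ⟨I, hI⟩ := M.exists_isBasis S
  obtain ⟨J, hJ⟩ := M.exists_isBasis T
  have hIJ : M.Indep (I ∪ J) := by
    by_contra hcon
    obtain ⟨C, hCs, hC⟩ := ((not_indep_iff (Set.union_subset hI.indep.subset_ground
      hJ.indep.subset_ground)).1 hcon).exists_isCircuit_subset
    have hsub : ∀ {S T I J : Set α}, I ⊆ S → J ⊆ T → Disjoint S T → C ⊆ I ∪ J → C ⊆ S → C ⊆ I :=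
      fun h1 h2 h3 h4 h5 x hx ↦ (h4 hx).elim id fun hx' ↦
        absurd (h2 hx') (Set.disjoint_left.1 h3 (h5 hx))
    rcases h C (hCs.trans (Set.union_subset_union hI.subset hJ.subset)) hC with h1 | h1
    · exact hC.not_indep (hI.indep.subset (hsub hI.subset hJ.subset hd hCs h1))
    · exact hC.not_indep (hJ.indep.subset (hsub hJ.subset hI.subset hd.symm
        (by rwa [Set.union_comm]) h1))
  have h1 := hIJ.skew (hd.mono hI.subset hJ.subset) (M.ground_finite.subset
    hI.indep.subset_ground) (M.ground_finite.subset hJ.indep.subset_ground)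
  have h2 := Skew.closure_right_iff.2 h1
  rw [hJ.closure_eq_closure] at h2
  have h3 := Skew.closure_right_iff.2 (Skew.closure_right_iff.1 h2).symm
  rw [hI.closure_eq_closure] at h3
  exact (Skew.closure_right_iff.1 h3).symm

end Matroid

/-! ### Adding an unbalanced loop at every vertex -/

namespace Matroid

open Multi

variable {α V : Type*} {M : Matroid α} {ends : α → Finset V}

namespace IsFrame

/-- The Hall-type condition says that every subset of `X` has enough vertices off `U`. Sets
attaining equality are closed under union; let `Y₀` be the largest and `W = U ∪ V(Y₀)`, of size `|U|
+ |Y₀|`. If nothing can be added, then `U'` lies in `W`, and each edge of `X'` has its ends in `W`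
or is spanned by `X \ Y₀`. The former number at most `|W \ U'|` and the latter at most `|X \ Y₀|`,
which bounds `|X'| + |U'|` by `|X| + |U|`. -/
lemma joint_aug [M.Finite] (h : M.IsFrame ends) {X X' : Finset α} {U U' : Finset V}
    (hX : M.Indep X) (hXU : ∀ Y ⊆ X, Y.card ≤ (vs ends Y \ U).card)
    (hX' : M.Indep X') (hXU' : ∀ Y ⊆ X', Y.card ≤ (vs ends Y \ U').card)
    (hlt : X.card + U.card < X'.card + U'.card) :
    (∃ e ∈ X', e ∉ X ∧ M.Indep ↑(insert e X) ∧
      ∀ Y ⊆ insert e X, Y.card ≤ (vs ends Y \ U).card) ∨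
    ∃ u ∈ U', u ∉ U ∧ ∀ Y ⊆ X, Y.card ≤ (vs ends Y \ insert u U).card := by
  by_contra! hcon
  obtain ⟨hcon1, hcon2⟩ := hcon
  have tight_union : ∀ Y₁ ⊆ X, ∀ Y₂ ⊆ X, (vs ends Y₁ \ U).card ≤ Y₁.card →
      (vs ends Y₂ \ U).card ≤ Y₂.card → (vs ends (Y₁ ∪ Y₂) \ U).card ≤ (Y₁ ∪ Y₂).card := by
    intro Y₁ h1 Y₂ h2 t1 t2
    have e1 := card_union_eq (vs ends Y₁ \ U) (vs ends Y₂ \ U)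
    have e2 := Finset.card_union_add_card_inter Y₁ Y₂
    have e3 := hXU (Y₁ ∩ Y₂) (Finset.inter_subset_left.trans h1)
    have e4 : (vs ends (Y₁ ∩ Y₂) \ U).card ≤ ((vs ends Y₁ \ U) ∩ (vs ends Y₂ \ U)).card := by
      refine Finset.card_le_card (Finset.subset_inter ?_ ?_)
      · exact Finset.sdiff_subset_sdiff (vs_mono Finset.inter_subset_left) subset_rfl
      · exact Finset.sdiff_subset_sdiff (vs_mono Finset.inter_subset_right) subset_rfl
    rw [vs_union, Finset.union_sdiff_distrib]
    omega
  obtain ⟨Y₀, hY₀, hmax⟩ := Finset.exists_max_image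
    (X.powerset.filter fun Y ↦ (vs ends Y \ U).card ≤ Y.card) Finset.card ⟨∅, by simp⟩
  rw [Finset.mem_filter, Finset.mem_powerset] at hY₀
  obtain ⟨hY₀X, ht₀⟩ := hY₀
  have hsub : ∀ Y ⊆ X, (vs ends Y \ U).card ≤ Y.card → Y ⊆ Y₀ := by
    intro Y hY ht
    have := hmax (Y₀ ∪ Y) (by
      rw [Finset.mem_filter, Finset.mem_powerset]
      exact ⟨Finset.union_subset hY₀X hY, tight_union _ hY₀X _ hY ht₀ ht⟩)
    rw [Finset.eq_of_subset_of_card_le Finset.subset_union_left this]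
    exact Finset.subset_union_right
  set W := U ∪ vs ends Y₀ with hW
  have hWc : W.card = U.card + Y₀.card := by
    have := hXU Y₀ hY₀X
    have e : W = U ∪ (vs ends Y₀ \ U) := by rw [hW, Finset.union_sdiff_self_eq_union]
    rw [e, Finset.card_union_of_disjoint Finset.disjoint_sdiff]
    omega
  have hU' : U' ⊆ W := by
    intro u hu
    by_cases huU : u ∈ U
    · exact Finset.mem_union_left _ huU
    obtain ⟨Y, hY, hYc⟩ := hcon2 u hu huU
    have h1 := hXU Y hY
    have huY : u ∈ vs ends Y := by
      by_contra hn
      rw [Finset.sdiff_insert, Finset.erase_eq_of_notMem (by simp [hn])] at hYc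
      omega
    rw [Finset.sdiff_insert] at hYc
    have h2 := Finset.pred_card_le_card_erase (s := vs ends Y \ U) (a := u)
    exact Finset.mem_union_right _ (vs_mono (hsub Y hY (by omega)) huY)
  have hE : ∀ e ∈ X', e ∈ M.E := fun e he ↦ hX'.subset_ground he
  have key : ∀ e ∈ X', ends e ⊆ W ∨ e ∈ M.closure ↑(X \ Y₀) := by
    intro e he
    by_cases heX : e ∈ X
    · by_cases heY : e ∈ Y₀
      · exact .inl ((ends_subset_vs heY).trans Finset.subset_union_right)
      · exact .inr (M.mem_closure_of_mem' (by simp [heX, heY]) (hE e he))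
    by_cases hind : M.Indep ↑(insert e X)
    -- Here `e` can be added in `M`, so it is the Hall condition that fails: removing `e` from the
    -- violating set leaves a tight set with the same vertices off `U`, which puts the ends of `e`
    -- in `W`.
    · obtain ⟨Y, hY, hYc⟩ := hcon1 e he heX hind
      have heY : e ∈ Y := by
        by_contra hn
        have := hXU Y ((Finset.subset_insert_iff_of_notMem hn).1 hY)
        omega
      have h1 : Y.erase e ⊆ X := by
        intro a ha
        have := hY (Finset.mem_of_mem_erase ha)
        rw [Finset.mem_insert] at this
        exact this.resolve_left (Finset.ne_of_mem_erase ha)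
      have h2 := hXU _ h1
      have h3 := Finset.card_erase_add_one heY
      have h4 : vs ends (Y.erase e) \ U ⊆ vs ends Y \ U :=
        Finset.sdiff_subset_sdiff (vs_mono (Finset.erase_subset _ _)) subset_rfl
      have h5 := Finset.eq_of_subset_of_card_le h4 (by omega)
      have h6 := hsub _ h1 (by rw [h5]; omega)
      left
      intro v hv
      by_cases hvU : v ∈ U
      · exact Finset.mem_union_left _ hvU
      · have : v ∈ vs ends Y \ U := Finset.mem_sdiff.2 ⟨ends_subset_vs heY hv, hvU⟩
        rw [← h5] at this
        exact Finset.mem_union_right _ (vs_mono h6 (Finset.mem_sdiff.1 this).1)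
    obtain ⟨C, hCX, hC⟩ := exists_isCircuit_of_not_indep (by
      rw [Finset.coe_insert]; exact Set.insert_subset (hE e he) hX.subset_ground) hind
    have heC : e ∈ C := by
      by_contra heC
      refine hC.not_indep (hX.subset ?_)
      exact_mod_cast (Finset.subset_insert_iff_of_notMem heC).1 hCX
    have hD : C.erase e ⊆ X := by
      intro a ha
      have := hCX (Finset.mem_of_mem_erase ha)
      rw [Finset.mem_insert] at this
      exact this.resolve_left (Finset.ne_of_mem_erase ha)
    have hDc := Finset.card_erase_add_one heC
    have hvD : vs ends (C.erase e) = vs ends C := by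
      refine Finset.Subset.antisymm (vs_mono (Finset.erase_subset _ _)) fun v hv ↦ ?_
      obtain ⟨f, hf, hvf⟩ := mem_vs.1 hv
      by_cases hfe : f = e
      · subst hfe
        obtain ⟨g, hg, hgf, hvg⟩ := h.exists_ne hC heC hvf
        exact mem_vs.2 ⟨g, Finset.mem_erase.2 ⟨hgf, hg⟩, hvg⟩
      · exact mem_vs.2 ⟨f, Finset.mem_erase.2 ⟨hfe, hf⟩, hvf⟩
    have hDU := hXU _ hD
    rw [hvD] at hDU
    have hevs := ends_subset_vs (ends := ends) heC
    have hdone : C.erase e ⊆ Y₀ → ends e ⊆ W := fun hs ↦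
      (hevs.trans (hvD ▸ vs_mono hs)).trans Finset.subset_union_right
    -- Now `e` closes a circuit `C` with `X`. Either `C - e` is tight and so inside `Y₀`, or `C`
    -- avoids `W` and `X \ Y₀` spans `e`, or the remaining case applies.
    by_cases ht : (vs ends C \ U).card ≤ (C.erase e).card
    · exact .inl (hdone (hsub _ hD (by rwa [hvD])))
    by_cases hdis : Disjoint (vs ends C) W
    · right
      have : e ∈ M.closure (↑C \ {e}) := hC.mem_closure_sdiff_singleton_of_mem heC
      refine M.closure_subset_closure ?_ this
      intro a ha
      have haC : a ∈ C := ha.1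
      simp only [Finset.coe_sdiff, Set.mem_sdiff, Finset.mem_coe]
      refine ⟨hD (Finset.mem_erase.2 ⟨ha.2, ha.1⟩), fun haY ↦ ?_⟩
      obtain ⟨v, hv⟩ := h.nonempty a (hC.subset_ground haC)
      exact Finset.disjoint_left.1 hdis (ends_subset_vs haC hv)
        (Finset.mem_union_right _ (ends_subset_vs haY hv))
    -- Not being tight, `C - e` has as many vertices off `U` as `C` has edges. So `C` is a cycle
    -- avoiding `U`, and it meets `V(Y₀)`; this overlap makes `Y₀ ∪ (C - e)` tight, and again `C -
    -- e` lies in `Y₀`.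
    left
    apply hdone
    have hle := h.card_vs_le hC
    have hle2 := Finset.card_le_card (Finset.sdiff_subset (s := vs ends C) (t := U))
    have hUC : vs ends C \ U = vs ends C := Finset.eq_of_subset_of_card_le Finset.sdiff_subset
      (by omega)
    have hcyc : IsCyc ends C := by
      refine (h.isCyc_or_isBicyc hC).resolve_right fun hb ↦ ?_
      have := hb.1
      omega
    have hmeet : (vs ends C ∩ vs ends Y₀).Nonempty := by
      rw [Finset.not_disjoint_iff] at hdis
      obtain ⟨v, hv, hvW⟩ := hdis
      rw [← hUC, Finset.mem_sdiff] at hv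
      exact ⟨v, Finset.mem_inter.2 ⟨hv.1, (Finset.mem_union.1 hvW).resolve_left hv.2⟩⟩
    have hs := hsub (Y₀ ∪ C.erase e) (Finset.union_subset hY₀X hD) ?_
    · exact Finset.subset_union_right.trans hs
    have heY : e ∉ Y₀ := fun hh ↦ heX (hY₀X hh)
    have e1 : (vs ends (Y₀ ∪ C.erase e) \ U).card ≤
        (vs ends Y₀ \ U).card + (vs ends C \ vs ends Y₀).card := by
      rw [vs_union, hvD]
      refine (Finset.card_le_card ?_).trans (Finset.card_union_le _ _)
      intro v hv
      simp only [Finset.mem_sdiff, Finset.mem_union] at hv ⊢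
      tauto
    have e2 : (Y₀ ∪ C.erase e).card = Y₀.card + (C.erase e \ Y₀).card := by
      rw [← Finset.card_union_of_disjoint Finset.disjoint_sdiff, Finset.union_sdiff_self_eq_union]
    suffices (vs ends C \ vs ends Y₀).card ≤ (C.erase e \ Y₀).card by omega
    have e3 : (C \ Y₀).card = (C.erase e \ Y₀).card + 1 := by
      rw [← Finset.card_erase_add_one (Finset.mem_sdiff.2 ⟨heC, heY⟩)]
      congr 2
      ext a; simp only [Finset.mem_erase, Finset.mem_sdiff]; tauto
    have e4 := Finset.card_sdiff_add_card_inter (vs ends C) (vs ends Y₀)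
    have e5 := Finset.card_sdiff_add_card_inter C Y₀
    have e6 := hcyc.2.1
    have e7 := Finset.card_pos.2 hmeet
    rcases (C ∩ Y₀).eq_empty_or_nonempty with h0 | h0
    · rw [h0, Finset.card_empty] at e5
      omega
    · have hss : C ∩ Y₀ ⊂ C := Finset.inter_subset_left.ssubset_of_ne fun hh ↦
        heY (Finset.mem_inter.1 (hh ▸ heC)).2
      have e8 := hcyc.2.2 _ hss h0
      have e9 : (vs ends (C ∩ Y₀)).card ≤ (vs ends C ∩ vs ends Y₀).card :=
        Finset.card_le_card (Finset.subset_inter (vs_mono Finset.inter_subset_left)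
          (vs_mono Finset.inter_subset_right))
      omega
  have c1 := Finset.card_filter_add_card_filter_not (s := X') (fun e ↦ ends e ⊆ W)
  have c2 := hXU' (X'.filter fun e ↦ ends e ⊆ W) (Finset.filter_subset _ _)
  have c3 : vs ends (X'.filter fun e ↦ ends e ⊆ W) \ U' ⊆ W \ U' := by
    refine Finset.sdiff_subset_sdiff (fun v hv ↦ ?_) subset_rfl
    obtain ⟨e, he, hve⟩ := mem_vs.1 hv
    exact (Finset.mem_filter.1 he).2 hve
  have c4 := Finset.card_le_card c3
  have c5 := Finset.card_sdiff_add_card_eq_card hU'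
  have c6 : (X'.filter fun e ↦ ¬ ends e ⊆ W).card ≤ (X \ Y₀).card := by
    have i1 : M.Indep ↑(X'.filter fun e ↦ ¬ ends e ⊆ W) :=
      hX'.subset (by exact_mod_cast Finset.filter_subset _ _)
    have i2 : M.Indep ↑(X \ Y₀) := hX.subset (by exact_mod_cast Finset.sdiff_subset)
    have e1 := i1.rk_eq_ncard
    have e2 := i2.rk_eq_ncard
    rw [Set.ncard_coe_finset] at e1 e2
    have := rk_le_of_subset_closure (M := M)
      (X := ↑(X'.filter fun e ↦ ¬ ends e ⊆ W)) (Y := ↑(X \ Y₀)) (by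
        intro e he
        have he' := Finset.mem_filter.1 (Finset.mem_coe.1 he)
        exact (key e he'.1).resolve_left he'.2)
    omega
  have c7 := Finset.card_sdiff_add_card_eq_card hY₀X
  omega

/-- The extension of a frame matroid by an unbalanced loop at each vertex. -/
noncomputable def jointExt [M.Finite] (h : M.IsFrame ends) : Matroid (α ⊕ V) :=
  (IndepMatroid.ofFinset (Sum.inl '' M.E ∪ Set.range Sum.inr)
    (fun I ↦ M.Indep ↑I.toLeft ∧ ∀ Y ⊆ I.toLeft, Y.card ≤ (vs ends Y \ I.toRight).card)
    (by
      have h0 : (∅ : Finset (α ⊕ V)).toLeft = ∅ := by ext; simp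
      refine ⟨by rw [h0]; simp, fun Y hY ↦ ?_⟩
      rw [h0, Finset.subset_empty] at hY
      simp [hY])
    (by
      rintro I J ⟨h1, h2⟩ hIJ
      have hl := Finset.toLeft_subset_toLeft hIJ
      refine ⟨h1.subset (by exact_mod_cast hl), fun Y hY ↦ (h2 Y (hY.trans hl)).trans
        (Finset.card_le_card (Finset.sdiff_subset_sdiff subset_rfl
          (Finset.toRight_subset_toRight hIJ)))⟩)
    (by
      rintro I J ⟨h1, h2⟩ ⟨h3, h4⟩ hlt
      rw [← Finset.card_toLeft_add_card_toRight (u := I),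
        ← Finset.card_toLeft_add_card_toRight (u := J)] at hlt
      rcases h.joint_aug h1 h2 h3 h4 hlt with ⟨e, he, heI, h5, h6⟩ | ⟨u, hu, huI, h5⟩
      · exact ⟨.inl e, by simpa using he, by simpa using heI, by
          rw [Finset.toLeft_insert_inl, Finset.toRight_insert_inl]; exact ⟨h5, h6⟩⟩
      · exact ⟨.inr u, by simpa using hu, by simpa using huI, by
          rw [Finset.toLeft_insert_inr, Finset.toRight_insert_inr]; exact ⟨h1, h5⟩⟩)
    (by
      rintro I ⟨h1, -⟩ (e | u) he
      · exact .inl ⟨e, h1.subset_ground (by simpa using he), rfl⟩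
      · exact .inr ⟨u, rfl⟩)).matroid

variable [M.Finite]

lemma jointExt_indep (h : M.IsFrame ends) {I : Finset (α ⊕ V)} : h.jointExt.Indep I ↔
    M.Indep ↑I.toLeft ∧ ∀ Y ⊆ I.toLeft, Y.card ≤ (vs ends Y \ I.toRight).card := by
  rw [jointExt, IndepMatroid.matroid_Indep, IndepMatroid.ofFinset_indep]

lemma jointExt_ground (h : M.IsFrame ends) :
    h.jointExt.E = Sum.inl '' M.E ∪ Set.range Sum.inr := rfl

lemma jointExt_finite [Finite V] (h : M.IsFrame ends) : h.jointExt.Finite :=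
  ⟨(M.ground_finite.image _).union (Set.finite_range _)⟩

lemma jointExt_indep_inl (h : M.IsFrame ends) {X : Set α} :
    h.jointExt.Indep (Sum.inl '' X) ↔ M.Indep X := by
  have key : ∀ F : Finset α, h.jointExt.Indep (Sum.inl '' (F : Set α)) ↔ M.Indep F := by
    intro F
    have h1 : (Sum.inl '' (F : Set α) : Set (α ⊕ V)) = ↑(F.map (.inl : α ↪ α ⊕ V)) := by simp
    have h2 : (F.map (.inl : α ↪ α ⊕ V)).toLeft = F := by ext; simp
    have h3 : (F.map (.inl : α ↪ α ⊕ V)).toRight = ∅ := by ext; simp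
    rw [h1, jointExt_indep, h2, h3]
    refine ⟨fun h ↦ h.1, fun hF ↦ ⟨hF, fun Y hY ↦ ?_⟩⟩
    rw [Finset.sdiff_empty]
    exact h.card_indep Y (hF.subset (by exact_mod_cast hY))
  constructor
  · intro hX
    have hXE : X ⊆ M.E := by
      intro e he
      rcases hX.subset_ground ⟨e, he, rfl⟩ with ⟨a, ha, hae⟩ | ⟨u, hu⟩
      · exact Sum.inl_injective hae ▸ ha
      · cases hu
    obtain ⟨F, rfl⟩ := (M.ground_finite.subset hXE).exists_finset_coe
    exact (key F).1 hX
  · intro hX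
    obtain ⟨F, rfl⟩ := (M.ground_finite.subset hX.subset_ground).exists_finset_coe
    exact (key F).2 hX

end IsFrame

/-! ### Matroids with a basis of joints, and their contractions -/

/-- `J` is a frame of `N`: a basis such that each element is spanned by two members of `J`, and
each element of `L` by one. -/
structure Jointed {γ : Type*} (N : Matroid γ) (J L : Set γ) : Prop where
  base : N.IsBase J
  two : ∀ e ∈ N.E, ∃ S ⊆ J, S.ncard ≤ 2 ∧ e ∈ N.closure S
  one : ∀ e ∈ L, e ∈ N.E → ∃ S ⊆ J, S.ncard ≤ 1 ∧ e ∈ N.closure S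

/-- An edge together with the joints at all its ends violates the Hall condition, since no end is
left for it. So an edge is spanned by the joints at its ends, and the joints form a basis. -/
lemma IsFrame.jointed [M.Finite] [Finite V] (h : M.IsFrame ends) {L : Set α}
    (hL : ∀ e ∈ L, (ends e).card ≤ 1) :
    h.jointExt.Jointed (Set.range Sum.inr) (Sum.inl '' L) := by
  have := h.jointExt_finite
  have := Fintype.ofFinite V
  have hind : ∀ U : Finset V, h.jointExt.Indep (Sum.inr '' (U : Set V)) := by
    intro U
    have h1 : (Sum.inr '' (U : Set V) : Set (α ⊕ V)) = ↑(U.map (.inr : V ↪ α ⊕ V)) := by simp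
    have h2 : (U.map (.inr : V ↪ α ⊕ V)).toLeft = ∅ := by ext; simp
    rw [h1, jointExt_indep, h2]
    simp
  have hr : (Set.range Sum.inr : Set (α ⊕ V)) = Sum.inr '' ((Finset.univ : Finset V) : Set V) := by
    simp
  have hinl : ∀ e ∈ M.E, Sum.inl e ∈ h.jointExt.E := fun e he ↦ .inl ⟨e, he, rfl⟩
  have hinr : ∀ u, Sum.inr u ∈ h.jointExt.E := fun u ↦ .inr ⟨u, rfl⟩
  have hspan : ∀ e ∈ M.E, Sum.inl e ∈ h.jointExt.closure (Sum.inr '' (ends e : Set V)) := by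
    intro e he
    rw [(hind _).mem_closure_iff_of_notMem (by simp)]
    rw [← not_indep_iff (Set.insert_subset (hinl e he) (hind _).subset_ground)]
    intro hi
    have h1 : insert (Sum.inl e) (Sum.inr '' (ends e : Set V) : Set (α ⊕ V)) =
        ↑(insert (Sum.inl e) ((ends e).map (.inr : V ↪ α ⊕ V))) := by simp
    rw [h1, jointExt_indep] at hi
    have h2 := hi.2 {e} (by simp)
    have h3 : (insert (Sum.inl e) ((ends e).map (.inr : V ↪ α ⊕ V))).toRight = ends e := by
      ext; simp
    rw [h3] at h2
    simp at h2
  have hcard : ∀ U : Finset V, (Sum.inr '' (U : Set V) : Set (α ⊕ V)).ncard = U.card := by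
    intro U
    rw [Set.ncard_image_of_injective _ Sum.inr_injective, Set.ncard_coe_finset]
  have hbI : h.jointExt.Indep (Set.range Sum.inr) := by rw [hr]; exact hind _
  refine ⟨?_, ?_, ?_⟩
  · rw [hbI.isBase_iff_ground_subset_closure]
    rintro _ (⟨e, he, rfl⟩ | hu)
    · exact h.jointExt.closure_subset_closure (Set.image_subset_range _ _) (hspan e he)
    · exact h.jointExt.mem_closure_of_mem' hu (Or.inr hu)
  · rintro _ (⟨e, he, rfl⟩ | ⟨u, rfl⟩)
    · exact ⟨_, Set.image_subset_range _ _, (hcard _).trans_le (h.card_le e he), hspan e he⟩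
    · exact ⟨{Sum.inr u}, by simp, by simp, h.jointExt.mem_closure_self _ (hinr u)⟩
  · rintro _ ⟨e, he, rfl⟩ heE
    have heM : e ∈ M.E := by
      rcases heE with ⟨a, ha, hae⟩ | ⟨u, hu⟩
      · exact Sum.inl_injective hae ▸ ha
      · cases hu
    exact ⟨_, Set.image_subset_range _ _, (hcard _).trans_le (hL e he), hspan e heM⟩

/-- The members of `J` needed to span `e`. -/
noncomputable def jends {γ : Type*} (N : Matroid γ) (J : Set γ) (e : γ) : Finset γ :=
  if h : {j ∈ J | e ∉ N.closure (J \ {j})}.Finite then h.toFinset else ∅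

namespace Jointed

variable {γ : Type*} {N : Matroid γ} [N.Finite] {J L : Set γ} {e : γ}

lemma finite (h : N.Jointed J L) : J.Finite := N.ground_finite.subset h.base.subset_ground

lemma mem_jends (h : N.Jointed J L) {j : γ} :
    j ∈ jends N J e ↔ j ∈ J ∧ e ∉ N.closure (J \ {j}) := by
  rw [jends, dif_pos (h.finite.subset (Set.sep_subset _ _))]
  simp

lemma jends_subset_base (h : N.Jointed J L) : ↑(jends N J e) ⊆ J := fun _ hj ↦
  (h.mem_jends.1 hj).1

lemma jends_subset (h : N.Jointed J L) {S : Set γ} (hS : S ⊆ J) (he : e ∈ N.closure S) :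
    ↑(jends N J e) ⊆ S := by
  intro j hj
  by_contra hjS
  have h1 : S ⊆ J \ {j} := fun x hx ↦ ⟨hS hx, by rintro rfl; exact hjS hx⟩
  exact (h.mem_jends.1 hj).2 (N.closure_subset_closure h1 he)

/-- Take a minimal subset `T` of `J` spanning `e`. If `e` were also spanned by `J` without some `j`
in `T`, then, closures of subsets of an independent set intersecting modularly, `T - j` would span
it. -/
lemma mem_closure_jends (h : N.Jointed J L) (he : e ∈ N.E) : e ∈ N.closure (jends N J e) := by
  have hfin := h.finite
  obtain ⟨T, -, hT⟩ := exists_minimal_le_of_wellFoundedLT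
    (fun F : Finset γ ↦ (F : Set γ) ⊆ J ∧ e ∈ N.closure F) hfin.toFinset
    ⟨by simp, by rw [hfin.coe_toFinset, h.base.closure_eq]; exact he⟩
  have : T ⊆ jends N J e := by
    intro j hj
    refine h.mem_jends.2 ⟨hT.1.1 hj, fun hej ↦ ?_⟩
    have h1 : e ∈ N.closure ((T : Set γ) ∩ (J \ {j})) := by
      rw [Indep.closure_inter_eq_inter_closure]
      · exact ⟨hT.1.2, hej⟩
      · exact h.base.indep.subset (Set.union_subset hT.1.1 Set.sdiff_subset)
    have h2 : (T : Set γ) ∩ (J \ {j}) = ↑(T.erase j) := by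
      ext x
      simp only [Set.mem_inter_iff, Finset.mem_coe, Set.mem_sdiff, Set.mem_singleton_iff,
        Finset.mem_erase]
      exact ⟨fun h ↦ ⟨h.2.2, h.1⟩, fun h ↦ ⟨h.2, hT.1.1 h.2, h.1⟩⟩
    rw [h2] at h1
    have h3 := hT.2 (y := T.erase j) ⟨fun x hx ↦ hT.1.1 (Finset.mem_of_mem_erase hx), h1⟩
      (Finset.erase_subset _ _) hj
    exact Finset.notMem_erase _ _ h3
  exact N.closure_subset_closure (by exact_mod_cast this) hT.1.2

lemma card_jends_le (h : N.Jointed J L) {S : Set γ} (hS : S ⊆ J) (he : e ∈ N.closure S) :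
    (jends N J e).card ≤ S.ncard := by
  rw [← Set.ncard_coe_finset]
  exact Set.ncard_le_ncard (h.jends_subset hS he) (h.finite.subset hS)

lemma card_jends_le_two (h : N.Jointed J L) (he : e ∈ N.E) : (jends N J e).card ≤ 2 := by
  obtain ⟨S, hS, hc, heS⟩ := h.two e he
  exact (h.card_jends_le hS heS).trans hc

lemma jends_of_mem (h : N.Jointed J L) (he : e ∈ J) : jends N J e = {e} := by
  ext j
  rw [h.mem_jends, Finset.mem_singleton]
  constructor
  · rintro ⟨hj, hn⟩
    by_contra hne
    exact hn (N.mem_closure_of_mem' ⟨he, fun hh ↦ hne hh.symm⟩ (h.base.subset_ground he))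
  · rintro rfl
    exact ⟨he, h.base.indep.notMem_closure_sdiff_of_mem he⟩

lemma jends_nonempty (h : N.Jointed J L) (he : N.Indep {e}) : (jends N J e).Nonempty := by
  by_contra hne
  rw [Finset.not_nonempty_iff_eq_empty] at hne
  have := h.mem_closure_jends (he.subset_ground rfl)
  rw [hne, Finset.coe_empty] at this
  exact he.notMem_closure_sdiff_of_mem rfl (by simpa using this)

/-- A matroid embedded in a jointed matroid is a frame matroid. -/
lemma isFrame (h : N.Jointed J L) {β : Type*} {R : Matroid β} {φ : β → γ}
    (hφ : Set.InjOn φ R.E) (hR : ∀ X ⊆ R.E, R.Indep X ↔ N.Indep (φ '' X))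
    (hl : ∀ e ∈ R.E, R.Indep {e}) : R.IsFrame fun e ↦ jends N J (φ e) := by
  have hl' : ∀ e ∈ R.E, N.Indep {φ e} := fun e he ↦ by
    have := (hR {e} (by simpa)).1 (hl e he)
    simpa using this
  have hE : ∀ e ∈ R.E, φ e ∈ N.E := fun e he ↦ (hl' e he).subset_ground rfl
  have hvs : ∀ X : Finset β, (X : Set β) ⊆ R.E →
      φ '' ↑X ⊆ N.closure ↑(vs (fun e ↦ jends N J (φ e)) X) := by
    rintro X hX _ ⟨e, he, rfl⟩
    have := ends_subset_vs (ends := fun e ↦ jends N J (φ e)) (Finset.mem_coe.1 he)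
    exact N.closure_subset_closure (by exact_mod_cast this) (h.mem_closure_jends (hE e (hX he)))
  have hvJ : ∀ X : Finset β, ↑(vs (fun e ↦ jends N J (φ e)) X) ⊆ J := by
    intro X j hj
    obtain ⟨e, -, hj⟩ := mem_vs.1 hj
    exact h.jends_subset_base hj
  refine ⟨fun e he ↦ h.jends_nonempty (hl' e he), fun e he ↦ h.card_jends_le_two (hE e he),
    ?_, ?_, ?_⟩
  · intro I hI
    have h1 := rk_le_of_subset_closure (hvs I hI.subset_ground)
    rw [((hR _ hI.subset_ground).1 hI).rk_eq_ncard, (hφ.mono hI.subset_ground).ncard_image,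
      (h.base.indep.subset (hvJ I)).rk_eq_ncard] at h1
    simpa using h1
  · intro I hI e he v hv hvI
    rw [hR _ (by rw [Finset.coe_insert]; exact Set.insert_subset he hI.subset_ground),
      Finset.coe_insert, Set.image_insert_eq]
    have hI' := (hR _ hI.subset_ground).1 hI
    -- The joints other than `v` span the image of `I` but not that of `e`, which has `v` among its
    -- ends.
    refine hI'.insert_indep_iff.2 (.inl ⟨hE e he, fun hcl ↦ (h.mem_jends.1 hv).2 ?_⟩)
    have h1 : φ '' ↑I ⊆ N.closure (J \ {v}) := (hvs I hI.subset_ground).trans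
      (N.closure_subset_closure fun x hx ↦ ⟨hvJ I hx, by
        rintro rfl
        exact hvI hx⟩)
    exact N.closure_subset_closure_of_subset_closure h1 hcl
  · intro I I' hI hI' hd
    have hI₁ := (hR _ hI.subset_ground).1 hI
    have hI₁' := (hR _ hI'.subset_ground).1 hI'
    rw [hR _ (by rw [Finset.coe_union]; exact Set.union_subset hI.subset_ground hI'.subset_ground),
      Finset.coe_union, Set.image_union]
    have h1 : N.Skew ↑(vs (fun e ↦ jends N J (φ e)) I) ↑(vs (fun e ↦ jends N J (φ e)) I') :=
      (h.base.indep.subset (Set.union_subset (hvJ I) (hvJ I'))).skew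
        (by exact_mod_cast hd) (Finset.finite_toSet _) (Finset.finite_toSet _)
    have h2 := ((h1.of_subset_closure (hvs I hI.subset_ground)).symm.of_subset_closure
      (hvs I' hI'.subset_ground)).symm
    exact h2.indep_union hI₁ hI₁' (I.finite_toSet.image _) (I'.finite_toSet.image _)

/-- Some end `u` of `e` lies outside `Y`, as `Y` does not span `e`. Modulo `e` this joint is
redundant: where it was used, the other end of `e`, if there is one, takes its place. Since `e` has
at most two ends, no element needs more joints than before. -/
lemma contractElem (h : N.Jointed J L) (he : e ∈ N.E) {Y : Set γ} (hY : Y ⊆ J)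
    (heY : e ∉ N.closure Y) : ∃ J', Y ⊆ J' ∧ J' ⊆ J ∧ (N ／ {e}).Jointed J' L := by
  obtain ⟨u, hu, huY⟩ : ∃ u ∈ jends N J e, u ∉ Y := by
    by_contra! hcon
    exact heY (N.closure_subset_closure hcon (h.mem_closure_jends he))
  have huJ := (h.mem_jends.1 hu).1
  have hue := (h.mem_jends.1 hu).2
  have hei : N.Indep {e} := by
    rw [indep_singleton, isNonloop_iff_notMem_loops he]
    exact fun h ↦ heY (N.closure_subset_closure (Set.empty_subset _) h)
  have heJ : e ∉ J \ {u} := fun hh ↦ hue (N.mem_closure_of_mem' hh he)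
  have hucl : u ∈ N.closure (insert e (↑(jends N J e) \ {u})) := by
    refine N.mem_closure_insert ?_ ?_
    · exact fun hh ↦ hue (N.closure_subset_closure
        (Set.sdiff_subset_sdiff_left h.jends_subset_base) hh)
    · rw [Set.insert_sdiff_singleton, Set.insert_eq_of_mem (by exact_mod_cast hu)]
      exact h.mem_closure_jends he
  have hje := h.card_jends_le_two he
  have key : ∀ f ∈ N.E, f ≠ e → ∀ S ⊆ J, f ∈ N.closure S → ∃ S' ⊆ J \ {u}, S'.ncard ≤ S.ncard ∧
      f ∈ (N ／ {e}).closure S' := by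
    intro f hf hfe S hS hfS
    by_cases huS : u ∈ S
    · refine ⟨S \ {u} ∪ (↑(jends N J e) \ {u}), Set.union_subset
        (Set.sdiff_subset_sdiff_left hS) (Set.sdiff_subset_sdiff_left h.jends_subset_base), ?_, ?_⟩
      · refine (Set.ncard_union_le _ _).trans ?_
        have h1 := Set.ncard_sdiff_singleton_add_one huS (h.finite.subset hS)
        have h2 := Set.ncard_sdiff_singleton_add_one (s := ↑(jends N J e)) (a := u)
          (by exact_mod_cast hu) (Finset.finite_toSet _)
        rw [Set.ncard_coe_finset] at h2
        omega
      · rw [contract_closure_eq]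
        refine ⟨N.closure_subset_closure_of_subset_closure (fun x hx ↦ ?_) hfS, hfe⟩
        by_cases hxu : x = u
        · subst hxu
          refine N.closure_subset_closure ?_ hucl
          rintro y (rfl | hy)
          · exact .inr rfl
          · exact .inl (.inr hy)
        · exact N.mem_closure_of_mem' (.inl (.inl ⟨hx, hxu⟩)) (h.base.subset_ground (hS hx))
    · refine ⟨S, fun x hx ↦ ⟨hS hx, ?_⟩, le_rfl, ?_⟩
      · rintro rfl; exact huS hx
      · rw [contract_closure_eq]
        exact ⟨N.closure_subset_closure Set.subset_union_left hfS, hfe⟩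
  refine ⟨J \ {u}, fun y hy ↦ ⟨hY hy, by rintro rfl; exact huY hy⟩, Set.sdiff_subset, ?_, ?_, ?_⟩
  · rw [hei.contract_isBase_iff, Set.union_singleton]
    exact ⟨h.base.exchange_base_of_notMem_closure huJ hue, by simpa using heJ⟩
  · rintro f ⟨hf, hfe⟩
    obtain ⟨S, hS, hc, hfS⟩ := h.two f hf
    obtain ⟨S', h1, h2, h3⟩ := key f hf hfe S hS hfS
    exact ⟨S', h1, h2.trans hc, h3⟩
  · rintro f hfL ⟨hf, hfe⟩
    obtain ⟨S, hS, hc, hfS⟩ := h.one f hfL hf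
    obtain ⟨S', h1, h2, h3⟩ := key f hf hfe S hS hfS
    exact ⟨S', h1, h2.trans hc, h3⟩

/-- One element is contracted at a time. Independence of `X ∪ Y` ensures at each stage that the
joints to be kept do not span the element being contracted. -/
lemma contract (h : N.Jointed J L) {X Y : Set γ} (hX : X.Finite) (hY : Y ⊆ J)
    (hXY : N.Indep (X ∪ Y)) (hd : Disjoint X Y) :
    ∃ J', Y ⊆ J' ∧ J' ⊆ J ∧ (N ／ X).Jointed J' L := by
  induction X, hX using Set.Finite.induction_on generalizing N J with
  | empty => exact ⟨J, hY, subset_rfl, by rwa [contract_empty]⟩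
  | @insert e X heX _ ih =>
    rw [Set.disjoint_insert_left] at hd
    have he : e ∉ N.closure Y := by
      have h1 : e ∈ insert e X ∪ Y := Or.inl (Or.inl rfl)
      have h2 : Y ⊆ (insert e X ∪ Y) \ {e} := fun y hy ↦ ⟨Or.inr hy, by
        rintro rfl; exact hd.1 hy⟩
      exact fun hh ↦ hXY.notMem_closure_sdiff_of_mem h1 (N.closure_subset_closure h2 hh)
    obtain ⟨J₁, hY₁, hJ₁, h₁⟩ := h.contractElem (hXY.subset_ground (.inl (.inl rfl))) hY he
    have hei : N.Indep {e} := hXY.subset (Set.singleton_subset_iff.2 (.inl (.inl rfl)))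
    obtain ⟨J', h2, h3, h4⟩ := ih h₁ hY₁ (by
      rw [hei.contract_indep_iff, Set.disjoint_singleton_right, Set.union_singleton,
        ← Set.insert_union]
      exact ⟨fun hh ↦ hh.elim heX hd.1, hXY⟩) hd.2
    refine ⟨J', h2, h3.trans hJ₁, ?_⟩
    rwa [contract_contract, Set.singleton_union] at h4

end Jointed

end Matroid

/-! ### Leaves of a tree by counting degrees -/

namespace Multi

variable {α V : Type*} {ends : α → Finset V}

/-- The degrees are positive and sum to `2|V| - 2`, so at least two of them are one. If no degree
exceeds two, a third leaf would make the sum too small. The degree bound is a hypothesis of the last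
clause only, because it is obtained later from a circuit. -/
lemma exists_two_leaves {X : Finset α} (h2 : ∀ e ∈ X, (ends e).card = 2)
    (h : (vs ends X).card = X.card + 1) : ∃ y ∈ vs ends X, ∃ y' ∈ vs ends X, y ≠ y' ∧
      deg ends X y = 1 ∧ deg ends X y' = 1 ∧ ((∀ v ∈ vs ends X, deg ends X v ≤ 2) →
        ∀ v ∈ vs ends X, v ≠ y → v ≠ y' → deg ends X v = 2) := by
  have hs := sum_deg (ends := ends) X
  rw [Finset.sum_congr rfl h2, Finset.sum_const, smul_eq_mul] at hs
  have hpos : ∀ v ∈ vs ends X, 1 ≤ deg ends X v := fun v hv ↦ one_le_deg.2 hv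
  have key : ∀ S ⊆ vs ends X, (∀ v ∈ vs ends X \ S, 2 ≤ deg ends X v) →
      2 * (vs ends X).card ≤ ∑ v ∈ vs ends X, deg ends X v + S.card := by
    intro S hS h3
    have h4 := Finset.card_nsmul_le_sum (vs ends X \ S) (fun v ↦ deg ends X v) 2 h3
    have h5 := Finset.card_nsmul_le_sum S (fun v ↦ deg ends X v) 1 fun v hv ↦ hpos v (hS hv)
    have h6 := Finset.sum_sdiff (f := fun v ↦ deg ends X v) hS
    have h7 := Finset.card_sdiff_add_card_eq_card hS
    simp only [smul_eq_mul] at h4 h5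
    omega
  obtain ⟨y, hy, hy1⟩ : ∃ y ∈ vs ends X, deg ends X y = 1 := by
    by_contra! hcon
    have := key ∅ (by simp) fun v hv ↦ by
      rw [Finset.sdiff_empty] at hv
      have := hpos v hv
      have := hcon v hv
      omega
    simp at this
    omega
  obtain ⟨y', hy', hyy', hy1'⟩ : ∃ y' ∈ vs ends X, y ≠ y' ∧ deg ends X y' = 1 := by
    by_contra! hcon
    have := key {y} (by simpa) fun v hv ↦ by
      rw [Finset.mem_sdiff, Finset.mem_singleton] at hv
      have := hpos v hv.1
      have := hcon v hv.1 fun h ↦ hv.2 h.symm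
      omega
    simp at this
    omega
  refine ⟨y, hy, y', hy', hyy', hy1, hy1', fun hle v hv hvy hvy' ↦ ?_⟩
  by_contra hne
  have hv1 : deg ends X v = 1 := by
    have := hpos v hv
    have := hle v hv
    omega
  have hS : ({y, y', v} : Finset V) ⊆ vs ends X := by
    intro u hu
    simp only [Finset.mem_insert, Finset.mem_singleton] at hu
    rcases hu with rfl | rfl | rfl <;> assumption
  have h4 := Finset.sum_le_card_nsmul (vs ends X \ {y, y', v}) (fun v ↦ deg ends X v) 2
    fun u hu ↦ hle u (Finset.mem_sdiff.1 hu).1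
  have h6 := Finset.sum_sdiff (f := fun v ↦ deg ends X v) hS
  have h7 := Finset.card_sdiff_add_card_eq_card hS
  have h8 : ∑ u ∈ ({y, y', v} : Finset V), deg ends X u = 3 := by
    rw [Finset.sum_insert (by simp [hyy', hvy.symm]), Finset.sum_insert (by simp [hvy'.symm]),
      Finset.sum_singleton]
    omega
  have h9 : ({y, y', v} : Finset V).card = 3 := by
    rw [Finset.card_insert_of_notMem (by simp [hyy', hvy.symm]),
      Finset.card_insert_of_notMem (by simp [hvy'.symm]), Finset.card_singleton]
  simp only [smul_eq_mul] at h4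
  omega

end Multi

/-! ### Spanning joints, and tips realised in minors -/

namespace Matroid

set_option linter.unusedSectionVars false

open Multi

variable {γ : Type*} {N : Matroid γ} [N.Finite] {J L : Set γ} {e f : γ}

lemma skew_congr_right {Q X Y : Set γ} (h : N.closure X = N.closure Y) :
    N.Skew Q X ↔ N.Skew Q Y := by
  rw [← Skew.closure_right_iff, h, Skew.closure_right_iff]

/-- The element `k` is free over everything in sight, so it raises both sides of the rank equation
by one. -/
lemma skew_insert_iff {Q T : Set γ} {k : γ} (hk : k ∈ N.E) (hkT : k ∉ N.closure (Q ∪ T)) :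
    N.Skew Q (insert k T) ↔ N.Skew Q T := by
  have h1 := rk_insert_of_notMem hk hkT
  have h2 := rk_insert_of_notMem hk fun h ↦ hkT (N.closure_subset_closure
    (Set.subset_union_right (s := Q)) h)
  rw [Skew, Skew, Set.union_insert, h1, h2]
  omega

namespace Jointed

/-- The joints needed to span a set of elements. -/
noncomputable abbrev jv (N : Matroid γ) (J : Set γ) (X : Finset γ) : Finset γ := vs (jends N J) X

lemma jv_subset (h : N.Jointed J L) (X : Finset γ) : (jv N J X : Set γ) ⊆ J := by
  intro j hj
  obtain ⟨e, -, hj⟩ := mem_vs.1 (Finset.mem_coe.1 hj)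
  exact h.jends_subset_base hj

lemma jv_ground (h : N.Jointed J L) (X : Finset γ) : (jv N J X : Set γ) ⊆ N.E :=
  (h.jv_subset X).trans h.base.subset_ground

lemma rk_finset (h : N.Jointed J L) {U : Finset γ} (hU : (U : Set γ) ⊆ J) : N.rk U = U.card := by
  rw [(h.base.indep.subset hU).rk_eq_ncard, Set.ncard_coe_finset]

lemma rk_jv (h : N.Jointed J L) (X : Finset γ) : N.rk (jv N J X) = (jv N J X).card :=
  h.rk_finset (h.jv_subset X)

lemma subset_closure_jv (h : N.Jointed J L) {X : Finset γ} (hX : (X : Set γ) ⊆ N.E) :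
    (X : Set γ) ⊆ N.closure (jv N J X) := fun e he ↦ by
  have h1 := ends_subset_vs (ends := jends N J) (Finset.mem_coe.1 he)
  exact N.closure_subset_closure (Finset.coe_subset.2 h1) (h.mem_closure_jends (hX he))

lemma skew_of_disjoint (h : N.Jointed J L) {X Y : Finset γ} (hX : (X : Set γ) ⊆ N.E)
    (hY : (Y : Set γ) ⊆ N.E) (hd : Disjoint (jv N J X) (jv N J Y)) : N.Skew X Y := by
  have h1 : N.Skew (jv N J X : Set γ) (jv N J Y) :=
    (h.base.indep.subset (Set.union_subset (h.jv_subset X) (h.jv_subset Y))).skew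
      (by exact_mod_cast hd) (Finset.finite_toSet _) (Finset.finite_toSet _)
  exact ((h1.of_subset_closure (h.subset_closure_jv hX)).symm.of_subset_closure
      (h.subset_closure_jv hY)).symm

/-- An end of an element is spanned by the element and its other ends. -/
lemma mem_closure_insert_end (h : N.Jointed J L) (he : e ∈ N.E) {k : γ} (hk : k ∈ jends N J e) :
    k ∈ N.closure (insert e (↑(jends N J e) \ {k})) := by
  refine N.mem_closure_insert ?_ ?_
  · exact fun hh ↦ (h.mem_jends.1 hk).2 (N.closure_subset_closure
      (Set.sdiff_subset_sdiff_left h.jends_subset_base) hh)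
  · rw [Set.insert_sdiff_singleton, Set.insert_eq_of_mem (by exact_mod_cast hk)]
    exact h.mem_closure_jends he

lemma mem_closure_of_ends_eq (h : N.Jointed J L) (he : e ∈ N.E) {a b : γ}
    (hab : jends N J e = {a, b}) : b ∈ N.closure {e, a} := by
  have hb : b ∈ jends N J e := by simp [hab]
  refine N.closure_subset_closure ?_ (h.mem_closure_insert_end he hb)
  rw [hab]
  intro x hx
  simp at hx ⊢
  tauto

/-- A link and one of its ends span the other end, and this propagates along a walk. -/
lemma mem_closure_of_reach (h : N.Jointed J L) {X : Finset γ} (hX : (X : Set γ) ⊆ N.E) {a b : γ}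
    (hr : Relation.ReflTransGen (AdjOn (jends N J) X) a b) (ha : a ∈ N.E) :
    b ∈ N.closure (insert a ↑X) := by
  induction hr with
  | refl => exact N.mem_closure_of_mem (Set.mem_insert _ _) (Set.insert_subset ha hX)
  | @tail c d _ hcd ih =>
    obtain ⟨e, he, hcd⟩ := hcd
    refine N.closure_subset_closure_of_subset_closure ?_
      (h.mem_closure_of_ends_eq (hX he) hcd)
    intro x hx
    rcases hx with rfl | rfl
    · exact N.mem_closure_of_mem (Set.mem_insert_of_mem _ he) (Set.insert_subset ha hX)
    · exact ih

lemma circuit_exists_ne (h : N.Jointed J L) {C : Finset γ} (hC : N.IsCircuit C) {e : γ}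
    (he : e ∈ C) {v : γ} (hv : v ∈ jends N J e) : ∃ f ∈ C, f ≠ e ∧ v ∈ jends N J f := by
  by_contra! hcon
  have h1 := hC.mem_closure_sdiff_singleton_of_mem (Finset.mem_coe.2 he)
  refine (h.mem_jends.1 hv).2 (N.closure_subset_closure_of_subset_closure ?_ h1)
  rintro f ⟨hf, hfe⟩
  have h2 : (jends N J f : Set γ) ⊆ J \ {v} := fun j hj ↦ ⟨h.jends_subset_base hj, by
    rintro rfl
    exact hcon f hf hfe hj⟩
  exact N.closure_subset_closure h2 (h.mem_closure_jends (hC.subset_ground hf))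

/-- A circuit together with one of its joints spans all of its joints. -/
lemma jv_subset_closure_of_isCircuit (h : N.Jointed J L) {C : Finset γ} (hC : N.IsCircuit C)
    {v : γ} (hv : v ∈ jv N J C) : (jv N J C : Set γ) ⊆ N.closure (insert v ↑C) := by
  intro w hw
  by_cases hr : Relation.ReflTransGen (AdjOn (jends N J) C) v w
  · exact h.mem_closure_of_reach hC.subset_ground hr (h.jv_ground C hv)
  -- Otherwise the circuit splits into two proper, hence independent, parts without common joints;
  -- these are skew and their union would be independent.
  exfalso
  obtain ⟨Z, hZ, h1, h2⟩ := exists_component C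
    (fun e he ↦ h.card_jends_le_two (hC.subset_ground he)) v
  have hu := Finset.union_sdiff_of_subset hZ
  have hss : ∀ Y ⊆ C, Y ≠ C → N.Indep Y := fun Y hY hne ↦
    hC.ssubset_indep (by exact_mod_cast hY.ssubset_of_ne hne)
  have hZC : Z ≠ C := by
    rintro rfl
    exact hr (h1 w hw)
  have hCZ : C \ Z ≠ C := by
    intro heq
    refine h2 v ?_ .refl
    rwa [heq]
  have hZE : (Z : Set γ) ⊆ N.E := fun x hx ↦ hC.subset_ground (hZ hx)
  have hCE : (↑(C \ Z) : Set γ) ⊆ N.E :=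
    fun x hx ↦ hC.subset_ground (Finset.sdiff_subset hx)
  have hsk := h.skew_of_disjoint hZE hCE (by
    rw [Finset.disjoint_left]
    exact fun x hx hx' ↦ h2 x hx' (h1 x hx))
  have := hsk.indep_union (hss Z hZ hZC) (hss _ Finset.sdiff_subset hCZ) (Finset.finite_toSet _)
    (Finset.finite_toSet _)
  rw [← Finset.coe_union, hu] at this
  exact hC.not_indep this

end Jointed

/-- `N'` is a minor of `N` in which `y` is the tip of the set `A` on the side of `B`. -/
structure TipVia (N N' : Matroid γ) (y : γ) (B A : Set γ) : Prop where
  mem : y ∈ N'.E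
  subset : B ⊆ N'.E
  notMem : y ∉ B
  indep : ∀ Q ⊆ B, N'.Indep Q ↔ N.Indep Q
  insert : ∀ Q ⊆ B, N'.Indep (insert y Q) ↔ N.Indep Q ∧ N.Skew Q A

/-- The tip of `A` on the side of `B` can be realised by an element of a frame. -/
def LoSide (N : Matroid γ) (L B A : Set γ) : Prop :=
  ∃ (N' : Matroid γ) (J' : Set γ) (y : γ), N'.Finite ∧ N'.Jointed J' L ∧ y ∈ J' ∧ N.TipVia N' y B A

/-- The tip of `A` on the side of `B` can be realised in a jointed matroid. -/
def FrSide (N : Matroid γ) (L B A : Set γ) : Prop :=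
  ∃ (N' : Matroid γ) (J' : Set γ) (y : γ), N'.Finite ∧ N'.Jointed J' L ∧ N.TipVia N' y B A

/-- Contracting `X` does not affect `B`, because `X` is skew to `B`. In the contraction `y` is
independent over `Q` exactly when `Q` is skew to `X` with `y`, and by assumption that set tests
skewness to `A`. -/
lemma tipVia_contract {X A B : Set γ} {y : γ} (hB : B ⊆ N.E) (hyX : y ∉ X) (hyB : y ∉ B)
    (hi : N.Indep (insert y X)) (hX : N.Skew X B)
    (h : ∀ Q ⊆ B, N.Indep Q → (N.Skew Q (insert y X) ↔ N.Skew Q A)) :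
    N.TipVia (N ／ X) y B A := by
  have hXi : N.Indep X := hi.subset (Set.subset_insert _ _)
  have hfin : ∀ {Y : Set γ}, Y ⊆ N.E → Y.Finite := fun h ↦ N.ground_finite.subset h
  have hd := hX.disjoint hXi hB
  refine ⟨⟨hi.subset_ground (Set.mem_insert _ _), hyX⟩, fun b hb ↦ ⟨hB hb, fun hbX ↦
    Set.disjoint_left.1 hd hbX hb⟩, hyB, fun Q hQ ↦ ?_, fun Q hQ ↦ ?_⟩
  · rw [contract_indep_iff_of_skew hXi (hfin hXi.subset_ground) (hfin (hQ.trans hB))]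
    exact and_iff_left (hX.symm.mono_left hQ)
  · have hdQ : Disjoint Q (insert y X) := by
      rw [Set.disjoint_insert_right]
      exact ⟨fun h ↦ hyB (hQ h), (hd.mono_right hQ).symm⟩
    have hiff : N.Indep (Q ∪ insert y X) ↔ N.Indep Q ∧ N.Skew Q (insert y X) := by
      refine ⟨fun h ↦ ⟨h.subset Set.subset_union_left, h.skew hdQ (hfin (hQ.trans hB))
        (hfin hi.subset_ground)⟩, fun h ↦ h.2.indep_union h.1 hi (hfin (hQ.trans hB))
        (hfin hi.subset_ground)⟩
    rw [hXi.contract_indep_iff, Set.insert_union, ← Set.union_insert, hiff,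
      Set.disjoint_insert_left]
    constructor
    · rintro ⟨-, h1, h2⟩
      exact ⟨h1, (h Q hQ h1).1 h2⟩
    · rintro ⟨h1, h2⟩
      exact ⟨⟨hyX, (hd.mono_right hQ).symm⟩, h1, (h Q hQ h1).2 h2⟩

/-- Since `X` with `y` is independent, the contraction of `X` can be carried out with `y` kept in
the basis of joints. -/
lemma Jointed.loSide (hN : N.Jointed J L) {X A B : Set γ} {y : γ} (hB : B ⊆ N.E) (hy : y ∈ J)
    (hyX : y ∉ X) (hyB : y ∉ B) (hi : N.Indep (insert y X)) (hX : N.Skew X B)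
    (h : ∀ Q ⊆ B, N.Indep Q → (N.Skew Q (insert y X) ↔ N.Skew Q A)) : N.LoSide L B A := by
  obtain ⟨J', h1, -, h2⟩ := hN.contract (X := X) (Y := {y})
    (N.ground_finite.subset ((Set.subset_insert _ _).trans hi.subset_ground)) (by simpa)
    (by rwa [Set.union_singleton]) (by simpa)
  exact ⟨N ／ X, J', y, inferInstance, h2, h1 rfl, tipVia_contract hB hyX hyB hi hX h⟩

lemma Jointed.frSide (hN : N.Jointed J L) {X A B : Set γ} {y : γ} (hB : B ⊆ N.E)
    (hyX : y ∉ X) (hyB : y ∉ B) (hi : N.Indep (insert y X)) (hX : N.Skew X B)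
    (h : ∀ Q ⊆ B, N.Indep Q → (N.Skew Q (insert y X) ↔ N.Skew Q A)) : N.FrSide L B A := by
  obtain ⟨J', -, -, h2⟩ := hN.contract (X := X) (Y := ∅)
    (N.ground_finite.subset ((Set.subset_insert _ _).trans hi.subset_ground)) (by simp)
    (by rw [Set.union_empty]; exact hi.subset (Set.subset_insert _ _)) (by simp)
  exact ⟨N ／ X, J', y, inferInstance, h2, tipVia_contract hB hyX hyB hi hX h⟩

lemma restrict_rk {S X : Set γ} (h : X ⊆ S) : (N ↾ S).rk X = N.rk X := by
  rw [rk, rk, restrict_eRk_eq _ h]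

/-- If a side of a 2-separation spans a joint, then its tip is realised by a joint. -/
lemma Jointed.loSide_of_mem_closure (hN : N.Jointed J L) {A B : Set γ} (hA : A ⊆ N.E)
    (hB : B ⊆ N.E) (hJ : Disjoint (A ∪ B) J) (hd : Disjoint A B) (hBne : B.Nonempty)
    (hlam : N.rk A + N.rk B = N.rk (A ∪ B) + 1)
    (hconn : ∀ S T : Set γ, S ∪ T = A ∪ B → Disjoint S T → S.Nonempty → T.Nonempty →
      N.rk (A ∪ B) < N.rk S + N.rk T)
    {j : γ} (hj : j ∈ J) (hjA : j ∈ N.closure A) : N.LoSide L B A := by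
  have hjE := hN.base.subset_ground hj
  have hji : N.Indep {j} := hN.base.indep.subset (by simpa)
  have hjAB : j ∉ A ∪ B := fun h ↦ Set.disjoint_left.1 hJ h hj
  have hjA' : j ∉ A := fun h ↦ hjAB (.inl h)
  have hjB' : j ∉ B := fun h ↦ hjAB (.inr h)
  have hfin : ∀ {Y : Set γ}, Y ⊆ N.E → Y.Finite := fun h ↦ N.ground_finite.subset h
  set E₀ := insert j (A ∪ B) with hE₀
  have hE₀E : E₀ ⊆ N.E := Set.insert_subset hjE (Set.union_subset hA hB)
  have : (N ↾ E₀).Finite := ⟨hfin hE₀E⟩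
  -- A circuit through `j` that reaches `B` is needed; its part in `A` will be contracted.
  obtain ⟨b, hbB, C, hC, hjC, hbC⟩ : ∃ b ∈ B, ∃ C, (N ↾ E₀).IsCircuit C ∧ j ∈ C ∧ b ∈ C := by
    by_contra! hcon
    -- By transitivity of circuits the elements sharing a circuit with `j` are skew to all others.
    -- If none were in `B`, this would separate `A ∪ B` once `j` is removed; `j` costs no rank since
    -- `A` spans it.
    set S := {e ∈ E₀ | e = j ∨ ∃ C, (N ↾ E₀).IsCircuit C ∧ j ∈ C ∧ e ∈ C} with hS
    have hjS : j ∈ S := ⟨Set.mem_insert _ _, .inl rfl⟩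
    have hSE : S ⊆ E₀ := Set.sep_subset _ _
    have hu : S ∪ E₀ \ S = E₀ := Set.union_sdiff_cancel hSE
    have hcirc : ∀ C ⊆ S ∪ E₀ \ S, (N ↾ E₀).IsCircuit C → C ⊆ S ∨ C ⊆ E₀ \ S := by
      intro C hCs hC
      by_contra! hne
      obtain ⟨⟨t, htC, htS⟩, ⟨s, hsC, hsS⟩⟩ : (∃ t ∈ C, t ∉ S) ∧ ∃ s ∈ C, s ∉ E₀ \ S := by
        simpa [Set.not_subset] using hne
      have hsS' : s ∈ S := by
        by_contra h
        exact hsS ⟨hC.subset_ground hsC, h⟩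
      refine htS ⟨hC.subset_ground htC, .inr ?_⟩
      rcases hsS'.2 with rfl | ⟨D, hD, hjD, hsD⟩
      · exact ⟨C, hC, hsC, htC⟩
      · exact hD.exists_isCircuit_mem_mem hC hjD htC ⟨s, hsD, hsC⟩
    have hsk := skew_of_forall_isCircuit (M := N ↾ E₀) (S := S) (T := E₀ \ S) hSE Set.sdiff_subset hcirc
      Set.disjoint_sdiff_right
    rw [Skew, hu, restrict_rk subset_rfl, restrict_rk hSE, restrict_rk Set.sdiff_subset] at hsk
    obtain ⟨a, haS, haj⟩ : ∃ a ∈ S, a ≠ j := by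
      obtain ⟨C, hCs, hC, hjC⟩ := exists_isCircuit_of_mem_closure hjA hjA'
      have hC' : (N ↾ E₀).IsCircuit C := by
        rw [restrict_isCircuit_iff hE₀E]
        exact ⟨hC, hCs.trans (Set.insert_subset_insert Set.subset_union_left)⟩
      by_contra! h
      have : C ⊆ {j} := fun x hx ↦ h x ⟨hC'.subset_ground hx, .inr ⟨C, hC', hjC, hx⟩⟩
      exact hC.not_indep (hji.subset this)
    have h1 := hconn (S \ {j}) (E₀ \ S) (by
      ext x
      simp only [Set.mem_union, Set.mem_sdiff, Set.mem_singleton_iff]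
      constructor
      · rintro (⟨h1, h2⟩ | ⟨h1, h2⟩)
        · exact (hSE h1).resolve_left h2
        · refine h1.resolve_left ?_
          rintro rfl
          exact h2 hjS
      · intro hx
        by_cases hxS : x ∈ S
        · refine .inl ⟨hxS, ?_⟩
          rintro rfl
          exact hjAB hx
        · exact .inr ⟨.inr hx, hxS⟩)
      (Set.disjoint_sdiff_right.mono_left Set.sdiff_subset) ⟨a, haS, haj⟩ (by
        obtain ⟨b, hb⟩ := hBne
        refine ⟨b, .inr (.inr hb), fun hbS ↦ ?_⟩
        rcases hbS.2 with rfl | ⟨D, hD, hjD, hbD⟩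
        · exact hjB' hb
        · exact hcon b hb D hD hjD hbD)
    have h2 : N.rk E₀ = N.rk (A ∪ B) :=
      rk_insert_of_mem (N.closure_subset_closure Set.subset_union_left hjA)
    have h3 := rk_mono (M := N) (Set.sdiff_subset (s := S) (t := {j}))
    omega
  rw [restrict_isCircuit_iff hE₀E] at hC
  obtain ⟨hC, hCE⟩ := hC
  set X := C ∩ A with hXdef
  set F := C ∩ B with hFdef
  have hXE : X ⊆ N.E := Set.inter_subset_right.trans hA
  have hFE : F ⊆ N.E := Set.inter_subset_right.trans hB
  have hCeq : F ∪ insert j X = C := by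
    ext x
    constructor
    · rintro (h | rfl | h)
      exacts [h.1, hjC, h.1]
    · intro hx
      rcases hCE hx with rfl | h | h
      exacts [.inr (.inl rfl), .inr (.inr ⟨hx, h⟩), .inl ⟨hx, h⟩]
  have hjX : j ∉ X := fun h ↦ hjA' h.2
  have hi : N.Indep (insert j X) := by
    refine hC.ssubset_indep ((Set.insert_subset hjC Set.inter_subset_left).ssubset_of_ne ?_)
    intro h
    have hb : b ∈ insert j X := h ▸ hbC
    rcases hb with rfl | hb
    · exact hjB' hbB
    · exact Set.disjoint_left.1 hd hb.2 hbB
  have hFX : N.Indep (F ∪ X) := by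
    refine hC.ssubset_indep ((Set.union_subset Set.inter_subset_left
      Set.inter_subset_left).ssubset_of_ne fun h ↦ ?_)
    have : j ∈ F ∪ X := h ▸ hjC
    exact this.elim (fun h ↦ hjB' h.2) hjX
  have hF : N.Indep F := hFX.subset Set.subset_union_left
  have hdF : Disjoint F (insert j X) := by
    rw [Set.disjoint_insert_right]
    exact ⟨fun h ↦ hjB' h.2, (hd.mono Set.inter_subset_right Set.inter_subset_right).symm⟩
  have hns : ¬ N.Skew F (insert j X) := fun h ↦ by
    have := h.indep_union hF hi (hfin hFE) (hfin hi.subset_ground)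
    rw [hCeq] at this
    exact hC.not_indep this
  have hcl : N.closure (insert j A) = N.closure A := closure_insert_eq_of_mem_closure hjA
  have hXA : insert j X ⊆ insert j A := Set.insert_subset_insert Set.inter_subset_right
  have hFA : ¬ N.Skew F A := fun h ↦ hns (((skew_congr_right hcl).2 h).mono_right hXA)
  -- `F` in `B` is not skew to `A`. If `X` were not skew to `B` either, the two would not be skew to
  -- each other, although their union is independent as a proper part of `C`.
  have hXB : N.Skew X B := by
    by_contra h
    exact not_skew_of_not_skew hlam.le Set.inter_subset_right Set.inter_subset_right hFA h
      (hFX.skew (hdF.mono_right (Set.subset_insert _ _)) (hfin hFE) (hfin hXE))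
  refine hN.loSide hB hj hjX hjB' hi hXB fun Q hQ _ ↦ ?_
  have hlam' : N.rk (insert j A) + N.rk B ≤ N.rk (insert j A ∪ B) + 1 := by
    rw [rk_insert_of_mem hjA, hlam]
    have := rk_mono (M := N) (Set.union_subset_union_left B (Set.subset_insert j A))
    omega
  rw [← skew_congr_right hcl, skew_iff_of_not_skew hlam' hQ hXA]
  exact fun h ↦ hns (h.mono_right Set.inter_subset_right).symm

end Matroid

/-! ### Sides that span no joint, and their minimal connectors -/

namespace Multi

variable {α V : Type*}

/-- The forests in which `x` and `y` lie in different components. -/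
def IsPairForest (ends : α → Finset V) (X : Finset α) (x y : V) : Prop :=
  IsForest ends X ∧ ∀ Z ⊆ X, Z.card + 1 < (vs ends Z ∪ {x, y}).card

lemma IsPairForest.symm {ends : α → Finset V} {X : Finset α} {x y : V}
    (h : IsPairForest ends X x y) : IsPairForest ends X y x := by
  unfold IsPairForest at h ⊢
  rwa [Finset.pair_comm]

end Multi

namespace Matroid

set_option linter.unusedSectionVars false

open Multi Jointed

variable {γ : Type*} {N : Matroid γ} [N.Finite] {J L : Set γ} {A T : Finset γ} {B : Set γ}

/-- A side of a 2-separation of a jointed matroid that spans no joint. -/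
structure Side (N : Matroid γ) (J L : Set γ) (A : Finset γ) (B : Set γ) : Prop where
  jointed : N.Jointed J L
  left : (A : Set γ) ⊆ N.E
  right : B ⊆ N.E
  disj : Disjoint (A : Set γ) B
  disjJ : Disjoint B J
  indep : ∀ e ∈ A, N.Indep {e}
  bal : ∀ j ∈ J, j ∉ N.closure A
  lam : N.rk A + N.rk B = N.rk (↑A ∪ B) + 1

/-- The side `A` together with its tip is a graphic matroid. -/
def GrSide (N : Matroid γ) (A : Finset γ) (B : Set γ) : Prop :=
  ∃ (ends : γ → Finset ℕ) (x y : ℕ), x ≠ y ∧ (∀ e ∈ A, (ends e).card = 2) ∧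
    (∀ Q ⊆ A, N.Indep Q ↔ IsForest ends Q) ∧
    ∀ Q ⊆ A, N.Indep Q ∧ N.Skew Q B ↔ IsPairForest ends Q x y

namespace Side

/-- If the rank reached the number of joints, `Z` would span them all, but the side spans none. This
says that the side has no unbalanced cycle. -/
lemma rk_lt (h : N.Side J L A B) {Z : Finset γ} (hZ : Z ⊆ A) (hne : Z.Nonempty) :
    N.rk Z < (jv N J Z).card := by
  have hZE : (Z : Set γ) ⊆ N.E := fun e he ↦ h.left (hZ he)
  have hcl := h.jointed.subset_closure_jv hZE
  have h1 := rk_le_of_subset_closure hcl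
  rw [h.jointed.rk_jv] at h1
  refine h1.lt_of_ne fun heq ↦ ?_
  obtain ⟨e, he⟩ := hne
  obtain ⟨j, hj⟩ := h.jointed.jends_nonempty (h.indep e (hZ he))
  have hjJ := ends_subset_vs (ends := jends N J) he hj
  refine h.bal j (h.jointed.jends_subset_base hj)
    (N.closure_subset_closure (Finset.coe_subset.2 hZ) ?_)
  refine subset_closure_of_rk_le (h.jointed.jv_ground Z) ?_ (Finset.mem_coe.2 hjJ)
  rw [heq, ← h.jointed.rk_jv Z]
  exact rk_le_of_subset_closure (Set.union_subset hcl (N.subset_closure _ (h.jointed.jv_ground Z)))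

lemma card_jends (h : N.Side J L A B) {e : γ} (he : e ∈ A) : (jends N J e).card = 2 := by
  have h1 := h.rk_lt (Z := {e}) (by simpa) (by simp)
  have h2 := (h.indep e he).rk_eq_ncard
  have h3 := h.jointed.card_jends_le_two (h.left he)
  rw [jv, vs_singleton, Finset.coe_singleton, h2, Set.ncard_singleton] at h1
  omega

lemma jends_eq_pair (h : N.Side J L A B) {e k : γ} (he : e ∈ A) (hk : k ∈ jends N J e) :
    ∃ y, y ≠ k ∧ jends N J e = {k, y} := by
  obtain ⟨a, b, hab, heq⟩ := Finset.card_eq_two.1 (h.card_jends he)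
  rw [heq] at hk
  simp only [Finset.mem_insert, Finset.mem_singleton] at hk
  rcases hk with rfl | rfl
  · exact ⟨b, hab.symm, heq⟩
  · exact ⟨a, hab, by rw [heq, Finset.pair_comm]⟩

lemma left_nonempty (h : N.Side J L A B) : A.Nonempty := by
  rw [Finset.nonempty_iff_ne_empty]
  rintro rfl
  have := h.lam
  simp at this

lemma joint_notMem_left (h : N.Side J L A B) {y : γ} (hy : y ∈ J) : y ∉ A := fun hyA ↦
  h.bal y hy (N.mem_closure_of_mem (Finset.mem_coe.2 hyA) h.left)

lemma joint_notMem_right (h : N.Side J L A B) {y : γ} (hy : y ∈ J) : y ∉ B := fun hyB ↦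
  Set.disjoint_left.1 h.disjJ hyB hy

/-- One joint added to a connected side spans all its joints, so the rank is short by exactly one.
-/
lemma card_jv_left (h : N.Side J L A B)
    (hc : ∀ v ∈ jv N J A, ↑(jv N J A) ⊆ N.closure (insert v ↑A)) :
    (jv N J A).card = N.rk A + 1 := by
  have h1 := h.rk_lt subset_rfl h.left_nonempty
  obtain ⟨v, hv⟩ : (jv N J A).Nonempty := Finset.card_pos.1 (by omega)
  have h2 := rk_le_of_subset_closure (hc v hv)
  rw [h.jointed.rk_jv] at h2
  have := N.rk_insert_le v A
  omega

/-- If `K` is a pair of joints of `A` in the guts, then it determines which subsets of `A` are skew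
to the other side. -/
lemma skew_iff_notMem (h : N.Side J L A B) {S : Set γ} {y y' : γ} (hy : y ∈ jv N J A)
    (hy' : y' ∈ jv N J A) (hyy' : y ≠ y') (hyS : y ∈ N.closure S) (hyS' : y' ∈ N.closure S)
    (hlam : N.rk (↑(jv N J A) ∪ S) + 2 = N.rk (jv N J A) + N.rk S) {Q : Finset γ} (hQ : Q ⊆ A) :
    N.Skew Q S ↔ y' ∉ N.closure (insert y ↑Q) := by
  have hyJ := h.jointed.jv_subset A hy
  have hyJ' := h.jointed.jv_subset A hy'
  have hyE := h.jointed.jv_ground A hy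
  have hyE' := h.jointed.jv_ground A hy'
  have hQE : (Q : Set γ) ⊆ N.E := fun e he ↦ h.left (hQ he)
  have hK : N.rk ({y, y'} : Set γ) = 2 := by
    have := h.jointed.rk_finset (U := {y, y'}) (by
      rw [Finset.coe_pair]; exact Set.insert_subset hyJ (by simpa))
    rwa [Finset.coe_pair, Finset.card_pair hyy'] at this
  have hyQ : y ∉ N.closure Q := fun hh ↦ h.bal y hyJ
    (N.closure_subset_closure (Finset.coe_subset.2 hQ) hh)
  have h1 : N.Skew Q {y, y'} ↔ y' ∉ N.closure (insert y ↑Q) := by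
    have e1 : (Q : Set γ) ∪ {y, y'} = insert y' (insert y ↑Q) := by
      ext; simp; tauto
    have e2 := rk_insert_of_notMem hyE hyQ
    rw [Skew, e1, hK, mem_closure_iff_rk hyE', e2]
    have := N.rk_insert_le y' (insert y ↑Q)
    have := rk_mono (M := N) (Set.subset_insert y' (insert y ↑Q))
    omega
  rw [← h1]
  have hKS : ({y, y'} : Set γ) ⊆ N.closure S := Set.insert_subset hyS (by simpa)
  refine ⟨fun hs ↦ (hs.symm.of_subset_closure hKS).symm, fun hs ↦ ?_⟩
  -- The joints of `A` and the set `S` share rank two, all of it spanned by `y` and `y'`.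
  -- Submodularity over `Q ∪ {y, y'}` carries skewness from the pair to `S`.
  have e3 := N.rk_submod' (U := ↑(jv N J A) ∪ S) (X := ↑(jv N J A) ∪ ↑Q) (Y := ↑Q ∪ (S ∪ {y, y'}))
    (Z := ↑Q ∪ {y, y'}) (by grind) (Set.union_subset Set.subset_union_right
      (Set.insert_subset (.inl hy) (Set.singleton_subset_iff.2 (.inl hy')))) (by grind)
  have e4 : N.rk (↑(jv N J A) ∪ ↑Q) ≤ N.rk (jv N J A) := rk_le_of_subset_closure
    (Set.union_subset (N.subset_closure _ (h.jointed.jv_ground A))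
      (((Finset.coe_subset.2 hQ).trans (h.jointed.subset_closure_jv h.left))))
  have e5 : N.rk (↑Q ∪ (S ∪ {y, y'})) = N.rk (↑Q ∪ S) := by
    refine rk_union_eq_of_closure_eq ?_ _
    rw [← closure_union_closure_left_eq, Set.union_eq_left.2 hKS, closure_closure]
  have e6 := N.rk_union_le Q S
  rw [Skew] at hs ⊢
  omega

end Side

/-- `T` is a minimal subset of `A` that is not skew to `B`. -/
structure Thin (N : Matroid γ) (A : Finset γ) (B : Set γ) (T : Finset γ) : Prop where
  subset : T ⊆ A
  not_skew : ¬ N.Skew T B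
  skew : ∀ X ⊂ T, N.Skew X B

namespace Side

lemma exists_thin (h : N.Side J L A B) : ∃ T, N.Thin A B T := by
  obtain ⟨T, hT, hmin⟩ := exists_minimal_le_of_wellFoundedLT
    (fun X : Finset γ ↦ ¬ N.Skew X B) A (by
      have := h.lam
      rw [not_skew_iff]; omega)
  exact ⟨T, hT, hmin.1, fun X hX ↦ by
    by_contra hn
    exact hX.2 (hmin.2 hn hX.1)⟩

end Side

namespace Thin

lemma nonempty (ht : N.Thin A B T) : T.Nonempty := by
  rw [Finset.nonempty_iff_ne_empty]
  rintro rfl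
  exact ht.not_skew (by simp [Skew])

lemma ground (ht : N.Thin A B T) (h : N.Side J L A B) : (T : Set γ) ⊆ N.E := fun _ he ↦
  h.left (ht.subset he)

/-- If `T - f` spanned `f`, skewness of `T - f` to `B` would pass to `T`. -/
lemma indep (ht : N.Thin A B T) (h : N.Side J L A B) : N.Indep T := by
  rw [indep_iff_forall_notMem_closure_sdiff (ht.ground h)]
  intro f hf hcl
  refine ht.not_skew (((ht.skew _ (Finset.erase_ssubset hf))).of_subset_closure ?_)
  intro e he
  rw [Finset.coe_erase]
  by_cases hef : e = f
  · rwa [hef]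
  · exact N.mem_closure_of_mem' ⟨he, hef⟩ (ht.ground h he)

lemma rk_eq (ht : N.Thin A B T) (h : N.Side J L A B) : N.rk T = T.card := by
  rw [(ht.indep h).rk_eq_ncard, Set.ncard_coe_finset]

lemma rk_union (ht : N.Thin A B T) (h : N.Side J L A B) :
    N.rk (↑T ∪ B) + 1 = T.card + N.rk B := by
  obtain ⟨f, hf⟩ := ht.nonempty
  have h1 := not_skew_iff.1 ht.not_skew
  have h2 := ht.skew _ (Finset.erase_ssubset hf)
  have h3 := ht.rk_eq h
  have h4 : N.rk ↑(T.erase f) = (T.erase f).card := by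
    rw [((ht.indep h).subset (Finset.coe_subset.2 (Finset.erase_subset f T))).rk_eq_ncard,
      Set.ncard_coe_finset]
  have h5 := Finset.card_erase_add_one hf
  have h6 := rk_mono (M := N) (Set.union_subset_union_left B
    (Finset.coe_subset.2 (Finset.erase_subset f T)))
  rw [Skew] at h2
  omega

lemma skew_iff (ht : N.Thin A B T) (h : N.Side J L A B) {Q : Set γ} (hQ : Q ⊆ B) :
    N.Skew Q A ↔ N.Skew Q T :=
  skew_iff_of_not_skew h.lam.le hQ (Finset.coe_subset.2 ht.subset) ht.not_skew

/-- If some joint of `T` is not spanned by `T ∪ B`, then the tip of `A` is a joint. -/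
lemma loSide_of_notMem (ht : N.Thin A B T) (h : N.Side J L A B) {k : γ} (hk : k ∈ jv N J T)
    (hkc : k ∉ N.closure (↑T ∪ B)) : N.LoSide L B A := by
  obtain ⟨f, hf, hkf⟩ := mem_vs.1 hk
  obtain ⟨y, hyk, hfe⟩ := h.jends_eq_pair (ht.subset hf) hkf
  have hyJ : y ∈ J := h.jointed.jends_subset_base (e := f) (by simp [hfe])
  have hkJ : k ∈ J := h.jointed.jends_subset_base hkf
  have hkE := h.jointed.base.subset_ground hkJ
  have hyE := h.jointed.base.subset_ground hyJ
  have hTE := ht.ground h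
  set X := T.erase f with hX
  have hXT : X ⊆ T := Finset.erase_subset f T
  have hXTc : (X : Set γ) ⊆ T := Finset.coe_subset.2 hXT
  have hyT : y ∉ T := fun hh ↦ h.joint_notMem_left hyJ (ht.subset hh)
  have hkT : k ∉ T := fun hh ↦ h.joint_notMem_left hkJ (ht.subset hh)
  have hXE : (X : Set γ) ⊆ N.E := hXTc.trans hTE
  have hkTc : k ∉ N.closure T := fun hh ↦ hkc (N.closure_subset_closure Set.subset_union_left hh)
  have hTX : (T : Set γ) = insert f ↑X := by
    rw [hX, Finset.coe_erase, Set.insert_sdiff_singleton, Set.insert_eq_of_mem hf]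
  have hyin : y ∈ N.closure (insert k ↑T) := by
    refine N.closure_subset_closure ?_ (h.jointed.mem_closure_of_ends_eq (hTE hf) hfe)
    rintro x (rfl | rfl)
    exacts [.inr hf, .inl rfl]
  have hfin : f ∈ N.closure (insert y (insert k ↑X)) := by
    refine N.closure_subset_closure ?_ (h.jointed.mem_closure_jends (hTE hf))
    rw [hfe, Finset.coe_pair]
    rintro x (rfl | rfl)
    exacts [.inr (.inl rfl), .inl rfl]
  have hE1 : insert y (insert k (X : Set γ)) ⊆ N.E :=
    Set.insert_subset hyE (Set.insert_subset hkE hXE)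
  -- Modulo `k` the edge `f`, with ends `k` and `y`, is parallel to the joint `y`. So after `k` and
  -- `T - f` are contracted, `y` plays the role that `f` would play as the tip; adding `k` is
  -- harmless because `T` and `B` do not span it.
  have hcl : N.closure (insert y (insert k ↑X)) = N.closure (insert k ↑T) := by
    refine (N.closure_subset_closure_of_subset_closure ?_).antisymm
      (N.closure_subset_closure_of_subset_closure ?_)
    · refine Set.insert_subset hyin ?_
      exact (Set.insert_subset_insert hXTc).trans (N.subset_closure _ (Set.insert_subset hkE hTE))
    · rw [hTX, Set.insert_comm]
      exact Set.insert_subset hfin ((Set.subset_insert _ _).trans (N.subset_closure _ hE1))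
  refine h.jointed.loSide (X := insert k ↑X) h.right hyJ ?_ (h.joint_notMem_right hyJ) ?_ ?_
    fun Q hQ hQi ↦ ?_
  · rintro (hh | hh)
    exacts [hyk hh, hyT (hXT hh)]
  · refine indep_of_le_rk ((X.finite_toSet.insert k).insert y) ?_
    rw [← rk_closure, hcl, rk_closure, rk_insert_of_notMem hkE hkTc, ht.rk_eq h,
      ← Finset.card_erase_add_one hf, ← hX]
    have h1 := Set.ncard_insert_le y (insert k (X : Set γ))
    have h2 := Set.ncard_insert_le k (X : Set γ)
    rw [Set.ncard_coe_finset] at h2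
    omega
  · refine ((skew_insert_iff hkE fun hh ↦ hkc ?_).2
      (ht.skew X (Finset.erase_ssubset hf)).symm).symm
    refine N.closure_subset_closure ?_ hh
    rw [Set.union_comm]
    exact Set.union_subset_union_left _ hXTc
  · rw [skew_congr_right hcl, skew_insert_iff hkE fun hh ↦ hkc ?_, ht.skew_iff h hQ]
    refine N.closure_subset_closure ?_ hh
    rw [Set.union_comm]
    exact Set.union_subset_union_right _ hQ

end Thin

end Matroid

/-! ### Connected sides and the tree joining them to the other side -/

namespace Matroid

set_option linter.unusedSectionVars false

open Multi Jointed

variable {γ : Type*} {N : Matroid γ} [N.Finite] {J L : Set γ} {A T : Finset γ} {B : Set γ}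

/-- A minimal set that is not skew to `B`, in a connected side, all of whose joints are spanned
by it and `B`. -/
structure Spine (N : Matroid γ) (J L : Set γ) (A : Finset γ) (B : Set γ) (T : Finset γ) : Prop where
  side : N.Side J L A B
  conn : ∀ v ∈ jv N J A, ↑(jv N J A) ⊆ N.closure (insert v ↑A)
  thin : N.Thin A B T
  cl : ↑(jv N J T) ⊆ N.closure (↑T ∪ B)

namespace Spine

lemma ground (h : N.Spine J L A B T) : (T : Set γ) ⊆ N.E := h.thin.ground h.side

lemma jv_subset_jv (h : N.Spine J L A B T) : jv N J T ⊆ jv N J A := vs_mono h.thin.subset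

/-- All joints of `A` are spanned by `A ∪ B`: those of `T` by assumption, the others by
connectedness. Replacing `A` by its joints raises its rank by one but not that of the union, so the
connectivity goes up from one to two. -/
lemma rk_jv_union (h : N.Spine J L A B T) :
    N.rk (↑(jv N J A) ∪ B) + 2 = N.rk (jv N J A) + N.rk B := by
  have h1 := h.side.card_jv_left h.conn
  have h2 := h.side.lam
  rw [h.side.jointed.rk_jv]
  suffices N.rk (↑(jv N J A) ∪ B) = N.rk (↑A ∪ B) by omega
  have hAB : (↑A ∪ B : Set γ) ⊆ N.E := Set.union_subset h.side.left h.side.right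
  have h3 := h.side.jointed.subset_closure_jv h.side.left
  obtain ⟨v, hv⟩ : (jv N J T).Nonempty := by
    rw [← Finset.card_pos]
    have := h.side.rk_lt h.thin.subset h.thin.nonempty
    omega
  refine (rk_le_of_subset_closure (Set.union_subset ((h.conn v (h.jv_subset_jv hv)).trans
    (N.closure_subset_closure_of_subset_closure (Set.insert_subset ?_ ?_))) ?_)).antisymm
    (rk_le_of_subset_closure (Set.union_subset ?_ ?_))
  · exact N.closure_subset_closure (Set.union_subset_union_left _
      (Finset.coe_subset.2 h.thin.subset)) (h.cl hv)
  · exact Set.subset_union_left.trans (N.subset_closure _ hAB)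
  · exact Set.subset_union_right.trans (N.subset_closure _ hAB)
  · exact h3.trans (N.closure_subset_closure Set.subset_union_left)
  · exact Set.subset_union_right.trans (N.subset_closure _ (Set.union_subset
      (h.side.jointed.jv_ground A) h.side.right))

lemma rk_jv_thin_union (h : N.Spine J L A B T) : N.rk (↑(jv N J T) ∪ B) + 1 = T.card + N.rk B := by
  rw [← h.thin.rk_union h.side]
  have hTB : (↑T ∪ B : Set γ) ⊆ N.E := Set.union_subset h.ground h.side.right
  have h3 := h.side.jointed.subset_closure_jv h.ground
  congr 1
  refine (rk_le_of_subset_closure (Set.union_subset h.cl (Set.subset_union_right.trans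
    (N.subset_closure _ hTB)))).antisymm (rk_le_of_subset_closure (Set.union_subset (h3.trans
    (N.closure_subset_closure Set.subset_union_left)) (Set.subset_union_right.trans
    (N.subset_closure _ (Set.union_subset (h.side.jointed.jv_ground T) h.side.right)))))

lemma rk_add_le (h : N.Spine J L A B T) {U : Finset γ} (hU : U ⊆ jv N J A) :
    U.card + N.rk B ≤ N.rk (↑U ∪ B) + 2 := by
  have h1 := N.rk_submod' (U := ↑(jv N J A) ∪ B) (X := ↑(jv N J A)) (Y := ↑U ∪ B) (Z := ↑U)
    (Set.union_subset_union_right _ Set.subset_union_right) (Finset.coe_subset.2 hU)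
    Set.subset_union_left
  have h2 := h.rk_jv_union
  have h3 := h.side.jointed.rk_finset (U := U)
    ((Finset.coe_subset.2 hU).trans (h.side.jointed.jv_subset A))
  omega

/-- At least `|T| + 1` because `T` is independent and spans no joint; at most that because `V(T)`
and `B` share rank two at most, while `V(T) ∪ B` has only the rank of `T ∪ B`. -/
lemma card_jv (h : N.Spine J L A B T) : (jv N J T).card = T.card + 1 := by
  have h1 := h.side.rk_lt h.thin.subset h.thin.nonempty
  rw [h.thin.rk_eq h.side] at h1
  have h2 := h.rk_add_le h.jv_subset_jv
  have h3 := h.rk_jv_thin_union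
  omega

/-- The joints of `T` already use up the rank two that the joints of `A` share with `B`. -/
lemma notMem_closure (h : N.Spine J L A B T) {s : γ} (hs : s ∈ jv N J A) (hsT : s ∉ jv N J T) :
    s ∉ N.closure (↑(jv N J T) ∪ B) := by
  intro hcl
  have h1 := h.rk_add_le (U := insert s (jv N J T)) (Finset.insert_subset hs h.jv_subset_jv)
  rw [Finset.card_insert_of_notMem hsT, Finset.coe_insert, Set.insert_union,
    rk_insert_of_mem hcl, h.card_jv] at h1
  have := h.rk_jv_thin_union
  omega

/-- As `D = T ∪ F` does not span `y`, it has as many joints as edges and all degrees two. So `F`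
acts as a path closing `T` up at its leaves, and `y`, `y'` are the only joints of `A` on `F`. Thus
the pair `y`, `y'` tests skewness to `F ∪ {y}`, and this amounts to skewness to `F` and to `B`. -/
lemma skew_iff_of_circuit (h : N.Spine J L A B T) {F : Finset γ} (hFB : (F : Set γ) ⊆ B)
    (hD : N.IsCircuit ↑(T ∪ F)) {y y' : γ} (hy : y ∈ jv N J T) (hy' : y' ∈ jv N J T) (hyy' : y ≠ y')
    (hdy : deg (jends N J) T y = 1) (hdy' : deg (jends N J) T y' = 1)
    (hd2 : ∀ v ∈ jv N J T, v ≠ y → v ≠ y' → deg (jends N J) T v = 2)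
    (hyD : y ∉ N.closure ↑(T ∪ F)) {Q : Finset γ} (hQ : Q ⊆ A) :
    N.Skew Q B ↔ y' ∉ N.closure (insert y ↑Q) := by
  have hJ := h.side.jointed
  have hyE := hJ.jv_ground T hy
  have hFE : (F : Set γ) ⊆ N.E := hFB.trans h.side.right
  have hdisj : Disjoint T F := by
    rw [← Finset.disjoint_coe]
    exact h.side.disj.mono (Finset.coe_subset.2 h.thin.subset) hFB
  have hFne : F.Nonempty := by
    rw [Finset.nonempty_iff_ne_empty]
    rintro rfl
    rw [Finset.union_empty] at hD
    exact hD.not_indep (h.thin.indep h.side)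
  have hFi : N.Indep F := by
    refine hD.ssubset_indep (Finset.coe_ssubset.2
      (ssubset_of_disjoint_union (Finset.union_comm F T) hdisj.symm h.thin.nonempty))
  have hrkF : N.rk F = F.card := by rw [hFi.rk_eq_ncard, Set.ncard_coe_finset]
  have hyDv : y ∈ jv N J (T ∪ F) := vs_mono Finset.subset_union_left hy
  have hjD := hJ.jv_subset_closure_of_isCircuit hD hyDv
  have hrkD : N.rk ↑(T ∪ F) + 1 = (T ∪ F).card := by
    have h1 := hD.eRk_add_one_eq
    rw [← cast_rk, Set.encard_coe_eq_coe_finsetCard] at h1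
    exact_mod_cast h1
  have hcl : ((T ∪ F : Finset γ) : Set γ) ⊆ N.closure (jv N J (T ∪ F)) :=
    hJ.subset_closure_jv hD.subset_ground
  -- `D` with `y` spans exactly the space of the joints of `D`, and `y` adds one to the rank `|D| -
  -- 1`.
  have hcardD : (jv N J (T ∪ F)).card = (T ∪ F).card := by
    have h1 := rk_le_of_subset_closure hjD
    rw [rk_insert_of_notMem hyE hyD, hJ.rk_jv] at h1
    have h2 : N.rk (insert y ↑(T ∪ F)) ≤ N.rk (jv N J (T ∪ F)) := rk_le_of_subset_closure
      (Set.insert_subset (N.mem_closure_of_mem (Finset.mem_coe.2 hyDv) (hJ.jv_ground _)) hcl)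
    rw [rk_insert_of_notMem hyE hyD, hJ.rk_jv] at h2
    omega
  have hdegD : ∀ v ∈ jv N J (T ∪ F), deg (jends N J) (T ∪ F) v = 2 := fun v hv ↦
    deg_eq_two (fun e he ↦ hJ.card_jends_le_two (hD.subset_ground he))
      (fun e he w hw ↦ hJ.circuit_exists_ne hD he hw) hcardD.symm.le hv
  have hint : jv N J T ∩ jv N J F = {y, y'} := by
    ext v
    rw [Finset.mem_inter, Finset.mem_insert, Finset.mem_singleton]
    constructor
    · rintro ⟨hvT, hvF⟩
      by_contra! hne
      have h1 := hdegD v (vs_mono Finset.subset_union_left hvT)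
      have h2 := one_le_deg.2 hvF
      rw [deg_union hdisj, hd2 v hvT hne.1 hne.2] at h1
      omega
    · rintro (rfl | rfl)
      · have h1 := hdegD v hyDv
        rw [deg_union hdisj] at h1
        exact ⟨hy, one_le_deg.1 (by omega)⟩
      · have h1 := hdegD v (vs_mono Finset.subset_union_left hy')
        rw [deg_union hdisj] at h1
        exact ⟨hy', one_le_deg.1 (by omega)⟩
  have hcardF : (jv N J F).card = F.card + 1 := by
    have h1 := card_union_eq (jv N J T) (jv N J F)
    rw [← vs_union, hint, Finset.card_pair hyy', h.card_jv] at h1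
    have h2 := Finset.card_union_of_disjoint hdisj
    change (jv N J (T ∪ F)).card + 2 = _ at h1
    omega
  have hyF : y ∈ jv N J F := Finset.mem_of_mem_inter_right (hint ▸ Finset.mem_insert_self _ _)
  have hyF' : y' ∈ jv N J F := Finset.mem_of_mem_inter_right (by rw [hint]; simp)
  have hyFc : y ∉ N.closure F := fun hh ↦ hyD (N.closure_subset_closure
    (Finset.coe_subset.2 Finset.subset_union_right) hh)
  have hFcl := hJ.subset_closure_jv hFE
  have hrkyF : N.rk (insert y ↑F) = F.card + 1 := by rw [rk_insert_of_notMem hyE hyFc, hrkF]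
  have hjF : (jv N J F : Set γ) ⊆ N.closure (insert y ↑F) := by
    refine subset_closure_of_rk_le (hJ.jv_ground F) ?_
    rw [hrkyF, ← hcardF, ← hJ.rk_jv]
    exact rk_le_of_subset_closure (Set.union_subset (Set.insert_subset (N.mem_closure_of_mem
      (Finset.mem_coe.2 hyF) (hJ.jv_ground _)) hFcl) (N.subset_closure _ (hJ.jv_ground F)))
  -- A further common joint would be spanned by `F` and `y`, hence by `V(T) ∪ B`, against
  -- `Spine.notMem_closure`.
  have hFA : jv N J A ∩ jv N J F = {y, y'} := by
    rw [← hint]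
    refine Finset.Subset.antisymm (fun s hs ↦ ?_)
      (Finset.inter_subset_inter_right h.jv_subset_jv)
    rw [Finset.mem_inter] at hs ⊢
    refine ⟨?_, hs.2⟩
    by_contra hsT
    refine h.notMem_closure hs.1 hsT (N.closure_subset_closure_of_subset_closure ?_ (hjF hs.2))
    have hE : (↑(jv N J T) ∪ B : Set γ) ⊆ N.E := Set.union_subset (hJ.jv_ground T) h.side.right
    exact (Set.insert_subset (Set.mem_union_left _ (Finset.mem_coe.2 hy))
      (hFB.trans Set.subset_union_right)).trans (N.subset_closure _ hE)
  have hyA := h.jv_subset_jv hy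
  have hcardA := h.side.card_jv_left h.conn
  have hrkU : N.rk (↑(jv N J A) ∪ insert y ↑F) = N.rk A + F.card := by
    have h1 := card_union_eq (jv N J A) (jv N J F)
    rw [hFA, Finset.card_pair hyy', hcardA, hcardF] at h1
    have h2 := hJ.rk_finset (U := jv N J A ∪ jv N J F) (by
      rw [Finset.coe_union]
      exact Set.union_subset (hJ.jv_subset A) (hJ.jv_subset F))
    rw [Finset.coe_union] at h2
    have h3 : N.rk (↑(jv N J A) ∪ insert y ↑F) = N.rk (↑(jv N J A) ∪ ↑(jv N J F)) := by
      have hE : (↑(jv N J A) ∪ ↑(jv N J F) : Set γ) ⊆ N.E :=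
        Set.union_subset (hJ.jv_ground A) (hJ.jv_ground F)
      have hE' : (↑(jv N J A) ∪ insert y ↑F : Set γ) ⊆ N.E :=
        Set.union_subset (hJ.jv_ground A) (Set.insert_subset hyE hFE)
      refine (rk_le_of_subset_closure (Set.union_subset (Set.subset_union_left.trans
        (N.subset_closure _ hE)) (Set.insert_subset (N.mem_closure_of_mem
          (Set.mem_union_left _ hyA) hE) (hFcl.trans (N.closure_subset_closure
          Set.subset_union_right))))).antisymm (rk_le_of_subset_closure (Set.union_subset
          (Set.subset_union_left.trans (N.subset_closure _ hE'))
          (hjF.trans (N.closure_subset_closure Set.subset_union_right))))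
    omega
  have hnsF : ¬ N.Skew F A := by
    intro hs
    have := (hs.mono_right (Finset.coe_subset.2 h.thin.subset)).indep_union hFi
      (h.thin.indep h.side) F.finite_toSet T.finite_toSet
    rw [Set.union_comm, ← Finset.coe_union] at this
    exact hD.not_indep this
  -- Otherwise `A ∪ F` would reach the full rank `r(A) + |F|` computed above, although `F` is not
  -- skew to `A`.
  have hyAF : y ∉ N.closure (↑A ∪ ↑F) := by
    intro hh
    have h1 := rk_insert_of_mem hh
    have h2 := not_skew_iff.1 hnsF
    have h3 : N.rk (↑(jv N J A) ∪ insert y ↑F) ≤ N.rk (insert y (↑A ∪ ↑F)) := by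
      have hE : insert y (↑A ∪ ↑F : Set γ) ⊆ N.E :=
        Set.insert_subset hyE (Set.union_subset h.side.left hFE)
      refine rk_le_of_subset_closure (Set.union_subset ((h.conn y hyA).trans
        (N.closure_subset_closure (Set.insert_subset_insert Set.subset_union_left))) ?_)
      exact (Set.insert_subset_insert Set.subset_union_right).trans (N.subset_closure _ hE)
    rw [Set.union_comm] at h2
    omega
  have hE3 : insert y (F : Set γ) ⊆ N.E := Set.insert_subset hyE hFE
  -- The pair is compared with `F ∪ {y}`; then the free joint `y` is dropped, and finally `F` is
  -- exchanged for `B`.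
  rw [← h.side.skew_iff_notMem hyA (h.jv_subset_jv hy') hyy' (S := insert y ↑F)
    (N.mem_closure_of_mem (Set.mem_insert _ _) hE3) (hjF hyF') (by
      rw [hrkU, hrkyF, hJ.rk_jv, hcardA]; omega) hQ,
    skew_insert_iff hyE fun hh ↦ hyAF (N.closure_subset_closure (Set.union_subset_union_left _
      (Finset.coe_subset.2 hQ)) hh)]
  have hlam : N.rk B + N.rk A ≤ N.rk (B ∪ A) + 1 := by
    rw [Set.union_comm]
    have := h.side.lam
    omega
  exact skew_iff_of_not_skew hlam (Finset.coe_subset.2 hQ) hFB hnsF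

end Spine

end Matroid

/-! ### Relabelling vertices -/

namespace Multi

variable {α V W : Type*} {ends : α → Finset V} {c : V → W} {X : Finset α}

/-- Relabelling of the vertices. -/
noncomputable def mapEnds (c : V → W) (ends : α → Finset V) (e : α) : Finset W := (ends e).image c

lemma vs_mapEnds (c : V → W) (ends : α → Finset V) (X : Finset α) :
    vs (mapEnds c ends) X = (vs ends X).image c := by
  ext w
  simp only [mem_vs, mapEnds, Finset.mem_image]
  grind

lemma card_mapEnds {e : α} (hc : Set.InjOn c (ends e)) :
    (mapEnds c ends e).card = (ends e).card := Finset.card_image_of_injOn hc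

lemma card_vs_mapEnds (hc : Set.InjOn c (vs ends X)) :
    (vs (mapEnds c ends) X).card = (vs ends X).card := by
  rw [vs_mapEnds, Finset.card_image_of_injOn hc]

lemma isForest_mapEnds (hc : Set.InjOn c (vs ends X)) :
    IsForest (mapEnds c ends) X ↔ IsForest ends X :=
  forall₂_congr fun Z hZ ↦ by
    rw [card_vs_mapEnds (hc.mono (Finset.coe_subset.2 (vs_mono hZ)))]

lemma isPairForest_mapEnds {x y : V} (hc : Set.InjOn c (insert x (insert y ↑(vs ends X)))) :
    IsPairForest (mapEnds c ends) X (c x) (c y) ↔ IsPairForest ends X x y := by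
  refine and_congr (isForest_mapEnds (hc.mono fun v hv ↦ .inr (.inr hv)))
    (forall₂_congr fun Z hZ ↦ ?_)
  have h1 : vs (mapEnds c ends) Z ∪ {c x, c y} = (vs ends Z ∪ {x, y}).image c := by
    rw [vs_mapEnds, Finset.image_union, Finset.image_insert, Finset.image_singleton]
  rw [h1, Finset.card_image_of_injOn]
  refine hc.mono fun v hv ↦ ?_
  rw [Finset.coe_union, Finset.coe_pair] at hv
  rcases hv with hv | rfl | rfl
  exacts [.inr (.inr (vs_mono hZ hv)), .inl rfl, .inr (.inl rfl)]

end Multi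

/-! ### Leaves of the tree, and graphic sides -/

namespace Matroid

set_option linter.unusedSectionVars false

open Multi Jointed

variable {γ : Type*} {N : Matroid γ} [N.Finite] {J L : Set γ} {A T : Finset γ} {B : Set γ}

namespace Spine

/-- If `y` is a leaf of `T` at the edge `f`, then `y` is spanned by `B` if it is spanned together
with a part of `B` by `T - f`, but `f` is not. -/
lemma leaf_mem_closure (h : N.Spine J L A B T) {y k f : γ} (hf : f ∈ T)
    (hfe : jends N J f = {k, y}) (hyX : y ∉ jv N J (T.erase f)) {Q : Set γ} (hQ : Q ⊆ B)
    (hy : y ∈ N.closure (Q ∪ ↑(T.erase f))) (hfn : f ∉ N.closure (Q ∪ ↑(T.erase f))) :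
    y ∈ N.closure B := by
  have hJ := h.side.jointed
  have hyJ : y ∈ J := hJ.jends_subset_base (e := f) (by simp [hfe])
  have hXT : T.erase f ⊆ T := Finset.erase_subset f T
  have hXE : (↑(T.erase f) : Set γ) ⊆ N.E := (Finset.coe_subset.2 hXT).trans h.ground
  have hyn : y ∉ Q ∪ ↑(T.erase f) := by
    rintro (hh | hh)
    · exact h.side.joint_notMem_right hyJ (hQ hh)
    · exact h.side.joint_notMem_left hyJ (h.thin.subset (hXT hh))
  obtain ⟨C, hCs, hC, hyC⟩ := exists_isCircuit_of_mem_closure hy hyn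
  obtain ⟨C, rfl⟩ := (N.ground_finite.subset hC.subset_ground).exists_finset_coe
  have hCy : (C : Set γ) \ {y} ⊆ Q ∪ ↑(T.erase f) := fun x hx ↦ (hCs hx.1).resolve_left hx.2
  have hycl := hC.mem_closure_sdiff_singleton_of_mem hyC
  by_cases hCX : ∃ g ∈ C, g ∈ T.erase f
  · exfalso
    obtain ⟨g, hgC, hgX⟩ := hCX
    have hcard : (jv N J (T.erase f)).card ≤ (T.erase f).card + 1 := by
      have h1 : jv N J (T.erase f) ⊆ (jv N J T).erase y := fun v hv ↦
        Finset.mem_erase.2 ⟨by rintro rfl; exact hyX hv, vs_mono hXT hv⟩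
      have h2 := Finset.card_le_card h1
      have h3 : y ∈ jv N J T := mem_vs.2 ⟨f, hf, by simp [hfe]⟩
      have h4 := Finset.card_erase_add_one h3
      have h5 := Finset.card_erase_add_one hf
      have h6 := h.card_jv
      omega
    have hXi : N.Indep ↑(T.erase f) := (h.thin.indep h.side).subset (Finset.coe_subset.2 hXT)
    have hrkX : N.rk ↑(T.erase f) = (T.erase f).card := by
      rw [hXi.rk_eq_ncard, Set.ncard_coe_finset]
    have hXlt := h.side.rk_lt (hXT.trans h.thin.subset) ⟨g, hgX⟩
    -- If `T - f` missed both ends of `f`, it would have no more vertices than edges, but a nonempty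
    -- independent part of `A` has a surplus vertex.
    have hkX : k ∈ jv N J (T.erase f) := by
      by_contra hk
      have h1 : jv N J (T.erase f) ⊆ ((jv N J T).erase y).erase k := fun v hv ↦
        Finset.mem_erase.2 ⟨by rintro rfl; exact hk hv,
          Finset.mem_erase.2 ⟨by rintro rfl; exact hyX hv, vs_mono hXT hv⟩⟩
      have h2 := Finset.card_le_card h1
      have h3 : y ∈ jv N J T := mem_vs.2 ⟨f, hf, by simp [hfe]⟩
      have hky : k ≠ y := by
        rintro rfl
        have := h.side.card_jends (h.thin.subset hf)
        rw [hfe] at this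
        simp at this
      have h3' : k ∈ (jv N J T).erase y :=
        Finset.mem_erase.2 ⟨hky, mem_vs.2 ⟨f, hf, by simp [hfe]⟩⟩
      have h4 := Finset.card_erase_add_one h3
      have h4' := Finset.card_erase_add_one h3'
      have h5 := Finset.card_erase_add_one hf
      have h6 := h.card_jv
      omega
    obtain ⟨v, hv⟩ := hJ.jends_nonempty (h.side.indep g (h.thin.subset (hXT hgX)))
    have hvX : v ∈ jv N J (T.erase f) := ends_subset_vs hgX hv
    have hvn : v ∉ N.closure ↑(T.erase f) := fun hh ↦ h.side.bal v (hJ.jv_subset _ hvX)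
      (N.closure_subset_closure (Finset.coe_subset.2 (hXT.trans h.thin.subset)) hh)
    -- `T - f` has at most one vertex more than edges, so any one of its joints completes it to a
    -- spanning set for all of them.
    have hspan : (jv N J (T.erase f) : Set γ) ⊆ N.closure (insert v ↑(T.erase f)) := by
      refine subset_closure_of_rk_le (hJ.jv_ground _) ?_
      have hle : N.rk (insert v ↑(T.erase f) ∪ ↑(jv N J (T.erase f))) ≤
          N.rk (jv N J (T.erase f)) := rk_le_of_subset_closure (Set.union_subset
          (Set.insert_subset (N.mem_closure_of_mem hvX (hJ.jv_ground _))
          (hJ.subset_closure_jv hXE)) (N.subset_closure _ (hJ.jv_ground _)))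
      rw [rk_insert_of_notMem (hJ.jv_ground _ hvX) hvn]
      rw [hJ.rk_jv] at hle
      omega
    have hCcl : (C : Set γ) ⊆ N.closure (Q ∪ ↑(T.erase f)) := by
      intro x hx
      by_cases hxy : x = y
      · rwa [hxy]
      · exact N.mem_closure_of_mem' (hCy ⟨hx, hxy⟩) (hC.subset_ground hx)
    have hyCv : y ∈ jv N J C := mem_vs.2 ⟨y, hyC, by simp [hJ.jends_of_mem hyJ]⟩
    -- The circuit contains the joint `y`, so it spans all its joints, among them an end `v` of `g`.
    -- From `v` the edges of `T - f` reach `k`, and with `y` this spans `f`, a contradiction.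
    have hvC := hJ.jv_subset_closure_of_isCircuit hC hyCv (mem_vs.2 ⟨g, hgC, hv⟩)
    rw [Set.insert_eq_of_mem hyC] at hvC
    have hvQ := N.closure_subset_closure_of_subset_closure hCcl hvC
    have hkQ : k ∈ N.closure (Q ∪ ↑(T.erase f)) :=
      N.closure_subset_closure_of_subset_closure (Set.insert_subset hvQ
        (Set.subset_union_right.trans (N.subset_closure _
          (Set.union_subset (hQ.trans h.side.right) hXE)))) (hspan hkX)
    refine hfn (N.closure_subset_closure_of_subset_closure ?_ (hJ.mem_closure_jends (h.ground hf)))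
    rw [hfe, Finset.coe_pair]
    exact Set.insert_subset hkQ (Set.singleton_subset_iff.2 hy)
  · push Not at hCX
    refine N.closure_subset_closure (fun x hx ↦ ?_) hycl
    exact (hCy hx).elim (fun hh ↦ hQ hh) fun hh ↦ (hCX x hx.1 hh).elim

/-- The attempt is to contract `T - f`, where `f` is the leaf edge at `y`, and to use `y` as the
tip. It succeeds if `y` and `f` have the same effect over `Q ∪ (T - f)` for every independent `Q` in
`B`. If for some `Q` only `y` is spanned, then `B` spans `y`. If only `f` is spanned, there is a
circuit through `T` and part of `B` that does not span `y`, and `Spine.skew_iff_of_circuit` applies.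
-/
lemma leaf (h : N.Spine J L A B T) {y y' : γ} (hy : y ∈ jv N J T) (hy' : y' ∈ jv N J T)
    (hyy' : y ≠ y') (hdy : deg (jends N J) T y = 1) (hdy' : deg (jends N J) T y' = 1)
    (hd2 : (∀ v ∈ jv N J T, deg (jends N J) T v ≤ 2) →
      ∀ v ∈ jv N J T, v ≠ y → v ≠ y' → deg (jends N J) T v = 2) :
    N.LoSide L B A ∨ y ∈ N.closure B ∨
      ∀ Q ⊆ A, N.Skew Q B ↔ y' ∉ N.closure (insert y ↑Q) := by
  have hJ := h.side.jointed
  have hyJ := hJ.jv_subset T hy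
  have hyE := hJ.jv_ground T hy
  obtain ⟨f, hf, hyf⟩ := mem_vs.1 hy
  obtain ⟨k, hky, hfe⟩ := h.side.jends_eq_pair (h.thin.subset hf) hyf
  rw [Finset.pair_comm] at hfe
  have hXT : T.erase f ⊆ T := Finset.erase_subset f T
  have hXE : (↑(T.erase f) : Set γ) ⊆ N.E := (Finset.coe_subset.2 hXT).trans h.ground
  have hins : insert f (↑(T.erase f) : Set γ) = T := by
    rw [Finset.coe_erase, Set.insert_sdiff_singleton, Set.insert_eq_of_mem (Finset.mem_coe.2 hf)]
  have hyX : y ∉ jv N J (T.erase f) := by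
    intro hh
    obtain ⟨g, hg, hyg⟩ := mem_vs.1 hh
    have : 1 < deg (jends N J) T y := Finset.one_lt_card.2 ⟨f, by simp [hf, hyf], g, by
      simp [hXT hg, hyg], (Finset.ne_of_mem_erase hg).symm⟩
    omega
  have hyT : y ∉ N.closure T := fun hh ↦ h.side.bal y hyJ
    (N.closure_subset_closure (Finset.coe_subset.2 h.thin.subset) hh)
  have hyXc : y ∉ N.closure ↑(T.erase f) := fun hh ↦ hyT
    (N.closure_subset_closure (Finset.coe_subset.2 hXT) hh)
  by_cases hall : ∀ Q ⊆ B, N.Indep Q → N.rk (Q ∪ insert y ↑(T.erase f)) = N.rk (Q ∪ ↑T)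
  · left
    have hXi := (h.thin.indep h.side).subset (Finset.coe_subset.2 hXT)
    have hXs := h.thin.skew _ (Finset.erase_ssubset hf)
    have hyXm : y ∉ (↑(T.erase f) : Set γ) := fun hh ↦ hyXc (N.mem_closure_of_mem hh hXE)
    refine hJ.loSide h.side.right hyJ hyXm (h.side.joint_notMem_right hyJ)
      (hXi.insert_indep_iff.2 (.inl ⟨hyE, hyXc⟩)) hXs fun Q hQ hQi ↦ ?_
    have e1 : N.rk (insert y ↑(T.erase f)) = N.rk T := by
      rw [← hins, rk_insert_of_notMem hyE hyXc, rk_insert_of_notMem (h.ground hf)]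
      rw [Finset.coe_erase]
      exact (h.thin.indep h.side).notMem_closure_sdiff_of_mem hf
    rw [h.thin.skew_iff h.side hQ, Skew, Skew, e1, hall Q hQ hQi]
  push Not at hall
  obtain ⟨Q, hQ, hQi, hne⟩ := hall
  right
  have e1 : Q ∪ insert y ↑(T.erase f) = insert y (Q ∪ ↑(T.erase f)) := Set.union_insert
  have e2 : Q ∪ ↑T = insert f (Q ∪ ↑(T.erase f)) := by rw [← hins, Set.union_insert]
  rw [e1, e2] at hne
  by_cases hyc : y ∈ N.closure (Q ∪ ↑(T.erase f))
  · left
    refine h.leaf_mem_closure hf hfe hyX hQ hyc fun hfc ↦ hne ?_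
    rw [rk_insert_of_mem hyc, rk_insert_of_mem hfc]
  right
  have hfc : f ∈ N.closure (Q ∪ ↑(T.erase f)) := by
    by_contra hfc
    exact hne (by rw [rk_insert_of_notMem hyE hyc, rk_insert_of_notMem (h.ground hf) hfc])
  have hfQ : f ∉ Q ∪ ↑(T.erase f) := by
    rintro (hh | hh)
    · exact Set.disjoint_left.1 h.side.disj (h.thin.subset hf) (hQ hh)
    · simp at hh
  obtain ⟨D, hDs, hD, hfD⟩ := exists_isCircuit_of_mem_closure hfc hfQ
  obtain ⟨D, rfl⟩ := (N.ground_finite.subset hD.subset_ground).exists_finset_coe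
  have hDs' : (D : Set γ) ⊆ Q ∪ ↑T := e2 ▸ hDs
  obtain ⟨F, hFQ, hTF⟩ : ∃ F : Finset γ, (F : Set γ) ⊆ Q ∧ T ∪ F = D := by
    have hDTi : ((D \ T : Finset γ) : Set γ) ⊆ Q := by
      intro x hx
      rw [Finset.coe_sdiff] at hx
      exact (hDs' hx.1).resolve_right hx.2
    have hTD : D ∩ T = T := by
      by_contra hne
      have hsk := h.thin.skew (D ∩ T) (Finset.inter_subset_right.ssubset_of_ne hne)
      have hsp : D \ T ⊂ D := Finset.sdiff_subset.ssubset_of_ne fun hh ↦ by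
        have h1 : f ∈ D \ T := by rw [hh]; exact hfD
        exact (Finset.mem_sdiff.1 h1).2 hf
      have := (hsk.mono_right (hDTi.trans hQ)).indep_union
        ((h.thin.indep h.side).subset (Finset.coe_subset.2 Finset.inter_subset_right))
        (hD.ssubset_indep (Finset.coe_ssubset.2 hsp)) (Finset.finite_toSet _)
        (Finset.finite_toSet _)
      rw [← Finset.coe_union, Finset.union_comm, Finset.sdiff_union_inter] at this
      exact hD.not_indep this
    refine ⟨D \ T, hDTi, ?_⟩
    rw [Finset.union_sdiff_self_eq_union, Finset.union_eq_right]
    exact Finset.inter_eq_right.1 hTD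
  subst hTF
  have hyD : y ∉ N.closure ↑(T ∪ F) := by
    refine fun hh ↦ hyc (N.closure_subset_closure_of_subset_closure ?_ hh)
    refine hDs.trans (Set.insert_subset hfc (N.subset_closure _
      (Set.union_subset (hQ.trans h.side.right) hXE)))
  -- A degree above two would leave `D` with fewer joints than edges. But `D` with the unspanned
  -- joint `y` has rank `|D|`, which is at most the number of joints of `D`.
  have hdeg : ∀ v ∈ jv N J T, deg (jends N J) T v ≤ 2 := by
    intro v hv
    have hvD : v ∈ jv N J (T ∪ F) := vs_mono Finset.subset_union_left hv
    by_contra! h3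
    have h1 : (jv N J (T ∪ F)).card < (T ∪ F).card := by
      have hsum := sum_deg (ends := jends N J) (T ∪ F)
      have hle := sum_ends_le (ends := jends N J) (X := T ∪ F)
        fun e he ↦ hJ.card_jends_le_two (hD.subset_ground he)
      have hlt : ∑ v ∈ jv N J (T ∪ F), 2 < ∑ v ∈ jv N J (T ∪ F), deg (jends N J) (T ∪ F) v :=
        Finset.sum_lt_sum (fun w hw ↦ two_le_deg (fun e he w hw ↦ hJ.circuit_exists_ne hD he hw) hw)
          ⟨v, hvD, h3.trans_le (Finset.card_le_card (Finset.filter_subset_filter _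
            Finset.subset_union_left))⟩
      rw [hsum] at hlt
      simp at hlt
      omega
    have hyDv : y ∈ jv N J (T ∪ F) := vs_mono Finset.subset_union_left hy
    have h2 : N.rk (insert y ↑(T ∪ F)) ≤ N.rk (jv N J (T ∪ F)) := rk_le_of_subset_closure
      (Set.insert_subset (N.mem_closure_of_mem (Finset.mem_coe.2 hyDv) (hJ.jv_ground _))
      (hJ.subset_closure_jv hD.subset_ground))
    rw [rk_insert_of_notMem hyE hyD, hJ.rk_jv] at h2
    have hrkD : N.rk ↑(T ∪ F) + 1 = (T ∪ F).card := by
      have h1 := hD.eRk_add_one_eq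
      rw [← cast_rk, Set.encard_coe_eq_coe_finsetCard] at h1
      exact_mod_cast h1
    omega
  exact fun R hR ↦ h.skew_iff_of_circuit (hFQ.trans hQ) hD hy hy' hyy' hdy hdy' (hd2 hdeg) hyD hR

end Spine

namespace Side

/-- A side with a pair of joints in the guts is graphic. -/
lemma grSide (h : N.Side J L A B) {x y : γ} (hx : x ∈ J) (hy : y ∈ J) (hxy : x ≠ y)
    (hK : ∀ Q ⊆ A, N.Skew Q B ↔ y ∉ N.closure (insert x ↑Q)) : N.GrSide A B := by
  have hJ := h.jointed
  -- The vertices of a graphic side are natural numbers, so the finitely many joints are renamed by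
  -- an injection.
  obtain ⟨c, hc⟩ := Set.countable_iff_exists_injOn.1 hJ.finite.countable
  have hQE : ∀ {Q : Finset γ}, Q ⊆ A → (Q : Set γ) ⊆ N.E := fun hQ e he ↦ h.left (hQ he)
  have hfor : ∀ Q ⊆ A, N.Indep Q ↔ IsForest (jends N J) Q := by
    intro Q hQ
    constructor
    · intro hi Z hZ hne
      have h1 := h.rk_lt (hZ.trans hQ) hne
      rwa [(hi.subset (Finset.coe_subset.2 hZ)).rk_eq_ncard, Set.ncard_coe_finset] at h1
    · intro hF
      by_contra hi
      obtain ⟨C, hCQ, hC⟩ := exists_isCircuit_of_not_indep (hQE hQ) hi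
      have h1 := hF C hCQ (by exact_mod_cast hC.nonempty)
      have h2 := card_vs_le_of_deg (ends := jends N J) (X := C)
        (fun e he ↦ (h.card_jends (hQ (hCQ he))).le) fun e he w hw ↦ hJ.circuit_exists_ne hC he hw
      omega
  have hpair : ∀ Q ⊆ A, N.Indep Q ∧ N.Skew Q B ↔ IsPairForest (jends N J) Q x y := by
    intro Q hQ
    unfold IsPairForest
    rw [← hfor Q hQ, hK Q hQ]
    refine and_congr_right fun hi ↦ ⟨fun hn Z hZ ↦ ?_, fun hn hcl ↦ ?_⟩
    · have hxZ : x ∉ N.closure Z := fun hh ↦ h.bal x hx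
        (N.closure_subset_closure (Finset.coe_subset.2 (hZ.trans hQ)) hh)
      have hyZ : y ∉ N.closure (insert x ↑Z) := fun hh ↦ hn
        (N.closure_subset_closure (Set.insert_subset_insert (Finset.coe_subset.2 hZ)) hh)
      have h1 := rk_insert_of_notMem (hJ.base.subset_ground hy) hyZ
      rw [rk_insert_of_notMem (hJ.base.subset_ground hx) hxZ,
        (hi.subset (Finset.coe_subset.2 hZ)).rk_eq_ncard, Set.ncard_coe_finset] at h1
      have hUJ : (↑(jv N J Z ∪ {x, y}) : Set γ) ⊆ J := by
        rw [Finset.coe_union, Finset.coe_pair]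
        exact Set.union_subset (hJ.jv_subset Z)
          (Set.insert_subset hx (Set.singleton_subset_iff.2 hy))
      have hUE := hUJ.trans hJ.base.subset_ground
      have h2 : N.rk (insert y (insert x ↑Z)) ≤ N.rk ↑(jv N J Z ∪ {x, y}) := by
        refine rk_le_of_subset_closure (Set.insert_subset (N.mem_closure_of_mem ?_ hUE)
          (Set.insert_subset (N.mem_closure_of_mem ?_ hUE)
          ((hJ.subset_closure_jv (hQE (hZ.trans hQ))).trans (N.closure_subset_closure ?_))))
        · simp
        · simp
        · exact Finset.coe_subset.2 Finset.subset_union_left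
      rw [hJ.rk_finset hUJ] at h2
      change _ < (jv N J Z ∪ {x, y}).card
      omega
    · have hyn : y ∉ insert x (Q : Set γ) := by
        rintro (hh | hh)
        · exact hxy hh.symm
        · exact h.joint_notMem_left hy (hQ hh)
      obtain ⟨C, hCs, hC, hyC⟩ := exists_isCircuit_of_mem_closure hcl hyn
      obtain ⟨C, rfl⟩ := (N.ground_finite.subset hC.subset_ground).exists_finset_coe
      have hxC : x ∈ C := by
        by_contra hxC
        refine h.bal y hy (N.closure_subset_closure ?_ (hC.mem_closure_sdiff_singleton_of_mem hyC))
        intro e he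
        rcases hCs he.1 with rfl | rfl | hh
        · exact (he.2 rfl).elim
        · exact (hxC he.1).elim
        · exact hQ hh
      have hZQ : C \ {x, y} ⊆ Q := by
        intro e he
        simp only [Finset.mem_sdiff, Finset.mem_insert, Finset.mem_singleton, not_or] at he
        rcases hCs he.1 with rfl | rfl | hh
        exacts [(he.2.2 rfl).elim, (he.2.1 rfl).elim, hh]
      have hxyC : {x, y} ⊆ C := Finset.insert_subset hxC (Finset.singleton_subset_iff.2 hyC)
      have hCeq := Finset.sdiff_union_of_subset hxyC
      have h1 := hn _ hZQ
      have hv : vs (jends N J) (C \ {x, y}) ∪ {x, y} = vs (jends N J) C := by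
        conv_rhs => rw [← hCeq]
        rw [vs_union]
        congr 1
        ext v
        simp [mem_vs, hJ.jends_of_mem hx, hJ.jends_of_mem hy]
      -- The circuit contains both joints `x` and `y`, which count as loops with one end each. The
      -- double count then bounds its vertices by one more than its remaining edges, so `x` and `y`
      -- are not separated.
      have h2 := Finset.card_nsmul_le_sum (vs (jends N J) C) (fun v ↦ deg (jends N J) C v) 2
        fun v hv ↦ two_le_deg (fun e he w hw ↦ hJ.circuit_exists_ne hC he hw) hv
      rw [sum_deg, smul_eq_mul, ← Finset.sum_sdiff hxyC, Finset.sum_pair hxy, hJ.jends_of_mem hx,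
        hJ.jends_of_mem hy, Finset.card_singleton, Finset.card_singleton,
        Finset.sum_congr rfl fun e he ↦ h.card_jends (hQ (hZQ he)), Finset.sum_const, smul_eq_mul,
        ← hv] at h2
      omega
  refine ⟨mapEnds c (jends N J), c x, c y, fun hh ↦ hxy (hc hx hy hh), fun e he ↦ ?_,
    fun Q hQ ↦ ?_, fun Q hQ ↦ ?_⟩
  · rw [card_mapEnds (hc.mono hJ.jends_subset_base), h.card_jends he]
  · rw [hfor Q hQ, isForest_mapEnds (hc.mono (hJ.jv_subset Q))]
  · rw [hpair Q hQ, isPairForest_mapEnds (hc.mono (Set.insert_subset hx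
      (Set.insert_subset hy (hJ.jv_subset Q))))]

/-- When no contraction works, both leaves of `T` are spanned by `B`, or one of them comes with a
closing circuit. In either case the pair of leaves tests skewness to `B`. -/
lemma loSide_or_grSide_of_conn (h : N.Side J L A B)
    (hc : ∀ v ∈ jv N J A, ↑(jv N J A) ⊆ N.closure (insert v ↑A)) :
    N.LoSide L B A ∨ N.GrSide A B := by
  obtain ⟨T, hT⟩ := h.exists_thin
  by_cases hcl : ↑(jv N J T) ⊆ N.closure (↑T ∪ B)
  swap
  · obtain ⟨k, hk, hkc⟩ := Set.not_subset.1 hcl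
    exact .inl (hT.loSide_of_notMem h hk hkc)
  have hs : N.Spine J L A B T := ⟨h, hc, hT, hcl⟩
  obtain ⟨y, hy, y', hy', hyy', hdy, hdy', hd2⟩ := exists_two_leaves (ends := jends N J) (X := T)
    (fun e he ↦ h.card_jends (hT.subset he)) hs.card_jv
  have hyA := hs.jv_subset_jv hy
  have hyA' := hs.jv_subset_jv hy'
  have hyJ := h.jointed.jv_subset _ hyA
  have hyJ' := h.jointed.jv_subset _ hyA'
  rcases hs.leaf hy hy' hyy' hdy hdy' hd2 with h1 | h1 | h1
  · exact .inl h1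
  · rcases hs.leaf hy' hy hyy'.symm hdy' hdy (fun hh v hv h1 h2 ↦ hd2 hh v hv h2 h1) with
      h2 | h2 | h2
    · exact .inl h2
    · exact .inr (h.grSide hyJ hyJ' hyy' fun Q hQ ↦
        h.skew_iff_notMem hyA hyA' hyy' h1 h2 hs.rk_jv_union hQ)
    · exact .inr (h.grSide hyJ' hyJ hyy'.symm h2)
  · exact .inr (h.grSide hyJ hyJ' hyy' h1)

end Side

end Matroid

/-! ### Forests glued at a vertex -/

namespace Multi

variable {α V : Type*} {ends : α → Finset V} {P Q : Finset α} {U W : Finset V} {x y z : V}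

lemma card_add_le_of_inter {S T : Finset V} (h : S ∩ T ⊆ {z}) :
    S.card + T.card ≤ (S ∪ T).card + 1 := by
  have h1 := card_union_eq S T
  have h2 := Finset.card_le_card h
  rw [Finset.card_singleton] at h2
  omega

lemma isForest_union (hd : Disjoint P Q) (h : vs ends P ∩ vs ends Q ⊆ {z}) :
    IsForest ends (P ∪ Q) ↔ IsForest ends P ∧ IsForest ends Q := by
  refine ⟨fun hF ↦ ⟨hF.mono Finset.subset_union_left, hF.mono Finset.subset_union_right⟩,
    fun ⟨hP, hQ⟩ Z hZ hne ↦ ?_⟩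
  obtain ⟨h1, h2⟩ := card_split hZ hd
  have h3 := card_add_le_of_inter (S := vs ends (Z ∩ P)) (T := vs ends (Z ∩ Q)) (z := z)
    ((Finset.inter_subset_inter (vs_mono Finset.inter_subset_right)
      (vs_mono Finset.inter_subset_right)).trans h)
  rw [← vs_union, ← h1] at h3
  rcases (Z ∩ P).eq_empty_or_nonempty with h4 | h4
  · rw [h4, Finset.empty_union] at h1
    exact hQ Z (by rw [h1]; exact Finset.inter_subset_right) hne
  rcases (Z ∩ Q).eq_empty_or_nonempty with h5 | h5
  · rw [h5, Finset.union_empty] at h1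
    exact hP Z (by rw [h1]; exact Finset.inter_subset_right) hne
  have := hP _ Finset.inter_subset_right h4
  have := hQ _ Finset.inter_subset_right h5
  omega

/-- A connection from `x` to `y` must pass through the cut vertex `z`, so it is broken exactly when
one of its halves is. The two edge sets are thus composed in series. -/
lemma isPairForest_union (hd : Disjoint P Q) (hP : vs ends P ⊆ U) (hQ : vs ends Q ⊆ W)
    (hUW : U ∩ W = {z}) (hx : x ∈ U) (hy : y ∈ W) (hPF : IsForest ends P)
    (hQF : IsForest ends Q) :
    IsPairForest ends (P ∪ Q) x y ↔ IsPairForest ends P x z ∨ IsPairForest ends Q z y := by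
  have hz : z ∈ U ∧ z ∈ W := Finset.mem_inter.1 (hUW ▸ Finset.mem_singleton_self z)
  have hvU : ∀ {Z}, Z ⊆ P → ∀ v ∈ vs ends Z, v ∈ U := fun h v hv ↦ hP (vs_mono h hv)
  have hvW : ∀ {Z}, Z ⊆ Q → ∀ v ∈ vs ends Z, v ∈ W := fun h v hv ↦ hQ (vs_mono h hv)
  have hUW' : ∀ v ∈ U, v ∈ W → v = z := fun v h1 h2 ↦
    Finset.mem_singleton.1 (hUW ▸ Finset.mem_inter.2 ⟨h1, h2⟩)
  constructor
  · intro h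
    by_contra! hcon
    obtain ⟨h1, h2⟩ := hcon
    unfold IsPairForest at h1 h2
    push Not at h1 h2
    obtain ⟨Z₁, hZ₁, hc₁⟩ := h1 hPF
    obtain ⟨Z₂, hZ₂, hc₂⟩ := h2 hQF
    have h3 := h.2 (Z₁ ∪ Z₂) (Finset.union_subset_union hZ₁ hZ₂)
    rw [Finset.card_union_of_disjoint (Finset.disjoint_of_subset_left hZ₁
      (Finset.disjoint_of_subset_right hZ₂ hd)), vs_union] at h3
    have h4 := card_union_eq (vs ends Z₁ ∪ {x, z}) (vs ends Z₂ ∪ {z, y})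
    have h5 : 1 ≤ ((vs ends Z₁ ∪ {x, z}) ∩ (vs ends Z₂ ∪ {z, y})).card :=
      Finset.card_pos.2 ⟨z, by simp⟩
    have h6 : (vs ends Z₁ ∪ vs ends Z₂ ∪ {x, y}).card ≤
        ((vs ends Z₁ ∪ {x, z}) ∪ (vs ends Z₂ ∪ {z, y})).card :=
      Finset.card_le_card (by grind)
    omega
  · have key : ∀ {P Q : Finset α} {U W : Finset V} {x y : V}, Disjoint P Q → IsForest ends P →
        IsForest ends Q → (∀ {Z}, Z ⊆ P → ∀ v ∈ vs ends Z, v ∈ U) →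
        (∀ {Z}, Z ⊆ Q → ∀ v ∈ vs ends Z, v ∈ W) → x ∈ U → y ∈ W → z ∈ U → z ∈ W →
        (∀ v ∈ U, v ∈ W → v = z) → IsPairForest ends P x z →
        ∀ Z ⊆ P ∪ Q, Z.card + 1 < (vs ends Z ∪ {x, y}).card := by
      intro P Q U W x y hd hPF hQF hvU hvW hx hy hzU hzW hUW h Z hZ
      obtain ⟨h1, h2⟩ := card_split hZ hd
      have h3 : vs ends Z = vs ends (Z ∩ P) ∪ vs ends (Z ∩ Q) := by
        conv_lhs => rw [h1]
        rw [vs_union]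
      have hU := hvU (Z := Z ∩ P) Finset.inter_subset_right
      have hW := hvW (Z := Z ∩ Q) Finset.inter_subset_right
      have h4 := h.2 (Z ∩ P) Finset.inter_subset_right
      have h5 := isForest_card_union_singleton (hQF.mono (Finset.inter_subset_right (s₁ := Z))) y
      have h6 := isForest_card_union_singleton (hPF.mono (Finset.inter_subset_right (s₁ := Z))) x
      -- If `z` occurs on the `Q` part, the two vertex counts overlap in `z` only and the extra unit
      -- from the `P` part survives. If not, the parts are vertex-disjoint and each has its own
      -- surplus vertex.
      by_cases hzQ : z ∈ vs ends (Z ∩ Q) ∪ {y}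
      · have h7 := card_add_le_of_inter (S := vs ends (Z ∩ P) ∪ {x, z})
          (T := vs ends (Z ∩ Q) ∪ {y}) (z := z) (by
            intro v hv
            simp only [Finset.mem_inter, Finset.mem_union, Finset.mem_insert,
              Finset.mem_singleton] at hv
            refine Finset.mem_singleton.2 (hUW v ?_ ?_)
            · rcases hv.1 with h | rfl | rfl
              exacts [hU v h, hx, hzU]
            · rcases hv.2 with h | rfl
              exacts [hW v h, hy])
        have h8 : (vs ends (Z ∩ P) ∪ {x, z}) ∪ (vs ends (Z ∩ Q) ∪ {y}) = vs ends Z ∪ {x, y} := by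
          rw [h3]
          ext v
          simp only [Finset.mem_union, Finset.mem_insert, Finset.mem_singleton] at hzQ ⊢
          constructor
          · rintro ((h | rfl | rfl) | h | rfl) <;> tauto
          · tauto
        rw [h8] at h7
        omega
      · have h7 : Disjoint (vs ends (Z ∩ P) ∪ {x}) (vs ends (Z ∩ Q) ∪ {y}) := by
          rw [Finset.disjoint_left]
          intro v hv hv'
          have : v = z := by
            simp only [Finset.mem_union, Finset.mem_singleton] at hv hv'
            refine hUW v ?_ ?_
            · rcases hv with h | rfl
              exacts [hU v h, hx]
            · rcases hv' with h | rfl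
              exacts [hW v h, hy]
          exact hzQ (this ▸ hv')
        have h8 := Finset.card_union_of_disjoint h7
        have h9 : (vs ends (Z ∩ P) ∪ {x}) ∪ (vs ends (Z ∩ Q) ∪ {y}) = vs ends Z ∪ {x, y} := by
          rw [h3]
          grind
        rw [h9] at h8
        omega
    have hF : IsForest ends (P ∪ Q) := (isForest_union hd (z := z) (by
      rw [← hUW]
      exact Finset.inter_subset_inter hP hQ)).2 ⟨hPF, hQF⟩
    rintro (h | h)
    · exact ⟨hF, key hd hPF hQF hvU hvW hx hy hz.1 hz.2 hUW' h⟩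
    · refine ⟨hF, fun Z hZ ↦ ?_⟩
      rw [Finset.pair_comm]
      exact key hd.symm hQF hPF hvW hvU hy hx hz.2 hz.1 (fun v h1 h2 ↦ hUW' v h2 h1) h.symm Z
        (by rwa [Finset.union_comm])

end Multi

/-! ### Disconnected sides: contraction of one part and series composition -/

namespace Matroid

set_option linter.unusedSectionVars false

open Multi Jointed

variable {γ : Type*} {N : Matroid γ} [N.Finite] {J L : Set γ} {A P Q : Finset γ} {B I : Set γ}

/-- A basis of `Q` is contracted in place of `Q`, since contractions that keep the joints are
available for independent sets. For sets disjoint from it the ranks are those of `N / Q`. -/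
lemma rk_contract_of_isBasis {Q X : Set γ} (hI : N.IsBasis I Q) (hX : X ⊆ N.E)
    (hd : Disjoint X I) : (N ／ I).rk X + N.rk Q = N.rk (X ∪ Q) := by
  obtain ⟨K, hK⟩ := (N ／ I).exists_isBasis X (by
    rw [contract_ground]; exact fun e he ↦ ⟨hX he, fun h ↦ Set.disjoint_left.1 hd he h⟩)
  have h1 := hI.indep.union_isBasis_union_of_contract_isBasis hK
  have hKE := hK.indep.subset_ground
  have hKI : Disjoint K I := hd.mono_left hK.subset
  have hcl : N.closure (X ∪ I) = N.closure (X ∪ Q) := by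
    rw [← closure_union_closure_right_eq, hI.closure_eq_closure, closure_union_closure_right_eq]
  have h2 : (N ／ I).rk X = K.ncard := by rw [rk, hK.eRk_eq_encard]; rfl
  have h3 : N.rk Q = I.ncard := by rw [rk, hI.eRk_eq_encard]; rfl
  have h4 : N.rk (X ∪ Q) = (K ∪ I).ncard := by
    rw [← rk_closure, ← hcl, rk_closure, rk, h1.eRk_eq_encard]; rfl
  rw [h2, h3, h4, Set.ncard_union_eq hKI ((N.ground_finite.subset (h1.indep.subset_ground)).subset
    Set.subset_union_left) ((N.ground_finite.subset (h1.indep.subset_ground)).subset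
    Set.subset_union_right)]

/-- A side with two parts that have no common joint. -/
structure SplitSide (N : Matroid γ) (J L : Set γ) (P Q : Finset γ) (B : Set γ) : Prop where
  side : N.Side J L (P ∪ Q) B
  disj : Disjoint P Q
  nonempty_left : P.Nonempty
  nonempty_right : Q.Nonempty
  conn : ∀ D ⊂ P ∪ Q, D.Nonempty →
    N.rk (↑(P ∪ Q) ∪ B) < N.rk D + N.rk (↑((P ∪ Q) \ D) ∪ B)
  jv_disj : Disjoint (jv N J P) (jv N J Q)

namespace SplitSide

lemma symm (h : N.SplitSide J L P Q B) : N.SplitSide J L Q P B := by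
  obtain ⟨h1, h2, h3, h4, h5, h6⟩ := h
  rw [Finset.union_comm] at h1 h5
  exact ⟨h1, h2.symm, h4, h3, h5, h6.symm⟩

lemma left_subset (h : N.SplitSide J L P Q B) : (P : Set γ) ⊆ N.E :=
  (Finset.coe_subset.2 Finset.subset_union_left).trans h.side.left

lemma skew (h : N.SplitSide J L P Q B) : N.Skew P Q :=
  h.side.jointed.skew_of_disjoint h.left_subset h.symm.left_subset h.jv_disj

/-- The parts are skew to each other, so cutting off `P` has connectivity at most one, with equality
only if `Q` is skew to `B`. Connectedness makes it at least one. -/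
lemma lam (h : N.SplitSide J L P Q B) :
    N.rk P + N.rk (↑Q ∪ B) = N.rk (↑P ∪ ↑Q ∪ B) + 1 ∧ N.Skew Q B := by
  have h1 := h.conn P (Finset.subset_union_left.ssubset_of_ne fun heq ↦ by
    obtain ⟨q, hq⟩ := h.nonempty_right
    have hqP : q ∈ P := by rw [heq]; exact Finset.mem_union_right _ hq
    exact Finset.disjoint_left.1 h.disj hqP hq) h.nonempty_left
  have e : (P ∪ Q) \ P = Q := by
    rw [Finset.union_sdiff_left, Finset.sdiff_eq_self_of_disjoint h.disj.symm]
  have h2 := h.side.lam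
  have h3 := h.skew
  rw [e] at h1
  rw [Finset.coe_union] at h1 h2
  have h4 := N.rk_union_le Q B
  rw [Skew] at h3 ⊢
  omega

lemma rk_contract (h : N.SplitSide J L P Q B) (hI : N.IsBasis I Q) {X : Set γ}
    (hX : X ⊆ ↑P ∪ B) : (N ／ I).rk X + N.rk Q = N.rk (X ∪ Q) := by
  refine rk_contract_of_isBasis hI (hX.trans (Set.union_subset h.left_subset h.side.right)) ?_
  rw [Set.disjoint_left]
  intro e he heI
  have heQ := hI.subset heI
  rcases hX he with hh | hh
  · exact Finset.disjoint_left.1 h.disj hh heQ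
  · exact Set.disjoint_left.1 h.side.disj (Finset.mem_coe.2 (Finset.mem_union_right _ heQ)) hh

lemma contract_indep_iff (h : N.SplitSide J L P Q B) (hI : N.IsBasis I Q) {X : Set γ}
    (hX : X ⊆ P ∨ X ⊆ B) : (N ／ I).Indep X ↔ N.Indep X := by
  have hXE : X ⊆ N.E := hX.elim (fun hh ↦ hh.trans h.left_subset) fun hh ↦ hh.trans h.side.right
  rw [contract_indep_iff_of_skew hI.indep (N.ground_finite.subset hI.indep.subset_ground)
    (N.ground_finite.subset hXE)]
  refine and_iff_left (Skew.mono_right ?_ hI.subset)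
  exact hX.elim (fun hh ↦ h.skew.mono_left hh) fun hh ↦ h.lam.2.symm.mono_left hh

/-- The tip of `P` against `Q ∪ B` becomes its tip against `B` alone, and all hypotheses pass to the
minor, so induction applies to the smaller side. -/
lemma exists_side (h : N.SplitSide J L P Q B) (hI : N.IsBasis I Q) :
    ∃ J', (N ／ I).Side J' L P B ∧ ∀ D ⊂ P, D.Nonempty →
      (N ／ I).rk (↑P ∪ B) < (N ／ I).rk D + (N ／ I).rk (↑(P \ D) ∪ B) := by
  obtain ⟨J', -, hJ', hj⟩ := h.side.jointed.contract (X := I) (Y := ∅)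
    (N.ground_finite.subset hI.indep.subset_ground) (by simp) (by simpa using hI.indep) (by simp)
  obtain ⟨h1, h2⟩ := h.lam
  have hrP := h.rk_contract hI (X := P) Set.subset_union_left
  have hrB := h.rk_contract hI (X := B) Set.subset_union_right
  have hrPB := h.rk_contract hI (X := ↑P ∪ B) subset_rfl
  have hsk := h.skew
  have hPB : (↑P ∪ B ∪ ↑Q : Set γ) = ↑P ∪ ↑Q ∪ B := Set.union_right_comm _ _ _
  have hdP : ∀ e ∈ P, e ∉ I := fun e he heI ↦ Finset.disjoint_left.1 h.disj he (hI.subset heI)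
  refine ⟨J', ⟨hj, fun e he ↦ ⟨h.left_subset he, hdP e he⟩, fun e he ↦ ⟨h.side.right he, fun heI ↦
    ?_⟩, ?_, h.side.disjJ.mono_right hJ', fun e he ↦ ?_, fun j hjJ hcl ↦ ?_, ?_⟩, fun D hD hne ↦ ?_⟩
  · exact Set.disjoint_left.1 h.side.disj (Finset.mem_coe.2 (Finset.mem_union_right _
      (hI.subset heI))) he
  · exact h.side.disj.mono_left (Finset.coe_subset.2 Finset.subset_union_left)
  · rw [h.contract_indep_iff hI (.inl (Set.singleton_subset_iff.2 he))]
    exact h.side.indep e (Finset.mem_union_left _ he)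
  · rw [contract_closure_eq] at hcl
    refine h.side.bal j (hJ' hjJ) (N.closure_subset_closure ?_ hcl.1)
    rw [Finset.coe_union]
    exact Set.union_subset_union_right _ hI.subset
  · rw [Skew, Set.union_comm] at h2
    rw [Skew] at hsk
    rw [hPB] at hrPB
    rw [Set.union_comm] at h1
    omega
  · have hDP := hD.1
    have hDr := h.rk_contract hI (X := D) ((Finset.coe_subset.2 hDP).trans Set.subset_union_left)
    have hDr' := h.rk_contract hI (X := ↑(P \ D) ∪ B) (Set.union_subset_union_left _
      (Finset.coe_subset.2 Finset.sdiff_subset))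
    have h3 := h.conn D (hD.trans_subset Finset.subset_union_left) hne
    have e1 : (P ∪ Q) \ D = (P \ D) ∪ Q := by
      rw [Finset.union_sdiff_distrib, Finset.sdiff_eq_self_of_disjoint
        (Finset.disjoint_of_subset_right hDP h.disj.symm)]
    have h4 : N.Skew D Q := h.skew.mono_left (Finset.coe_subset.2 hDP)
    rw [e1, Finset.coe_union, Finset.coe_union, Set.union_right_comm,
      Set.union_right_comm ((P \ D : Finset γ) : Set γ)] at h3
    rw [Skew] at h4
    omega

/-- Skewness of a subset of `B` to `P` modulo `Q` is the same as skewness to `P ∪ Q`, since `Q` is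
skew both to `P` and to `B`. So a realisation of one tip is a realisation of the other. -/
lemma loSide (h : N.SplitSide J L P Q B) (hI : N.IsBasis I Q) (hlo : (N ／ I).LoSide L B P) :
    N.LoSide L B ↑(P ∪ Q) := by
  obtain ⟨N', J', y, h1, h2, h3, h4⟩ := hlo
  refine ⟨N', J', y, h1, h2, h3, h4.mem, h4.subset, h4.notMem, fun R hR ↦ ?_, fun R hR ↦ ?_⟩
  · rw [h4.indep R hR, h.contract_indep_iff hI (.inr hR)]
  · rw [h4.insert R hR, h.contract_indep_iff hI (.inr hR)]
    refine and_congr_right fun _ ↦ ?_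
    have e1 := h.rk_contract hI (X := R) (hR.trans Set.subset_union_right)
    have e2 := h.rk_contract hI (X := P) Set.subset_union_left
    have e3 := h.rk_contract hI (X := R ∪ ↑P) (Set.union_subset (hR.trans Set.subset_union_right)
      Set.subset_union_left)
    have e4 := h.skew
    have e5 := h.lam.2.symm.mono_left hR
    rw [Set.union_assoc] at e3
    rw [Finset.coe_union]
    unfold Skew at *
    omega

lemma skew_contract_iff (h : N.SplitSide J L P Q B) (hI : N.IsBasis I Q) {R : Set γ}
    (hR : R ⊆ P) : (N ／ I).Skew R B ↔ N.Skew R (↑Q ∪ B) := by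
  have e1 := h.rk_contract hI (X := R) (hR.trans Set.subset_union_left)
  have e2 := h.rk_contract hI (X := B) Set.subset_union_right
  have e3 := h.rk_contract hI (X := R ∪ B) (Set.union_subset_union_left _ hR)
  have e4 := h.skew.mono_left hR
  have e5 := h.lam.2
  rw [Set.union_assoc, Set.union_comm B] at e3
  rw [Set.union_comm B] at e2
  unfold Skew at *
  omega

/-- `P` and `Q` lie in series between the guts: `B` is reached only if both parts are passed. If
neither is broken, `R ∪ B` is not skew to `Q`, and the rank-one guts between `Q` and `P ∪ B` then
exclude skewness to `S`. -/
lemma skew_union_iff (h : N.SplitSide J L P Q B) {R S : Set γ} (hR : R ⊆ P) (hS : S ⊆ Q) :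
    N.Skew (R ∪ S) B ↔ N.Skew R (↑Q ∪ B) ∨ N.Skew S (↑P ∪ B) := by
  have key : ∀ {P Q : Finset γ} {R S : Set γ}, N.SplitSide J L P Q B → R ⊆ P → S ⊆ Q →
      N.Skew R (↑Q ∪ B) → N.Skew (R ∪ S) B := by
    intro P Q R S h hR hS hs
    have e1 := hs.mono_right (Set.union_subset_union_left B hS)
    have e2 := h.lam.2.mono_left hS
    have e3 := (h.skew.mono_left hR).mono_right hS
    unfold Skew at *
    rw [Set.union_assoc]
    omega
  refine ⟨fun hs ↦ ?_, fun hs ↦ hs.elim (key h hR hS) fun hs ↦ ?_⟩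
  · by_contra! hcon
    obtain ⟨hc1, hc2⟩ := hcon
    have hlam : N.rk ↑Q + N.rk (↑P ∪ B) ≤ N.rk (↑Q ∪ (↑P ∪ B)) + 1 := by
      rw [← Set.union_assoc]
      exact h.symm.lam.1.le
    have h1 : ¬ N.Skew (R ∪ B) Q := by
      intro hh
      refine hc1 ?_
      have e1 := h.symm.lam.2.mono_left hR
      have e2 := h.lam.2
      have e3 : R ∪ B ∪ ↑Q = R ∪ (↑Q ∪ B) := by rw [Set.union_assoc, Set.union_comm B]
      rw [Skew, e3] at hh
      unfold Skew at *
      omega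
    have h2 := not_skew_of_not_skew hlam (Set.union_subset_union_left B hR) hS h1 hc2
    refine h2 ?_
    have e1 := h.symm.lam.2.mono_left hR
    have e2 := (h.skew.mono_left hR).mono_right hS
    have e3 : R ∪ B ∪ S = R ∪ S ∪ B := Set.union_right_comm _ _ _
    unfold Skew at *
    rw [e3]
    omega
  · rw [Set.union_comm]
    exact key h.symm hS hR hs

/-- The two graphs are placed in a common vertex set so that they share a single vertex, the second
end of the first tip and the first end of the second. The new tip joins the two remaining ends. -/
lemma exists_ends_union (h : N.SplitSide J L P Q B) {I' : Set γ} (hI : N.IsBasis I Q)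
    (hI' : N.IsBasis I' P) (h1 : (N ／ I).GrSide P B) (h2 : (N ／ I').GrSide Q B) {V : Type*}
    (hV : ∀ x₂ y₁ : ℕ, ∃ c₁ c₂ : ℕ → V, c₁.Injective ∧ c₂.Injective ∧ c₂ x₂ = c₁ y₁ ∧
      ∀ v ∈ Set.range c₁, v ∈ Set.range c₂ → v = c₁ y₁) :
    ∃ (ends : γ → Finset V) (x y : V), x ≠ y ∧ (∀ e ∈ P ∪ Q, (ends e).card = 2) ∧
      (∀ R ⊆ P ∪ Q, N.Indep R ↔ IsForest ends R) ∧
      ∀ R ⊆ P ∪ Q, N.Indep R ∧ N.Skew R B ↔ IsPairForest ends R x y := by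
  obtain ⟨e₁, x₁, y₁, hxy₁, hc₁, hi₁, hp₁⟩ := h1
  obtain ⟨e₂, x₂, y₂, hxy₂, hc₂, hi₂, hp₂⟩ := h2
  obtain ⟨c₁, c₂, hinj₁, hinj₂, hz, hint⟩ := hV x₂ y₁
  set ends : γ → Finset V := fun e ↦ if e ∈ P then mapEnds c₁ e₁ e else mapEnds c₂ e₂ e with hends
  have hQn : ∀ e ∈ Q, e ∉ P := fun e he heP ↦ Finset.disjoint_left.1 h.disj heP he
  have hv₁ : ∀ X ⊆ P, vs ends X = vs (mapEnds c₁ e₁) X := fun X hX ↦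
    Finset.biUnion_congr rfl fun e he ↦ by simp [hends, hX he]
  have hv₂ : ∀ X ⊆ Q, vs ends X = vs (mapEnds c₂ e₂) X := fun X hX ↦
    Finset.biUnion_congr rfl fun e he ↦ by simp [hends, hQn e (hX he)]
  have hf₁ : ∀ X ⊆ P, IsForest ends X ↔ N.Indep X := fun X hX ↦ by
    rw [← h.contract_indep_iff hI (.inl (Finset.coe_subset.2 hX)), hi₁ X hX,
      ← isForest_mapEnds (ends := e₁) hinj₁.injOn]
    exact forall₂_congr fun Z hZ ↦ by rw [hv₁ Z (hZ.trans hX)]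
  have hf₂ : ∀ X ⊆ Q, IsForest ends X ↔ N.Indep X := fun X hX ↦ by
    rw [← h.symm.contract_indep_iff hI' (.inl (Finset.coe_subset.2 hX)), hi₂ X hX,
      ← isForest_mapEnds (ends := e₂) hinj₂.injOn]
    exact forall₂_congr fun Z hZ ↦ by rw [hv₂ Z (hZ.trans hX)]
  have hp₁' : ∀ X ⊆ P, N.Indep X ∧ N.Skew X (↑Q ∪ B) ↔ IsPairForest ends X (c₁ x₁) (c₁ y₁) :=
    fun X hX ↦ by
      rw [← h.skew_contract_iff hI (Finset.coe_subset.2 hX),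
        ← h.contract_indep_iff hI (.inl (Finset.coe_subset.2 hX)), hp₁ X hX,
        ← isPairForest_mapEnds (ends := e₁) hinj₁.injOn, IsPairForest, IsPairForest]
      refine and_congr (forall₂_congr fun Z hZ ↦ ?_) (forall₂_congr fun Z hZ ↦ ?_) <;>
      rw [hv₁ Z (hZ.trans hX)]
  have hp₂' : ∀ X ⊆ Q, N.Indep X ∧ N.Skew X (↑P ∪ B) ↔ IsPairForest ends X (c₂ x₂) (c₂ y₂) :=
    fun X hX ↦ by
      rw [← h.symm.skew_contract_iff hI' (Finset.coe_subset.2 hX),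
        ← h.symm.contract_indep_iff hI' (.inl (Finset.coe_subset.2 hX)), hp₂ X hX,
        ← isPairForest_mapEnds (ends := e₂) hinj₂.injOn, IsPairForest, IsPairForest]
      refine and_congr (forall₂_congr fun Z hZ ↦ ?_) (forall₂_congr fun Z hZ ↦ ?_) <;>
      rw [hv₂ Z (hZ.trans hX)]
  set U := insert (c₁ x₁) (insert (c₁ y₁) (vs ends P)) with hU
  set W := insert (c₂ x₂) (insert (c₂ y₂) (vs ends Q)) with hW
  have hUr : ∀ v ∈ U, v ∈ Set.range c₁ := by
    intro v hv
    rw [hU, hv₁ P subset_rfl, vs_mapEnds] at hv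
    simp only [Finset.mem_insert, Finset.mem_image] at hv
    rcases hv with rfl | rfl | ⟨a, -, rfl⟩ <;> exact ⟨_, rfl⟩
  have hWr : ∀ v ∈ W, v ∈ Set.range c₂ := by
    intro v hv
    rw [hW, hv₂ Q subset_rfl, vs_mapEnds] at hv
    simp only [Finset.mem_insert, Finset.mem_image] at hv
    rcases hv with rfl | rfl | ⟨a, -, rfl⟩ <;> exact ⟨_, rfl⟩
  have hUW : U ∩ W = {c₁ y₁} := by
    ext v
    rw [Finset.mem_inter, Finset.mem_singleton]
    refine ⟨fun hv ↦ hint v (hUr v hv.1) (hWr v hv.2), ?_⟩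
    rintro rfl
    exact ⟨by simp [hU], by rw [← hz]; simp [hW]⟩
  have hPU : vs ends P ⊆ U := fun v hv ↦ by simp [hU, hv]
  have hQW : vs ends Q ⊆ W := fun v hv ↦ by simp [hW, hv]
  have hsplit : ∀ R ⊆ P ∪ Q, ∃ R₁ ⊆ P, ∃ R₂ ⊆ Q, R = R₁ ∪ R₂ ∧ Disjoint R₁ R₂ := fun R hR ↦
    ⟨R ∩ P, Finset.inter_subset_right, R ∩ Q, Finset.inter_subset_right, (card_split hR h.disj).1,
      Finset.disjoint_of_subset_left Finset.inter_subset_right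
        (Finset.disjoint_of_subset_right Finset.inter_subset_right h.disj)⟩
  have hind : ∀ R₁ ⊆ P, ∀ R₂ ⊆ Q, N.Indep ↑(R₁ ∪ R₂) ↔ N.Indep R₁ ∧ N.Indep R₂ := by
    intro R₁ h1 R₂ h2
    rw [Finset.coe_union]
    refine ⟨fun hh ↦ ⟨hh.subset Set.subset_union_left, hh.subset Set.subset_union_right⟩,
      fun hh ↦ ((h.skew.mono_left (Finset.coe_subset.2 h1)).mono_right
        (Finset.coe_subset.2 h2)).indep_union hh.1 hh.2 R₁.finite_toSet R₂.finite_toSet⟩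
  refine ⟨ends, c₁ x₁, c₂ y₂, fun heq ↦ hxy₁ (hinj₁ (hint _ ⟨_, rfl⟩ ⟨_, heq.symm⟩)), fun e he ↦ ?_, fun R hR ↦ ?_, fun R hR ↦ ?_⟩
  · by_cases heP : e ∈ P
    · simp only [hends, heP, if_true]
      rw [card_mapEnds hinj₁.injOn, hc₁ e heP]
    · have heQ := (Finset.mem_union.1 he).resolve_left heP
      simp only [hends, heP, if_false]
      rw [card_mapEnds hinj₂.injOn, hc₂ e heQ]
  · obtain ⟨R₁, h1, R₂, h2, rfl, hd⟩ := hsplit R hR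
    rw [hind R₁ h1 R₂ h2, isForest_union hd (z := c₁ y₁), hf₁ R₁ h1, hf₂ R₂ h2]
    rw [← hUW]
    exact Finset.inter_subset_inter ((vs_mono h1).trans hPU) ((vs_mono h2).trans hQW)
  · obtain ⟨R₁, h1, R₂, h2, rfl, hd⟩ := hsplit R hR
    have hFF : IsForest ends (R₁ ∪ R₂) ↔ N.Indep R₁ ∧ N.Indep R₂ := by
      rw [isForest_union hd (z := c₁ y₁), hf₁ R₁ h1, hf₂ R₂ h2]
      rw [← hUW]
      exact Finset.inter_subset_inter ((vs_mono h1).trans hPU) ((vs_mono h2).trans hQW)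
    rw [hind R₁ h1 R₂ h2]
    by_cases hii : N.Indep R₁ ∧ N.Indep R₂
    · rw [isPairForest_union hd ((vs_mono h1).trans hPU) ((vs_mono h2).trans hQW) hUW
        (by simp [hU]) (by simp [hW]) ((hf₁ R₁ h1).2 hii.1) ((hf₂ R₂ h2).2 hii.2), ← hp₁' R₁ h1,
        ← hz, ← hp₂' R₂ h2, Finset.coe_union,
        h.skew_union_iff (Finset.coe_subset.2 h1) (Finset.coe_subset.2 h2)]
      tauto
    · exact ⟨fun hh ↦ (hii hh.1).elim, fun hh ↦ (hii (hFF.1 hh.1)).elim⟩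

lemma grSide (h : N.SplitSide J L P Q B) {I' : Set γ} (hI : N.IsBasis I Q) (hI' : N.IsBasis I' P)
    (h1 : (N ／ I).GrSide P B) (h2 : (N ／ I').GrSide Q B) : N.GrSide (P ∪ Q) B := by
  -- The first graph is placed on even numbers and the second on odd ones, except that `x₂` goes to
  -- the even number `2 * y₁`.
  refine h.exists_ends_union hI hI' h1 h2 fun x₂ y₁ ↦
    ⟨fun v ↦ 2 * v, fun v ↦ if v = x₂ then 2 * y₁ else 2 * v + 1, ?_, ?_, by simp, ?_⟩
  · intro a b hab
    simp only at hab
    omega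
  · intro a b hab
    simp only at hab
    split_ifs at hab <;> omega
  · rintro _ ⟨a, rfl⟩ ⟨b, hb⟩
    simp only at hb ⊢
    split_ifs at hb <;> omega

end SplitSide

/-- A side that spans no joint has its tip at a joint, or is graphic. -/
lemma Side.loSide_or_grSide (h : N.Side J L A B) (hA : ∀ D ⊂ A, D.Nonempty →
    N.rk (↑A ∪ B) < N.rk D + N.rk (↑(A \ D) ∪ B)) : N.LoSide L B A ∨ N.GrSide A B := by
  induction hn : A.card using Nat.strong_induction_on generalizing N J A with
  | _ n ih =>
    by_cases hc : ∀ v ∈ jv N J A, ↑(jv N J A) ⊆ N.closure (insert v ↑A)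
    · exact h.loSide_or_grSide_of_conn hc
    push Not at hc
    obtain ⟨v, hv, hnv⟩ := hc
    obtain ⟨w, hw, hwv⟩ := Set.not_subset.1 hnv
    have hreach : ¬ Relation.ReflTransGen (AdjOn (jends N J) A) v w := fun hr ↦
      hwv (h.jointed.mem_closure_of_reach h.left hr (h.jointed.jv_ground A hv))
    -- `P` is the part of `A` reachable from `v`. As `w` is not reached, the rest is nonempty, and
    -- contracting a basis of either part leaves a smaller side.
    obtain ⟨P, hP, h1, h2⟩ := exists_component A
      (fun e he ↦ h.jointed.card_jends_le_two (h.left he)) v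
    obtain ⟨Q, rfl, hd, h2⟩ : ∃ Q, P ∪ Q = A ∧ Disjoint P Q ∧
        ∀ u ∈ jv N J Q, ¬ Relation.ReflTransGen (AdjOn (jends N J) A) v u :=
      ⟨A \ P, Finset.union_sdiff_of_subset hP, Finset.disjoint_sdiff, h2⟩
    have hPne : P.Nonempty := by
      rw [Finset.nonempty_iff_ne_empty]
      rintro rfl
      rw [Finset.empty_union] at h2 hv
      exact h2 v hv .refl
    have hQne : Q.Nonempty := by
      rw [Finset.nonempty_iff_ne_empty]
      rintro rfl
      rw [Finset.union_empty] at h1 hw hreach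
      exact hreach (h1 w hw)
    have hs : N.SplitSide J L P Q B := ⟨h, hd, hPne, hQne, hA, by
      rw [Finset.disjoint_left]
      exact fun u hu hu' ↦ h2 u hu' (h1 u hu)⟩
    have hcard := Finset.card_union_of_disjoint hd
    have hP0 := Finset.card_pos.2 hPne
    have hQ0 := Finset.card_pos.2 hQne
    obtain ⟨I, hI⟩ := N.exists_isBasis ↑Q hs.symm.left_subset
    obtain ⟨I', hI'⟩ := N.exists_isBasis ↑P hs.left_subset
    obtain ⟨J₁, hs₁, hc₁⟩ := hs.exists_side hI
    obtain ⟨J₂, hs₂, hc₂⟩ := hs.symm.exists_side hI'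
    rcases ih P.card (by omega) hs₁ hc₁ rfl with hlo | hgr₁
    · exact .inl (hs.loSide hI hlo)
    rcases ih Q.card (by omega) hs₂ hc₂ rfl with hlo | hgr₂
    · left
      rw [Finset.union_comm]
      exact hs.symm.loSide hI' hlo
    · exact .inr (hs.grSide hI hI' hgr₁ hgr₂)

end Matroid

/-! ### 2-separations, tips and 2-sums -/

namespace Matroid

set_option linter.unusedSectionVars false

open Multi Jointed

section Embedding

variable {β γ : Type*} {R : Matroid β} {N : Matroid γ} {φ : β → γ} {X Y : Set β}

/-- `φ` identifies `R` with a restriction of `N`. -/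
structure EmbedsVia (R : Matroid β) (N : Matroid γ) (φ : β → γ) : Prop where
  injOn : Set.InjOn φ R.E
  indep_iff : ∀ X ⊆ R.E, R.Indep X ↔ N.Indep (φ '' X)

variable [R.Finite] [N.RankFinite]

lemma EmbedsVia.rk_image (h : R.EmbedsVia N φ) (hX : X ⊆ R.E) : N.rk (φ '' X) = R.rk X := by
  obtain ⟨I, hI⟩ := R.exists_isBasis X
  obtain ⟨K, hK⟩ := N.exists_isBasis' (φ '' X)
  have h1 : R.rk X = I.ncard := by rw [rk, hI.eRk_eq_encard]; rfl
  have h2 : N.rk (φ '' X) = K.ncard := by rw [rk, hK.eRk_eq_encard]; rfl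
  obtain ⟨K', hK', rfl⟩ := Set.subset_image_iff.1 hK.subset
  have h3 := (h.indep_iff _ (hK'.trans hX)).2 hK.indep
  have h4 := (h.indep_iff _ (hI.subset.trans hX)).1 hI.indep
  refine le_antisymm ?_ ?_
  · rw [h2, (h.injOn.mono (hK'.trans hX)).ncard_image, ← h3.rk_eq_ncard]
    exact rk_mono hK'
  · rw [h1, ← (h.injOn.mono (hI.subset.trans hX)).ncard_image, ← h4.rk_eq_ncard]
    exact rk_mono (Set.image_mono hI.subset)

lemma EmbedsVia.skew_image (h : R.EmbedsVia N φ) (hX : X ⊆ R.E) (hY : Y ⊆ R.E) :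
    N.Skew (φ '' X) (φ '' Y) ↔ R.Skew X Y := by
  rw [Skew, Skew, ← Set.image_union, h.rk_image hX, h.rk_image hY, h.rk_image (Set.union_subset hX hY)]

end Embedding

lemma skew_of_forall_indep {α : Type*} {M : Matroid α} [M.Finite] {S T : Set α} (hS : S ⊆ M.E)
    (hT : T ⊆ M.E) (hd : Disjoint S T)
    (h : ∀ I ⊆ S, ∀ K ⊆ T, M.Indep I → M.Indep K → M.Indep (I ∪ K)) : M.Skew S T := by
  obtain ⟨I, hI⟩ := M.exists_isBasis S
  obtain ⟨K, hK⟩ := M.exists_isBasis T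
  have hIK := h I hI.subset K hK.subset hI.indep hK.indep
  have hfin : ∀ {X}, M.Indep X → X.Finite := fun hX ↦ M.ground_finite.subset hX.subset_ground
  have h1 := hIK.skew (hd.mono hI.subset hK.subset) (hfin hI.indep) (hfin hK.indep)
  exact ((h1.of_subset_closure hI.subset_closure).symm.of_subset_closure hK.subset_closure).symm

/-- `(A, B)` is a separation of order at most two of the connected matroid `M`. -/
structure TwoSep {α : Type*} (M : Matroid α) (A B : Set α) : Prop where
  union : A ∪ B = M.E
  disj : Disjoint A B
  lam : M.rk A + M.rk B = M.rk (A ∪ B) + 1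
  conn : ∀ S T : Set α, S ∪ T = A ∪ B → Disjoint S T → S.Nonempty → T.Nonempty →
    M.rk (A ∪ B) < M.rk S + M.rk T

variable {α : Type*} {M : Matroid α} {A B L : Set α}

lemma IsKSeparation.twoSep [M.Finite] (h : M.IsKSeparation 2 A B) (hc : M.HasNoOneSeparation) :
    M.TwoSep A B := by
  obtain ⟨h1, h2, h3, h4, h5⟩ := h
  have hE : M.eRank = M.rk (A ∪ B) := by rw [cast_rk, h1, eRk_ground]
  refine ⟨h1, h2, ?_, fun S T hST hd hS hT ↦ ?_⟩
  · rw [hE, ← cast_rk, ← cast_rk] at h5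
    have : M.rk A + M.rk B + 1 = M.rk (A ∪ B) + 2 := by exact_mod_cast h5
    omega
  · by_contra hcon
    refine hc S T ⟨hST.trans h1, hd, ?_, ?_, ?_⟩
    · simpa [Set.one_le_encard_iff_nonempty] using hS
    · simpa [Set.one_le_encard_iff_nonempty] using hT
    · rw [hE, ← cast_rk, ← cast_rk]
      have := M.rk_union_le S T
      rw [hST] at this
      have h6 : M.rk S + M.rk T + 1 = M.rk (A ∪ B) + 1 := by omega
      exact_mod_cast h6

namespace TwoSep

lemma symm (h : M.TwoSep A B) : M.TwoSep B A := by
  obtain ⟨h1, h2, h3, h4⟩ := h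
  rw [Set.union_comm] at h1 h3
  refine ⟨h1, h2.symm, by omega, ?_⟩
  rwa [Set.union_comm B]

lemma left_subset (h : M.TwoSep A B) : A ⊆ M.E := h.union ▸ Set.subset_union_left

lemma right_subset (h : M.TwoSep A B) : B ⊆ M.E := h.union ▸ Set.subset_union_right

lemma left_nonempty (h : M.TwoSep A B) : A.Nonempty := by
  rw [Set.nonempty_iff_ne_empty]
  rintro rfl
  have := h.lam
  simp at this

lemma not_skew (h : M.TwoSep A B) : ¬ M.Skew A B := by
  have := h.lam
  rw [Skew]
  omega

/-- A matroid loop would be separated from all other elements. -/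
lemma indep_singleton [M.Finite] (h : M.TwoSep A B) {e : α} (he : e ∈ M.E) : M.Indep {e} := by
  by_contra hi
  have h1 : M.rk {e} = 0 := by
    have h2 := rk_le_ncard (M := M) (Set.finite_singleton e)
    rw [Set.ncard_singleton] at h2
    have h3 : ¬ 1 ≤ M.rk {e} := fun h3 ↦ hi (indep_of_le_rk (Set.finite_singleton e) (by simpa))
    omega
  have h2 := h.conn {e} (M.E \ {e}) (by rw [h.union]; simpa) Set.disjoint_sdiff_right (by simp) (by
    obtain ⟨a, ha⟩ := h.left_nonempty
    obtain ⟨b, hb⟩ := h.symm.left_nonempty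
    have hab : a ≠ b := fun hab ↦ Set.disjoint_left.1 h.disj ha (hab ▸ hb)
    by_cases hae : a = e
    · exact ⟨b, h.right_subset hb, by rintro rfl; exact hab hae⟩
    · exact ⟨a, h.left_subset ha, hae⟩)
  have h3 := rk_mono (M := M) (Set.sdiff_subset (s := M.E) (t := {e}))
  rw [h.union] at h2
  omega

end TwoSep

/-- `R` is the matroid on `A` and the basepoint `none` in a 2-sum decomposition of `M`. -/
structure IsTip (M : Matroid α) (A B : Set α) (R : Matroid (Option α)) : Prop where
  ground : R.E = insert none (some '' A)
  indep : ∀ Q ⊆ A, R.Indep (some '' Q) ↔ M.Indep Q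
  insert : ∀ Q ⊆ A, R.Indep (insert none (some '' Q)) ↔ M.Indep Q ∧ M.Skew Q B

lemma exists_eq_of_subset_insert_none {X : Set (Option α)} (hX : X ⊆ insert none (some '' A)) :
    ∃ Q ⊆ A, X = some '' Q ∨ X = insert none (some '' Q) := by
  have hQ : some ⁻¹' X ⊆ A := fun a ha ↦ by
    rcases hX ha with h | ⟨b, hb, hba⟩
    · cases h
    · cases hba; exact hb
  refine ⟨some ⁻¹' X, hQ, ?_⟩
  by_cases hn : none ∈ X
  · right
    ext (_ | a) <;> simp [hn]
  · left
    ext (_ | a) <;> simp [hn]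

namespace IsTip

variable {R R' : Matroid (Option α)}

lemma unique (h : M.IsTip A B R) (h' : M.IsTip A B R') : R = R' := by
  refine ext_indep (h.ground.trans h'.ground.symm) fun X hX ↦ ?_
  rw [h.ground] at hX
  obtain ⟨Q, hQ, rfl | rfl⟩ := exists_eq_of_subset_insert_none hX
  · rw [h.indep Q hQ, h'.indep Q hQ]
  · rw [h.insert Q hQ, h'.insert Q hQ]

lemma indep_none (h : M.IsTip A B R) : R.Indep {none} := by
  have := (h.insert ∅ (Set.empty_subset _)).2 ⟨M.empty_indep, by simp [Skew]⟩
  simpa using this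

lemma finite [M.Finite] (h : M.IsTip A B R) (hA : A ⊆ M.E) : R.Finite :=
  ⟨by rw [h.ground]; exact ((M.ground_finite.subset hA).image _).insert _⟩

end IsTip

/-- The map sending the basepoint to `y`. -/
def baseAt {γ : Type*} (f : α → γ) (y : γ) (o : Option α) : γ := o.elim y f

lemma baseAt_image {γ : Type*} (f : α → γ) (y : γ) (Q : Set α) :
    baseAt f y '' (some '' Q) = f '' Q := by
  rw [Set.image_image]; rfl

lemma baseAt_image_insert {γ : Type*} (f : α → γ) (y : γ) (Q : Set α) :
    baseAt f y '' (insert none (some '' Q)) = insert y (f '' Q) := by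
  rw [Set.image_insert_eq, baseAt_image]; rfl

lemma baseAt_injOn {γ : Type*} {f : α → γ} {y : γ} (hf : Set.InjOn f A) (hy : y ∉ f '' A) :
    Set.InjOn (baseAt f y) (insert none (some '' A)) := by
  rw [Set.injOn_insert (by simp)]
  refine ⟨?_, ?_⟩
  · rintro _ ⟨a, ha, rfl⟩ _ ⟨b, hb, rfl⟩ hab
    exact congrArg some (hf ha hb hab)
  · rwa [baseAt_image]

/-- A tip that is realised in a minor of an extension embeds there. -/
lemma IsTip.embedsVia [M.Finite] {γ : Type*} {R : Matroid (Option α)} {N N' : Matroid γ} [N.Finite]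
    {f : α → γ} {y : γ} (h : M.IsTip A B R) (hf : M.EmbedsVia N f) (hA : A ⊆ M.E) (hB : B ⊆ M.E)
    (ht : N.TipVia N' y (f '' A) (f '' B)) : R.EmbedsVia N' (baseAt f y) := by
  refine ⟨?_, fun X hX ↦ ?_⟩
  · rw [h.ground]
    exact baseAt_injOn (hf.injOn.mono hA) ht.notMem
  rw [h.ground] at hX
  obtain ⟨Q, hQ, rfl | rfl⟩ := exists_eq_of_subset_insert_none hX
  · rw [baseAt_image, ht.indep _ (Set.image_mono hQ), h.indep Q hQ,
      hf.indep_iff _ (hQ.trans hA)]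
  · rw [baseAt_image_insert, ht.insert _ (Set.image_mono hQ), h.insert Q hQ,
      hf.indep_iff _ (hQ.trans hA), hf.skew_image (hQ.trans hA) hB]

lemma isTip_comap {N' : Matroid α} {y : α} (ht : M.TipVia N' y A B) :
    M.IsTip A B ((N'.comap (baseAt id y)) ↾ (Insert.insert none (some '' A))) := by
  have hinj : Set.InjOn (baseAt id y) (Insert.insert none (some '' A)) :=
    baseAt_injOn (Set.injOn_id A) (by simpa using ht.notMem)
  refine ⟨rfl, fun Q hQ ↦ ?_, fun Q hQ ↦ ?_⟩
  · have hs : some '' Q ⊆ Insert.insert none (some '' A) :=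
      (Set.image_mono hQ).trans (Set.subset_insert _ _)
    rw [restrict_indep_iff, comap_indep_iff, baseAt_image, Set.image_id, ht.indep Q hQ]
    exact ⟨fun h ↦ h.1.1, fun h ↦ ⟨⟨h, hinj.mono hs⟩, hs⟩⟩
  · have hs : Insert.insert none (some '' Q) ⊆ Insert.insert none (some '' A) :=
      Set.insert_subset_insert (Set.image_mono hQ)
    rw [restrict_indep_iff, comap_indep_iff, baseAt_image_insert, Set.image_id, ht.insert Q hQ]
    exact ⟨fun h ↦ h.1.1, fun h ↦ ⟨⟨h, hinj.mono hs⟩, hs⟩⟩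

namespace TwoSep

variable [M.Finite]

/-- Contract all but one element `f` of a minimal subset of `B` that is not skew to `A`. The element
left over serves as the basepoint and is renamed to it. -/
lemma exists_isTip (h : M.TwoSep A B) : ∃ R, M.IsTip A B R := by
  have hfin : ∀ {X}, X ⊆ M.E → X.Finite := fun hX ↦ M.ground_finite.subset hX
  obtain ⟨T, -, hT⟩ := exists_minimal_le_of_wellFoundedLT
    (fun F : Finset α ↦ (F : Set α) ⊆ B ∧ ¬ M.Skew F A) (hfin h.right_subset).toFinset
    ⟨by simp, by simpa using fun hs ↦ h.not_skew hs.symm⟩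
  have hmin : ∀ X ⊂ T, M.Skew X A := fun X hX ↦ by
    by_contra hn
    exact hX.2 (hT.2 ⟨(Finset.coe_subset.2 hX.1).trans hT.1.1, hn⟩ hX.1)
  have hTE := hT.1.1.trans h.right_subset
  obtain ⟨f, hf⟩ : T.Nonempty := by
    rw [Finset.nonempty_iff_ne_empty]
    rintro rfl
    exact hT.1.2 (by simp [Skew])
  have hTi : M.Indep T := by
    rw [indep_iff_forall_notMem_closure_sdiff hTE]
    intro f hf hcl
    refine hT.1.2 (((hmin _ (Finset.erase_ssubset hf))).of_subset_closure ?_)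
    intro e he
    rw [Finset.coe_erase]
    by_cases hef : e = f
    · rwa [hef]
    · exact M.mem_closure_of_mem' ⟨he, hef⟩ (hTE he)
  have hins : Insert.insert f (↑(T.erase f) : Set α) = T := by
    rw [Finset.coe_erase, Set.insert_sdiff_singleton, Set.insert_eq_of_mem (Finset.mem_coe.2 hf)]
  refine ⟨_, isTip_comap (tipVia_contract (X := ↑(T.erase f)) (y := f) h.left_subset (by simp)
    (fun hfA ↦ Set.disjoint_left.1 h.disj hfA (hT.1.1 hf)) (by rwa [hins])
    (hmin _ (Finset.erase_ssubset hf)) fun Q hQ _ ↦ ?_)⟩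
  rw [hins]
  exact (skew_iff_of_not_skew (by have := h.symm.lam; omega) hQ hT.1.1 hT.1.2).symm

/-- Independent `P` and `Q` fail to be skew only if each fails to be skew to the whole other side,
because the guts have rank one; skewness is what makes the union independent. -/
lemma indep_union_iff (h : M.TwoSep A B) {R₁ R₂ : Matroid (Option α)} (h₁ : M.IsTip A B R₁)
    (h₂ : M.IsTip B A R₂) {P Q : Set α} (hP : P ⊆ A) (hQ : Q ⊆ B) : M.Indep (P ∪ Q) ↔
      R₁.Indep (some '' P) ∧ R₂.Indep (some '' Q) ∧
      (R₁.Indep (insert none (some '' P)) ∨ R₂.Indep (insert none (some '' Q))) := by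
  have hfin : ∀ {X}, X ⊆ M.E → X.Finite := fun hX ↦ M.ground_finite.subset hX
  have hPf := hfin (hP.trans h.left_subset)
  have hQf := hfin (hQ.trans h.right_subset)
  rw [h₁.indep P hP, h₂.indep Q hQ, h₁.insert P hP, h₂.insert Q hQ]
  constructor
  · intro hi
    have h1 := hi.subset Set.subset_union_left
    have h2 := hi.subset Set.subset_union_right
    refine ⟨h1, h2, ?_⟩
    by_contra! hcon
    have := not_skew_of_not_skew h.symm.lam.le hP hQ (hcon.1 h1) (hcon.2 h2)
    exact this (hi.skew (h.disj.mono hP hQ) hPf hQf)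
  · rintro ⟨h1, h2, ⟨-, h3⟩ | ⟨-, h3⟩⟩
    · exact (h3.mono_right hQ).indep_union h1 h2 hPf hQf
    · exact (h3.mono_right hP).symm.indep_union h1 h2 hPf hQf

lemma indep_singleton_tip (h : M.TwoSep A B) {R : Matroid (Option α)} (hR : M.IsTip A B R)
    {e : Option α} (he : e ∈ R.E) : R.Indep {e} := by
  rw [hR.ground] at he
  rcases he with rfl | ⟨a, ha, rfl⟩
  · exact hR.indep_none
  · rw [← Set.image_singleton, hR.indep _ (Set.singleton_subset_iff.2 ha)]
    exact h.indep_singleton (h.left_subset ha)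

/-- Otherwise a basis of `A` would stay independent with the basepoint, making all of `A` skew to
`B`. -/
lemma none_mem_closure (h : M.TwoSep A B) {R : Matroid (Option α)} (hR : M.IsTip A B R) :
    none ∈ R.closure (some '' A) := by
  have hRE := hR.ground
  obtain ⟨I, hI⟩ := R.exists_isBasis (some '' A) (by rw [hRE]; exact Set.subset_insert _ _)
  rw [← hI.closure_eq_closure]
  by_contra hcl
  have h1 := hI.indep.insert_indep_iff.2 (.inl ⟨by rw [hRE]; exact Set.mem_insert _ _, hcl⟩)
  obtain ⟨K, hK, rfl⟩ := Set.subset_image_iff.1 hI.subset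
  rw [hR.insert K hK] at h1
  refine h.not_skew (h1.2.of_subset_closure fun a ha ↦ ?_)
  by_cases haK : a ∈ K
  · exact M.mem_closure_of_mem' haK (h.left_subset ha)
  by_contra hac
  have h2 := h1.1.insert_indep_iff.2 (.inl ⟨h.left_subset ha, hac⟩)
  rw [← hR.indep _ (Set.insert_subset ha hK), Set.image_insert_eq] at h2
  have h3 := hI.mem_of_insert_indep ⟨a, ha, rfl⟩ h2
  obtain ⟨b, hb, hab⟩ := h3
  cases hab
  exact haK hb

/-- The matroids of a 2-sum decomposition of a connected matroid are connected. -/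
lemma tip_conn (h : M.TwoSep A B) {R : Matroid (Option α)} (hR : M.IsTip A B R)
    {S T : Set (Option α)} (hST : S ∪ T = R.E) (hd : Disjoint S T) (hS : S.Nonempty)
    (hT : T.Nonempty) : ¬ R.Skew S T := by
  have := hR.finite h.left_subset
  have key : ∀ {S T : Set (Option α)}, S ∪ T = R.E → Disjoint S T → T.Nonempty → none ∈ S →
      ¬ R.Skew S T := by
    intro S T hST hd hT hnS hsk
    obtain ⟨R₂, h₂⟩ := h.symm.exists_isTip
    have hfin : ∀ {X}, R.Indep X → X.Finite := fun hX ↦ R.ground_finite.subset hX.subset_ground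
    have hsub : ∀ {X}, X ⊆ S ∪ T → none ∉ X → ∃ X' ⊆ A, X = some '' X' := by
      intro X hX hnX
      rw [hST, hR.ground] at hX
      obtain ⟨X', hX', rfl | rfl⟩ := exists_eq_of_subset_insert_none hX
      · exact ⟨X', hX', rfl⟩
      · simp at hnX
    obtain ⟨T', hT', rfl⟩ := hsub Set.subset_union_right
      fun hnT ↦ Set.disjoint_left.1 hd hnS hnT
    obtain ⟨S', hS', hSe⟩ := hsub (X := S \ {none}) (Set.sdiff_subset.trans Set.subset_union_left)
      (by simp)
    have hS'S : ∀ a ∈ S', some a ∈ S := fun a ha ↦ by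
      have : some a ∈ S \ {none} := by rw [hSe]; exact ⟨a, ha, rfl⟩
      exact this.1
    have hdS : Disjoint T' S' := by
      rw [Set.disjoint_left]
      exact fun a ha haS ↦ Set.disjoint_left.1 hd (hS'S a haS) ⟨a, ha, rfl⟩
    have hAe : T' ∪ S' = A := by
      refine (Set.union_subset hT' hS').antisymm fun a ha ↦ ?_
      have : some a ∈ S ∪ some '' T' := by rw [hST, hR.ground]; exact .inr ⟨a, ha, rfl⟩
      rcases this with hh | ⟨b, hb, hba⟩
      · right
        have : some a ∈ S \ {none} := ⟨hh, by simp⟩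
        rw [hSe] at this
        obtain ⟨b, hb, hba⟩ := this
        cases hba
        exact hb
      · cases hba
        exact .inl hb
    have hTE : T' ⊆ M.E := hT'.trans h.left_subset
    have hSB : S' ∪ B ⊆ M.E := Set.union_subset (hS'.trans h.left_subset) h.right_subset
    have hd' : Disjoint T' (S' ∪ B) := hdS.union_right (h.disj.mono_left hT')
    have h1 := h.conn T' (S' ∪ B) (by rw [← Set.union_assoc, hAe]) hd'
      (by simpa using hT) (by
        obtain ⟨b, hb⟩ := h.symm.left_nonempty
        exact ⟨b, .inr hb⟩)
    -- A separation of the tip matroid lifts to `M` by placing `B` on the side of the basepoint. The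
    -- test `indep_union_iff` refers to the other side only through the basepoint, so it carries
    -- over.
    have h2 : M.Skew T' (S' ∪ B) := by
      refine skew_of_forall_indep hTE hSB hd' fun I hI K hK hIi hKi ↦ ?_
      have hKe : K = K ∩ S' ∪ K ∩ B := by
        rw [← Set.inter_union_distrib_left, Set.inter_eq_left.2 hK]
      have hKS : K ∩ S' ⊆ A := Set.inter_subset_right.trans hS'
      have hKB : K ∩ B ⊆ B := Set.inter_subset_right
      rw [hKe, h.indep_union_iff hR h₂ hKS hKB] at hKi
      rw [hKe, ← Set.union_assoc, h.indep_union_iff hR h₂ (Set.union_subset (hI.trans hT') hKS) hKB]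
      have hIR := (hR.indep I (hI.trans hT')).2 hIi
      have hunion : ∀ Y ⊆ S, R.Indep Y → R.Indep (some '' I ∪ Y) := fun Y hY hYi ↦
        ((hsk.symm.mono_left (Set.image_mono hI)).mono_right hY).indep_union hIR hYi
          (hfin hIR) (hfin hYi)
      have hKS' : some '' (K ∩ S') ⊆ S := by
        rintro _ ⟨a, ha, rfl⟩
        exact hS'S a ha.2
      rw [Set.image_union]
      refine ⟨hunion _ hKS' hKi.1, hKi.2.1, hKi.2.2.imp_left fun hh ↦ ?_⟩
      rw [← Set.union_insert]
      exact hunion _ (Set.insert_subset hnS hKS') hh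
    rw [Skew, ← Set.union_assoc, hAe] at h2
    omega
  by_cases hn : none ∈ S
  · exact key hST hd hT hn
  · have hnT : none ∈ T := by
      have : none ∈ S ∪ T := by rw [hST, hR.ground]; exact Set.mem_insert _ _
      exact this.resolve_left hn
    exact fun hs ↦ key (by rw [Set.union_comm, hST]) hd.symm hS hnT hs.symm

end TwoSep

namespace IsTwoSum

variable {M₁ M₂ : Matroid (Option α)}

lemma symm (h : M.IsTwoSum A B M₁ M₂) : M.IsTwoSum B A M₂ M₁ := by
  obtain ⟨h1, h2, h3, h4, h5⟩ := h
  refine ⟨h1.symm, by rw [h2, Set.union_comm], h4, h3, fun C ↦ ?_⟩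
  rw [h5]
  constructor
  · rintro (h | h | ⟨C₁, C₂, h1, h2, h3, h4, h5⟩)
    exacts [.inr (.inl h), .inl h, .inr (.inr ⟨C₂, C₁, h2, h1, h4, h3, by rw [h5, Set.union_comm]⟩)]
  · rintro (h | h | ⟨C₁, C₂, h1, h2, h3, h4, h5⟩)
    exacts [.inr (.inl h), .inl h, .inr (.inr ⟨C₂, C₁, h2, h1, h4, h3, by rw [h5, Set.union_comm]⟩)]

lemma subset_of_isCircuit (h : M.IsTwoSum A B M₁ M₂) {C : Set α} (hC : M₁.IsCircuit (some '' C)) :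
    C ⊆ A := fun a ha ↦ by
  have := hC.subset_ground ⟨a, ha, rfl⟩
  rw [h.2.2.1] at this
  rcases this with hh | ⟨b, hb, hba⟩
  · cases hh
  · cases hba; exact hb

lemma preimage_subset (h : M.IsTwoSum A B M₁ M₂) {C : Set (Option α)} (hC : M₁.IsCircuit C) :
    some ⁻¹' C ⊆ A := fun a ha ↦ by
  have := hC.subset_ground ha
  rw [h.2.2.1] at this
  rcases this with hh | ⟨b, hb, hba⟩
  · cases hh
  · cases hba; exact hb

/-- If no circuit crossed the 2-sum, every circuit would lie in `A` or in `B`, and the sides would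
be skew. -/
lemma exists_isCircuit [M.Finite] (h : M.IsTwoSum A B M₁ M₂) (hs : M.TwoSep A B) :
    ∃ C₁ C₂, M₁.IsCircuit C₁ ∧ M₂.IsCircuit C₂ ∧ none ∈ C₁ ∧ none ∈ C₂ ∧
      (some ⁻¹' C₁).Nonempty ∧ (some ⁻¹' C₂).Nonempty := by
  by_contra! hcon
  refine hs.not_skew (skew_of_forall_isCircuit hs.left_subset hs.right_subset ?_ hs.disj)
  intro C _ hC
  rcases (h.2.2.2.2 C).1 hC with hh | hh | ⟨C₁, C₂, h1, h2, h3, h4, rfl⟩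
  · exact .inl (h.subset_of_isCircuit hh)
  · exact .inr (h.symm.subset_of_isCircuit hh)
  · rcases (some ⁻¹' C₁).eq_empty_or_nonempty with h5 | h5
    · rw [h5, Set.empty_union]
      exact .inr (h.symm.preimage_subset h2)
    · rw [hcon C₁ C₂ h1 h2 h3 h4 h5, Set.union_empty]
      exact .inl (h.preimage_subset h1)

lemma singleton_none_not_isCircuit [M.Finite] (h : M.IsTwoSum A B M₁ M₂) (hs : M.TwoSep A B) :
    ¬ M₁.IsCircuit {none} := by
  intro hn
  obtain ⟨C₁, C₂, h1, h2, h3, h4, ⟨a, ha⟩, -⟩ := h.exists_isCircuit hs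
  have := hn.eq_of_subset_isCircuit h1 (Set.singleton_subset_iff.2 h3)
  rw [← this] at ha
  cases ha

lemma preimage_nonempty [M.Finite] (h : M.IsTwoSum A B M₁ M₂) (hs : M.TwoSep A B)
    {C : Set (Option α)} (hC : M₁.IsCircuit C) : (some ⁻¹' C).Nonempty := by
  by_contra hne
  rw [Set.not_nonempty_iff_eq_empty] at hne
  refine h.singleton_none_not_isCircuit hs ?_
  obtain ⟨x, hx⟩ := hC.nonempty
  have : C = {none} := by
    ext (_ | a)
    · rcases x with _ | b
      · simpa using hx
      · exact (Set.eq_empty_iff_forall_notMem.1 hne b hx).elim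
    · simpa using Set.eq_empty_iff_forall_notMem.1 hne a
  rwa [← this]

/-- Circuits of `M` inside `A` are those of `M₁` avoiding the basepoint. A circuit of `M₁` in `Q`
and the basepoint combines with one through the basepoint of `M₂` to a crossing circuit, which
obstructs skewness; conversely any obstruction has this form. So the summands of a 2-sum are unique.
-/
lemma isTip [M.Finite] (h : M.IsTwoSum A B M₁ M₂) (hs : M.TwoSep A B) : M.IsTip A B M₁ := by
  have hE := h.2.2.1
  have hindep : ∀ Q ⊆ A, M₁.Indep (some '' Q) ↔ M.Indep Q := by
    intro Q hQ
    have hQE : some '' Q ⊆ M₁.E := by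
      rw [hE]; exact (Set.image_mono hQ).trans (Set.subset_insert _ _)
    rw [indep_iff_forall_subset_not_isCircuit hQE,
      indep_iff_forall_subset_not_isCircuit (hQ.trans hs.left_subset)]
    constructor
    · intro hn C hCQ hC
      rcases (h.2.2.2.2 C).1 hC with hh | hh | ⟨C₁, C₂, h1, h2, h3, h4, rfl⟩
      · exact hn _ (Set.image_mono hCQ) hh
      · obtain ⟨c, hc⟩ := hC.nonempty
        exact Set.disjoint_left.1 hs.disj (hQ (hCQ hc)) (h.symm.subset_of_isCircuit hh hc)
      · obtain ⟨c, hc⟩ := h.symm.preimage_nonempty hs.symm h2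
        exact Set.disjoint_left.1 hs.disj (hQ (hCQ (.inr hc))) (h.symm.preimage_subset h2 hc)
    · intro hn C hCQ hC
      obtain ⟨C', hC', rfl⟩ := Set.subset_image_iff.1 hCQ
      exact hn C' hC' ((h.2.2.2.2 C').2 (.inl hC))
  refine ⟨hE, hindep, fun Q hQ ↦ ?_⟩
  have hQE : insert none (some '' Q) ⊆ M₁.E := by
    rw [hE]; exact Set.insert_subset_insert (Set.image_mono hQ)
  constructor
  · intro hi
    refine ⟨(hindep Q hQ).1 (hi.subset (Set.subset_insert _ _)), skew_of_forall_isCircuit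
      (hQ.trans hs.left_subset) hs.right_subset ?_ (hs.disj.mono_left hQ)⟩
    intro C hCQ hC
    rcases (h.2.2.2.2 C).1 hC with hh | hh | ⟨C₁, C₂, h1, h2, h3, h4, rfl⟩
    · exact .inl fun c hc ↦ (hCQ hc).resolve_right fun hcB ↦
        Set.disjoint_left.1 hs.disj (h.subset_of_isCircuit hh hc) hcB
    · exact .inr (h.symm.subset_of_isCircuit hh)
    · refine (h1.not_indep (hi.subset ?_)).elim
      rintro (_ | a) ha
      · exact Set.mem_insert _ _
      · refine .inr ⟨a, (hCQ (.inl ha)).resolve_right fun hcB ↦ ?_, rfl⟩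
        exact Set.disjoint_left.1 hs.disj (h.preimage_subset h1 ha) hcB
  · rintro ⟨hi, hsk⟩
    by_contra hn
    obtain ⟨C₁, hC₁, h1⟩ := ((not_indep_iff hQE).1 hn).exists_isCircuit_subset
    have h3 : none ∈ C₁ := by
      by_contra h3
      exact h1.not_indep (((hindep Q hQ).2 hi).subset ((Set.subset_insert_iff_of_notMem h3).1 hC₁))
    obtain ⟨-, C₂, -, h2, -, h4, -, -⟩ := h.exists_isCircuit hs
    have hC := (h.2.2.2.2 _).2 (.inr (.inr ⟨C₁, C₂, h1, h2, h3, h4, rfl⟩))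
    have hP : some ⁻¹' C₁ ⊆ Q := fun a ha ↦ by
      rcases hC₁ ha with hh | ⟨b, hb, hba⟩
      · cases hh
      · cases hba; exact hb
    have hB := h.symm.preimage_subset h2
    have hfin : ∀ {X}, X ⊆ M.E → X.Finite := fun hX ↦ M.ground_finite.subset hX
    have hBi : M.Indep (some ⁻¹' C₂) := by
      refine hC.ssubset_indep (Set.subset_union_right.ssubset_of_ne fun heq ↦ ?_)
      obtain ⟨c, hc⟩ := h.preimage_nonempty hs h1
      have hcB : c ∈ some ⁻¹' C₂ := by rw [heq]; exact .inl hc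
      exact Set.disjoint_left.1 hs.disj (hQ (hP hc)) (hB hcB)
    exact hC.not_indep (((hsk.mono_left hP).mono_right hB).indep_union (hi.subset hP) hBi
      (hfin (hP.trans (hQ.trans hs.left_subset))) (hfin (hB.trans hs.right_subset)))

end IsTwoSum

end Matroid

/-! ### Forests with an added edge -/

namespace Multi

variable {α β V W : Type*} {ends : α → Finset V} {X P Q : Finset α} {x y : V} {e : α}

lemma vs_map (f : β ↪ α) (Y : Finset β) : vs ends (Y.map f) = vs (fun b ↦ ends (f b)) Y := by
  ext v
  simp [mem_vs]

lemma isForest_map (f : β ↪ α) (Y : Finset β) :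
    IsForest ends (Y.map f) ↔ IsForest (fun b ↦ ends (f b)) Y := by
  constructor
  · intro h Z hZ hne
    have := h (Z.map f) (Finset.map_subset_map.2 hZ) (by simpa)
    rwa [vs_map, Finset.card_map] at this
  · intro h Z hZ hne
    obtain ⟨Z, hZ', rfl⟩ := Finset.subset_map_iff.1 hZ
    rw [vs_map, Finset.card_map]
    exact h Z hZ' (by simpa using hne)

lemma isPairForest_map (f : β ↪ α) (Y : Finset β) :
    IsPairForest ends (Y.map f) x y ↔ IsPairForest (fun b ↦ ends (f b)) Y x y := by
  refine and_congr (isForest_map f Y) ⟨fun h Z hZ ↦ ?_, fun h Z hZ ↦ ?_⟩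
  · have := h (Z.map f) (Finset.map_subset_map.2 hZ)
    rwa [vs_map, Finset.card_map] at this
  · obtain ⟨Z, hZ', rfl⟩ := Finset.subset_map_iff.1 hZ
    rw [vs_map, Finset.card_map]
    exact h Z hZ'

lemma isForest_insert {Y : Finset α} (hY : ∀ a, a ∈ Y ↔ a = e ∨ a ∈ X) (he : e ∉ X)
    (hxy : ends e = {x, y}) : IsForest ends Y ↔ IsPairForest ends X x y := by
  obtain rfl : Y = insert e X := by
    ext a
    rw [hY, Finset.mem_insert]
  constructor
  · intro h
    refine ⟨h.mono (Finset.subset_insert _ _), fun Z hZ ↦ ?_⟩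
    have := h (insert e Z) (Finset.insert_subset_insert _ hZ) (by simp)
    rwa [Finset.card_insert_of_notMem fun hh ↦ he (hZ hh), vs_insert, hxy,
      Finset.union_comm] at this
  · intro h Z hZ hne
    by_cases heZ : e ∈ Z
    · have h1 : Z.erase e ⊆ X := fun a ha ↦
        (Finset.mem_insert.1 (hZ (Finset.mem_of_mem_erase ha))).resolve_left
          (Finset.ne_of_mem_erase ha)
      have h2 := h.2 _ h1
      rw [Finset.union_comm, ← hxy, ← vs_insert, Finset.insert_erase heZ,
        Finset.card_erase_add_one heZ] at h2
      exact h2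
    · exact h.1 Z ((Finset.subset_insert_iff_of_notMem heZ).1 hZ) hne

lemma IsForest.insert_leaf (h : IsForest ends X) (h2 : (ends e).card = 2) {v : V} (hv : v ∈ ends e)
    (hvX : v ∉ vs ends X) : IsForest ends (insert e X) := by
  intro Z hZ hne
  by_cases heZ : e ∈ Z
  · have h1 : Z.erase e ⊆ X := fun a ha ↦
      (Finset.mem_insert.1 (hZ (Finset.mem_of_mem_erase ha))).resolve_left
        (Finset.ne_of_mem_erase ha)
    have h3 := Finset.card_erase_add_one heZ
    rcases (Z.erase e).eq_empty_or_nonempty with h0 | h0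
    · have h4 := Finset.card_le_card (ends_subset_vs (ends := ends) heZ)
      rw [h0, Finset.card_empty] at h3
      omega
    · have h4 := h _ h1 h0
      have h5 : insert v (vs ends (Z.erase e)) ⊆ vs ends Z :=
        Finset.insert_subset (ends_subset_vs heZ hv) (vs_mono (Finset.erase_subset _ _))
      have h6 := Finset.card_le_card h5
      rw [Finset.card_insert_of_notMem fun hh ↦ hvX (vs_mono h1 hh)] at h6
      omega
  · exact h Z ((Finset.subset_insert_iff_of_notMem heZ).1 hZ) hne

lemma IsForest.card_le (h : IsForest ends X) : X.card ≤ (vs ends X).card := by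
  rcases X.eq_empty_or_nonempty with rfl | hne
  · simp
  · exact (h X subset_rfl hne).le

end Multi

/-! ### Frame representations: relabelling, graphic matroids and full rank -/

namespace Matroid

set_option linter.unusedSectionVars false

open Multi Jointed

section Frame

variable {β V W : Type*} {R : Matroid β} {ends : β → Finset V}

lemma IsFrame.map (h : R.IsFrame ends) {c : V → W} {S : Set V} (hc : Set.InjOn c S)
    (hS : ∀ e ∈ R.E, (ends e : Set V) ⊆ S) : R.IsFrame (mapEnds c ends) := by
  have hvS : ∀ X : Finset β, (X : Set β) ⊆ R.E → (vs ends X : Set V) ⊆ S := by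
    intro X hX v hv
    obtain ⟨e, he, hve⟩ := mem_vs.1 (Finset.mem_coe.1 hv)
    exact hS e (hX he) hve
  refine ⟨fun e he ↦ (h.nonempty e he).image c, fun e he ↦ Finset.card_image_le.trans
    (h.card_le e he), fun I hI ↦ ?_, fun I hI e he w hw hwI ↦ ?_, fun I I' hI hI' hd ↦ ?_⟩
  · rw [card_vs_mapEnds (hc.mono (hvS I hI.subset_ground))]
    exact h.card_indep I hI
  · obtain ⟨v, hv, rfl⟩ := Finset.mem_image.1 hw
    refine h.leaf I hI e he v hv fun hvI ↦ hwI ?_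
    rw [vs_mapEnds]
    exact Finset.mem_image_of_mem c hvI
  · refine h.union I I' hI hI' ?_
    rw [vs_mapEnds, vs_mapEnds, Finset.disjoint_left] at hd
    rw [Finset.disjoint_left]
    exact fun v hv hv' ↦ hd (Finset.mem_image_of_mem c hv) (Finset.mem_image_of_mem c hv')

/-- `R` is the cycle matroid of the multigraph with ends `ends`. -/
structure IsForestRep (R : Matroid β) (ends : β → Finset V) : Prop where
  card_eq : ∀ e ∈ R.E, (ends e).card = 2
  indep_iff : ∀ X : Finset β, (X : Set β) ⊆ R.E → (R.Indep X ↔ IsForest ends X)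

lemma IsForestRep.map (h : R.IsForestRep ends) {c : V → W} (hc : c.Injective) :
    R.IsForestRep (mapEnds c ends) :=
  ⟨fun e he ↦ by rw [card_mapEnds hc.injOn, h.card_eq e he], fun X hX ↦ by
    rw [h.indep_iff X hX, isForest_mapEnds hc.injOn]⟩

lemma disjoint_of_disjoint_vs {I I' : Finset β} (hn : ∀ e ∈ I, (ends e).Nonempty)
    (hd : Disjoint (vs ends I) (vs ends I')) : Disjoint I I' := by
  rw [Finset.disjoint_left]
  intro e he he'
  obtain ⟨v, hv⟩ := hn e he
  exact Finset.disjoint_left.1 hd (ends_subset_vs he hv) (ends_subset_vs he' hv)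

lemma IsForestRep.isFrame (h : R.IsForestRep ends) : R.IsFrame ends := by
  refine ⟨fun e he ↦ Finset.card_pos.1 (by rw [h.card_eq e he]; omega),
    fun e he ↦ (h.card_eq e he).le, fun I hI ↦ ((h.indep_iff I hI.subset_ground).1 hI).card_le,
    fun I hI e he v hv hvI ↦ ?_, fun I I' hI hI' hd ↦ ?_⟩
  · rw [h.indep_iff _ (by rw [Finset.coe_insert]; exact Set.insert_subset he hI.subset_ground)]
    exact ((h.indep_iff I hI.subset_ground).1 hI).insert_leaf (h.card_eq e he) hv hvI
  · have hn : ∀ e ∈ I, (ends e).Nonempty := fun e he ↦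
      Finset.card_pos.1 (by rw [h.card_eq e (hI.subset_ground he)]; omega)
    rcases I.eq_empty_or_nonempty with rfl | ⟨e, he⟩
    · simpa using hI'
    obtain ⟨z, -⟩ := hn e he
    have hE : (↑(I ∪ I') : Set β) ⊆ R.E := by
      rw [Finset.coe_union]
      exact Set.union_subset hI.subset_ground hI'.subset_ground
    rw [h.indep_iff _ hE]
    refine (isForest_union (disjoint_of_disjoint_vs hn hd) (z := z) ?_).2
      ⟨(h.indep_iff I hI.subset_ground).1 hI, (h.indep_iff I' hI'.subset_ground).1 hI'⟩
    rw [Finset.disjoint_iff_inter_eq_empty.1 hd]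
    exact Finset.empty_subset _

/-- A graphic matroid is represented with loops at the edges at `x`. -/
lemma IsForestRep.isFrame_sdiff (h : R.IsForestRep ends) (x : V) :
    R.IsFrame fun e ↦ ends e \ {x} := by
  have hv : ∀ X : Finset β, vs (fun e ↦ ends e \ {x}) X = vs ends X \ {x} := by
    intro X
    ext v
    simp only [mem_vs, Finset.mem_sdiff]
    grind
  have hn : ∀ e ∈ R.E, (ends e \ {x}).Nonempty := fun e he ↦ by
    have h1 := h.card_eq e he
    have h2 := Finset.le_card_sdiff {x} (ends e)
    rw [Finset.card_singleton] at h2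
    exact Finset.card_pos.1 (by omega)
  refine ⟨hn, fun e he ↦ (Finset.card_le_card Finset.sdiff_subset).trans (h.card_eq e he).le,
    fun I hI ↦ ?_, fun I hI e he v hve hvI ↦ ?_, fun I I' hI hI' hd ↦ ?_⟩
  · rw [hv]
    rcases I.eq_empty_or_nonempty with rfl | hne
    · simp
    · have h1 := (h.indep_iff I hI.subset_ground).1 hI I subset_rfl hne
      have h2 := Finset.le_card_sdiff {x} (vs ends I)
      rw [Finset.card_singleton] at h2
      omega
  · rw [hv] at hvI
    rw [Finset.mem_sdiff] at hve hvI
    exact h.isFrame.leaf I hI e he v hve.1 fun hh ↦ hvI ⟨hh, hve.2⟩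
  · have hd' := disjoint_of_disjoint_vs (fun e he ↦ hn e (hI.subset_ground he)) hd
    rw [hv, hv] at hd
    have hE : (↑(I ∪ I') : Set β) ⊆ R.E := by
      rw [Finset.coe_union]
      exact Set.union_subset hI.subset_ground hI'.subset_ground
    rw [h.indep_iff _ hE]
    -- Sets that are disjoint after the deletion of `x` share at most `x` in the original graph, and
    -- forests sharing one vertex have a forest as union.
    refine (isForest_union hd' (z := x) fun v hv ↦ ?_).2
      ⟨(h.indep_iff I hI.subset_ground).1 hI, (h.indep_iff I' hI'.subset_ground).1 hI'⟩
    by_contra hvx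
    rw [Finset.mem_inter] at hv
    exact Finset.disjoint_left.1 hd (Finset.mem_sdiff.2 ⟨hv.1, hvx⟩)
      (Finset.mem_sdiff.2 ⟨hv.2, hvx⟩)

lemma IsFrame.skew_of_disjoint [R.Finite] (h : R.IsFrame ends) {X Y : Finset β}
    (hX : (X : Set β) ⊆ R.E) (hY : (Y : Set β) ⊆ R.E) (hd : Disjoint (vs ends X) (vs ends Y)) :
    R.Skew X Y := by
  refine skew_of_forall_indep hX hY (by
    rw [Finset.disjoint_coe]
    exact disjoint_of_disjoint_vs (fun e he ↦ h.nonempty e (hX he)) hd) ?_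
  intro I hI K hK hIi hKi
  obtain ⟨I, rfl⟩ := (X.finite_toSet.subset hI).exists_finset_coe
  obtain ⟨K, rfl⟩ := (Y.finite_toSet.subset hK).exists_finset_coe
  rw [← Finset.coe_union]
  exact h.union I K hIi hKi (hd.mono (vs_mono hI) (vs_mono hK))

/-- A matroid that is not the direct sum of two restrictions. -/
def IsConn (R : Matroid β) : Prop := ∀ S T : Set β, S ∪ T = R.E → Disjoint S T → S.Nonempty →
  T.Nonempty → ¬ R.Skew S T

lemma IsFrame.eq_empty_of_disjoint [R.Finite] (h : R.IsFrame ends) (hc : R.IsConn)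
    {X Y : Finset β} (hXY : (X : Set β) ∪ Y = R.E) (hX : X.Nonempty)
    (hd : Disjoint (vs ends X) (vs ends Y)) : Y = ∅ := by
  have hXE : (X : Set β) ⊆ R.E := hXY ▸ Set.subset_union_left
  have hYE : (Y : Set β) ⊆ R.E := hXY ▸ Set.subset_union_right
  by_contra hY
  exact hc X Y hXY (by
    rw [Finset.disjoint_coe]
    exact disjoint_of_disjoint_vs (fun e he ↦ h.nonempty e (hXE he)) hd) hX
    (Finset.nonempty_iff_ne_empty.2 hY) (h.skew_of_disjoint hXE hYE hd)

/-- A connected frame matroid has full rank or is graphic. -/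
lemma IsFrame.full_or_isForestRep [R.Finite] (h : R.IsFrame ends) (hc : R.IsConn) {E : Finset β}
    (hE : (E : Set β) = R.E) :
    (∃ I : Finset β, R.Indep I ∧ (vs ends E).card = I.card) ∨ R.IsForestRep ends := by
  by_cases hZ : ∃ Z : Finset β, R.Indep Z ∧ Z.Nonempty ∧ (vs ends Z).card ≤ Z.card
  · left
    obtain ⟨Z, hZi, hZne, hZc⟩ := hZ
    have hsub : ∀ {X : Finset β}, R.Indep X → X ⊆ E := fun hX ↦ by
      rw [← Finset.coe_subset, hE]; exact hX.subset_ground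
    -- A largest independent set with no more vertices than edges. No edge can leave its vertex set,
    -- since the leaf axiom would add that edge; connectedness then makes it cover every vertex.
    obtain ⟨I, hI, hmax⟩ := Finset.exists_max_image (E.powerset.filter fun Z : Finset β ↦
      R.Indep Z ∧ Z.Nonempty ∧ (vs ends Z).card ≤ Z.card) Finset.card
      ⟨Z, by simp [hsub hZi, hZi, hZne, hZc]⟩
    rw [Finset.mem_filter, Finset.mem_powerset] at hI
    obtain ⟨hIE, hIi, hIne, hIc⟩ := hI
    have hIc' := h.card_indep I hIi
    refine ⟨I, hIi, ?_⟩
    suffices vs ends I = vs ends E by rw [← this]; omega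
    by_contra hne
    have hcross : ∀ e ∈ E, ∀ u ∈ ends e, u ∈ vs ends I → ends e ⊆ vs ends I := by
      intro e he u hu huI v hv
      by_contra hvI
      have h1 := h.leaf I hIi e (hE ▸ he) v hv hvI
      have heI : e ∉ I := fun hh ↦ hvI (ends_subset_vs hh hv)
      have h2 : vs ends (insert e I) ⊆ insert v (vs ends I) := by
        rw [vs_insert]
        refine Finset.union_subset (fun w hw ↦ ?_) (Finset.subset_insert _ _)
        by_contra hwn
        rw [Finset.mem_insert, not_or] at hwn
        have h3 : ({u, v, w} : Finset V) ⊆ ends e := by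
          intro z hz
          simp only [Finset.mem_insert, Finset.mem_singleton] at hz
          rcases hz with rfl | rfl | rfl <;> assumption
        have h4 := (Finset.card_le_card h3).trans (h.card_le e (hE ▸ he))
        have huv : u ≠ v := by rintro rfl; exact hvI huI
        have huw : u ≠ w := by rintro rfl; exact hwn.2 huI
        rw [Finset.card_insert_of_notMem (by simp [huv, huw]),
          Finset.card_pair (fun h ↦ hwn.1 h.symm)] at h4
        omega
      have h5 := (Finset.card_le_card h2).trans (Finset.card_insert_le _ _)
      have h6 := Finset.card_insert_of_notMem heI
      have h7 := hmax (insert e I) (by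
        rw [Finset.mem_filter, Finset.mem_powerset]
        exact ⟨Finset.insert_subset he hIE, h1, by simp, by omega⟩)
      omega
    have hempty := h.eq_empty_of_disjoint hc (X := E.filter fun e ↦ ends e ⊆ vs ends I)
      (Y := E.filter fun e ↦ ¬ ends e ⊆ vs ends I) (by
        rw [← Finset.coe_union, Finset.filter_union_filter_not_eq, hE])
      (by
        obtain ⟨i, hi⟩ := hIne
        exact ⟨i, Finset.mem_filter.2 ⟨hIE hi, ends_subset_vs hi⟩⟩) (by
        rw [Finset.disjoint_left]
        intro v hv hv'
        obtain ⟨e, he, hve⟩ := mem_vs.1 hv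
        obtain ⟨f, hf, hvf⟩ := mem_vs.1 hv'
        rw [Finset.mem_filter] at he hf
        exact hf.2 (hcross f hf.1 v hvf (he.2 hve)))
    refine hne (Finset.Subset.antisymm (vs_mono hIE) fun v hv ↦ ?_)
    obtain ⟨e, he, hve⟩ := mem_vs.1 hv
    by_contra hvI
    have : e ∈ E.filter fun e ↦ ¬ ends e ⊆ vs ends I :=
      Finset.mem_filter.2 ⟨he, fun hh ↦ hvI (hh hve)⟩
    rw [hempty] at this
    exact Finset.notMem_empty _ this
  · right
    -- Now every nonempty independent set has fewer edges than vertices, so the independent sets are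
    -- exactly the forests.
    push Not at hZ
    refine ⟨fun e he ↦ ?_, fun X hX ↦ ⟨fun hXi Z hZX hne ↦ hZ Z
      (hXi.subset (Finset.coe_subset.2 hZX)) hne, fun hF ↦ ?_⟩⟩
    · have h1 := hZ {e} (by rw [Finset.coe_singleton]; exact h.indep_singleton he) (by simp)
      have h2 := h.card_le e he
      rw [vs_singleton, Finset.card_singleton] at h1
      omega
    · by_contra hi
      obtain ⟨C, hCX, hC⟩ := exists_isCircuit_of_not_indep hX hi
      have h1 := hF C hCX (by exact_mod_cast hC.nonempty)
      have h2 := h.card_vs_le hC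
      omega

end Frame

/-! ### The dichotomy for the summands of a 2-separation -/

section Tips

variable {α : Type*} {M : Matroid α} {A B L : Set α} {R R₁ R₂ : Matroid (Option α)}

/-- `R` is represented with the elements of `L` as loops. -/
def LRep (R : Matroid (Option α)) (L : Set α) (ends : Option α → Finset ℕ) : Prop :=
  R.IsFrame ends ∧ ∀ e ∈ L, some e ∈ R.E → (ends (some e)).card = 1

/-- `R` can be represented with `L` and the basepoint as loops. -/
def LoRep (R : Matroid (Option α)) (L : Set α) : Prop :=
  ∃ ends, R.LRep L ends ∧ (ends none).card = 1

/-- `R` can be represented in full rank, with `L` as loops and the basepoint as a link. -/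
def FullRep (R : Matroid (Option α)) (L : Set α) : Prop :=
  ∃ ends, R.LRep L ends ∧ (ends none).card = 2 ∧ ∃ E I : Finset (Option α), (E : Set _) = R.E ∧
    R.Indep I ∧ (vs ends E).card = I.card

/-- `R` is graphic. -/
def GrRep (R : Matroid (Option α)) : Prop := ∃ ends : Option α → Finset ℕ, R.IsForestRep ends

/-- Deleting an end of the basepoint from the vertex set turns the edges there, the basepoint among
them, into unbalanced loops without changing the matroid. -/
lemma GrRep.loRep (h : R.GrRep) (hn : none ∈ R.E) (hL : ∀ e ∈ L, some e ∉ R.E) : R.LoRep L := by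
  obtain ⟨ends, h⟩ := h
  obtain ⟨x, y, hxy, he⟩ := Finset.card_eq_two.1 (h.card_eq none hn)
  refine ⟨_, ⟨h.isFrame_sdiff x, fun e he hE ↦ (hL e he hE).elim⟩, ?_⟩
  have : ends none \ {x} = {y} := by
    rw [he]
    ext v
    simp only [Finset.mem_sdiff, Finset.mem_insert, Finset.mem_singleton]
    grind
  convert Finset.card_singleton y using 2
  convert this

/-- A graphic representation has no loops, so it contains no element of `L` and can be turned into
one with the basepoint as a loop. In full rank the basepoint is a loop or a link. -/
lemma LRep.loRep_or_fullRep [R.Finite] {ends : Option α → Finset ℕ} (h : R.LRep L ends)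
    (hn : none ∈ R.E) (hc : R.IsConn) : R.LoRep L ∨ R.FullRep L := by
  obtain ⟨E, hE⟩ := R.ground_finite.exists_finset_coe
  rcases h.1.full_or_isForestRep hc hE with ⟨I, hI, hIc⟩ | hF
  · by_cases h1 : (ends none).card = 1
    · exact .inl ⟨ends, h, h1⟩
    · have h2 := h.1.card_le none hn
      have h3 := Finset.card_pos.2 (h.1.nonempty none hn)
      exact .inr ⟨ends, h, by omega, E, I, hE, hI, hIc⟩
  · refine .inl (GrRep.loRep ⟨ends, hF⟩ hn fun e heL heE ↦ ?_)
    have h1 := hF.card_eq _ heE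
    have h2 := h.2 e heL heE
    omega

lemma vs_baseAt_map {V : Type*} {ends : α → Finset V} {K : Finset V} (Q : Finset α) :
    vs (baseAt ends K) (Q.map Function.Embedding.some) = vs ends Q := vs_map _ _

lemma vs_baseAt_insertNone {V : Type*} {ends : α → Finset V} {K : Finset V} (Q : Finset α) :
    vs (baseAt ends K) (Finset.insertNone Q) = vs ends Q ∪ K := by
  ext v
  simp only [mem_vs, Finset.mem_union, Finset.mem_insertNone]
  constructor
  · rintro ⟨_ | a, ha, hv⟩
    · exact Or.inr hv
    · exact Or.inl ⟨a, ha a rfl, hv⟩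
  · rintro (⟨a, ha, hv⟩ | hv)
    · exact ⟨some a, by simpa using ha, hv⟩
    · exact ⟨none, by simp, hv⟩

lemma coe_insertNone (Q : Finset α) :
    ((Finset.insertNone Q : Finset (Option α)) : Set (Option α)) = insert none (some '' Q) := by
  ext (_ | a) <;> simp

lemma coe_map_some (Q : Finset α) :
    ((Q.map Function.Embedding.some : Finset (Option α)) : Set (Option α)) = some '' Q :=
  Finset.coe_map _ _

lemma IsTip.indep_map (ht : M.IsTip A B R) {Q : Finset α} (hQ : (Q : Set α) ⊆ A) :
    R.Indep ↑(Q.map Function.Embedding.some) ↔ M.Indep Q := by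
  rw [coe_map_some, ht.indep _ hQ]

lemma IsTip.indep_insertNone (ht : M.IsTip A B R) {Q : Finset α} (hQ : (Q : Set α) ⊆ A) :
    R.Indep ↑(Finset.insertNone Q) ↔ M.Indep Q ∧ M.Skew Q B := by
  rw [coe_insertNone, ht.insert _ hQ]

variable [M.Finite]

/-- The ends of an element are the joints needed to span it, renamed to natural numbers. A joint
needs only itself, so the basepoint becomes a loop if it is realised by a joint. -/
lemma TwoSep.exists_lRep {γ : Type*} {N N' : Matroid γ} [N.Finite] [N'.Finite] {J' L' : Set γ}
    {f : α → γ} {y : γ} (h : M.TwoSep A B) (hR : M.IsTip A B R) (hf : M.EmbedsVia N f)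
    (hj : N'.Jointed J' L') (hL : f '' L ⊆ L') (ht : N.TipVia N' y (f '' A) (f '' B)) :
    ∃ ends, R.LRep L ends ∧ (y ∈ J' → (ends none).card = 1) := by
  have he := hR.embedsVia hf h.left_subset h.right_subset ht
  have hfr := hj.isFrame he.injOn he.indep_iff fun e heR ↦ h.indep_singleton_tip hR heR
  obtain ⟨c, hc⟩ := Set.countable_iff_exists_injOn.1 hj.finite.countable
  refine ⟨_, ⟨hfr.map hc fun e _ ↦ hj.jends_subset_base, fun e heL heR ↦ ?_⟩, fun hy ↦ ?_⟩
  · have hi := (he.indep_iff _ (Set.singleton_subset_iff.2 heR)).1 (h.indep_singleton_tip hR heR)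
    rw [Set.image_singleton] at hi
    obtain ⟨S, hS, hS1, heS⟩ := hj.one _ (hL ⟨e, heL, rfl⟩) (hi.subset_ground rfl)
    have h1 := hj.card_jends_le hS heS
    have h2 := Finset.card_pos.2 (hj.jends_nonempty hi)
    rw [card_mapEnds (ends := fun e ↦ jends N' J' (baseAt f y e)) (hc.mono hj.jends_subset_base)]
    exact le_antisymm (h1.trans hS1) h2
  · rw [card_mapEnds (ends := fun e ↦ jends N' J' (baseAt f y e)) (hc.mono hj.jends_subset_base)]
    change (jends N' J' y).card = 1
    rw [hj.jends_of_mem hy, Finset.card_singleton]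

lemma IsTip.exists_finset (hR : M.IsTip A B R) {X : Finset (Option α)} (hX : (X : Set _) ⊆ R.E) :
    ∃ Q : Finset α, (Q : Set α) ⊆ A ∧
      (X = Q.map Function.Embedding.some ∨
        X = Finset.insertNone Q) := by
  rw [hR.ground] at hX
  obtain ⟨Q, hQ, hXQ⟩ := exists_eq_of_subset_insert_none hX
  have hfin : Q.Finite := by
    refine Set.Finite.of_finite_image (f := some) (X.finite_toSet.subset ?_)
      (Option.some_injective α).injOn
    rcases hXQ with h | h <;> rw [h]
    exact Set.subset_insert _ _
  obtain ⟨Q, rfl⟩ := hfin.exists_finset_coe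
  refine ⟨Q, hQ, hXQ.imp (fun h ↦ ?_) fun h ↦ ?_⟩
  · rw [← Finset.coe_inj, h, coe_map_some]
  · rw [← Finset.coe_inj, h, coe_insertNone]

lemma TwoSep.grRep {γ : Type*} {N : Matroid γ} [N.Finite] {f : α → γ} {A' : Finset γ}
    (h : M.TwoSep A B) (hR : M.IsTip A B R) (hf : M.EmbedsVia N f) (hinj : f.Injective)
    (hA' : (A' : Set γ) = f '' A) (hg : N.GrSide A' (f '' B)) : R.GrRep := by
  obtain ⟨ends, x, y, hxy, hc, hi, hp⟩ := hg
  refine ⟨baseAt (fun a ↦ ends (f a)) {x, y}, fun e he ↦ ?_, fun X hX ↦ ?_⟩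
  · rw [hR.ground] at he
    rcases he with rfl | ⟨a, ha, rfl⟩
    · exact Finset.card_pair hxy
    · exact hc (f a) (by rw [← Finset.mem_coe, hA']; exact ⟨a, ha, rfl⟩)
  · obtain ⟨Q, hQ, hXQ⟩ := hR.exists_finset hX
    have hQE := hQ.trans h.left_subset
    have hQf : Q.map ⟨f, hinj⟩ ⊆ A' := by
      rw [← Finset.coe_subset, hA', Finset.coe_map]
      exact Set.image_mono hQ
    have hQc : ((Q.map ⟨f, hinj⟩ : Finset γ) : Set γ) = f '' Q := Finset.coe_map _ _
    rcases hXQ with rfl | rfl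
    · have h1 := hi _ hQf
      rw [isForest_map, hQc, ← hf.indep_iff _ hQE] at h1
      rw [isForest_map, hR.indep_map hQ, h1]
      rfl
    · have h1 := hp _ hQf
      rw [isPairForest_map, hQc, ← hf.indep_iff _ hQE, hf.skew_image hQE h.right_subset] at h1
      rw [isForest_insert (X := Q.map Function.Embedding.some) (e := none) (x := x) (y := y)
        (by rintro (_ | a) <;> simp) (by simp) (by
          change ({x, y} : Finset ℕ) = _
          ext
          simp only [Finset.mem_insert, Finset.mem_singleton]), isPairForest_map,
        hR.indep_insertNone hQ, h1]
      rfl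

/-- Works in the extension of `M` by joints. If the tip of `A` can be made a joint, the summand on
`B` has the basepoint as a loop. Otherwise `A` spans no joint and is graphic, and the summand on `B`
still has some representation, necessarily of full rank and with the basepoint as a link. -/
lemma TwoSep.loRep_or {V : Type*} [Finite V] {ends : α → Finset V} (h : M.TwoSep A B)
    (h₁ : M.IsTip A B R₁) (h₂ : M.IsTip B A R₂) (hF : M.IsFrame ends)
    (hL : ∀ e ∈ L, (ends e).card ≤ 1) :
    R₂.LoRep L ∨ R₁.GrRep ∧ Disjoint L A ∧ R₂.FullRep L := by
  have hNf := hF.jointExt_finite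
  have hj := hF.jointed hL
  have hf : M.EmbedsVia hF.jointExt Sum.inl :=
    ⟨Sum.inl_injective.injOn, fun X _ ↦ hF.jointExt_indep_inl.symm⟩
  set N := hF.jointExt with hN
  have hR₂fin := h₂.finite h.right_subset
  have hnone : none ∈ R₂.E := by rw [h₂.ground]; exact Set.mem_insert _ _
  have hrk : ∀ {X}, X ⊆ M.E → N.rk (Sum.inl '' X) = M.rk X := fun hX ↦ hf.rk_image hX
  have himE : ∀ {X}, X ⊆ M.E → Sum.inl '' X ⊆ N.E := fun hX ↦ by
    rw [hN, IsFrame.jointExt_ground]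
    exact (Set.image_mono hX).trans Set.subset_union_left
  have hAE := himE h.left_subset
  have hBE := himE h.right_subset
  have hABE : A ∪ B ⊆ M.E := h.union.le
  have hd : Disjoint (Sum.inl (β := V) '' A) (Sum.inl '' B) :=
    (Set.disjoint_image_iff Sum.inl_injective).2 h.disj
  have hlam : N.rk (Sum.inl '' A) + N.rk (Sum.inl '' B) =
      N.rk (Sum.inl '' A ∪ Sum.inl '' B) + 1 := by
    rw [← Set.image_union, hrk h.left_subset, hrk h.right_subset, hrk hABE, h.lam]
  have hconn : ∀ S T : Set (α ⊕ V), S ∪ T = Sum.inl '' A ∪ Sum.inl '' B → Disjoint S T →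
      S.Nonempty → T.Nonempty → N.rk (Sum.inl '' A ∪ Sum.inl '' B) < N.rk S + N.rk T := by
    intro S T hST hdST hS hT
    rw [← Set.image_union] at hST ⊢
    obtain ⟨S, hS', rfl⟩ := Set.subset_image_iff.1 (hST ▸ Set.subset_union_left (s := S) (t := T))
    obtain ⟨T, hT', rfl⟩ := Set.subset_image_iff.1
      (hST ▸ Set.subset_union_right (s := Sum.inl '' S) (t := T))
    rw [hrk hABE, hrk (hS'.trans hABE), hrk (hT'.trans hABE)]
    rw [← Set.image_union] at hST
    exact h.conn S T (Sum.inl_injective.image_injective hST)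
      ((Set.disjoint_image_iff Sum.inl_injective).1 hdST) (by simpa using hS) (by simpa using hT)
  have hdJ : Disjoint (Sum.inl '' A ∪ Sum.inl '' B) (Set.range (Sum.inr (α := α) (β := V))) := by
    rw [Set.disjoint_left]
    rintro _ (⟨a, -, rfl⟩ | ⟨a, -, rfl⟩) ⟨u, hu⟩ <;> cases hu
  have hlo : N.LoSide (Sum.inl '' L) (Sum.inl '' B) (Sum.inl '' A) → R₂.LoRep L := by
    rintro ⟨N', J', y, hN', hj', hy, ht⟩
    obtain ⟨ends', h1, h2⟩ := h.symm.exists_lRep h₂ hf hj' subset_rfl ht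
    exact ⟨ends', h1, h2 hy⟩
  by_cases hbal : ∀ j ∈ Set.range Sum.inr, j ∉ N.closure (Sum.inl '' A)
  swap
  · push Not at hbal
    obtain ⟨j, hjJ, hjA⟩ := hbal
    exact .inl (hlo (hj.loSide_of_mem_closure hAE hBE hdJ hd (h.symm.left_nonempty.image _) hlam
      hconn hjJ hjA))
  obtain ⟨A', hA'⟩ := (N.ground_finite.subset hAE).exists_finset_coe
  have hs : N.Side (Set.range Sum.inr) (Sum.inl '' L) A' (Sum.inl '' B) := by
    refine ⟨hj, by rwa [hA'], hBE, by rwa [hA'], hdJ.mono_left Set.subset_union_right,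
      fun e he ↦ ?_, by rwa [hA'], by rwa [hA']⟩
    have he' : e ∈ Sum.inl '' A := hA' ▸ he
    obtain ⟨a, ha, rfl⟩ := he'
    rw [← Set.image_singleton, ← hf.indep_iff _ (Set.singleton_subset_iff.2 (h.left_subset ha))]
    exact h.indep_singleton (h.left_subset ha)
  have hHyp : ∀ D ⊂ A', D.Nonempty →
      N.rk (↑A' ∪ Sum.inl '' B) < N.rk D + N.rk (↑(A' \ D) ∪ Sum.inl '' B) := by
    intro D hD hDne
    rw [hA']
    have hDA : (D : Set (α ⊕ V)) ⊆ Sum.inl '' A := hA' ▸ Finset.coe_subset.2 hD.1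
    refine hconn _ _ ?_ ?_ hDne ?_
    · rw [← Set.union_assoc, Finset.coe_sdiff, Set.union_sdiff_cancel (Finset.coe_subset.2 hD.1),
        hA']
    · rw [Finset.coe_sdiff]
      exact Set.disjoint_sdiff_right.union_right (hd.mono_left hDA)
    · obtain ⟨b, hb⟩ := h.symm.left_nonempty
      exact ⟨_, .inr ⟨b, hb, rfl⟩⟩
  rcases hs.loSide_or_grSide (fun D hD hne ↦ by convert hHyp D hD hne) with h1 | h1
  · rw [hA'] at h1
    exact .inl (hlo h1)
  -- Contracting a minimal connector in `A` up to one element makes that element the basepoint. It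
  -- need not be a joint, so only a frame representation results.
  have hfr : ∃ ends, R₂.LRep L ends := by
    obtain ⟨T, hT⟩ := hs.exists_thin
    obtain ⟨f, hfT⟩ := hT.nonempty
    have hins : insert f (↑(T.erase f) : Set (α ⊕ V)) = T := by
      rw [Finset.coe_erase, Set.insert_sdiff_singleton,
        Set.insert_eq_of_mem (Finset.mem_coe.2 hfT)]
    have hfA : f ∈ Sum.inl '' A := hA' ▸ hT.subset hfT
    obtain ⟨N', J', y, hN', hj', ht⟩ := hj.frSide (X := ↑(T.erase f)) (y := f)
      (A := Sum.inl '' A) hBE (by simp)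
      (fun hfB ↦ Set.disjoint_left.1 hd hfA hfB) (by rw [hins]; exact hT.indep hs)
      (hT.skew _ (Finset.erase_ssubset hfT)) fun Q hQ _ ↦ by
        rw [hins, ← hA']
        exact (hT.skew_iff hs hQ).symm
    obtain ⟨ends', h1, -⟩ := h.symm.exists_lRep h₂ hf hj' subset_rfl ht
    exact ⟨ends', h1⟩
  obtain ⟨ends', hfr⟩ := hfr
  refine (hfr.loRep_or_fullRep hnone fun S T hST hdST hS hT ↦
    h.symm.tip_conn h₂ hST hdST hS hT).imp_right fun hfull ↦
      ⟨h.grRep h₁ hf Sum.inl_injective hA' h1, ?_, hfull⟩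
  -- Each element of a side that spans no joint needs two joints, whereas elements of `L` need at
  -- most one.
  rw [Set.disjoint_left]
  intro e heL heA
  have heA' : Sum.inl e ∈ A' := by rw [← Finset.mem_coe, hA']; exact ⟨e, heA, rfl⟩
  have h2 := hs.card_jends heA'
  obtain ⟨S, hS, hS1, heS⟩ := hj.one (Sum.inl e) ⟨e, heL, rfl⟩ (hs.left heA')
  have h3 := hj.card_jends_le hS heS
  omega

end Tips

end Matroid

/-! ### Gluing two representations along the basepoint -/

namespace Multi

variable {α V : Type*} {ends : α → Finset V} {P Q : Finset α} {x y : V}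

/-- Every subset falls into two vertex-disjoint forests, to which `x` and `y` can be added
separately; each piece has a surplus vertex. -/
lemma isPairForest_union_of_disjoint (hxy : x ≠ y) (hPQ : IsForest ends (P ∪ Q))
    (hd : Disjoint (vs ends P) (vs ends Q)) (hx : x ∉ vs ends Q) (hy : y ∉ vs ends P) :
    IsPairForest ends (P ∪ Q) x y := by
  refine ⟨hPQ, fun Z hZ ↦ ?_⟩
  have hP := isForest_card_union_singleton
    (hPQ.mono ((Finset.inter_subset_right (s₁ := Z)).trans Finset.subset_union_left)) x
  have hQ := isForest_card_union_singleton
    (hPQ.mono ((Finset.inter_subset_right (s₁ := Z)).trans Finset.subset_union_right)) y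
  have h1 : Z = Z ∩ P ∪ Z ∩ Q := by
    rw [← Finset.inter_union_distrib_left, Finset.inter_eq_left.2 hZ]
  have hvP : vs ends (Z ∩ P) ⊆ vs ends P := vs_mono Finset.inter_subset_right
  have hvQ : vs ends (Z ∩ Q) ⊆ vs ends Q := vs_mono Finset.inter_subset_right
  have hd' : Disjoint (vs ends (Z ∩ P) ∪ {x}) (vs ends (Z ∩ Q) ∪ {y}) := by
    rw [Finset.disjoint_union_left, Finset.disjoint_union_right, Finset.disjoint_union_right]
    refine ⟨⟨hd.mono hvP hvQ, ?_⟩, ?_, ?_⟩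
    · rw [Finset.disjoint_singleton_right]; exact fun h ↦ hy (hvP h)
    · rw [Finset.disjoint_singleton_left]; exact fun h ↦ hx (hvQ h)
    · rw [Finset.disjoint_singleton_left, Finset.mem_singleton]; exact hxy
  have h2 : vs ends Z ∪ {x, y} = (vs ends (Z ∩ P) ∪ {x}) ∪ (vs ends (Z ∩ Q) ∪ {y}) := by
    conv_lhs => rw [h1, vs_union]
    ext v
    simp only [Finset.mem_union, Finset.mem_insert, Finset.mem_singleton]
    tauto
  have h3 : Z.card ≤ (Z ∩ P).card + (Z ∩ Q).card := by
    conv_lhs => rw [h1]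
    exact Finset.card_union_le _ _
  rw [h2, Finset.card_union_of_disjoint hd']
  omega

end Multi

namespace Matroid

set_option linter.unusedSectionVars false

open Multi

variable {α V W : Type*} {M : Matroid α} {A B : Set α} {R R₁ R₂ : Matroid (Option α)}
  {ends : α → Finset V} {K : Finset V}

/-- The graph with ends `ends`, together with an edge joining the vertices in `K`, represents
the part `A` of the 2-separation `(A, B)`. -/
structure HalfFrame (M : Matroid α) (A B : Set α) (ends : α → Finset V) (K : Finset V) : Prop where
  nonempty : ∀ a ∈ A, (ends a).Nonempty
  card_le : ∀ a ∈ A, (ends a).card ≤ 2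
  card_indep : ∀ Q : Finset α, (Q : Set α) ⊆ A → M.Indep Q → Q.card ≤ (vs ends Q).card
  card_skew : ∀ Q : Finset α, (Q : Set α) ⊆ A → M.Indep Q → M.Skew Q B →
    Q.card + 1 ≤ (vs ends Q ∪ K).card
  leaf : ∀ Q : Finset α, (Q : Set α) ⊆ A → M.Indep Q → ∀ a ∈ A, ∀ v ∈ ends a, v ∉ vs ends Q →
    M.Indep ↑(insert a Q)
  leaf_skew : ∀ Q : Finset α, (Q : Set α) ⊆ A → M.Indep Q → M.Skew Q B → ∀ a ∈ A,
    ∀ v ∈ ends a, v ∉ vs ends Q → v ∉ K → M.Skew ↑(insert a Q) B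
  leaf_tip : ∀ Q : Finset α, (Q : Set α) ⊆ A → M.Indep Q → ∀ v ∈ K, v ∉ vs ends Q → M.Skew Q B
  union : ∀ P Q : Finset α, (P : Set α) ⊆ A → (Q : Set α) ⊆ A → M.Indep P → M.Indep Q →
    Disjoint (vs ends P) (vs ends Q) → M.Indep ↑(P ∪ Q)
  union_skew : ∀ P Q : Finset α, (P : Set α) ⊆ A → (Q : Set α) ⊆ A → M.Indep P → M.Indep Q →
    M.Skew P B → Disjoint (vs ends P) (vs ends Q) → Disjoint K (vs ends Q) → M.Skew ↑(P ∪ Q) B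

lemma IsFrame.indep_insert {β : Type*} {N : Matroid β} {ends : β → Finset V} (h : N.IsFrame ends)
    {I : Finset β} (hI : N.Indep I) {e : β} (he : e ∈ N.E) {v : V} (hv : v ∈ ends e)
    (hvI : v ∉ vs ends I) : N.Indep (insert e (I : Set β)) := by
  rw [← Finset.coe_insert]
  exact h.leaf I hI e he v hv hvI

lemma IsFrame.indep_union {β : Type*} {N : Matroid β} {ends : β → Finset V} (h : N.IsFrame ends)
    {I J : Finset β} (hI : N.Indep I) (hJ : N.Indep J) (hd : Disjoint (vs ends I) (vs ends J)) :
    N.Indep (I ∪ J : Set β) := by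
  rw [← Finset.coe_union]
  exact h.union I J hI hJ hd

/-- The axioms are those of the tip matroid, written out for sets without and with the basepoint;
adding the basepoint means being skew to the other side and having the vertices of `K` as well. -/
lemma IsFrame.halfFrame (h : R.IsFrame (baseAt ends K)) (ht : M.IsTip A B R) :
    M.HalfFrame A B ends K := by
  have hE : ∀ {a}, a ∈ A → some a ∈ R.E := fun ha ↦ by
    rw [ht.ground]; exact .inr ⟨_, ha, rfl⟩
  have hn : none ∈ R.E := by rw [ht.ground]; exact Set.mem_insert _ _
  have hins : ∀ {a} {Q : Finset α}, (Q : Set α) ⊆ A → a ∈ A → (↑(insert a Q) : Set α) ⊆ A := by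
    intro a Q hQ ha
    rw [Finset.coe_insert]
    exact Set.insert_subset ha hQ
  have hun : ∀ {P Q : Finset α}, (P : Set α) ⊆ A → (Q : Set α) ⊆ A → (↑(P ∪ Q) : Set α) ⊆ A := by
    intro P Q hP hQ
    rw [Finset.coe_union]
    exact Set.union_subset hP hQ
  refine ⟨fun a ha ↦ h.nonempty _ (hE ha), fun a ha ↦ h.card_le _ (hE ha), fun Q hQ hi ↦ ?_,
    fun Q hQ hi hs ↦ ?_, fun Q hQ hi a ha v hv hvQ ↦ ?_,
    fun Q hQ hi hs a ha v hv hvQ hvK ↦ ?_, fun Q hQ hi v hv hvQ ↦ ?_, fun P Q hP hQ hPi hQi hd ↦ ?_,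
    fun P Q hP hQ hPi hQi hs hd hdK ↦ ?_⟩
  · have := h.card_indep _ ((ht.indep_map hQ).2 hi)
    rwa [vs_baseAt_map, Finset.card_map] at this
  · have := h.card_indep _ ((ht.indep_insertNone hQ).2 ⟨hi, hs⟩)
    rwa [vs_baseAt_insertNone, Finset.card_insertNone] at this
  · have := h.indep_insert ((ht.indep_map hQ).2 hi) (hE ha) hv (by rwa [vs_baseAt_map])
    refine (ht.indep_map (hins hQ ha)).1 ?_
    convert this using 1
    rw [coe_map_some, coe_map_some, Finset.coe_insert, Set.image_insert_eq]
  · have := h.indep_insert ((ht.indep_insertNone hQ).2 ⟨hi, hs⟩) (hE ha) hv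
      (by rw [vs_baseAt_insertNone, Finset.mem_union]; tauto)
    refine ((ht.indep_insertNone (hins hQ ha)).1 ?_).2
    convert this using 1
    rw [coe_insertNone, coe_insertNone, Finset.coe_insert,
      Set.image_insert_eq, Set.insert_comm]
  · have := h.indep_insert ((ht.indep_map hQ).2 hi) hn hv (by rwa [vs_baseAt_map])
    refine ((ht.indep_insertNone hQ).1 ?_).2
    convert this using 1
    rw [coe_insertNone, coe_map_some]
  · have := h.indep_union ((ht.indep_map hP).2 hPi) ((ht.indep_map hQ).2 hQi)
      (by rwa [vs_baseAt_map, vs_baseAt_map])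
    refine (ht.indep_map (hun hP hQ)).1 ?_
    convert this using 1
    rw [coe_map_some, coe_map_some, coe_map_some, Finset.coe_union,
      Set.image_union]
  · have := h.indep_union ((ht.indep_insertNone hP).2 ⟨hPi, hs⟩) ((ht.indep_map hQ).2 hQi)
      (by rw [vs_baseAt_map, vs_baseAt_insertNone]; exact Finset.disjoint_union_left.2 ⟨hd, hdK⟩)
    refine ((ht.indep_insertNone (hun hP hQ)).1 ?_).2
    convert this using 1
    rw [coe_map_some, coe_insertNone, coe_insertNone, Finset.coe_union,
      Set.image_union, Set.insert_union]

/-- The part `A` is represented by a graph with a virtual edge `xy`. -/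
structure GraphicHalf (M : Matroid α) (A B : Set α) (ends : α → Finset V) (x y : V) : Prop where
  indep_iff : ∀ Q : Finset α, (Q : Set α) ⊆ A → (M.Indep Q ↔ IsForest ends Q)
  skew_iff : ∀ Q : Finset α, (Q : Set α) ⊆ A →
    (M.Indep Q ∧ M.Skew Q B ↔ IsPairForest ends Q x y)

lemma IsForestRep.graphicHalf {x y : V} (h : R.IsForestRep (baseAt ends {x, y}))
    (ht : M.IsTip A B R) : M.GraphicHalf A B ends x y := by
  refine ⟨fun Q hQ ↦ ?_, fun Q hQ ↦ ?_⟩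
  · rw [← ht.indep_map hQ, h.indep_iff, isForest_map]
    · rfl
    · rw [coe_map_some, ht.ground]
      exact (Set.image_mono hQ).trans (Set.subset_insert _ _)
  · rw [← ht.indep_insertNone hQ, h.indep_iff,
      isForest_insert (X := Q.map Function.Embedding.some) (e := none) (x := x) (y := y),
      isPairForest_map]
    · rfl
    · rintro (_ | a) <;> simp
    · simp
    · rfl
    · rw [coe_insertNone, ht.ground]
      exact Set.insert_subset_insert (Set.image_mono hQ)

lemma TwoSep.indep_union_iff_skew [M.Finite] (h : M.TwoSep A B) {P Q : Finset α}
    (hP : (P : Set α) ⊆ A) (hQ : (Q : Set α) ⊆ B) :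
    M.Indep ↑(P ∪ Q) ↔ M.Indep P ∧ M.Indep Q ∧ (M.Skew P B ∨ M.Skew Q A) := by
  obtain ⟨R₁, h₁⟩ := h.exists_isTip
  obtain ⟨R₂, h₂⟩ := h.symm.exists_isTip
  rw [Finset.coe_union, h.indep_union_iff h₁ h₂ hP hQ, h₁.indep _ hP, h₂.indep _ hQ,
    h₁.insert _ hP, h₂.insert _ hQ]
  tauto

lemma TwoSep.exists_split (h : M.TwoSep A B) {I : Finset α} (hI : (I : Set α) ⊆ M.E) :
    ∃ P Q : Finset α, I = P ∪ Q ∧ Disjoint P Q ∧ (P : Set α) ⊆ A ∧ (Q : Set α) ⊆ B := by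
  refine ⟨I.filter (· ∈ A), I.filter (· ∉ A), (Finset.filter_union_filter_not_eq _ _).symm,
    Finset.disjoint_filter_filter_not _ _ _, fun e he ↦ ?_, fun e he ↦ ?_⟩
  · exact (Finset.mem_filter.1 he).2
  · have h1 := Finset.mem_filter.1 (Finset.mem_coe.1 he)
    have h2 := hI h1.1
    rw [← h.union] at h2
    exact h2.resolve_left h1.2

section Glue

variable [M.Finite]

/-- If the new vertex is an end of the basepoint, `Q` misses that end and is therefore skew to `A`.
If not, a skew `P` stays skew. -/
lemma HalfFrame.leaf_union (h : M.TwoSep A B) (h₁ : M.HalfFrame A B ends K)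
    (h₂ : M.HalfFrame B A ends K) {P Q : Finset α} (hP : (P : Set α) ⊆ A) (hQ : (Q : Set α) ⊆ B)
    (hi : M.Indep ↑(P ∪ Q)) {a : α} (ha : a ∈ A) {v : V} (hv : v ∈ ends a)
    (hvPQ : v ∉ vs ends (P ∪ Q)) : M.Indep ↑(insert a (P ∪ Q)) := by
  rw [vs_union, Finset.mem_union, not_or] at hvPQ
  rw [h.indep_union_iff_skew hP hQ] at hi
  obtain ⟨hPi, hQi, hs⟩ := hi
  have h1 := h₁.leaf P hP hPi a ha v hv hvPQ.1
  have hP' : (↑(insert a P) : Set α) ⊆ A := by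
    rw [Finset.coe_insert]
    exact Set.insert_subset ha hP
  rw [← Finset.insert_union, h.indep_union_iff_skew hP' hQ]
  refine ⟨h1, hQi, ?_⟩
  by_cases hvK : v ∈ K
  · exact .inr (h₂.leaf_tip Q hQ hQi v hvK hvPQ.2)
  · exact hs.imp_left fun hs ↦ h₁.leaf_skew P hP hPi hs a ha v hv hvPQ.1 hvK

lemma inter_vs_subset (hmeet : ∀ a ∈ A, ∀ b ∈ B, ends a ∩ ends b ⊆ K) {P Q : Finset α}
    (hP : (P : Set α) ⊆ A) (hQ : (Q : Set α) ⊆ B) : vs ends P ∩ vs ends Q ⊆ K := by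
  intro v hv
  rw [Finset.mem_inter] at hv
  obtain ⟨a, ha, hva⟩ := mem_vs.1 hv.1
  obtain ⟨b, hb, hvb⟩ := mem_vs.1 hv.2
  exact hmeet a (hP ha) b (hQ hb) (Finset.mem_inter.2 ⟨hva, hvb⟩)

/-- Only the single vertex of `K` can be shared. If it lies on `P`, skewness of `P` gives a surplus
vertex that pays for it. -/
lemma HalfFrame.card_union (h₁ : M.HalfFrame A B ends K)
    (h₂ : M.HalfFrame B A ends K) (hmeet : ∀ a ∈ A, ∀ b ∈ B, ends a ∩ ends b ⊆ K)
    (hK : K.card = 1) {P Q : Finset α} (hP : (P : Set α) ⊆ A) (hQ : (Q : Set α) ⊆ B)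
    (hPi : M.Indep P) (hQi : M.Indep Q) (hs : M.Skew P B) :
    P.card + Q.card ≤ (vs ends P ∪ vs ends Q).card := by
  have h1 := h₁.card_indep P hP hPi
  have h2 := h₂.card_indep Q hQ hQi
  have h3 := h₁.card_skew P hP hPi hs
  have h4 := card_union_eq (vs ends P) (vs ends Q)
  have h5 := inter_vs_subset hmeet hP hQ
  obtain ⟨z, rfl⟩ := Finset.card_eq_one.1 hK
  have h6 := Finset.card_le_card h5
  rw [Finset.card_singleton] at h6
  rcases (vs ends P ∩ vs ends Q).eq_empty_or_nonempty with h0 | ⟨w, hw⟩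
  · rw [h0, Finset.card_empty] at h4
    omega
  · have hwz := Finset.mem_singleton.1 (h5 hw)
    rw [hwz] at hw
    rw [Finset.union_eq_left.2
      (Finset.singleton_subset_iff.2 (Finset.mem_inter.1 hw).1)] at h3
    omega

/-- The surplus vertex of the forest `P` pays for one shared vertex. When both ends of the basepoint
are shared, the side that is skew supplies a further surplus. -/
lemma GraphicHalf.card_union {x y : V} (h₁ : M.GraphicHalf A B ends x y)
    (h₂ : M.HalfFrame B A ends {x, y}) (hmeet : ∀ a ∈ A, ∀ b ∈ B, ends a ∩ ends b ⊆ {x, y})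
    {P Q : Finset α} (hP : (P : Set α) ⊆ A) (hQ : (Q : Set α) ⊆ B)
    (hPi : M.Indep P) (hQi : M.Indep Q) (hs : M.Skew P B ∨ M.Skew Q A) :
    P.card + Q.card ≤ (vs ends P ∪ vs ends Q).card := by
  have hF := (h₁.indep_iff P hP).1 hPi
  have h2 := h₂.card_indep Q hQ hQi
  have h4 := card_union_eq (vs ends P) (vs ends Q)
  have h5 := inter_vs_subset hmeet hP hQ
  have h6 := (Finset.card_le_card h5).trans (Finset.card_le_two)
  rcases P.eq_empty_or_nonempty with rfl | hne
  · have h7 := Finset.card_le_card (Finset.subset_union_right (s₁ := vs ends ∅) (s₂ := vs ends Q))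
    rw [Finset.card_empty]
    omega
  have h7 := hF P subset_rfl hne
  by_cases h8 : (vs ends P ∩ vs ends Q).card ≤ 1
  · omega
  have h9 : vs ends P ∩ vs ends Q = {x, y} :=
    Finset.eq_of_subset_of_card_le h5 (by have := Finset.card_le_two (a := x) (b := y); omega)
  rcases hs with hs | hs
  · have h10 := ((h₁.skew_iff P hP).1 ⟨hPi, hs⟩).2 P subset_rfl
    rw [← h9, Finset.union_eq_left.2 Finset.inter_subset_left] at h10
    omega
  · have h10 := h₂.card_skew Q hQ hQi hs
    rw [← h9, Finset.union_eq_left.2 Finset.inter_subset_right] at h10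
    omega

lemma HalfFrame.skew_union_of_disjoint (h₁ : M.HalfFrame A B ends K) (h₂ : M.HalfFrame B A ends K)
    {P P' Q Q' : Finset α} (hP : (P : Set α) ⊆ A) (hP' : (P' : Set α) ⊆ A) (hQ : (Q : Set α) ⊆ B)
    (hQ' : (Q' : Set α) ⊆ B) (hPi : M.Indep P) (hPi' : M.Indep P') (hQi : M.Indep Q)
    (hQi' : M.Indep Q') (hs : M.Skew P B ∨ M.Skew Q A) (hd : Disjoint (vs ends P) (vs ends P'))
    (hd' : Disjoint (vs ends Q) (vs ends Q')) (hK : Disjoint K (vs ends P' ∪ vs ends Q')) :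
    M.Skew ↑(P ∪ P') B ∨ M.Skew ↑(Q ∪ Q') A := by
  rw [Finset.disjoint_union_right] at hK
  exact hs.imp (fun hs ↦ h₁.union_skew P P' hP hP' hPi hPi' hs hd hK.1)
    fun hs ↦ h₂.union_skew Q Q' hQ hQ' hQi hQi' hs hd' hK.2

/-- Representations of the two parts of a 2-separation are glued along the basepoint. -/
lemma TwoSep.isFrame (h : M.TwoSep A B) (h₁ : M.HalfFrame A B ends K)
    (h₂ : M.HalfFrame B A ends K) (hmeet : ∀ a ∈ A, ∀ b ∈ B, ends a ∩ ends b ⊆ K)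
    (hK : K.card = 1 ∨ ∃ x y, K = {x, y} ∧ M.GraphicHalf A B ends x y) : M.IsFrame ends := by
  have hmeet' : ∀ b ∈ B, ∀ a ∈ A, ends b ∩ ends a ⊆ K := fun b hb a ha ↦ by
    rw [Finset.inter_comm]; exact hmeet a ha b hb
  refine ⟨fun e he ↦ ?_, fun e he ↦ ?_, fun I hI ↦ ?_, fun I hI e he v hv hvI ↦ ?_,
    fun I I' hI hI' hd ↦ ?_⟩
  · rw [← h.union] at he
    exact he.elim (h₁.nonempty e) (h₂.nonempty e)
  · rw [← h.union] at he
    exact he.elim (h₁.card_le e) (h₂.card_le e)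
  · obtain ⟨P, Q, rfl, hPQ, hP, hQ⟩ := h.exists_split hI.subset_ground
    rw [h.indep_union_iff_skew hP hQ] at hI
    obtain ⟨hPi, hQi, hs⟩ := hI
    rw [Finset.card_union_of_disjoint hPQ, vs_union]
    rcases hK with hK | ⟨x, y, rfl, hG⟩
    · rcases hs with hs | hs
      · exact h₁.card_union h₂ hmeet hK hP hQ hPi hQi hs
      · rw [add_comm, Finset.union_comm]
        exact h₂.card_union h₁ hmeet' hK hQ hP hQi hPi hs
    · exact hG.card_union h₂ hmeet hP hQ hPi hQi hs
  · obtain ⟨P, Q, rfl, hPQ, hP, hQ⟩ := h.exists_split hI.subset_ground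
    rw [← h.union] at he
    rcases he with he | he
    · exact h₁.leaf_union h h₂ hP hQ hI he hv hvI
    · rw [Finset.union_comm] at hI hvI ⊢
      exact h₂.leaf_union h.symm h₁ hQ hP hI he hv hvI
  · obtain ⟨P, Q, rfl, hPQ, hP, hQ⟩ := h.exists_split hI.subset_ground
    obtain ⟨P', Q', rfl, hPQ', hP', hQ'⟩ := h.exists_split hI'.subset_ground
    rw [h.indep_union_iff_skew hP hQ] at hI
    rw [h.indep_union_iff_skew hP' hQ'] at hI'
    obtain ⟨hPi, hQi, hs⟩ := hI
    obtain ⟨hPi', hQi', hs'⟩ := hI'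
    have hd0 := hd
    rw [vs_union, vs_union, Finset.disjoint_union_left, Finset.disjoint_union_right,
      Finset.disjoint_union_right] at hd
    obtain ⟨⟨hdP, hdPQ⟩, hdQP, hdQ⟩ := hd
    rw [Finset.union_union_union_comm, h.indep_union_iff_skew (by
      rw [Finset.coe_union]
      exact Set.union_subset hP hP') (by
      rw [Finset.coe_union]
      exact Set.union_subset hQ hQ')]
    have hPP := h₁.union P P' hP hP' hPi hPi' hdP
    refine ⟨hPP, h₂.union Q Q' hQ hQ' hQi hQi' hdQ, ?_⟩
    -- If one of the two sets avoids the ends of the basepoint, a part of the other that is skew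
    -- remains so after the union.
    by_cases hK' : Disjoint K (vs ends (P' ∪ Q'))
    · rw [vs_union] at hK'
      exact h₁.skew_union_of_disjoint h₂ hP hP' hQ hQ' hPi hPi' hQi hQi' hs hdP hdQ hK'
    by_cases hK'' : Disjoint K (vs ends (P ∪ Q))
    · rw [vs_union] at hK''
      rw [Finset.union_comm P, Finset.union_comm Q]
      exact h₁.skew_union_of_disjoint h₂ hP' hP hQ' hQ hPi' hPi hQi' hQi hs' hdP.symm hdQ.symm hK''
    -- Now the two vertex-disjoint sets each contain an end of the basepoint, so these ends differ
    -- and `K` is not a single vertex. In the graphic side the union of the two forests keeps the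
    -- ends apart.
    left
    rw [Finset.disjoint_left] at hK' hK'' hd0
    push Not at hK' hK''
    obtain ⟨q, hqK, hq⟩ := hK'
    obtain ⟨p, hpK, hp⟩ := hK''
    have hpq : p ≠ q := by rintro rfl; exact hd0 hp hq
    have hq' : q ∉ vs ends P := fun hh ↦ hd0 (vs_mono Finset.subset_union_left hh) hq
    have hp' : p ∉ vs ends P' := fun hh ↦ hd0 hp (vs_mono Finset.subset_union_left hh)
    rcases hK with hK | ⟨x, y, rfl, hG⟩
    · exact (hpq (Finset.card_le_one.1 hK.le p hpK q hqK)).elim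
    have hPPA : (↑(P ∪ P') : Set α) ⊆ A := by
      rw [Finset.coe_union]
      exact Set.union_subset hP hP'
    have h3 := isPairForest_union_of_disjoint hpq ((hG.indep_iff _ hPPA).1 hPP) hdP hp' hq'
    refine ((hG.skew_iff _ hPPA).2 ?_).2
    simp only [Finset.mem_insert, Finset.mem_singleton] at hpK hqK
    rcases hpK with rfl | rfl <;> rcases hqK with rfl | rfl
    · exact (hpq rfl).elim
    · exact h3
    · exact h3.symm
    · exact (hpq rfl).elim

end Glue

end Matroid

/-! ### Components of an edge set -/

namespace Multi

variable {α V : Type*} {ends : α → Finset V} {X Z : Finset α} {u v : V}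

lemma reach_of_component (h : ∀ w ∈ vs ends (X \ Z), ¬ Relation.ReflTransGen (AdjOn ends X) u w)
    (huv : Relation.ReflTransGen (AdjOn ends X) u v) :
    Relation.ReflTransGen (AdjOn ends Z) u v := by
  induction huv with
  | refl => exact .refl
  | @tail b c hb hbc ih =>
    obtain ⟨e, he, hbc⟩ := hbc
    refine ih.tail ⟨e, ?_, hbc⟩
    by_contra heZ
    exact h b (ends_subset_vs (Finset.mem_sdiff.2 ⟨he, heZ⟩) (by rw [hbc]; simp)) hb

/-- The connected component of a vertex of `X`. -/
lemma exists_connected_component (hX : ∀ e ∈ X, (ends e).card ≤ 2) (hu : u ∈ vs ends X) :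
    ∃ Z ⊆ X, u ∈ vs ends Z ∧ Disjoint (vs ends Z) (vs ends (X \ Z)) ∧
      (∀ v ∈ vs ends Z, Relation.ReflTransGen (AdjOn ends Z) u v) ∧
      ∀ v ∈ vs ends X, Relation.ReflTransGen (AdjOn ends X) u v → v ∈ vs ends Z := by
  obtain ⟨Z, hZX, h1, h2⟩ := exists_component (ends := ends) X hX u
  have h3 : ∀ v ∈ vs ends X, Relation.ReflTransGen (AdjOn ends X) u v → v ∈ vs ends Z := by
    intro v hv hr
    obtain ⟨e, he, hve⟩ := mem_vs.1 hv
    by_contra hvZ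
    refine h2 v (ends_subset_vs (Finset.mem_sdiff.2 ⟨he, fun heZ ↦ hvZ ?_⟩) hve) hr
    exact ends_subset_vs heZ hve
  refine ⟨Z, hZX, h3 u hu .refl, ?_, fun v hv ↦ reach_of_component h2 (h1 v hv), h3⟩
  rw [Finset.disjoint_left]
  exact fun v hv hv' ↦ h2 v hv' (h1 v hv)

end Multi

/-! ### Connectedness and balance of the two sides -/

namespace Matroid

set_option linter.unusedSectionVars false

open Multi

section BiasedGraph

variable {β V : Type*} {N : Matroid β} {ends : β → Finset V} {W : Finset V} {X : Finset β}

namespace IsFrame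

lemma vertsOf_biasedGraph (h : N.IsFrame ends) (hN : N.Finite) (hW : ∀ e ∈ N.E, ends e ⊆ W)
    (hX : (X : Set β) ⊆ N.E) : (h.biasedGraph hN W hW).graph.vertsOf X = ↑(vs ends X) := by
  change (graph N ends W).vertsOf X = _
  rw [Graph.vertsOf_coe, vs_congr fun e he ↦ ?_]
  rw [h.endsF_graph hW, if_pos (hX he)]

lemma connectedOn_biasedGraph (h : N.IsFrame ends) (hN : N.Finite) (hW : ∀ e ∈ N.E, ends e ⊆ W)
    (hX : (X : Set β) ⊆ N.E) : (h.biasedGraph hN W hW).graph.ConnectedOn X ↔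
      ∀ u ∈ vs ends X, ∀ v ∈ vs ends X, Relation.ReflTransGen (AdjOn ends X) u v := by
  rw [Graph.ConnectedOn, h.vertsOf_biasedGraph hN hW hX]
  have : (fun a b ↦ ∃ e ∈ (X : Set β), (h.biasedGraph hN W hW).graph.IsLink e a b) =
      AdjOn ends X := by
    ext a b
    constructor
    · rintro ⟨e, he, hl⟩
      exact ⟨e, he, hl.2.1⟩
    · rintro ⟨e, he, hl⟩
      have h1 := hW e (hX he)
      rw [hl] at h1
      exact ⟨e, he, hX he, hl, h1 (by simp), h1 (by simp)⟩
  rw [this]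
  rfl

lemma isBalancedOn_biasedGraph (h : N.IsFrame ends) (hN : N.Finite)
    (hW : ∀ e ∈ N.E, ends e ⊆ W) (hX : (X : Set β) ⊆ N.E) :
    (h.biasedGraph hN W hW).IsBalancedOn X ↔ ∀ C ⊆ X, IsCyc ends C → N.IsCircuit C := by
  have key : ∀ C : Finset β, IsCyc (h.biasedGraph hN W hW).graph.endsF C ↔
    (C : Set β) ⊆ N.E ∧ IsCyc ends C := fun C ↦ h.isCyc_endsF hW
  constructor
  · intro hb C hC hcyc
    by_contra hn
    refine hb C (Finset.coe_subset.2 hC) (BiasedGraph.isUnbalancedCycle_iff.2 ⟨C, rfl,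
      (key C).2 ⟨(Finset.coe_subset.2 hC).trans hX, hcyc⟩, fun hh ↦ hn ?_⟩)
    exact ((h.mem_balanced_biasedGraph hN hW).1 hh).1
  · intro hb C hC hu
    obtain ⟨C, rfl, hcyc, hn⟩ := BiasedGraph.isUnbalancedCycle_iff.1 hu
    have h1 := ((key C).1 hcyc).2
    exact hn ((h.mem_balanced_biasedGraph hN hW).2 ⟨hb C (Finset.coe_subset.1 hC) h1, h1⟩)

lemma isUnbalancedLoopAt_biasedGraph (h : N.IsFrame ends) (hN : N.Finite)
    (hW : ∀ e ∈ N.E, ends e ⊆ W) {e : β} (he : e ∈ N.E) {v : V} (hv : ends e = {v}) :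
    (h.biasedGraph hN W hW).IsUnbalancedLoopAt e v := by
  constructor
  · rw [Graph.isLoopAt_iff_endsF]
    change (graph N ends W).endsF e = _
    rw [h.endsF_graph hW, if_pos he, hv]
  · intro hb
    exact hb.1.not_indep (h.indep_singleton he)

lemma mem_balanced_iff (h : N.IsFrame ends) (hN : N.Finite) (hW : ∀ e ∈ N.E, ends e ⊆ W)
    {C : Set β} : C ∈ (h.biasedGraph hN W hW).balanced ↔
      ∃ F : Finset β, C = F ∧ N.IsCircuit F ∧ IsCyc ends F := by
  constructor
  · intro hC
    obtain ⟨F, rfl, -⟩ := Graph.isCycleSet_iff.1 hC.2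
    exact ⟨F, rfl, (h.mem_balanced_biasedGraph hN hW).1 hC⟩
  · rintro ⟨F, rfl, hF⟩
    exact (h.mem_balanced_biasedGraph hN hW).2 hF

lemma isLBiased_biasedGraph {L : Set β} (h : N.IsFrame ends) (hN : N.Finite)
    (hW : ∀ e ∈ N.E, ends e ⊆ W) (hL : ∀ e ∈ L, e ∈ N.E ∧ (ends e).card = 1) :
    (h.biasedGraph hN W hW).IsLBiased L := by
  intro e he
  obtain ⟨v, hv⟩ := Finset.card_eq_one.1 (hL e he).2
  exact ⟨v, h.isUnbalancedLoopAt_biasedGraph hN hW (hL e he).1 hv⟩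

end IsFrame

/-- In a representation of full rank, every component has an unbalanced cycle. -/
lemma IsFrame.exists_isCyc_of_full (h : N.IsFrame ends) {J Z : Finset β} (hJ : N.Indep J)
    (hJX : J ⊆ X) (hc : J.card = (vs ends X).card) (hne : (vs ends Z).Nonempty) (hZ : Z ⊆ X)
    (hd : Disjoint (vs ends Z) (vs ends (X \ Z))) : ∃ C ⊆ Z, IsCyc ends C ∧ ¬ N.IsCircuit C := by
  have h1 := h.card_indep (J \ Z) (hJ.subset (Finset.coe_subset.2 Finset.sdiff_subset))
  have h2 : vs ends (J \ Z) ⊆ vs ends (X \ Z) := vs_mono (Finset.sdiff_subset_sdiff hJX subset_rfl)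
  have h3 := Finset.card_le_card h2
  have h4 : vs ends X = vs ends Z ∪ vs ends (X \ Z) := by
    rw [← vs_union, Finset.union_sdiff_of_subset hZ]
  rw [h4, Finset.card_union_of_disjoint hd] at hc
  have h5 := Finset.card_inter_add_card_sdiff J Z
  have h6 := Finset.card_le_card (vs_mono (ends := ends) (Finset.inter_subset_right (s₁ := J)
    (s₂ := Z)))
  have h7 := Finset.card_pos.2 hne
  -- `J` has as many edges as there are vertices, and at most `|V(X \ Z)|` of them lie outside `Z`.
  -- So `J ∩ Z` has enough edges for a cycle, which is unbalanced as part of an independent set.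
  obtain ⟨C, hC, hcyc⟩ := exists_isCyc (ends := ends) (X := J ∩ Z) (Finset.card_pos.1 (by omega))
    (fun e he ↦ h.nonempty e (hJ.subset_ground (Finset.mem_inter.1 he).1)) (by omega)
  refine ⟨C, hC.trans Finset.inter_subset_right, hcyc, fun hcirc ↦ hcirc.not_indep ?_⟩
  exact hJ.subset (Finset.coe_subset.2 (hC.trans Finset.inter_subset_left))

end BiasedGraph

section Types

variable {α V : Type*} {M : Matroid α} [M.Finite] {A B : Set α} {R : Matroid (Option α)}
  {ends : α → Finset V} {K : Finset V} {E : Finset α}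

/-- Every component of a part of a 2-separation contains an end of the basepoint. -/
lemma TwoSep.exists_reach (h : M.TwoSep A B) (t : M.IsTip A B R) (F : R.IsFrame (baseAt ends K))
    (hE : (E : Set α) = A) {u : V} (hu : u ∈ vs ends E) :
    ∃ z ∈ K, z ∈ vs ends E ∧ Relation.ReflTransGen (AdjOn ends E) u z := by
  have := t.finite h.left_subset
  have hH := F.halfFrame t
  obtain ⟨Z, hZ, huZ, hd, hr, -⟩ := exists_connected_component (ends := ends)
    (fun e he ↦ hH.card_le e (hE ▸ he)) hu
  by_contra! hcon
  -- A component missing the ends of the basepoint would share no vertex with the other edges and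
  -- the basepoint, so the connected tip matroid would be separated.
  have h1 := F.eq_empty_of_disjoint (fun S T hST hdST hS hT ↦ h.tip_conn t hST hdST hS hT)
    (X := Z.map Function.Embedding.some) (Y := Finset.insertNone (E \ Z)) (by
      rw [coe_map_some, coe_insertNone, t.ground, Set.union_insert, ← Set.image_union,
        ← Finset.coe_union, Finset.union_sdiff_of_subset hZ, hE]) (by
      obtain ⟨e, he, -⟩ := mem_vs.1 huZ
      exact ⟨some e, by simpa using he⟩) (by
      rw [vs_baseAt_map, vs_baseAt_insertNone, Finset.disjoint_union_right]
      refine ⟨hd, ?_⟩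
      rw [Finset.disjoint_left]
      intro v hv hvK
      exact hcon v hvK (vs_mono hZ hv) (reach_mono hZ (hr v hv)))
  have h2 : none ∈ Finset.insertNone (E \ Z) := by simp
  rw [h1] at h2
  exact Finset.notMem_empty _ h2

lemma TwoSep.exists_isCircuit_insertNone (h : M.TwoSep A B) (t : M.IsTip A B R) :
    ∃ Q : Finset α, (Q : Set α) ⊆ A ∧ R.IsCircuit ↑(Finset.insertNone Q) ∧ M.Indep Q ∧
      Q.Nonempty := by
  have := t.finite h.left_subset
  obtain ⟨C, -, hC, hn⟩ := exists_isCircuit_of_mem_closure (h.none_mem_closure t) (by simp)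
  obtain ⟨C, rfl⟩ := (R.ground_finite.subset hC.subset_ground).exists_finset_coe
  obtain ⟨Q, hQ, rfl | rfl⟩ := t.exists_finset hC.subset_ground
  · simp at hn
  refine ⟨Q, hQ, hC, ?_, ?_⟩
  · rw [← t.indep_map hQ]
    refine hC.ssubset_indep ⟨fun x hx ↦ ?_, fun hh ↦ ?_⟩
    · rw [coe_map_some] at hx
      rw [coe_insertNone]
      exact .inr hx
    · have := hh hn
      simp at this
  · rw [Finset.nonempty_iff_ne_empty]
    rintro rfl
    refine hC.not_indep ?_
    rw [coe_insertNone]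
    simpa using t.indep_none

/-- A circuit through the basepoint contains a loop, so it has more edges than vertices. Without the
basepoint it still has as many edges as vertices and is independent, so it contains an unbalanced
cycle. -/
lemma TwoSep.exists_isCyc_of_card_eq_one (h : M.TwoSep A B) (t : M.IsTip A B R)
    (F : R.IsFrame (baseAt ends K)) (hK : K.card = 1) (hE : (E : Set α) = A) :
    ∃ C ⊆ E, IsCyc ends C ∧ ¬ M.IsCircuit C := by
  obtain ⟨Q, hQ, hC, hi, hne⟩ := h.exists_isCircuit_insertNone t
  have h1 := card_vs_lt_of_deg (ends := baseAt ends K) (fun e he ↦ F.card_le e (hC.subset_ground he))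
    (fun _ he _ hv ↦ F.exists_ne hC he hv) (e := none) (by simp) hK.le
  rw [vs_baseAt_insertNone, Finset.card_insertNone] at h1
  have h2 := Finset.card_le_card (Finset.subset_union_left (s₁ := vs ends Q) (s₂ := K))
  obtain ⟨C, hCQ, hcyc⟩ := exists_isCyc (ends := ends) hne
    (fun e he ↦ (F.halfFrame t).nonempty e (hQ he)) (by omega)
  exact ⟨C, hCQ.trans (Finset.coe_subset.1 (hE ▸ hQ)), hcyc, fun hc ↦ hc.not_indep
    (hi.subset (Finset.coe_subset.2 hCQ))⟩

lemma IsForestRep.isCyc_of_isCircuit {β : Type*} {N : Matroid β} {ends : β → Finset V}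
    (h : N.IsForestRep ends) {C : Finset β} (hC : N.IsCircuit C) : IsCyc ends C := by
  refine ⟨by exact_mod_cast hC.nonempty, ?_, fun Z hZ hne ↦ ?_⟩
  · refine le_antisymm (h.isFrame.card_vs_le hC) ?_
    obtain ⟨e, he⟩ : C.Nonempty := by exact_mod_cast hC.nonempty
    have h1 : N.Indep ↑(C.erase e) := by
      rw [Finset.coe_erase]
      exact hC.sdiff_singleton_indep he
    have h2 := Finset.card_erase_add_one he
    rcases (C.erase e).eq_empty_or_nonempty with h0 | h0
    · rw [h0, Finset.card_empty] at h2
      have h3 := Finset.card_le_card (ends_subset_vs (ends := ends) he)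
      rw [h.card_eq e (hC.subset_ground he)] at h3
      omega
    · have h3 := (h.indep_iff _ h1.subset_ground).1 h1 _ subset_rfl h0
      have h4 := Finset.card_le_card (vs_mono (ends := ends) (Finset.erase_subset e C))
      omega
  · have h1 : N.Indep Z := hC.ssubset_indep (by exact_mod_cast hZ)
    exact (h.indep_iff Z h1.subset_ground).1 h1 Z subset_rfl hne

lemma IsForestRep.isCircuit_of_isCyc {β : Type*} {N : Matroid β} {ends : β → Finset V}
    (h : N.IsForestRep ends) {C : Finset β} (hCE : (C : Set β) ⊆ N.E) (hC : IsCyc ends C) :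
    N.IsCircuit C := by
  rw [isCircuit_iff_forall_ssubset, dep_iff, h.indep_iff C hCE]
  refine ⟨⟨fun hF ↦ (hF C subset_rfl hC.1).ne' hC.2.1, hCE⟩, fun I hI ↦ ?_⟩
  obtain ⟨I, rfl⟩ := (C.finite_toSet.subset hI.subset).exists_finset_coe
  rw [h.indep_iff I (hI.subset.trans hCE)]
  exact fun Z hZ hne ↦ hC.2.2 Z (hZ.trans_ssubset (by exact_mod_cast hI)) hne

/-- The graphic side of a 2-separation joins the ends of the basepoint. -/
lemma TwoSep.reach_of_isForestRep (h : M.TwoSep A B) (t : M.IsTip A B R)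
    (F : R.IsForestRep (baseAt ends K)) (hE : (E : Set α) = A) :
    K ⊆ vs ends E ∧ ∀ x ∈ K, ∀ y ∈ K, Relation.ReflTransGen (AdjOn ends E) x y := by
  obtain ⟨Q, hQ, hC, hi, hne⟩ := h.exists_isCircuit_insertNone t
  have hcyc := F.isCyc_of_isCircuit hC
  have hQE : Q ⊆ E := Finset.coe_subset.1 (hE ▸ hQ)
  have hn : none ∈ Finset.insertNone Q := by simp
  constructor
  · intro v hv
    obtain ⟨f, hf, hfn, hvf⟩ := F.isFrame.exists_ne hC hn (v := v) hv
    rcases f with _ | a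
    · exact (hfn rfl).elim
    · exact ends_subset_vs (hQE (by simpa using hf)) hvf
  · intro x hx y hy
    have h1 := hcyc.reach_erase (fun e he ↦ F.isFrame.card_le e (hC.subset_ground he)) hn
      (ends_subset_vs hn hx) (ends_subset_vs hn hy)
    refine Relation.ReflTransGen.mono (fun a b hab ↦ ?_) _ _ h1
    obtain ⟨_ | e, he, hab⟩ := hab
    · simp at he
    · exact ⟨e, hQE (by simpa using he), hab⟩

/-- The basepoint is spanned by the side, so some base avoids it. That base has as many elements as
there are vertices in all, which forces the ends of the basepoint to be met by edges of the side. -/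
lemma TwoSep.exists_full (h : M.TwoSep A B) (t : M.IsTip A B R) (F : R.IsFrame (baseAt ends K))
    (hfull : ∃ E' I : Finset (Option α), (E' : Set _) = R.E ∧ R.Indep I ∧
      (vs (baseAt ends K) E').card = I.card) (hE : (E : Set α) = A) :
    K ⊆ vs ends E ∧ ∃ J ⊆ E, M.Indep J ∧ J.card = (vs ends E).card := by
  have := t.finite h.left_subset
  obtain ⟨E', I, hE', hI, hc⟩ := hfull
  obtain rfl : E' = Finset.insertNone E := by
    rw [← Finset.coe_inj, hE', coe_insertNone, t.ground, hE]
  rw [vs_baseAt_insertNone] at hc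
  obtain ⟨J, hJ⟩ := R.exists_isBasis (some '' A) (by rw [t.ground]; exact Set.subset_insert _ _)
  obtain ⟨J, hJA, rfl⟩ := Set.subset_image_iff.1 hJ.subset
  obtain ⟨J, rfl⟩ := ((E.finite_toSet).subset (hE ▸ hJA)).exists_finset_coe
  have hJE : J ⊆ E := Finset.coe_subset.1 (hE ▸ hJA)
  have hbase : R.IsBase (some '' (J : Set α)) := by
    refine hJ.indep.isBase_of_ground_subset_closure ?_
    rw [hJ.closure_eq_closure, t.ground]
    refine Set.insert_subset (h.none_mem_closure t) (R.subset_closure _ ?_)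
    rw [t.ground]
    exact Set.subset_insert _ _
  have hJi : M.Indep J := (t.indep _ hJA).1 hJ.indep
  have h1 := hI.encard_le_eRank
  rw [← hbase.encard_eq_eRank, ← coe_map_some, Set.encard_coe_eq_coe_finsetCard,
    Set.encard_coe_eq_coe_finsetCard, Finset.card_map, Nat.cast_le] at h1
  have h2 := (F.halfFrame t).card_indep J hJA hJi
  have h3 := Finset.card_le_card (vs_mono (ends := ends) hJE)
  have h4 : vs ends E = vs ends E ∪ K :=
    Finset.eq_of_subset_of_card_le Finset.subset_union_left (by omega)
  have h5 := congrArg Finset.card h4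
  exact ⟨by rw [h4]; exact Finset.subset_union_right, J, hJE, hJi, by omega⟩

end Types

end Matroid

/-! ### Cycles through the basepoint -/

namespace Multi

variable {α β V : Type*} {ends : α → Finset V} {K : Finset V} {P Q : Finset α}

lemma isCyc_map (f : β ↪ α) (Y : Finset β) :
    IsCyc ends (Y.map f) ↔ IsCyc (fun b ↦ ends (f b)) Y := by
  rw [IsCyc, IsCyc, vs_map, Finset.card_map, Finset.map_nonempty]
  refine and_congr_right fun _ ↦ and_congr_right fun _ ↦ ⟨fun h Z hZ hne ↦ ?_, fun h Z hZ hne ↦ ?_⟩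
  · have := h (Z.map f) (Finset.map_ssubset_map.2 hZ) (by simpa)
    rwa [vs_map, Finset.card_map] at this
  · obtain ⟨Z, hZ', rfl⟩ := Finset.subset_map_iff.1 hZ.1
    rw [vs_map, Finset.card_map]
    exact h Z (Finset.map_ssubset_map.1 hZ) (by simpa using hne)

lemma exists_eq_map_or_insertNone (Z : Finset (Option α)) :
    ∃ Y : Finset α, Z = Y.map Function.Embedding.some ∨ Z = Finset.insertNone Y := by
  refine ⟨Finset.eraseNone Z, ?_⟩
  by_cases hn : none ∈ Z
  · right
    ext (_ | a) <;> simp [hn]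
  · left
    ext (_ | a) <;> simp [hn]

/-- Subsets containing the basepoint have the vertices of `K` added and one edge more; the counts
are separated accordingly. -/
lemma isCyc_insertNone : IsCyc (Matroid.baseAt ends K) (Finset.insertNone P) ↔
    (vs ends P ∪ K).card = P.card + 1 ∧ (∀ Z ⊆ P, Z.Nonempty → Z.card < (vs ends Z).card) ∧
      ∀ Z ⊂ P, Z.card + 1 < (vs ends Z ∪ K).card := by
  rw [IsCyc, Matroid.vs_baseAt_insertNone, Finset.card_insertNone]
  have hn : none ∈ Finset.insertNone P := by simp
  constructor
  · rintro ⟨-, h1, h2⟩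
    refine ⟨h1, fun Z hZ hne ↦ ?_, fun Z hZ ↦ ?_⟩
    · have := h2 (Z.map Function.Embedding.some) ⟨fun x hx ↦ ?_, fun hh ↦ ?_⟩ (by simpa)
      · rwa [Matroid.vs_baseAt_map, Finset.card_map] at this
      · obtain ⟨a, ha, rfl⟩ := Finset.mem_map.1 hx
        simpa using hZ ha
      · have := hh hn
        simp at this
    · have := h2 (Finset.insertNone Z) (Finset.insertNone.lt_iff_lt.2 hZ) ⟨none, by simp⟩
      rwa [Matroid.vs_baseAt_insertNone, Finset.card_insertNone] at this
  · rintro ⟨h1, h2, h3⟩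
    refine ⟨⟨none, hn⟩, h1, fun Z hZ hne ↦ ?_⟩
    obtain ⟨Z, rfl | rfl⟩ := exists_eq_map_or_insertNone Z
    · rw [Matroid.vs_baseAt_map, Finset.card_map]
      refine h2 Z (fun a ha ↦ ?_) (by simpa using hne)
      simpa using hZ.1 (Finset.mem_map_of_mem Function.Embedding.some ha)
    · rw [Matroid.vs_baseAt_insertNone, Finset.card_insertNone]
      exact h3 Z (Finset.insertNone.lt_iff_lt.1 hZ)

lemma IsCyc.inter_eq (h : IsCyc ends (P ∪ Q)) (hd : Disjoint P Q) (hP : P.Nonempty)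
    (hQ : Q.Nonempty) (hK : K.card = 2) (hPQ : vs ends P ∩ vs ends Q ⊆ K) :
    vs ends P ∩ vs ends Q = K :=
  Finset.eq_of_subset_of_card_le hPQ (hK.trans_le (h.two_le_inter rfl hd hP hQ))

/-- The two parts of a crossing cycle meet in both ends of the basepoint, so the basepoint can stand
in for the other part. The count for a proper subset `Z` of `P` comes from the proper subset `Z ∪ Q`
of the cycle. -/
lemma IsCyc.isCyc_insertNone (h : IsCyc ends (P ∪ Q)) (hd : Disjoint P Q) (hP : P.Nonempty)
    (hQ : Q.Nonempty) (hK : K.card = 2) (hPQ : vs ends P ∩ vs ends Q ⊆ K) :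
    IsCyc (Matroid.baseAt ends K) (Finset.insertNone P) := by
  have hI := h.inter_eq hd hP hQ hK hPQ
  have hKP : K ⊆ vs ends P := hI ▸ Finset.inter_subset_left
  have hKQ : K ⊆ vs ends Q := hI ▸ Finset.inter_subset_right
  have hsP := ssubset_of_disjoint_union rfl hd hQ
  have hsQ := ssubset_of_disjoint_union (Finset.union_comm Q P) hd.symm hP
  have h1 := h.2.2 P hsP hP
  have h2 := h.2.2 Q hsQ hQ
  have h3 := card_union_eq (vs ends P) (vs ends Q)
  rw [← vs_union, h.2.1, hI, hK, Finset.card_union_of_disjoint hd] at h3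
  refine Multi.isCyc_insertNone.2 ⟨?_, fun Z hZ hne ↦ h.2.2 Z (hZ.trans_ssubset hsP) hne,
    fun Z hZ ↦ ?_⟩
  · rw [Finset.union_eq_left.2 hKP]
    omega
  · have hZd : Disjoint Z Q := hd.mono_left hZ.1
    have h4 : Z ∪ Q ⊂ P ∪ Q := by
      obtain ⟨a, ha, haZ⟩ := Finset.exists_of_ssubset hZ
      refine Finset.ssubset_iff_subset_ne.2
        ⟨Finset.union_subset_union_left hZ.1, fun hh ↦ ?_⟩
      have h5 : a ∈ Z ∪ Q := hh ▸ Finset.mem_union_left _ ha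
      rcases Finset.mem_union.1 h5 with h5 | h5
      · exact haZ h5
      · exact Finset.disjoint_left.1 hd ha h5
    have h5 := h.2.2 _ h4 (hQ.mono Finset.subset_union_right)
    rw [Finset.card_union_of_disjoint hZd] at h5
    have h6 : vs ends (Z ∪ Q) ⊆ (vs ends Z ∪ K) ∪ vs ends Q := by
      rw [vs_union]
      exact Finset.union_subset_union_left Finset.subset_union_left
    have h7 := Finset.card_le_card h6
    have h8 := card_union_eq (vs ends Z ∪ K) (vs ends Q)
    have h9 := Finset.card_le_card (Finset.subset_inter (Finset.subset_union_right
      (s₁ := vs ends Z) (s₂ := K)) hKQ)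
    omega

lemma subset_vs_of_isCyc_insertNone (h : IsCyc (Matroid.baseAt ends K) (Finset.insertNone P))
    (hP : P.Nonempty) : K ⊆ vs ends P := by
  obtain ⟨h1, h2, -⟩ := isCyc_insertNone.1 h
  have h3 := h2 P subset_rfl hP
  have h4 : vs ends P = vs ends P ∪ K :=
    Finset.eq_of_subset_of_card_le Finset.subset_union_left (by omega)
  rw [h4]
  exact Finset.subset_union_right

lemma isCyc_union_of_insertNone (hP : IsCyc (Matroid.baseAt ends K) (Finset.insertNone P))
    (hQ : IsCyc (Matroid.baseAt ends K) (Finset.insertNone Q)) (hd : Disjoint P Q)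
    (hPne : P.Nonempty) (hQne : Q.Nonempty) (hK : K.card = 2)
    (hPQ : vs ends P ∩ vs ends Q ⊆ K) : IsCyc ends (P ∪ Q) := by
  have hKP := subset_vs_of_isCyc_insertNone hP hPne
  have hKQ := subset_vs_of_isCyc_insertNone hQ hQne
  obtain ⟨p1, p2, p3⟩ := isCyc_insertNone.1 hP
  obtain ⟨q1, q2, q3⟩ := isCyc_insertNone.1 hQ
  have hI : vs ends P ∩ vs ends Q = K := hPQ.antisymm (Finset.subset_inter hKP hKQ)
  refine ⟨hPne.mono Finset.subset_union_left, ?_, fun Z hZ hne ↦ ?_⟩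
  · have h3 := card_union_eq (vs ends P) (vs ends Q)
    rw [Finset.union_eq_left.2 hKP] at p1
    rw [Finset.union_eq_left.2 hKQ] at q1
    rw [vs_union, Finset.card_union_of_disjoint hd]
    rw [hI] at h3
    omega
  · have hZe : Z ∩ P ∪ Z ∩ Q = Z := by
      rw [← Finset.inter_union_distrib_left, Finset.inter_eq_left.2 hZ.1]
    have hdZ : Disjoint (Z ∩ P) (Z ∩ Q) :=
      hd.mono Finset.inter_subset_right Finset.inter_subset_right
    have h1 := card_union_eq (vs ends (Z ∩ P)) (vs ends (Z ∩ Q))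
    have h2 : vs ends (Z ∩ P) ∩ vs ends (Z ∩ Q) ⊆ K := (Finset.inter_subset_inter
      (vs_mono Finset.inter_subset_right) (vs_mono Finset.inter_subset_right)).trans hPQ
    have h3 := Finset.card_le_card h2
    have h4 : Z.card = (Z ∩ P).card + (Z ∩ Q).card := by
      rw [← Finset.card_union_of_disjoint hdZ, hZe]
    rw [← vs_union, hZe] at h1
    have hZP := p2 (Z ∩ P) Finset.inter_subset_right
    have hZQ := q2 (Z ∩ Q) Finset.inter_subset_right
    rcases (Z ∩ P).eq_empty_or_nonempty with h5 | h5
    · rw [h5, Finset.empty_union] at hZe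
      rw [hZe] at hZQ
      exact hZQ hne
    rcases (Z ∩ Q).eq_empty_or_nonempty with h6 | h6
    · rw [h6, Finset.union_empty] at hZe
      rw [hZe] at hZP
      exact hZP hne
    have h7 := hZP h5
    have h8 := hZQ h6
    by_cases h9 : (vs ends (Z ∩ P) ∩ vs ends (Z ∩ Q)).card ≤ 1
    · omega
    have h10 := Finset.eq_of_subset_of_card_le h2 (by omega)
    -- When both ends are shared, one of the two parts is properly contained in its path, and the
    -- basepoint count for that part gives a surplus of two.
    by_cases h11 : Z ∩ P = P
    · have h12 : Z ∩ Q ⊂ Q := by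
        refine Finset.ssubset_iff_subset_ne.2 ⟨Finset.inter_subset_right, fun hh ↦ hZ.2 ?_⟩
        rw [h11, hh] at hZe
        exact hZe.le
      have h13 := q3 _ h12
      rw [← h10, Finset.union_eq_left.2 Finset.inter_subset_right] at h13
      omega
    · have h13 := p3 _ (Finset.ssubset_iff_subset_ne.2 ⟨Finset.inter_subset_right, h11⟩)
      rw [← h10, Finset.union_eq_left.2 Finset.inter_subset_left] at h13
      omega

end Multi

/-! ### Building the loop-sum and the link-sum -/

namespace Matroid

set_option linter.unusedSectionVars false

open Multi

variable {α V : Type*} {M : Matroid α} {A B L : Set α} {R R₁ R₂ : Matroid (Option α)}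
  {ends : α → Finset V} {K W : Finset V}

lemma isCyc_baseAt_map {C : Finset α} :
    IsCyc (baseAt ends K) (C.map Function.Embedding.some) ↔ IsCyc ends C := isCyc_map _ _

lemma IsFrame.some_image_mem_balanced (h : R.IsFrame (baseAt ends K)) (hR : R.Finite)
    (hW : ∀ e ∈ R.E, baseAt ends K e ⊆ W) {C : Set α} :
    some '' C ∈ (h.biasedGraph hR W hW).balanced ↔
      ∃ F : Finset α, C = F ∧ R.IsCircuit (some '' (F : Set α)) ∧ IsCyc ends F := by
  rw [h.mem_balanced_iff hR hW]
  constructor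
  · rintro ⟨F, hF, hc⟩
    obtain ⟨F, rfl | rfl⟩ := exists_eq_map_or_insertNone F
    · rw [coe_map_some] at hF hc
      exact ⟨F, Set.image_injective.2 (Option.some_injective α) hF, hc.1, isCyc_baseAt_map.1 hc.2⟩
    · have h1 : none ∈ some '' C := by rw [hF]; simp
      simp at h1
  · rintro ⟨F, rfl, hc⟩
    exact ⟨F.map Function.Embedding.some, (coe_map_some F).symm, by rw [coe_map_some]; exact hc.1,
      isCyc_baseAt_map.2 hc.2⟩

lemma IsTwoSum.exists_insertNone [M.Finite] (hs : M.IsTwoSum A B R₁ R₂) (h : M.TwoSep A B)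
    {C : Set (Option α)} (hC : R₁.IsCircuit C) (hn : none ∈ C) : ∃ P : Finset α,
      C = ↑(Finset.insertNone P) ∧ some ⁻¹' C = P ∧ (P : Set α) ⊆ A ∧ P.Nonempty := by
  have := (hs.isTip h).finite h.left_subset
  obtain ⟨C, rfl⟩ := (R₁.ground_finite.subset hC.subset_ground).exists_finset_coe
  obtain ⟨P, rfl | rfl⟩ := exists_eq_map_or_insertNone C
  · simp at hn
  have h1 : some ⁻¹' ((Finset.insertNone P : Finset (Option α)) : Set (Option α)) = P := by
    ext a
    simp
  have h2 := hs.preimage_nonempty h hC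
  have h3 := hs.preimage_subset hC
  rw [h1] at h2 h3
  exact ⟨P, rfl, h1, h3, by exact_mod_cast h2⟩

lemma IsFrame.isGluing {A B : Finset α} {W₁ W₂ : Finset V} (h : M.TwoSep A B)
    (t₁ : M.IsTip A B R₁) (t₂ : M.IsTip B A R₂) (F : M.IsFrame ends)
    (F₁ : R₁.IsFrame (baseAt ends K)) (F₂ : R₂.IsFrame (baseAt ends K)) (hM : M.Finite)
    (hR₁ : R₁.Finite) (hR₂ : R₂.Finite) (hW : ∀ e ∈ M.E, ends e ⊆ W₁ ∪ W₂)
    (hW₁ : ∀ e ∈ R₁.E, baseAt ends K e ⊆ W₁) (hW₂ : ∀ e ∈ R₂.E, baseAt ends K e ⊆ W₂)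
    (hWK : W₁ ∩ W₂ = K) : (F.biasedGraph hM (W₁ ∪ W₂) hW).IsGluing (F₁.biasedGraph hR₁ W₁ hW₁)
      (F₂.biasedGraph hR₂ W₂ hW₂) K := by
  refine ⟨Finset.coe_union _ _, (Finset.coe_inter _ _).symm.trans (congrArg _ hWK), ?_, ?_⟩
  · have h1 : E((F₁.biasedGraph hR₁ W₁ hW₁).graph) = R₁.E := F₁.edgeSet_graph hW₁
    have h2 : E((F₂.biasedGraph hR₂ W₂ hW₂).graph) = R₂.E := F₂.edgeSet_graph hW₂
    rw [h1, h2, t₁.ground, t₂.ground]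
    rintro _ ⟨rfl | ⟨a, ha, rfl⟩, hb⟩
    · rfl
    · rcases hb with hb | ⟨b, hb, hba⟩
      · cases hb
      · cases hba
        exact (Set.disjoint_left.1 h.disj ha hb).elim
  · intro e x y
    have m₁ : some e ∈ R₁.E ↔ e ∈ A := by rw [t₁.ground]; simp
    have m₂ : some e ∈ R₂.E ↔ e ∈ B := by rw [t₂.ground]; simp
    constructor
    · rintro ⟨he, hl, -, -⟩
      rw [← h.union] at he
      have hx : x ∈ ends e := by rw [hl]; simp
      have hy : y ∈ ends e := by rw [hl]; simp
      rcases he with he | he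
      · have := hW₁ _ (m₁.2 he)
        exact .inl ⟨m₁.2 he, hl, this hx, this hy⟩
      · have := hW₂ _ (m₂.2 he)
        exact .inr ⟨m₂.2 he, hl, this hx, this hy⟩
    · rintro (⟨he, hl, hx, hy⟩ | ⟨he, hl, hx, hy⟩)
      · exact ⟨h.left_subset (m₁.1 he), hl, Finset.mem_union_left _ hx, Finset.mem_union_left _ hy⟩
      · exact ⟨h.right_subset (m₂.1 he), hl, Finset.mem_union_right _ hx,
          Finset.mem_union_right _ hy⟩

lemma exists_vertices {A B : Finset α} (h : M.TwoSep A B)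
    (t₁ : M.IsTip A B R₁) (t₂ : M.IsTip B A R₂)
    (hmeet : ∀ a ∈ (A : Set α), ∀ b ∈ (B : Set α), ends a ∩ ends b ⊆ K) :
    ∃ W₁ W₂ : Finset V, (∀ e ∈ M.E, ends e ⊆ W₁ ∪ W₂) ∧ (∀ e ∈ R₁.E, baseAt ends K e ⊆ W₁) ∧
      (∀ e ∈ R₂.E, baseAt ends K e ⊆ W₂) ∧ W₁ ∩ W₂ = K := by
  have key : ∀ {X : Finset α} {e : Option α}, e ∈ (insert none (some '' X) : Set (Option α)) →
      baseAt ends K e ⊆ vs ends X ∪ K := by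
    rintro X _ (rfl | ⟨a, ha, rfl⟩)
    · exact Finset.subset_union_right
    · exact (ends_subset_vs ha).trans Finset.subset_union_left
  refine ⟨vs ends A ∪ K, vs ends B ∪ K, fun e he ↦ ?_, fun e he ↦ key (t₁.ground ▸ he),
    fun e he ↦ key (t₂.ground ▸ he), ?_⟩
  · rw [← h.union] at he
    rcases he with he | he
    · exact ((ends_subset_vs he).trans Finset.subset_union_left).trans Finset.subset_union_left
    · exact ((ends_subset_vs he).trans Finset.subset_union_left).trans Finset.subset_union_right
  · rw [← Finset.inter_union_distrib_right, Finset.union_eq_right]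
    exact inter_vs_subset hmeet subset_rfl subset_rfl

section Sums

variable [M.Finite] {A B : Finset α}

/-- Two representations with loops at the basepoint give a representation of the 2-sum as a
loop-sum. -/
theorem TwoSep.exists_loopSum (h : M.TwoSep A B) (t₁ : M.IsTip A B R₁) (t₂ : M.IsTip B A R₂)
    (F₁ : R₁.IsFrame (baseAt ends K)) (F₂ : R₂.IsFrame (baseAt ends K))
    (hmeet : ∀ a ∈ (A : Set α), ∀ b ∈ (B : Set α), ends a ∩ ends b ⊆ K) (hK : K.card = 1)
    (hL : ∀ e ∈ L, e ∈ M.E ∧ (ends e).card = 1) :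
    ∃ Ω : BiasedGraph V α, Ω.Represents M ∧ Ω.IsLBiased L ∧ Ω.IsType1 A B ∧
      ∃ Ω₁ Ω₂ : BiasedGraph V (Option α), Ω₁.Represents R₁ ∧ Ω₂.Represents R₂ ∧
        (M.IsTwoSum A B R₁ R₂ → Ω.IsLoopSum Ω₁ Ω₂) := by
  have hM : M.Finite := inferInstance
  have hR₁ := t₁.finite h.left_subset
  have hR₂ := t₂.finite h.right_subset
  have F := h.isFrame (F₁.halfFrame t₁) (F₂.halfFrame t₂) hmeet (.inl hK)
  obtain ⟨W₁, W₂, hW, hW₁, hW₂, hWK⟩ := exists_vertices h t₁ t₂ hmeet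
  obtain ⟨z, rfl⟩ := Finset.card_eq_one.1 hK
  have hn₁ : none ∈ R₁.E := by rw [t₁.ground]; exact Set.mem_insert _ _
  have hn₂ : none ∈ R₂.E := by rw [t₂.ground]; exact Set.mem_insert _ _
  have hside : ∀ {A B : Finset α} {R : Matroid (Option α)}, M.TwoSep A B → M.IsTip A B R →
      R.IsFrame (baseAt ends {z}) → z ∈ vs ends A ∧
      (F.biasedGraph hM (W₁ ∪ W₂) hW).graph.ConnectedOn A ∧
      ¬ (F.biasedGraph hM (W₁ ∪ W₂) hW).IsBalancedOn A := by
    intro A B R h t F'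
    have hr : ∀ u ∈ vs ends A, z ∈ vs ends A ∧ Relation.ReflTransGen (AdjOn ends A) u z := by
      intro u hu
      obtain ⟨z', hz', hr⟩ := h.exists_reach t F' rfl hu
      rw [Finset.mem_singleton] at hz'
      rwa [hz'] at hr
    refine ⟨?_, ?_, ?_⟩
    · obtain ⟨a, ha⟩ := h.left_nonempty
      obtain ⟨u, hu⟩ := F.nonempty a (h.left_subset ha)
      exact (hr u (ends_subset_vs ha hu)).1
    · rw [F.connectedOn_biasedGraph hM hW h.left_subset]
      exact fun u hu v hv ↦ (hr u hu).2.trans (reach_symm (hr v hv).2)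
    · rw [F.isBalancedOn_biasedGraph hM hW h.left_subset]
      intro hb
      obtain ⟨C, hC, hcyc, hc⟩ := h.exists_isCyc_of_card_eq_one t F' (by simp) rfl
      exact hc (hb C hC hcyc)
  obtain ⟨hzA, hcA, huA⟩ := hside h t₁ F₁
  obtain ⟨hzB, hcB, huB⟩ := hside h.symm t₂ F₂
  refine ⟨F.biasedGraph hM (W₁ ∪ W₂) hW, F.represents_biasedGraph hM hW,
    F.isLBiased_biasedGraph hM hW hL, ⟨hcA, huA, hcB, huB, z, ?_⟩, F₁.biasedGraph hR₁ W₁ hW₁,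
    F₂.biasedGraph hR₂ W₂ hW₂, F₁.represents_biasedGraph hR₁ hW₁,
    F₂.represents_biasedGraph hR₂ hW₂, fun hs ↦ ⟨z,
    F₁.isUnbalancedLoopAt_biasedGraph hR₁ hW₁ hn₁ rfl,
    F₂.isUnbalancedLoopAt_biasedGraph hR₂ hW₂ hn₂ rfl, ?_, fun C ↦ ?_⟩⟩
  · rw [F.vertsOf_biasedGraph hM hW h.left_subset, F.vertsOf_biasedGraph hM hW h.right_subset,
      ← Finset.coe_inter, ← Finset.coe_singleton, Finset.coe_inj]
    exact (inter_vs_subset hmeet subset_rfl subset_rfl).antisymm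
      (Finset.singleton_subset_iff.2 (Finset.mem_inter.2 ⟨hzA, hzB⟩))
  · have := IsFrame.isGluing h t₁ t₂ F F₁ F₂ hM hR₁ hR₂ hW hW₁ hW₂ hWK
    rwa [Finset.coe_singleton] at this
  · rw [F₁.some_image_mem_balanced hR₁ hW₁, F₂.some_image_mem_balanced hR₂ hW₂,
      F.mem_balanced_iff hM hW]
    constructor
    · rintro ⟨C, rfl, hC, hcyc⟩
      rcases (hs.2.2.2.2 _).1 hC with hc | hc | ⟨C₁, C₂, h1, h2, n1, n2, hCe⟩
      · exact .inl ⟨C, rfl, hc, hcyc⟩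
      · exact .inr ⟨C, rfl, hc, hcyc⟩
      -- A crossing circuit is never a cycle here: a cycle split between the sides would need two
      -- shared vertices, and there is only one.
      · obtain ⟨P, -, hP, hPA, hPne⟩ := hs.exists_insertNone h h1 n1
        obtain ⟨Q, -, hQ, hQB, hQne⟩ := hs.symm.exists_insertNone h.symm h2 n2
        rw [hP, hQ, ← Finset.coe_union, Finset.coe_inj] at hCe
        have h3 := hcyc.two_le_inter hCe.symm
          (Finset.disjoint_coe.1 (h.disj.mono hPA hQB)) hPne hQne
        have h4 := Finset.card_le_card (inter_vs_subset hmeet hPA hQB)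
        rw [Finset.card_singleton] at h4
        omega
    · rintro (⟨C, rfl, hc, hcyc⟩ | ⟨C, rfl, hc, hcyc⟩)
      · exact ⟨C, rfl, (hs.2.2.2.2 _).2 (.inl hc), hcyc⟩
      · exact ⟨C, rfl, (hs.2.2.2.2 _).2 (.inr (.inl hc)), hcyc⟩

/-- Two representations with links at the basepoint, one of them balanced and one of full rank,
give a representation of the 2-sum as a link-sum. -/
theorem TwoSep.exists_linkSum (h : M.TwoSep A B) (t₁ : M.IsTip A B R₁) (t₂ : M.IsTip B A R₂)
    (F₁ : R₁.IsForestRep (baseAt ends K)) (F₂ : R₂.IsFrame (baseAt ends K))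
    (hmeet : ∀ a ∈ (A : Set α), ∀ b ∈ (B : Set α), ends a ∩ ends b ⊆ K)
    (hfull : ∃ E I : Finset (Option α), (E : Set _) = R₂.E ∧ R₂.Indep I ∧
      (vs (baseAt ends K) E).card = I.card)
    (hL : ∀ e ∈ L, e ∈ M.E ∧ (ends e).card = 1) :
    ∃ Ω : BiasedGraph V α, Ω.Represents M ∧ Ω.IsLBiased L ∧ Ω.IsType2Left A B ∧
      ∃ Ω₁ Ω₂ : BiasedGraph V (Option α), Ω₁.Represents R₁ ∧ Ω₂.Represents R₂ ∧
        (M.IsTwoSum A B R₁ R₂ → Ω.IsLinkSumLeft Ω₁ Ω₂) := by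
  have hM : M.Finite := inferInstance
  have hR₁ := t₁.finite h.left_subset
  have hR₂ := t₂.finite h.right_subset
  have hn₁ : none ∈ R₁.E := by rw [t₁.ground]; exact Set.mem_insert _ _
  have hn₂ : none ∈ R₂.E := by rw [t₂.ground]; exact Set.mem_insert _ _
  have hK : K.card = 2 := F₁.card_eq none hn₁
  obtain ⟨x, y, hxy, rfl⟩ := Finset.card_eq_two.1 hK
  have hG := F₁.graphicHalf t₁
  have F := h.isFrame (F₁.isFrame.halfFrame t₁) (F₂.halfFrame t₂) hmeet (.inr ⟨x, y, rfl, hG⟩)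
  obtain ⟨W₁, W₂, hW, hW₁, hW₂, hWK⟩ := exists_vertices h t₁ t₂ hmeet
  obtain ⟨hKA, hreach⟩ := h.reach_of_isForestRep t₁ F₁ (E := A) rfl
  obtain ⟨hKB, J, hJB, hJ, hJc⟩ := h.symm.exists_full t₂ F₂ hfull (E := B) rfl
  have hxK : x ∈ ({x, y} : Finset V) := by simp
  have hyK : y ∈ ({x, y} : Finset V) := by simp
  have hrB : ∀ u ∈ vs ends B, Relation.ReflTransGen (AdjOn ends B) u x ∨
      Relation.ReflTransGen (AdjOn ends B) u y := by
    intro u hu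
    obtain ⟨z, hz, -, hr⟩ := h.symm.exists_reach t₂ F₂ rfl hu
    simp only [Finset.mem_insert, Finset.mem_singleton] at hz
    rcases hz with rfl | rfl
    exacts [.inl hr, .inr hr]
  have hBE : ∀ e ∈ B, (ends e).card ≤ 2 := fun e he ↦ F.card_le e (h.right_subset he)
  have hsub : ∀ {Z : Finset α}, Z ⊆ B → (Z : Set α) ⊆ M.E := fun hZ ↦
    (Finset.coe_subset.2 hZ).trans h.right_subset
  have hunb : ∀ {Z : Finset α}, Z ⊆ B → (vs ends Z).Nonempty →
      Disjoint (vs ends Z) (vs ends (B \ Z)) →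
      ¬ (F.biasedGraph hM (W₁ ∪ W₂) hW).IsBalancedOn Z := by
    intro Z hZ hne hd
    rw [F.isBalancedOn_biasedGraph hM hW (hsub hZ)]
    intro hb
    obtain ⟨C, hC, hcyc, hc⟩ := F.exists_isCyc_of_full hJ hJB hJc hne hZ hd
    exact hc (hb C hC hcyc)
  have hconn : ∀ {Z : Finset α} {u : V}, Z ⊆ B →
      (∀ v ∈ vs ends Z, Relation.ReflTransGen (AdjOn ends Z) u v) →
      (F.biasedGraph hM (W₁ ∪ W₂) hW).graph.ConnectedOn Z := by
    intro Z u hZ hr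
    rw [F.connectedOn_biasedGraph hM hW (hsub hZ)]
    exact fun a ha b hb ↦ (reach_symm (hr a ha)).trans (hr b hb)
  refine ⟨F.biasedGraph hM (W₁ ∪ W₂) hW, F.represents_biasedGraph hM hW,
    F.isLBiased_biasedGraph hM hW hL, ⟨?_, ?_, x, y, hxy, ?_, ?_⟩,
    F₁.isFrame.biasedGraph hR₁ W₁ hW₁, F₂.biasedGraph hR₂ W₂ hW₂,
    F₁.isFrame.represents_biasedGraph hR₁ hW₁, F₂.represents_biasedGraph hR₂ hW₂,
    fun hs ↦ ⟨?_, x, y, hxy, ?_, ?_, ?_, fun C ↦ ?_⟩⟩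
  · rw [F.connectedOn_biasedGraph hM hW h.left_subset]
    intro u hu v hv
    obtain ⟨z, hz, -, hr⟩ := h.exists_reach t₁ F₁.isFrame rfl hu
    obtain ⟨z', hz', -, hr'⟩ := h.exists_reach t₁ F₁.isFrame rfl hv
    exact (hr.trans (hreach z hz z' hz')).trans (reach_symm hr')
  · rw [F.isBalancedOn_biasedGraph hM hW h.left_subset]
    intro C hC hcyc
    have hCA : (C : Set α) ⊆ A := Finset.coe_subset.2 hC
    rw [isCircuit_iff_forall_ssubset, dep_iff, hG.indep_iff C hCA]
    refine ⟨⟨fun hF ↦ (hF C subset_rfl hcyc.1).ne' hcyc.2.1, hCA.trans h.left_subset⟩,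
      fun I hI ↦ ?_⟩
    obtain ⟨I, rfl⟩ := (C.finite_toSet.subset hI.subset).exists_finset_coe
    rw [hG.indep_iff I (hI.subset.trans hCA)]
    exact fun Z hZ hne ↦ hcyc.2.2 Z (hZ.trans_ssubset (by exact_mod_cast hI)) hne
  · rw [F.vertsOf_biasedGraph hM hW h.left_subset, F.vertsOf_biasedGraph hM hW h.right_subset,
      ← Finset.coe_inter, (inter_vs_subset hmeet subset_rfl subset_rfl).antisymm
        (Finset.subset_inter hKA hKB), Finset.coe_pair]
  -- Every component of `B` contains `x` or `y`. If they are joined, `B` is connected; otherwise the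
  -- components of `x` and `y` are the only two, and full rank makes each of them unbalanced.
  · by_cases hxyB : Relation.ReflTransGen (AdjOn ends B) x y
    · left
      refine ⟨hconn (u := x) subset_rfl fun v hv ↦ ?_, hunb subset_rfl ⟨x, hKB hxK⟩ (by simp [vs])⟩
      rcases hrB v hv with hr | hr
      · exact reach_symm hr
      · exact hxyB.trans (reach_symm hr)
    · right
      obtain ⟨X, hX, hxX, hdX, hrX, hX'⟩ := exists_connected_component hBE (hKB hxK)
      obtain ⟨Y, hY, hyY, hdY, hrY, hY'⟩ := exists_connected_component hBE (hKB hyK)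
      refine ⟨X, Y, ?_, ?_, hconn hX hrX, hunb hX ⟨x, hxX⟩ hdX, ?_, hconn hY hrY,
        hunb hY ⟨y, hyY⟩ hdY, ?_⟩
      · rw [← Finset.coe_union, Finset.coe_inj]
        refine Finset.Subset.antisymm (fun e he ↦ ?_) (Finset.union_subset hX hY)
        obtain ⟨u, hu⟩ := F.nonempty e (h.right_subset he)
        have huB := ends_subset_vs he hu
        by_contra hn
        rw [Finset.mem_union, not_or] at hn
        rcases hrB u huB with hr | hr
        · exact Finset.disjoint_left.1 hdX (hX' u huB (reach_symm hr))
            (ends_subset_vs (Finset.mem_sdiff.2 ⟨he, hn.1⟩) hu)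
        · exact Finset.disjoint_left.1 hdY (hY' u huB (reach_symm hr))
            (ends_subset_vs (Finset.mem_sdiff.2 ⟨he, hn.2⟩) hu)
      · rw [F.vertsOf_biasedGraph hM hW (hsub hX), F.vertsOf_biasedGraph hM hW (hsub hY),
          Finset.disjoint_coe, Finset.disjoint_left]
        exact fun v hv hv' ↦ hxyB ((reach_mono hX (hrX v hv)).trans
          (reach_symm (reach_mono hY (hrY v hv'))))
      · rw [F.vertsOf_biasedGraph hM hW (hsub hX)]
        exact hxX
      · rw [F.vertsOf_biasedGraph hM hW (hsub hY)]
        exact hyY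
  · have h1 : E((F₁.isFrame.biasedGraph hR₁ W₁ hW₁).graph) = R₁.E := F₁.isFrame.edgeSet_graph hW₁
    obtain ⟨E, hE⟩ := R₁.ground_finite.exists_finset_coe
    rw [h1, ← hE, F₁.isFrame.isBalancedOn_biasedGraph hR₁ hW₁ hE.le]
    exact fun C hC hcyc ↦ F₁.isCircuit_of_isCyc ((Finset.coe_subset.2 hC).trans hE.le) hcyc
  · exact ⟨hn₁, rfl, hW₁ none hn₁ hxK, hW₁ none hn₁ hyK⟩
  · exact ⟨hn₂, rfl, hW₂ none hn₂ hxK, hW₂ none hn₂ hyK⟩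
  · have := IsFrame.isGluing h t₁ t₂ F F₁.isFrame F₂ hM hR₁ hR₂ hW hW₁ hW₂ hWK
    rwa [Finset.coe_pair] at this
  · rw [F₁.isFrame.some_image_mem_balanced hR₁ hW₁, F₂.some_image_mem_balanced hR₂ hW₂,
      F.mem_balanced_iff hM hW]
    constructor
    · rintro ⟨C, rfl, hC, hcyc⟩
      rcases (hs.2.2.2.2 _).1 hC with hc | hc | ⟨C₁, C₂, h1, h2, n1, n2, hCe⟩
      · exact .inl ⟨C, rfl, hc, hcyc⟩
      · exact .inr (.inl ⟨C, rfl, hc, hcyc⟩)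
      · obtain ⟨P, rfl, hP, hPA, hPne⟩ := hs.exists_insertNone h h1 n1
        obtain ⟨Q, rfl, hQ, hQB, hQne⟩ := hs.symm.exists_insertNone h.symm h2 n2
        have hCe' := hCe
        rw [hP, hQ, ← Finset.coe_union, Finset.coe_inj] at hCe'
        subst hCe'
        have hd : Disjoint P Q := Finset.disjoint_coe.1 (h.disj.mono hPA hQB)
        have hPQ := inter_vs_subset hmeet hPA hQB
        refine .inr (.inr ⟨_, (F₁.isFrame.mem_balanced_biasedGraph hR₁ hW₁).2
          ⟨h1, hcyc.isCyc_insertNone hd hPne hQne hK hPQ⟩, _,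
          (F₂.mem_balanced_biasedGraph hR₂ hW₂).2 ⟨h2, ?_⟩, n1, n2, hCe⟩)
        rw [Finset.union_comm] at hcyc
        rw [Finset.inter_comm] at hPQ
        exact hcyc.isCyc_insertNone hd.symm hQne hPne hK hPQ
    · rintro (⟨C, rfl, hc, hcyc⟩ | ⟨C, rfl, hc, hcyc⟩ | ⟨C₁, hC₁, C₂, hC₂, n1, n2, rfl⟩)
      · exact ⟨C, rfl, (hs.2.2.2.2 _).2 (.inl hc), hcyc⟩
      · exact ⟨C, rfl, (hs.2.2.2.2 _).2 (.inr (.inl hc)), hcyc⟩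
      · have hc := (hs.2.2.2.2 _).2 (.inr (.inr ⟨C₁, C₂, hC₁.1, hC₂.1, n1, n2, rfl⟩))
        obtain ⟨P, rfl, hP, hPA, hPne⟩ := hs.exists_insertNone h hC₁.1 n1
        obtain ⟨Q, rfl, hQ, hQB, hQne⟩ := hs.symm.exists_insertNone h.symm hC₂.1 n2
        rw [hP, hQ, ← Finset.coe_union] at hc ⊢
        exact ⟨P ∪ Q, rfl, hc, isCyc_union_of_insertNone
          ((F₁.isFrame.mem_balanced_biasedGraph hR₁ hW₁).1 hC₁).2
          ((F₂.mem_balanced_biasedGraph hR₂ hW₂).1 hC₂).2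
          (Finset.disjoint_coe.1 (h.disj.mono hPA hQB)) hPne hQne hK
          (inter_vs_subset hmeet hPA hQB)⟩

end Sums

end Matroid

/-! ### Matching the basepoints, and the theorem -/

namespace Matroid

set_option linter.unusedSectionVars false

open Multi

section Relabel

variable {β V : Type*} {N : Matroid β} {ends ends' : β → Finset V}

lemma IsFrame.congr (h : N.IsFrame ends) (he : ∀ e ∈ N.E, ends' e = ends e) :
    N.IsFrame ends' := by
  have hv : ∀ {I : Finset β}, N.Indep I → vs ends' I = vs ends I := fun hI ↦
    IsFrame.vs_congr fun e heI ↦ he e (hI.subset_ground heI)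
  refine ⟨fun e heE ↦ ?_, fun e heE ↦ ?_, fun I hI ↦ ?_, fun I hI e heE v hve hvI ↦ ?_,
    fun I J hI hJ hd ↦ ?_⟩
  · rw [he e heE]; exact h.nonempty e heE
  · rw [he e heE]; exact h.card_le e heE
  · rw [hv hI]; exact h.card_indep I hI
  · rw [he e heE] at hve
    rw [hv hI] at hvI
    exact h.leaf I hI e heE v hve hvI
  · rw [hv hI, hv hJ] at hd
    exact h.union I J hI hJ hd

lemma IsForestRep.congr (h : N.IsForestRep ends) (he : ∀ e ∈ N.E, ends' e = ends e) :
    N.IsForestRep ends' := by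
  refine ⟨fun e heE ↦ by rw [he e heE]; exact h.card_eq e heE, fun X hX ↦ ?_⟩
  rw [h.indep_iff X hX]
  refine forall_congr' fun Z ↦ forall_congr' fun hZ ↦ ?_
  rw [IsFrame.vs_congr fun e heZ ↦ he e (hX (hZ heZ))]

lemma card_mapEnds_le {W : Type*} {c : V → W} {e : β} :
    (mapEnds c ends e).card ≤ (ends e).card := Finset.card_image_le

/-- The first graph goes to even numbers and the second to odd ones, except that the ends of the
second basepoint follow a bijection to the ends of the first. -/
lemma exists_relabel (K₁ K₂ : Finset ℕ) (h : K₂.card = K₁.card) : ∃ c₁ c₂ : ℕ → ℕ,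
    c₁.Injective ∧ c₂.Injective ∧ (∀ u v, c₁ u = c₂ v → v ∈ K₂) ∧
      ∀ w, (∃ u ∈ K₁, c₁ u = w) ↔ ∃ v ∈ K₂, c₂ v = w := by
  let g := Finset.equivOfCardEq h
  refine ⟨fun u ↦ 2 * u, fun v ↦ if hv : v ∈ K₂ then 2 * (g ⟨v, hv⟩ : ℕ) else 2 * v + 1,
    fun u v huv ↦ by simpa using huv, fun u v huv ↦ ?_, fun u v huv ↦ ?_, fun w ↦ ⟨?_, ?_⟩⟩
  · dsimp only at huv
    split_ifs at huv with hu hv hv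
    · have h1 : (g ⟨u, hu⟩ : ℕ) = g ⟨v, hv⟩ := by omega
      simpa using g.injective (Subtype.ext h1)
    · omega
    · omega
    · omega
  · dsimp only at huv
    split_ifs at huv with hv
    · exact hv
    · omega
  · rintro ⟨u, hu, rfl⟩
    obtain ⟨⟨v, hv⟩, hvu⟩ := g.surjective ⟨u, hu⟩
    refine ⟨v, hv, ?_⟩
    dsimp only
    rw [dif_pos hv, hvu]
  · rintro ⟨v, hv, rfl⟩
    exact ⟨g ⟨v, hv⟩, (g ⟨v, hv⟩).2, by dsimp only; rw [dif_pos hv]⟩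

end Relabel

variable {α V W : Type*} {M : Matroid α} {A B L : Set α} {R R₁ R₂ : Matroid (Option α)}

/-- Representations of the two parts of a 2-separation are made to share the basepoint only. -/
lemma exists_common_ends {e₁ e₂ : Option α → Finset V} {c₁ c₂ : V → W} (h : M.TwoSep A B)
    (t₁ : M.IsTip A B R₁) (t₂ : M.IsTip B A R₂)
    (hc : ∀ u v, c₁ u = c₂ v → v ∈ e₂ none)
    (hK : ∀ w, (∃ u ∈ e₁ none, c₁ u = w) ↔ ∃ v ∈ e₂ none, c₂ v = w) :
    ∃ (ends : α → Finset W) (K : Finset W), (∀ o ∈ R₁.E, baseAt ends K o = mapEnds c₁ e₁ o) ∧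
      (∀ o ∈ R₂.E, baseAt ends K o = mapEnds c₂ e₂ o) ∧
      ∀ a ∈ A, ∀ b ∈ B, ends a ∩ ends b ⊆ K := by
  have hAB : ∀ {b}, b ∈ B → b ∉ A := fun hb ha ↦ Set.disjoint_left.1 h.disj ha hb
  refine ⟨fun a ↦ if a ∈ A then mapEnds c₁ e₁ (some a) else mapEnds c₂ e₂ (some a),
    mapEnds c₁ e₁ none, fun o ho ↦ ?_, fun o ho ↦ ?_, fun a ha b hb w hw ↦ ?_⟩
  · rw [t₁.ground] at ho
    rcases ho with rfl | ⟨a, ha, rfl⟩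
    · rfl
    · exact if_pos ha
  · rw [t₂.ground] at ho
    rcases ho with rfl | ⟨b, hb, rfl⟩
    · ext w
      change w ∈ mapEnds c₁ e₁ none ↔ _
      rw [mapEnds, mapEnds, Finset.mem_image, Finset.mem_image]
      exact hK w
    · exact if_neg (hAB hb)
  · dsimp only at hw
    rw [if_pos ha, if_neg (hAB hb), Finset.mem_inter, mapEnds, mapEnds, Finset.mem_image,
      Finset.mem_image] at hw
    obtain ⟨⟨u, -, rfl⟩, v, -, hvu⟩ := hw
    rw [mapEnds, Finset.mem_image]
    exact (hK _).2 ⟨v, hc u v hvu.symm, hvu⟩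

section Main

variable [M.Finite]

theorem TwoSep.exists_of_loRep (h : M.TwoSep A B) (t₁ : M.IsTip A B R₁) (t₂ : M.IsTip B A R₂)
    (h₁ : R₁.LoRep L) (h₂ : R₂.LoRep L) (hL : L ⊆ M.E) :
    ∃ Ω : BiasedGraph ℕ α, Ω.Represents M ∧ Ω.IsLBiased L ∧ Ω.IsType1 A B ∧
      ∃ Ω₁ Ω₂ : BiasedGraph ℕ (Option α), Ω₁.Represents R₁ ∧ Ω₂.Represents R₂ ∧
        (M.IsTwoSum A B R₁ R₂ → Ω.IsLoopSum Ω₁ Ω₂) := by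
  obtain ⟨e₁, ⟨F₁, L₁⟩, n₁⟩ := h₁
  obtain ⟨e₂, ⟨F₂, L₂⟩, n₂⟩ := h₂
  obtain ⟨c₁, c₂, i₁, i₂, hc, hK⟩ := exists_relabel (e₁ none) (e₂ none) (n₂.trans n₁.symm)
  obtain ⟨ends, K, k₁, k₂, hmeet⟩ := exists_common_ends h t₁ t₂ hc hK
  obtain ⟨A, rfl⟩ := (M.ground_finite.subset h.left_subset).exists_finset_coe
  obtain ⟨B, rfl⟩ := (M.ground_finite.subset h.right_subset).exists_finset_coe
  have m₁ : ∀ {e}, e ∈ A → some e ∈ R₁.E := fun he ↦ by rw [t₁.ground]; exact .inr ⟨_, he, rfl⟩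
  have m₂ : ∀ {e}, e ∈ B → some e ∈ R₂.E := fun he ↦ by rw [t₂.ground]; exact .inr ⟨_, he, rfl⟩
  have hK1 : K = mapEnds c₁ e₁ none := k₁ none (by rw [t₁.ground]; exact Set.mem_insert _ _)
  refine h.exists_loopSum t₁ t₂ ((F₁.map i₁.injOn fun e _ ↦ Set.subset_univ _).congr k₁)
    ((F₂.map i₂.injOn fun e _ ↦ Set.subset_univ _).congr k₂) hmeet
    (by rw [hK1, card_mapEnds i₁.injOn, n₁]) fun e he ↦ ⟨hL he, ?_⟩
  have heE := hL he
  rw [← h.union] at heE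
  rcases heE with heE | heE
  · have h1 : ends e = _ := k₁ (some e) (m₁ heE)
    rw [h1, card_mapEnds i₁.injOn, L₁ e he (m₁ heE)]
  · have h1 : ends e = _ := k₂ (some e) (m₂ heE)
    rw [h1, card_mapEnds i₂.injOn, L₂ e he (m₂ heE)]

theorem TwoSep.exists_of_grRep (h : M.TwoSep A B) (t₁ : M.IsTip A B R₁) (t₂ : M.IsTip B A R₂)
    (h₁ : R₁.GrRep) (hLA : Disjoint L A) (h₂ : R₂.FullRep L) (hL : L ⊆ M.E) :
    ∃ Ω : BiasedGraph ℕ α, Ω.Represents M ∧ Ω.IsLBiased L ∧ Ω.IsType2Left A B ∧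
      ∃ Ω₁ Ω₂ : BiasedGraph ℕ (Option α), Ω₁.Represents R₁ ∧ Ω₂.Represents R₂ ∧
        (M.IsTwoSum A B R₁ R₂ → Ω.IsLinkSumLeft Ω₁ Ω₂) := by
  obtain ⟨e₁, F₁⟩ := h₁
  obtain ⟨e₂, ⟨F₂, L₂⟩, n₂, E, I, hE, hI, hEI⟩ := h₂
  have n₁ := F₁.card_eq none (by rw [t₁.ground]; exact Set.mem_insert _ _)
  obtain ⟨c₁, c₂, i₁, i₂, hc, hK⟩ := exists_relabel (e₁ none) (e₂ none) (n₂.trans n₁.symm)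
  obtain ⟨ends, K, k₁, k₂, hmeet⟩ := exists_common_ends h t₁ t₂ hc hK
  obtain ⟨A, rfl⟩ := (M.ground_finite.subset h.left_subset).exists_finset_coe
  obtain ⟨B, rfl⟩ := (M.ground_finite.subset h.right_subset).exists_finset_coe
  refine h.exists_linkSum t₁ t₂ ((F₁.map i₁).congr k₁)
    ((F₂.map i₂.injOn fun e _ ↦ Set.subset_univ _).congr k₂) hmeet ⟨E, I, hE, hI, ?_⟩
    fun e he ↦ ⟨hL he, ?_⟩
  · rw [IsFrame.vs_congr (fun e he ↦ k₂ e (hE ▸ he)), card_vs_mapEnds i₂.injOn, hEI]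
  · have heE := hL he
    rw [← h.union] at heE
    have heB := heE.resolve_left (Set.disjoint_left.1 hLA he)
    have m : some e ∈ R₂.E := by rw [t₂.ground]; exact .inr ⟨_, heB, rfl⟩
    have h1 : ends e = _ := k₂ (some e) m
    rw [h1, card_mapEnds i₂.injOn, L₂ e he m]

/-- A frame representation on a finite vertex set. -/
lemma exists_isFrame_finite {Ω : BiasedGraph V α} (hΩ : Ω.Represents M)
    (hl : ∀ e ∈ M.E, M.Indep {e}) (hLB : Ω.IsLBiased L) :
    ∃ ends : α → Finset (Option {v // v ∈ V(Ω.graph)}), M.IsFrame ends ∧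
      ∀ e ∈ L, (ends e).card ≤ 1 := by
  have F := hΩ.isFrame hl
  -- The type `V` may be infinite, while the extension by joints must be finite. The value `none` is
  -- a default for points that are not vertices and is never the image of an end.
  refine ⟨mapEnds (fun v ↦ if h : v ∈ V(Ω.graph) then some ⟨v, h⟩ else none) Ω.graph.endsF,
    F.map (S := V(Ω.graph)) (fun u hu v hv huv ↦ ?_) fun e _ v hv ↦ ?_, fun e he ↦ ?_⟩
  · rw [dif_pos hu, dif_pos hv] at huv
    exact congrArg Subtype.val (Option.some_injective _ huv)
  · exact (Graph.mem_endsF.1 hv).vertex_mem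
  · obtain ⟨v, hv, -⟩ := hLB e he
    rw [Graph.isLoopAt_iff_endsF] at hv
    refine card_mapEnds_le.trans ?_
    rw [hv, Finset.card_singleton]

/-- The dichotomy is applied to both sides. If each summand can have its basepoint as a loop, the
result is a loop-sum; if one fails, the opposite side is graphic and a link-sum results. The graph
is built from the tips, before any 2-sum is given, and uniqueness of tips identifies them with the
summands. -/
theorem exists_biasedGraph {Ω₀ : BiasedGraph V α} (hconn : M.HasNoOneSeparation)
    (hΩ₀ : Ω₀.Represents M) (hLB : Ω₀.IsLBiased L) (hAB : M.IsKSeparation 2 A B) :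
    ∃ Ω : BiasedGraph ℕ α, Ω.Represents M ∧ Ω.IsLBiased L ∧
      (Ω.IsType1 A B ∨ Ω.IsType2 A B) ∧
      ∀ M₁ M₂ : Matroid (Option α), M.IsTwoSum A B M₁ M₂ →
        ∃ Ω₁ Ω₂ : BiasedGraph ℕ (Option α), Ω₁.Represents M₁ ∧ Ω₂.Represents M₂ ∧
          (Ω.IsType1 A B → Ω.IsLoopSum Ω₁ Ω₂) ∧
          (Ω.IsType2 A B → Ω.IsLinkSum Ω₁ Ω₂) := by
  have h := hAB.twoSep hconn
  obtain ⟨R₁, t₁⟩ := h.exists_isTip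
  obtain ⟨R₂, t₂⟩ := h.symm.exists_isTip
  have := Ω₀.finite_verts.to_subtype
  obtain ⟨ends, F, hL1⟩ :=
    exists_isFrame_finite hΩ₀ (fun e he ↦ h.indep_singleton he) hLB
  have hL : L ⊆ M.E := fun e he ↦ by
    obtain ⟨v, hv, -⟩ := hLB e he
    rw [hΩ₀.1]
    exact hv.edge_mem
  rcases h.loRep_or t₁ t₂ F hL1 with l₂ | ⟨g₁, d, f₂⟩
  · rcases h.symm.loRep_or t₂ t₁ F hL1 with l₁ | ⟨g₂, d, f₁⟩
    · obtain ⟨Ω, hΩ, hLΩ, hT, Ω₁, Ω₂, hΩ₁, hΩ₂, hsum⟩ := h.exists_of_loRep t₁ t₂ l₁ l₂ hL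
      refine ⟨Ω, hΩ, hLΩ, .inl hT, fun M₁ M₂ hs ↦ ?_⟩
      obtain rfl := t₁.unique (hs.isTip h)
      obtain rfl := t₂.unique (hs.symm.isTip h.symm)
      refine ⟨Ω₁, Ω₂, hΩ₁, hΩ₂, fun _ ↦ hsum hs, ?_⟩
      -- The types exclude each other: in type 1 both sides are unbalanced, in type 2 one of them is
      -- balanced.
      rintro (hT' | hT')
      · exact (hT.2.1 hT'.2.1).elim
      · exact (hT.2.2.2.1 hT'.2.1).elim
    · obtain ⟨Ω, hΩ, hLΩ, hT, Ω₂, Ω₁, hΩ₂, hΩ₁, hsum⟩ :=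
        h.symm.exists_of_grRep t₂ t₁ g₂ d f₁ hL
      refine ⟨Ω, hΩ, hLΩ, .inr (.inr hT), fun M₁ M₂ hs ↦ ?_⟩
      obtain rfl := t₁.unique (hs.isTip h)
      obtain rfl := t₂.unique (hs.symm.isTip h.symm)
      exact ⟨Ω₁, Ω₂, hΩ₁, hΩ₂, fun hT' ↦ (hT'.2.2.2.1 hT.2.1).elim, fun _ ↦ .inr (hsum hs.symm)⟩
  · obtain ⟨Ω, hΩ, hLΩ, hT, Ω₁, Ω₂, hΩ₁, hΩ₂, hsum⟩ := h.exists_of_grRep t₁ t₂ g₁ d f₂ hL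
    refine ⟨Ω, hΩ, hLΩ, .inr (.inl hT), fun M₁ M₂ hs ↦ ?_⟩
    obtain rfl := t₁.unique (hs.isTip h)
    obtain rfl := t₂.unique (hs.symm.isTip h.symm)
    exact ⟨Ω₁, Ω₂, hΩ₁, hΩ₂, fun hT' ↦ (hT'.2.1 hT.2.1).elim, fun _ ↦ .inl (hsum hs)⟩

end Main

end Matroid

end

theorem mainTheorem9 {α : Type*} (M : Matroid α) (hfin : M.Finite) (L : Set α)
    (hconn : M.HasNoOneSeparation) (hframe : M.IsFrameMatroidal L)
    (A B : Set α) (hAB : M.IsKSeparation 2 A B) :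
    ∃ (V : Type) (Ω : BiasedGraph V α), Ω.Represents M ∧ Ω.IsLBiased L ∧
      (Ω.IsType1 A B ∨ Ω.IsType2 A B) ∧
      ∀ M₁ M₂ : Matroid (Option α), M.IsTwoSum A B M₁ M₂ →
        ∃ Ω₁ Ω₂ : BiasedGraph V (Option α), Ω₁.Represents M₁ ∧ Ω₂.Represents M₂ ∧
          (Ω.IsType1 A B → Ω.IsLoopSum Ω₁ Ω₂) ∧
          (Ω.IsType2 A B → Ω.IsLinkSum Ω₁ Ω₂) := by
  have := hfin
  obtain ⟨V, Ω₀, hΩ₀, hLB⟩ := hframe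
  exact ⟨ℕ, Matroid.exists_biasedGraph hconn hΩ₀ hLB hAB⟩
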